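/- **Conventions.** The ground ring is $\mathbb Z$. A dg-module is a lower $\mathbb Z$-graded (possibly unbounded) abelian group with a differential of degree $-1$; tensor products, duals and desuspensions carry the usual Koszul signs. A $\Sigma_*$-object is a sequence $M(r)$, $r\in\mathbb N$, of dg-modules with actions of the symmetric groups $\Sigma_r$. A morphism of $\Sigma_*$-objects is a fibration (resp. weak equivalence) if it is surjective in every arity and degree (resp. induces an isomorphism in homology in every arity). Operads $P$ are connected: $P(0)=0$ and $P(1)=\mathbb Z$ is generated by the operadic unit; dually, cooperads $D$ satisfy $D(0)=0$ and $D(1)=\mathbb Z$ through the counit. Fibrations and weak equivalences of operads are those of the underlying $\Sigma_*$-objects. A $\Sigma_*$-object (resp. a connected operad) is cofibrant if the morphism from the initial object has the left lifting property with respect to the morphisms of $\Sigma_*$-objects (resp. of connected operads) which are both fibrations and weak equivalences. **The operads $E_n$.** Let $E$ be the chain Barratt–Eccles operad: $E(0)=0$ and, for $r\ge1$, $E(r)=N_*(E\Sigma_r)$ is the normalized chain complex of the simplicial set whose $d$-simplices are the sequences $(w_0,\dots,w_d)$ of permutations of $r$ elements, with the diagonal left action of $\Sigma_r$ and the composites induced,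 through the Eilenberg–Zilber shuffle maps, by the substitution of permutations. For $n\ge1$, $E_n\subset E$ is the suboperad spanned by the non-degenerate simplices $\underline w=(w_0,\dots,w_d)$ such that $\mu_{ij}(\underline w)<n$ for all pairs $i\neq j$, where $\mu_{ij}(\underline w)$ is the number of indices $k$ such that $i,j$ occur in different orders in the sequences of values of $w_k$ and $w_{k+1}$. **Suspension.** The operadic suspension of an operad $P$ is $\Lambda P(r)=\Sigma^{1-r}P(r)^{\pm}$, where $\pm$ is the twist by the signature, with the operad structure given by $\Lambda P = \mathrm{End}_{\mathbb Z[1]}\otimes P$, $\mathbb Z[1]$ being $\mathbb Z$ placed in degree $1$. Let $\mathrm{sgn}$ be the cochain on $E(r)$, concentrated in degree $r-1$, which maps $(w_0,\dots,w_{r-1})$ to the signature of the sequence of first values $(w_0(1),\dots,w_{r-1}(1))$ if this sequence is a permutation of $\{1,\dots,r\}$, and to $0$ otherwise. The cap product $(w_0,\dots,w_d)\mapsto \mathrm{sgn}(w_0,\dots,w_{r-1})\cdot(w_{r-1},\dots,w_d)$ defines morphisms $\sigma:\Lambda E_{n+1}\to E_n$, $n\ge1$. **The cooperads $D_n$.**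 For $n\ge1$ let $D_n=\Lambda^{-n}E_n^\vee=(\Lambda^nE_n)^\vee$ be the cooperad formed by the $\mathbb Z$-duals $\mathrm{Hom}(\Lambda^nE_n(r),\mathbb Z)$ (each $\Lambda^n E_n(r)$ is degreewise free and finitely generated), and let $\sigma^*:D_n\to D_{n+1}$ be the transpose of $\Lambda^n\sigma:\Lambda^{n+1}E_{n+1}\to\Lambda^nE_n$. **The cobar construction.** For a connected cooperad $D$, $B^c(D)=(F(\Sigma^{-1}\bar D),\partial)$ is the free operad on $\Sigma^{-1}\bar D$, where $\bar D$ consists of the components $D(r)$, $r\ge2$. Its differential is the derivation determined on the generators by $\Sigma^{-1}c\mapsto-\Sigma^{-1}(\delta c)+\sum_\tau\sum\pm\,\Sigma^{-1}c'\circ_\tau\Sigma^{-1}c''$, where $\delta$ is the differential of $D$, $\tau$ ranges over the reduced trees with two vertices and $r$ inputs, $\sum c'\otimes c''$ is the component on $\tau$ of the decomposition of $c$, with $c'$ labelling the root vertex, and $\pm=(-1)^{|c'|}$. **Proposition.** Each $D_n$, $n\ge1$, is a connected cooperad and each $\sigma^*:D_n\to D_{n+1}$ is a morphism of cooperads. The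 sequence $$D_1\xrightarrow{\sigma^*}D_2\xrightarrow{\sigma^*}D_3\xrightarrow{\sigma^*}\cdots$$ has a colimit $D_\infty=\operatorname{colim}_nD_n$ in the category of connected cooperads. The cooperad $D_\infty$ is cofibrant as a $\Sigma_*$-object, and its cobar construction $B^c(D_\infty)$ is an operad which is cofibrant as a connected operad. -/

import Mathlib

open scoped TensorProduct

noncomputable section

namespace EnKoszul

open Equiv (Perm)

attribute [local instance 2000] TensorProduct.instModule

/-! ### Symmetric sequences of dg-modules -/

/-- The data of a `Σ_*`-object in dg-modules over `ℤ`: for every arity `r`, a `ℤ`-graded abelian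
group `X r`, a differential lowering the degree by one (the two degrees are linked by an equation,
to avoid transports), and operators for the permutations of the `r` inputs. -/
structure SigmaData where
  X : ℕ → ℤ → Type
  [grp : ∀ r i, AddCommGroup (X r i)]
  d : ∀ {r : ℕ} {i j : ℤ}, j + 1 = i → X r i →ₗ[ℤ] X r j
  act : ∀ {r : ℕ} {i : ℤ}, Perm (Fin r) → X r i →ₗ[ℤ] X r i

attribute [instance] SigmaData.grp

/-- The laws of a `Σ_*`-object: `d² = 0`, and `Σ_r` acts (on the left) by chain maps. -/
structure IsSigma (A : SigmaData) : Prop where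
  d_d : ∀ {r : ℕ} {i j k : ℤ} (hij : j + 1 = i) (hjk : k + 1 = j) (x : A.X r i),
    A.d hjk (A.d hij x) = 0
  act_one : ∀ {r : ℕ} {i : ℤ} (x : A.X r i), A.act 1 x = x
  act_mul : ∀ {r : ℕ} {i : ℤ} (σ τ : Perm (Fin r)) (x : A.X r i),
    A.act (σ * τ) x = A.act σ (A.act τ x)
  d_act : ∀ {r : ℕ} {i j : ℤ} (h : j + 1 = i) (σ : Perm (Fin r)) (x : A.X r i),
    A.d h (A.act σ x) = A.act σ (A.d h x)

/-- Families of linear maps of degree zero. -/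
abbrev GradedMap (A B : SigmaData) : Type := ∀ (r : ℕ) (i : ℤ), A.X r i →ₗ[ℤ] B.X r i

/-- Morphisms of `Σ_*`-objects: they commute with differentials and permutations. -/
structure IsSigmaHom {A B : SigmaData} (f : GradedMap A B) : Prop where
  map_d : ∀ {r : ℕ} {i j : ℤ} (h : j + 1 = i) (x : A.X r i), f r j (A.d h x) = B.d h (f r i x)
  map_act : ∀ {r : ℕ} {i : ℤ} (σ : Perm (Fin r)) (x : A.X r i),
    f r i (A.act σ x) = B.act σ (f r i x)

/-- Fibrations: surjective in every arity and every degree. -/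
def IsFibration {A B : SigmaData} (f : GradedMap A B) : Prop :=
  ∀ (r : ℕ) (i : ℤ), Function.Surjective (f r i)

/-- Weak equivalences: injective and surjective on homology, in every arity and every degree. -/
def IsWeakEquivalence {A B : SigmaData} (f : GradedMap A B) : Prop :=
  ∀ (r : ℕ) (i : ℤ),
    (∀ x : A.X r i, A.d (sub_add_cancel i 1) x = 0 →
      (∃ y : B.X r (i + 1), B.d rfl y = f r i x) → ∃ z : A.X r (i + 1), A.d rfl z = x) ∧
    (∀ y : B.X r i, B.d (sub_add_cancel i 1) y = 0 →
      ∃ x : A.X r i, A.d (sub_add_cancel i 1) x = 0 ∧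
        ∃ z : B.X r (i + 1), y - f r i x = B.d rfl z)

/-- `L` is a cofibrant `Σ_*`-object: `0 → L` has the left lifting property with respect to the
acyclic fibrations of `Σ_*`-objects. -/
def IsCofibrantSigma (L : SigmaData) : Prop :=
  IsSigma L ∧
  ∀ (A B : SigmaData), IsSigma A → IsSigma B →
  ∀ p : GradedMap A B, IsSigmaHom p → IsFibration p → IsWeakEquivalence p →
  ∀ f : GradedMap L B, IsSigmaHom f →
  ∃ g : GradedMap L A, IsSigmaHom g ∧ ∀ (r : ℕ) (i : ℤ) (x : L.X r i), p r i (g r i x) = f r i x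

/-! ### Input sharing for partial composites -/

/-- The inputs of a partial composite `p ∘_e q`, where `p` has `s` inputs and `q` has `t` inputs
(numbered from `0`): the input `i ≠ e` of `p` goes to `i` if `i < e` and to `i + t - 1` if `i > e`,
the input `j` of `q` goes to `e + j`. -/
def insFun {s t r : ℕ} (hr : r + 1 = s + t) (e : Fin s) : {i : Fin s // i ≠ e} ⊕ Fin t → Fin r
  | Sum.inl i => if h : i.1 < e then ⟨i.1, by have := i.1.2; have := e.2; omega⟩
      else ⟨i.1 + t - 1, by
        have := i.1.2
        have h2 : (i.1 : ℕ) ≠ e := fun h' => i.2 (Fin.ext h')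
        omega⟩
  | Sum.inr j => ⟨e + j, by have := j.2; have := e.2; omega⟩

theorem insFun_injective {s t r : ℕ} (hr : r + 1 = s + t) (e : Fin s) :
    Function.Injective (insFun hr e) := by
  rintro (⟨i, hi⟩ | j) (⟨i', hi'⟩ | j') h
  · have h1 : (i : ℕ) ≠ e := fun h' => hi (Fin.ext h')
    have h2 : (i' : ℕ) ≠ e := fun h' => hi' (Fin.ext h')
    have : (i : ℕ) = i' := by
      simp only [insFun, Fin.lt_def] at h
      split_ifs at h <;> simp only [Fin.mk.injEq] at h <;> omega
    simp [Fin.ext this]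
  · exfalso
    have h1 : (i : ℕ) ≠ e := fun h' => hi (Fin.ext h')
    have := j'.2
    simp only [insFun, Fin.lt_def] at h
    split_ifs at h <;> simp only [Fin.mk.injEq] at h <;> omega
  · exfalso
    have h1 : (i' : ℕ) ≠ e := fun h' => hi' (Fin.ext h')
    have := j.2
    simp only [insFun, Fin.lt_def] at h
    split_ifs at h <;> simp only [Fin.mk.injEq] at h <;> omega
  · simp only [insFun, Fin.mk.injEq] at h
    exact congrArg Sum.inr (Fin.ext (by omega))

theorem insFun_bijective {s t r : ℕ} (hr : r + 1 = s + t) (e : Fin s) :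
    Function.Bijective (insFun hr e) := by
  rw [Fintype.bijective_iff_injective_and_card]
  refine ⟨insFun_injective hr e, ?_⟩
  have := e.2
  simp [Fintype.card_subtype_compl]
  omega

/-- `insFun` as a bijection. -/
def insEquiv {s t r : ℕ} (hr : r + 1 = s + t) (e : Fin s) :
    {i : Fin s // i ≠ e} ⊕ Fin t ≃ Fin r :=
  Equiv.ofBijective (insFun hr e) (insFun_bijective hr e)

/-- The permutation of the inputs of `p ∘_e q` induced by permutations `σ` of the inputs of `p` and
`τ` of the inputs of `q`; it goes from the numbering of `p ∘_e q` to that of `p ∘_{σ e} q`. -/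
def blockPerm {s t r : ℕ} (hr : r + 1 = s + t) (e : Fin s) (σ : Perm (Fin s)) (τ : Perm (Fin t)) :
    Perm (Fin r) :=
  (insEquiv hr e).symm.trans
    ((Equiv.sumCongr
      (σ.subtypeEquiv (fun _ => (σ.injective.ne_iff).symm) : {i // i ≠ e} ≃ {i // i ≠ σ e}) τ).trans
      (insEquiv hr (σ e)))

/-! ### Connected operads -/

/-- The data of an operad in dg-modules, presented by partial composites
`p ∘_e q ∈ P(r)`, `r + 1 = s + t`, for `p ∈ P(s)`, `q ∈ P(t)`. -/
structure OperadData extends SigmaData where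
  one : ∀ {i : ℤ}, i = 0 → X 1 i
  comp : ∀ {s t r : ℕ} {i j k : ℤ}, r + 1 = s + t → i + j = k → Fin s →
    (X s i →ₗ[ℤ] X t j →ₗ[ℤ] X r k)

/-- The laws of a connected operad: `P(0) = 0`, `P(1) = ℤ` (generated by the unit), and the unit,
associativity, equivariance and derivation relations of the partial composites. -/
structure IsOperad (P : OperadData) : Prop where
  isSigma : IsSigma P.toSigmaData
  arity_zero : ∀ i : ℤ, Subsingleton (P.X 0 i)
  arity_one : ∀ i : ℤ, i ≠ 0 → Subsingleton (P.X 1 i)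
  arity_one_zero : Function.Bijective (fun n : ℤ => n • (P.one rfl : P.X 1 0))
  one_comp : ∀ {r : ℕ} {k : ℤ} (hr : r + 1 = 1 + r) (hk : 0 + k = k) (e : Fin 1) (q : P.X r k),
    P.comp hr hk e (P.one rfl) q = q
  comp_one : ∀ {r : ℕ} {k : ℤ} (hr : r + 1 = r + 1) (hk : k + 0 = k) (e : Fin r) (p : P.X r k),
    P.comp hr hk e p (P.one rfl) = p
  assoc_seq : ∀ {s t u a b r : ℕ} {i j k l m n : ℤ} (ha : a + 1 = s + t) (hra : r + 1 = a + u)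
    (hb : b + 1 = t + u) (hrb : r + 1 = s + b) (hl : i + j = l) (hln : l + k = n)
    (hm : j + k = m) (hmn : i + m = n) (e : Fin s) (f : Fin t) (g : Fin a), (g : ℕ) = e + f →
    ∀ (p : P.X s i) (q : P.X t j) (x : P.X u k),
    P.comp hra hln g (P.comp ha hl e p q) x = P.comp hrb hmn e p (P.comp hb hm f q x)
  assoc_par : ∀ {s t u a b r : ℕ} {i j k l m n : ℤ} (ha : a + 1 = s + t) (hra : r + 1 = a + u)
    (hb : b + 1 = s + u) (hrb : r + 1 = b + t) (hl : i + j = l) (hln : l + k = n)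
    (hm : i + k = m) (hmn : m + j = n) (e f : Fin s) (g : Fin a) (h : Fin b), e < f →
    (g : ℕ) + 1 = f + t → (h : ℕ) = e →
    ∀ (p : P.X s i) (q : P.X t j) (x : P.X u k),
    P.comp hra hln g (P.comp ha hl e p q) x =
      (j * k).negOnePow • P.comp hrb hmn h (P.comp hb hm f p x) q
  equivariance : ∀ {s t r : ℕ} {i j k : ℤ} (hr : r + 1 = s + t) (hk : i + j = k) (e : Fin s)
    (σ : Perm (Fin s)) (τ : Perm (Fin t)) (p : P.X s i) (q : P.X t j),
    P.comp hr hk (σ e) (P.act σ p) (P.act τ q) = P.act (blockPerm hr e σ τ) (P.comp hr hk e p q)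
  leibniz : ∀ {s t r : ℕ} {i i' j j' k k' : ℤ} (hr : r + 1 = s + t) (hk : i + j = k)
    (hi : i' + 1 = i) (hj : j' + 1 = j) (hk' : k' + 1 = k) (h₁ : i' + j = k') (h₂ : i + j' = k')
    (e : Fin s) (p : P.X s i) (q : P.X t j),
    P.d hk' (P.comp hr hk e p q) =
      P.comp hr h₁ e (P.d hi p) q + i.negOnePow • P.comp hr h₂ e p (P.d hj q)

/-- Morphisms of connected operads. -/
structure IsOperadHom {P Q : OperadData} (f : GradedMap P.toSigmaData Q.toSigmaData) : Prop where
  isSigmaHom : IsSigmaHom f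
  map_one : f 1 0 (P.one rfl) = Q.one rfl
  map_comp : ∀ {s t r : ℕ} {i j k : ℤ} (hr : r + 1 = s + t) (hk : i + j = k) (e : Fin s)
    (p : P.X s i) (q : P.X t j),
    f r k (P.comp hr hk e p q) = Q.comp hr hk e (f s i p) (f t j q)

/-- `P` is a cofibrant (connected) operad: the morphism `I → P` from the initial operad has the
left lifting property with respect to the acyclic fibrations of connected operads, where fibrations
and weak equivalences are those of the underlying `Σ_*`-objects. -/
def IsCofibrantOperad (P : OperadData) : Prop :=
  IsOperad P ∧
  ∀ (A B : OperadData), IsOperad A → IsOperad B →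
  ∀ p : GradedMap A.toSigmaData B.toSigmaData,
    IsOperadHom p → IsFibration p → IsWeakEquivalence p →
  ∀ f : GradedMap P.toSigmaData B.toSigmaData, IsOperadHom f →
  ∃ g : GradedMap P.toSigmaData A.toSigmaData,
    IsOperadHom g ∧ ∀ (r : ℕ) (i : ℤ) (x : P.X r i), p r i (g r i x) = f r i x

/-! ### Connected cooperads -/

/-- The data of a cooperad in dg-modules, presented by partial decompositions dual to the partial
composites: `decomp hr hk e` is the component of degree `(i, j)` of `D(r) → D(s) ⊗ D(t)`. -/
structure CooperadData extends SigmaData where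
  counit : ∀ {i : ℤ}, i = 0 → X 1 i →ₗ[ℤ] ℤ
  decomp : ∀ {s t r : ℕ} {i j k : ℤ}, r + 1 = s + t → i + j = k → Fin s →
    (X r k →ₗ[ℤ] X s i ⊗[ℤ] X t j)

/-- The laws of a connected cooperad: `D(0) = 0`, `D(1) = ℤ` through the counit, and the relations
dual to those of a connected operad.  By `finite`, the components of the decompositions define a
map to the direct sum `⨁_{i + j = k} D(s)_i ⊗ D(t)_j`. -/
structure IsCooperad (D : CooperadData) : Prop where
  isSigma : IsSigma D.toSigmaData
  arity_zero : ∀ i : ℤ, Subsingleton (D.X 0 i)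
  arity_one : ∀ i : ℤ, i ≠ 0 → Subsingleton (D.X 1 i)
  arity_one_zero : Function.Bijective (D.counit rfl : D.X 1 0 →ₗ[ℤ] ℤ)
  finite : ∀ {s t r : ℕ} {k : ℤ} (hr : r + 1 = s + t) (e : Fin s) (c : D.X r k),
    {p : ℤ × ℤ | ∃ hk : p.1 + p.2 = k, D.decomp hr hk e c ≠ 0}.Finite
  counit_decomp : ∀ {r : ℕ} {k : ℤ} (hr : r + 1 = 1 + r) (hk : 0 + k = k) (e : Fin 1)
    (c : D.X r k), TensorProduct.lid ℤ _ ((D.counit rfl).rTensor _ (D.decomp hr hk e c)) = c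
  decomp_counit : ∀ {r : ℕ} {k : ℤ} (hr : r + 1 = r + 1) (hk : k + 0 = k) (e : Fin r)
    (c : D.X r k), TensorProduct.rid ℤ _ ((D.counit rfl).lTensor _ (D.decomp hr hk e c)) = c
  coassoc_seq : ∀ {s t u a b r : ℕ} {i j k l m n : ℤ} (ha : a + 1 = s + t) (hra : r + 1 = a + u)
    (hb : b + 1 = t + u) (hrb : r + 1 = s + b) (hl : i + j = l) (hln : l + k = n)
    (hm : j + k = m) (hmn : i + m = n) (e : Fin s) (f : Fin t) (g : Fin a), (g : ℕ) = e + f →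
    ∀ c : D.X r n,
    TensorProduct.assoc ℤ _ _ _ ((D.decomp ha hl e).rTensor (D.X u k) (D.decomp hra hln g c)) =
      (D.decomp hb hm f).lTensor (D.X s i) (D.decomp hrb hmn e c)
  coassoc_par : ∀ {s t u a b r : ℕ} {i j k l m n : ℤ} (ha : a + 1 = s + t) (hra : r + 1 = a + u)
    (hb : b + 1 = s + u) (hrb : r + 1 = b + t) (hl : i + j = l) (hln : l + k = n)
    (hm : i + k = m) (hmn : m + j = n) (e f : Fin s) (g : Fin a) (h : Fin b), e < f →
    (g : ℕ) + 1 = f + t → (h : ℕ) = e →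
    ∀ c : D.X r n,
    TensorProduct.rightComm ℤ _ _ _
        ((D.decomp ha hl e).rTensor (D.X u k) (D.decomp hra hln g c)) =
      (j * k).negOnePow • (D.decomp hb hm f).rTensor (D.X t j) (D.decomp hrb hmn h c)
  equivariance : ∀ {s t r : ℕ} {i j k : ℤ} (hr : r + 1 = s + t) (hk : i + j = k) (e : Fin s)
    (σ : Perm (Fin s)) (τ : Perm (Fin t)) (c : D.X r k),
    D.decomp hr hk (σ e) (D.act (blockPerm hr e σ τ) c) =
      TensorProduct.map (D.act σ) (D.act τ) (D.decomp hr hk e c)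
  leibniz : ∀ {s t r : ℕ} {i i' j j' k k' : ℤ} (hr : r + 1 = s + t) (hi : i + 1 = i')
    (hj : j + 1 = j') (hk : k + 1 = k') (h : i + j = k) (h₁ : i' + j = k') (h₂ : i + j' = k')
    (e : Fin s) (c : D.X r k'),
    D.decomp hr h e (D.d hk c) =
      (D.d hi).rTensor (D.X t j) (D.decomp hr h₁ e c) +
        i.negOnePow • (D.d hj).lTensor (D.X s i) (D.decomp hr h₂ e c)

/-- Morphisms of connected cooperads. -/
structure IsCooperadHom {C D : CooperadData} (f : GradedMap C.toSigmaData D.toSigmaData) :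
    Prop where
  isSigmaHom : IsSigmaHom f
  map_counit : ∀ x : C.X 1 0, D.counit rfl (f 1 0 x) = C.counit rfl x
  map_decomp : ∀ {s t r : ℕ} {i j k : ℤ} (hr : r + 1 = s + t) (hk : i + j = k) (e : Fin s)
    (c : C.X r k),
    D.decomp hr hk e (f r k c) = TensorProduct.map (f s i) (f t j) (C.decomp hr hk e c)

/-- `L`, with the morphisms `ι n : D n → L`, is a colimit of the sequence
`D 0 → D 1 → D 2 → ⋯` in the category of connected cooperads. -/
structure IsSeqColimit (D : ℕ → CooperadData)
    (φ : ∀ n, GradedMap (D n).toSigmaData (D (n + 1)).toSigmaData)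
    (L : CooperadData) (ι : ∀ n, GradedMap (D n).toSigmaData L.toSigmaData) : Prop where
  isCooperad : IsCooperad L
  isHom : ∀ n, IsCooperadHom (ι n)
  comm : ∀ n r i (x : (D n).X r i), ι (n + 1) r i (φ n r i x) = ι n r i x
  existsUnique : ∀ T : CooperadData, IsCooperad T →
    ∀ f : ∀ n, GradedMap (D n).toSigmaData T.toSigmaData, (∀ n, IsCooperadHom (f n)) →
    (∀ n r i (x : (D n).X r i), f (n + 1) r i (φ n r i x) = f n r i x) →
    ∃! g : GradedMap L.toSigmaData T.toSigmaData,
      IsCooperadHom g ∧ ∀ n r i (x : (D n).X r i), g r i (ι n r i x) = f n r i x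

/-! ### Operadic suspension and duality -/

/-- Degreewise finitely generated and free `Σ_*`-objects. -/
class FiniteFree (A : SigmaData) : Prop where
  finite : ∀ (r : ℕ) (i : ℤ), Module.Finite ℤ (A.X r i)
  free : ∀ (r : ℕ) (i : ℤ), Module.Free ℤ (A.X r i)

/-- The operadic suspension `ΛP(r) = Σ^{1-r} P(r)^±`: an element of degree `i` of `ΛP(r)` is an
element of degree `i + r - 1` of `P(r)`.  The signs are those of the tensor product
`End_{ℤ[1]} ⊗ P` with the endomorphism operad of `ℤ[1]`. -/
def lam (P : OperadData) : OperadData where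
  X r i := P.X r (i + (r - 1))
  d {r i j} h := (((r : ℤ) - 1).negOnePow : ℤ) • P.d (by omega)
  act σ := (Perm.sign σ : ℤ) • P.act σ
  one h := P.one (by subst h; norm_num)
  comp {s t r i j k} hr hk e :=
    ((((t : ℤ) - 1) * (i + (s - 1) + e)).negOnePow : ℤ) • P.comp hr (by omega) e

/-- The functor `Λ` on families of linear maps. -/
def lamMap {P Q : OperadData} (f : GradedMap P.toSigmaData Q.toSigmaData) :
    GradedMap (lam P).toSigmaData (lam Q).toSigmaData :=
  fun r i => f r (i + (r - 1))

/-- The functor `Λⁿ` on families of linear maps. -/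
def lamPowMap : ∀ (n : ℕ) {P Q : OperadData}, GradedMap P.toSigmaData Q.toSigmaData →
    GradedMap (lam^[n] P).toSigmaData (lam^[n] Q).toSigmaData
  | 0, _, _, f => f
  | n + 1, _, _, f => lamPowMap n (lamMap f)

instance lam_finiteFree (P : OperadData) [h : FiniteFree P.toSigmaData] :
    FiniteFree (lam P).toSigmaData where
  finite r i := h.finite r (i + (r - 1))
  free r i := h.free r (i + (r - 1))

instance lamPow_finiteFree (n : ℕ) (P : OperadData) [h : FiniteFree P.toSigmaData] :
    FiniteFree (lam^[n] P).toSigmaData := by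
  induction n generalizing P with
  | zero => exact h
  | succ n ih => exact ih (lam P)

/-- The dual cooperad `P^∨(r) = Hom(P(r), ℤ)` of a degreewise finitely generated free operad.  A
homomorphism of degree `i` is a linear form on `P(r)_{-i}`; its differential is
`-(-1)^i f ∘ d`, and the decomposition of `f` is `f ∘ (- ∘_e -)` under the isomorphism
`P^∨(s) ⊗ P^∨(t) ≃ (P(s) ⊗ P(t))^∨`, `(a ⊗ b)(p ⊗ q) = (-1)^{|b||p|} a(p) b(q)`. -/
def dual (P : OperadData) [h : FiniteFree P.toSigmaData] : CooperadData where
  X r i := Module.Dual ℤ (P.X r (-i))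
  d {_ i j} h := (-(i.negOnePow : ℤ)) • (P.d (show -i + 1 = -j by omega)).dualMap
  act σ := (P.act σ⁻¹).dualMap
  counit h := Module.Dual.eval ℤ _ (P.one (by omega))
  decomp {s t _ i j _} hr hk e :=
    haveI := h.finite s (-i)
    haveI := h.finite t (-j)
    haveI := h.free s (-i)
    haveI := h.free t (-j)
    ((i * j).negOnePow : ℤ) • ((TensorProduct.dualDistribEquiv ℤ (P.X s (-i)) (P.X t (-j))).symm.toLinearMap ∘ₗ
      (TensorProduct.lift (P.comp hr (show -i + -j = _ by omega) e)).dualMap)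

/-- The transpose of a family of linear maps. -/
def dualMap {P Q : OperadData} [FiniteFree P.toSigmaData] [FiniteFree Q.toSigmaData]
    (f : GradedMap P.toSigmaData Q.toSigmaData) :
    GradedMap (dual Q).toSigmaData (dual P).toSigmaData :=
  fun r i =>
    show Module.Dual ℤ (Q.X r (-i)) →ₗ[ℤ] Module.Dual ℤ (P.X r (-i)) from (f r (-i)).dualMap

/-! ### The Barratt–Eccles operad and its filtration -/

open Classical in
/-- The number `μ_{ij}` of variations of the order of `i, j` along a sequence of permutations, a
permutation `w` being seen as the sequence of its values `(w(0), …, w(r-1))`. -/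
def variations {r : ℕ} (i j : Fin r) : List (Perm (Fin r)) → ℕ
  | a :: b :: l =>
    (if (a.symm i < a.symm j ↔ b.symm i < b.symm j) then 0 else 1) + variations i j (b :: l)
  | _ => 0

/-- Basis simplices of `E_n(r)` in degree `d`: non-degenerate sequences `(w_0, …, w_d)` of
permutations such that `μ_{ij} < n` for all pairs; by convention `E_n(0) = 0`. -/
structure IsSimplex (n r : ℕ) (d : ℤ) (w : List (Perm (Fin r))) : Prop where
  arity_pos : 0 < r
  ne_nil : w ≠ []
  length_eq : (w.length : ℤ) = d + 1
  nondegenerate : w.IsChain (· ≠ ·)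
  variations_lt : ∀ i j : Fin r, i ≠ j → variations i j w < n

/-- The type of basis simplices of `E_n(r)_d`. -/
def Simp (n r : ℕ) (d : ℤ) : Type := {w : List (Perm (Fin r)) // IsSimplex n r d w}

instance (n r : ℕ) (d : ℤ) : Finite (Simp n r d) := by
  have : {w : List (Perm (Fin r)) | IsSimplex n r d w}.Finite := by
    refine (List.finite_length_eq (Perm (Fin r)) (d + 1).toNat).subset fun w hw => ?_
    have := hw.length_eq
    change w.length = _
    omega
  exact this.to_subtype

open Classical in
/-- The class of a sequence of permutations in the normalized complex; degenerate sequences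
vanish. -/
def simplex (n : ℕ) {r : ℕ} (d : ℤ) (w : List (Perm (Fin r))) : Simp n r d →₀ ℤ :=
  if h : IsSimplex n r d w then Finsupp.single ⟨w, h⟩ 1 else 0

/-- The paths `(0,0) = (k_0, l_0) → ⋯ → (k_{m+n}, l_{m+n}) = (m, n)` in the product of two
sequences, each with the signature of the corresponding shuffle: a step in the second sequence
taken before `k` remaining steps of the first one contributes `(-1)^k`. -/
def shuffles {α β : Type} : List α → List β → List (ℤ × List (α × β))
  | [], _ => []
  | _ :: _, [] => []
  | [a], [b] => [(1, [(a, b)])]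
  | a :: a' :: as, [b] => (shuffles (a' :: as) [b]).map fun p => (p.1, (a, b) :: p.2)
  | [a], b :: b' :: bs => (shuffles [a] (b' :: bs)).map fun p => (p.1, (a, b) :: p.2)
  | a :: a' :: as, b :: b' :: bs =>
    ((shuffles (a' :: as) (b :: b' :: bs)).map fun p => (p.1, (a, b) :: p.2)) ++
      ((shuffles (a :: a' :: as) (b' :: bs)).map fun p =>
        ((-1) ^ (as.length + 1) * p.1, (a, b) :: p.2))
  termination_by a b => a.length + b.length

/-- The substitution `u ∘_e v` of permutations: the value `e` in the sequence of values of `u` is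
replaced by the sequence of values of `v` (with the usual shifts of the values). -/
def permComp {s t r : ℕ} (hr : r + 1 = s + t) (e : Fin s) (u : Perm (Fin s)) (v : Perm (Fin t)) :
    Perm (Fin r) :=
  blockPerm hr (u.symm e) u v

/-- The `n`-th layer `E_n` of the Barratt–Eccles chain operad. -/
def barrattEccles (n : ℕ) : OperadData where
  X r i := Simp n r i →₀ ℤ
  d {_ _ j} _ := Finsupp.linearCombination ℤ fun w =>
    ∑ m ∈ Finset.range w.1.length, (-1 : ℤ) ^ m • simplex n j (w.1.eraseIdx m)
  act {_ i} σ := Finsupp.linearCombination ℤ fun w => simplex n i (w.1.map (σ * ·))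
  one {i} _ := simplex n i [1]
  comp {_ _ _ _ _ k} hr _ e := Finsupp.linearCombination ℤ fun u =>
    Finsupp.linearCombination ℤ fun v =>
      ((shuffles u.1 v.1).map fun p =>
        p.1 • simplex n k (p.2.map fun ab => permComp hr e ab.1 ab.2)).sum

instance barrattEccles_finiteFree (n : ℕ) : FiniteFree (barrattEccles n).toSigmaData where
  finite r i := inferInstanceAs (Module.Finite ℤ (Simp n r i →₀ ℤ))
  free r i := inferInstanceAs (Module.Free ℤ (Simp n r i →₀ ℤ))

open Classical in
/-- The cochain `sgn`: the signature of `(w_0(0), …, w_{r-1}(0))` if this sequence is a permutation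
of the `r` inputs, and zero otherwise (in particular in degrees other than `r - 1`). -/
def sgnCochain {r : ℕ} (hr : 0 < r) (w : List (Perm (Fin r))) : ℤ :=
  if hw : w.length = r then
    if hf : Function.Bijective fun m : Fin r => w.get (m.cast hw.symm) ⟨0, hr⟩ then
      (Perm.sign (Equiv.ofBijective _ hf) : ℤ)
    else 0
  else 0

/-- The suspension morphism `σ : E_{n+1} → Λ⁻¹E_n`, written as `ΛE_{n+1} → E_n`: the cap product
`sgn ∩ (w_0, …, w_d) = sgn(w_0, …, w_{r-1}) (w_{r-1}, …, w_d)`. -/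
def suspension (n : ℕ) :
    GradedMap (lam (barrattEccles (n + 1))).toSigmaData (barrattEccles n).toSigmaData :=
  fun r i => Finsupp.linearCombination ℤ fun w : Simp (n + 1) r (i + (r - 1)) =>
    sgnCochain w.2.arity_pos (w.1.take r) • simplex n i (w.1.drop (r - 1))

/-- The cooperad `D_n = Λ⁻ⁿE_n^∨ = (ΛⁿE_n)^∨`. -/
def dualCooperad (n : ℕ) : CooperadData := dual (lam^[n] (barrattEccles n))

/-- The morphism `σ^* : D_n → D_{n+1}`, transpose of `Λⁿσ : Λⁿ⁺¹E_{n+1} → ΛⁿE_n`. -/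
def suspensionStar (n : ℕ) :
    GradedMap (dualCooperad n).toSigmaData (dualCooperad (n + 1)).toSigmaData :=
  dualMap (P := lam^[n + 1] (barrattEccles (n + 1))) (Q := lam^[n] (barrattEccles n))
    (lamPowMap n (suspension n))

/-! ### Free and quasi-free operads -/

/-- Formal operadic expressions in the elements of `M(r)`, `r ≥ 2`. -/
inductive FreeTerm (M : SigmaData) : ℕ → ℤ → Type
  | gen {r : ℕ} {i : ℤ} (hr : 2 ≤ r) (x : M.X r i) : FreeTerm M r i
  | one {i : ℤ} (hi : i = 0) : FreeTerm M 1 i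
  | zero {r : ℕ} {i : ℤ} : FreeTerm M r i
  | add {r : ℕ} {i : ℤ} (p q : FreeTerm M r i) : FreeTerm M r i
  | neg {r : ℕ} {i : ℤ} (p : FreeTerm M r i) : FreeTerm M r i
  | act {r : ℕ} {i : ℤ} (σ : Perm (Fin r)) (p : FreeTerm M r i) : FreeTerm M r i
  | comp {s t r : ℕ} {i j k : ℤ} (hr : r + 1 = s + t) (hk : i + j = k) (e : Fin s)
      (p : FreeTerm M s i) (q : FreeTerm M t j) : FreeTerm M r k

open FreeTerm in
/-- The relations between formal operadic expressions: those of graded abelian groups, of operads,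
and the additivity and equivariance of the generators. -/
inductive FreeRel (M : SigmaData) : ∀ {r : ℕ} {i : ℤ}, FreeTerm M r i → FreeTerm M r i → Prop
  | add_left {r : ℕ} {i : ℤ} {p p' : FreeTerm M r i} (q : FreeTerm M r i) :
      FreeRel M p p' → FreeRel M (add p q) (add p' q)
  | add_right {r : ℕ} {i : ℤ} (p : FreeTerm M r i) {q q' : FreeTerm M r i} :
      FreeRel M q q' → FreeRel M (add p q) (add p q')
  | neg_congr {r : ℕ} {i : ℤ} {p p' : FreeTerm M r i} :
      FreeRel M p p' → FreeRel M (neg p) (neg p')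
  | act_congr {r : ℕ} {i : ℤ} (σ : Perm (Fin r)) {p p' : FreeTerm M r i} :
      FreeRel M p p' → FreeRel M (act σ p) (act σ p')
  | comp_left {s t r : ℕ} {i j k : ℤ} (hr : r + 1 = s + t) (hk : i + j = k) (e : Fin s)
      {p p' : FreeTerm M s i} (q : FreeTerm M t j) :
      FreeRel M p p' → FreeRel M (comp hr hk e p q) (comp hr hk e p' q)
  | comp_right {s t r : ℕ} {i j k : ℤ} (hr : r + 1 = s + t) (hk : i + j = k) (e : Fin s)
      (p : FreeTerm M s i) {q q' : FreeTerm M t j} :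
      FreeRel M q q' → FreeRel M (comp hr hk e p q) (comp hr hk e p q')
  | add_assoc {r : ℕ} {i : ℤ} (p q x : FreeTerm M r i) :
      FreeRel M (add (add p q) x) (add p (add q x))
  | add_comm {r : ℕ} {i : ℤ} (p q : FreeTerm M r i) : FreeRel M (add p q) (add q p)
  | zero_add {r : ℕ} {i : ℤ} (p : FreeTerm M r i) : FreeRel M (add zero p) p
  | neg_add {r : ℕ} {i : ℤ} (p : FreeTerm M r i) : FreeRel M (add (neg p) p) zero
  | gen_add {r : ℕ} {i : ℤ} (hr : 2 ≤ r) (x y : M.X r i) :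
      FreeRel M (gen hr (x + y)) (add (gen hr x) (gen hr y))
  | gen_act {r : ℕ} {i : ℤ} (hr : 2 ≤ r) (σ : Perm (Fin r)) (x : M.X r i) :
      FreeRel M (gen hr (M.act σ x)) (act σ (gen hr x))
  | act_add {r : ℕ} {i : ℤ} (σ : Perm (Fin r)) (p q : FreeTerm M r i) :
      FreeRel M (act σ (add p q)) (add (act σ p) (act σ q))
  | act_one {r : ℕ} {i : ℤ} (p : FreeTerm M r i) : FreeRel M (act 1 p) p
  | act_mul {r : ℕ} {i : ℤ} (σ τ : Perm (Fin r)) (p : FreeTerm M r i) :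
      FreeRel M (act (σ * τ) p) (act σ (act τ p))
  | comp_add_left {s t r : ℕ} {i j k : ℤ} (hr : r + 1 = s + t) (hk : i + j = k) (e : Fin s)
      (p p' : FreeTerm M s i) (q : FreeTerm M t j) :
      FreeRel M (comp hr hk e (add p p') q) (add (comp hr hk e p q) (comp hr hk e p' q))
  | comp_add_right {s t r : ℕ} {i j k : ℤ} (hr : r + 1 = s + t) (hk : i + j = k) (e : Fin s)
      (p : FreeTerm M s i) (q q' : FreeTerm M t j) :
      FreeRel M (comp hr hk e p (add q q')) (add (comp hr hk e p q) (comp hr hk e p q'))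
  | one_comp {r : ℕ} {k : ℤ} (hr : r + 1 = 1 + r) (hk : 0 + k = k) (e : Fin 1)
      (q : FreeTerm M r k) : FreeRel M (comp hr hk e (one rfl) q) q
  | comp_one {r : ℕ} {k : ℤ} (hr : r + 1 = r + 1) (hk : k + 0 = k) (e : Fin r)
      (p : FreeTerm M r k) : FreeRel M (comp hr hk e p (one rfl)) p
  | assoc_seq {s t u a b r : ℕ} {i j k l m n : ℤ} (ha : a + 1 = s + t) (hra : r + 1 = a + u)
      (hb : b + 1 = t + u) (hrb : r + 1 = s + b) (hl : i + j = l) (hln : l + k = n)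
      (hm : j + k = m) (hmn : i + m = n) (e : Fin s) (f : Fin t) (g : Fin a)
      (hg : (g : ℕ) = e + f) (p : FreeTerm M s i) (q : FreeTerm M t j) (x : FreeTerm M u k) :
      FreeRel M (comp hra hln g (comp ha hl e p q) x) (comp hrb hmn e p (comp hb hm f q x))
  | assoc_par_even {s t u a b r : ℕ} {i j k l m n : ℤ} (ha : a + 1 = s + t) (hra : r + 1 = a + u)
      (hb : b + 1 = s + u) (hrb : r + 1 = b + t) (hl : i + j = l) (hln : l + k = n)
      (hm : i + k = m) (hmn : m + j = n) (e f : Fin s) (g : Fin a) (h : Fin b) (hef : e < f)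
      (hg : (g : ℕ) + 1 = f + t) (hh : (h : ℕ) = e) (hjk : Even (j * k))
      (p : FreeTerm M s i) (q : FreeTerm M t j) (x : FreeTerm M u k) :
      FreeRel M (comp hra hln g (comp ha hl e p q) x) (comp hrb hmn h (comp hb hm f p x) q)
  | assoc_par_odd {s t u a b r : ℕ} {i j k l m n : ℤ} (ha : a + 1 = s + t) (hra : r + 1 = a + u)
      (hb : b + 1 = s + u) (hrb : r + 1 = b + t) (hl : i + j = l) (hln : l + k = n)
      (hm : i + k = m) (hmn : m + j = n) (e f : Fin s) (g : Fin a) (h : Fin b) (hef : e < f)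
      (hg : (g : ℕ) + 1 = f + t) (hh : (h : ℕ) = e) (hjk : Odd (j * k))
      (p : FreeTerm M s i) (q : FreeTerm M t j) (x : FreeTerm M u k) :
      FreeRel M (comp hra hln g (comp ha hl e p q) x) (neg (comp hrb hmn h (comp hb hm f p x) q))
  | equivariance {s t r : ℕ} {i j k : ℤ} (hr : r + 1 = s + t) (hk : i + j = k) (e : Fin s)
      (σ : Perm (Fin s)) (τ : Perm (Fin t)) (p : FreeTerm M s i) (q : FreeTerm M t j) :
      FreeRel M (comp hr hk (σ e) (act σ p) (act τ q)) (act (blockPerm hr e σ τ) (comp hr hk e p q))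

/-- The component of arity `r` and degree `i` of the free operad on the `Σ_*`-object formed by the
components `M(r)`, `r ≥ 2`. -/
def FreeOp (M : SigmaData) (r : ℕ) (i : ℤ) : Type :=
  Quot (fun p q : FreeTerm M r i => FreeRel M p q)

namespace FreeOp

variable {M : SigmaData}

/-- The class of a formal expression. -/
def mk {r : ℕ} {i : ℤ} (p : FreeTerm M r i) : FreeOp M r i := Quot.mk _ p

theorem sound {r : ℕ} {i : ℤ} {p q : FreeTerm M r i} (h : FreeRel M p q) : mk p = mk q :=
  Quot.sound h

instance (r : ℕ) (i : ℤ) : Add (FreeOp M r i) :=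
  ⟨Quot.map₂ FreeTerm.add (fun p _ _ h => .add_right p h) (fun _ _ q h => .add_left q h)⟩

instance (r : ℕ) (i : ℤ) : Zero (FreeOp M r i) := ⟨mk FreeTerm.zero⟩

instance (r : ℕ) (i : ℤ) : Neg (FreeOp M r i) :=
  ⟨Quot.map FreeTerm.neg (fun _ _ h => .neg_congr h)⟩

instance (r : ℕ) (i : ℤ) : AddCommGroup (FreeOp M r i) where
  add_assoc := by rintro ⟨p⟩ ⟨q⟩ ⟨x⟩; exact Quot.sound (.add_assoc p q x)
  zero_add := by rintro ⟨p⟩; exact Quot.sound (.zero_add p)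
  add_zero := by
    rintro ⟨p⟩
    exact (Quot.sound (.add_comm p .zero)).trans (Quot.sound (.zero_add p))
  add_comm := by rintro ⟨p⟩ ⟨q⟩; exact Quot.sound (.add_comm p q)
  neg_add_cancel := by rintro ⟨p⟩; exact Quot.sound (.neg_add p)
  nsmul := nsmulRec
  zsmul := zsmulRec

/-- The inclusion of the generators. -/
def gen {r : ℕ} {i : ℤ} (hr : 2 ≤ r) : M.X r i →ₗ[ℤ] FreeOp M r i :=
  AddMonoidHom.toIntLinearMap
    (AddMonoidHom.mk' (fun x => mk (.gen hr x)) fun x y => Quot.sound (.gen_add hr x y))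

/-- The operadic unit of the free operad. -/
def one {i : ℤ} (hi : i = 0) : FreeOp M 1 i := mk (.one hi)

/-- The action of permutations on the free operad. -/
def act {r : ℕ} {i : ℤ} (σ : Perm (Fin r)) : FreeOp M r i →ₗ[ℤ] FreeOp M r i :=
  AddMonoidHom.toIntLinearMap
    (AddMonoidHom.mk' (Quot.map (FreeTerm.act σ) fun _ _ h => .act_congr σ h) (by
      rintro ⟨p⟩ ⟨q⟩; exact Quot.sound (.act_add σ p q)))

/-- The partial composites of the free operad. -/
def comp {s t r : ℕ} {i j k : ℤ} (hr : r + 1 = s + t) (hk : i + j = k) (e : Fin s) :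
    FreeOp M s i →ₗ[ℤ] FreeOp M t j →ₗ[ℤ] FreeOp M r k :=
  AddMonoidHom.toIntLinearMap
    (AddMonoidHom.mk' (fun p => AddMonoidHom.toIntLinearMap
      (AddMonoidHom.mk'
        (Quot.map₂ (FreeTerm.comp hr hk e) (fun p _ _ h => .comp_right hr hk e p h)
          (fun _ _ q h => .comp_left hr hk e q h) p)
        (by
          induction p using Quot.ind with | mk p => ?_
          rintro ⟨q⟩ ⟨q'⟩
          exact Quot.sound (.comp_add_right hr hk e p q q'))))
      (by
        rintro ⟨p⟩ ⟨p'⟩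
        ext ⟨q⟩
        exact Quot.sound (.comp_add_left hr hk e p p' q)))

theorem equivariance {s t r : ℕ} {i j k : ℤ} (hr : r + 1 = s + t) (hk : i + j = k) (e : Fin s)
    (σ : Perm (Fin s)) (τ : Perm (Fin t)) (p : FreeOp M s i) (q : FreeOp M t j) :
    comp hr hk (σ e) (act σ p) (act τ q) = act (blockPerm hr e σ τ) (comp hr hk e p q) := by
  obtain ⟨p⟩ := p; obtain ⟨q⟩ := q
  exact Quot.sound (.equivariance hr hk e σ τ p q)

theorem act_one {r : ℕ} {i : ℤ} (p : FreeOp M r i) : act 1 p = p := by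
  obtain ⟨p⟩ := p; exact Quot.sound (.act_one p)

theorem act_mul {r : ℕ} {i : ℤ} (σ τ : Perm (Fin r)) (p : FreeOp M r i) :
    act (σ * τ) p = act σ (act τ p) := by
  obtain ⟨p⟩ := p; exact Quot.sound (.act_mul σ τ p)

theorem one_comp {r : ℕ} {k : ℤ} (hr : r + 1 = 1 + r) (hk : 0 + k = k) (e : Fin 1)
    (q : FreeOp M r k) : comp hr hk e (one rfl) q = q := by
  obtain ⟨q⟩ := q; exact Quot.sound (.one_comp hr hk e q)

theorem comp_one {r : ℕ} {k : ℤ} (hr : r + 1 = r + 1) (hk : k + 0 = k) (e : Fin r)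
    (p : FreeOp M r k) : comp hr hk e p (one rfl) = p := by
  obtain ⟨p⟩ := p; exact Quot.sound (.comp_one hr hk e p)

theorem assoc_seq {s t u a b r : ℕ} {i j k l m n : ℤ} (ha : a + 1 = s + t)
    (hra : r + 1 = a + u) (hb : b + 1 = t + u) (hrb : r + 1 = s + b) (hl : i + j = l)
    (hln : l + k = n) (hm : j + k = m) (hmn : i + m = n) (e : Fin s) (f : Fin t) (g : Fin a)
    (hg : (g : ℕ) = e + f) (p : FreeOp M s i) (q : FreeOp M t j) (x : FreeOp M u k) :
    comp hra hln g (comp ha hl e p q) x = comp hrb hmn e p (comp hb hm f q x) := by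
  obtain ⟨p⟩ := p; obtain ⟨q⟩ := q; obtain ⟨x⟩ := x
  exact Quot.sound (.assoc_seq ha hra hb hrb hl hln hm hmn e f g hg p q x)

theorem assoc_par {s t u a b r : ℕ} {i j k l m n : ℤ} (ha : a + 1 = s + t)
    (hra : r + 1 = a + u) (hb : b + 1 = s + u) (hrb : r + 1 = b + t) (hl : i + j = l)
    (hln : l + k = n) (hm : i + k = m) (hmn : m + j = n) (e f : Fin s) (g : Fin a) (h : Fin b)
    (hef : e < f) (hg : (g : ℕ) + 1 = f + t) (hh : (h : ℕ) = e)
    (p : FreeOp M s i) (q : FreeOp M t j) (x : FreeOp M u k) :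
    comp hra hln g (comp ha hl e p q) x =
      (j * k).negOnePow • comp hrb hmn h (comp hb hm f p x) q := by
  obtain ⟨p⟩ := p; obtain ⟨q⟩ := q; obtain ⟨x⟩ := x
  rcases Int.even_or_odd (j * k) with hjk | hjk
  · rw [Int.negOnePow_even _ hjk, one_smul]
    exact Quot.sound (.assoc_par_even ha hra hb hrb hl hln hm hmn e f g h hef hg hh hjk p q x)
  · rw [Int.negOnePow_odd _ hjk, Units.neg_smul, one_smul]
    exact Quot.sound (.assoc_par_odd ha hra hb hrb hl hln hm hmn e f g h hef hg hh hjk p q x)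

end FreeOp

/-- A homomorphism of degree `-1` of `Σ_*`-objects from the generators `M` of the free operad to
the free operad. -/
structure GenDerivation (M : SigmaData) where
  toFun : ∀ {r : ℕ} {i j : ℤ}, 2 ≤ r → j + 1 = i → M.X r i →ₗ[ℤ] FreeOp M r j
  map_act : ∀ {r : ℕ} {i j : ℤ} (hr : 2 ≤ r) (h : j + 1 = i) (σ : Perm (Fin r)) (x : M.X r i),
    toFun hr h (M.act σ x) = FreeOp.act σ (toFun hr h x)

/-- The extension of `θ` to formal expressions by the derivation relation
`∂(p ∘_e q) = ∂p ∘_e q + (-1)^{|p|} p ∘_e ∂q`. -/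
def derivTerm {M : SigmaData} (θ : GenDerivation M) :
    ∀ {r : ℕ} {i : ℤ}, FreeTerm M r i → ∀ j : ℤ, j + 1 = i → FreeOp M r j
  | _, _, .gen hr x, _, h => θ.toFun hr h x
  | _, _, .one _, _, _ => 0
  | _, _, .zero, _, _ => 0
  | _, _, .add p q, j, h => derivTerm θ p j h + derivTerm θ q j h
  | _, _, .neg p, j, h => -derivTerm θ p j h
  | _, _, .act σ p, j, h => FreeOp.act σ (derivTerm θ p j h)
  | _, _, .comp (i := a) (j := b) hr hk e p q, j, h =>
    FreeOp.comp hr (show a - 1 + b = j by omega) e (derivTerm θ p (a - 1) (by omega)) (FreeOp.mk q) +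
      a.negOnePow • FreeOp.comp hr (show a + (b - 1) = j by omega) e (FreeOp.mk p)
        (derivTerm θ q (b - 1) (by omega))

theorem map_units_smul {A B : Type} [AddCommGroup A] [AddCommGroup B] (f : A →ₗ[ℤ] B) (u : ℤˣ)
    (x : A) : f (u • x) = u • f x := by
  rcases Int.units_eq_one_or u with rfl | rfl <;> simp

theorem units_smul_apply {A B : Type} [AddCommGroup A] [AddCommGroup B] (f : A →ₗ[ℤ] B) (u : ℤˣ)
    (x : A) : (u • f) x = u • f x := by
  rcases Int.units_eq_one_or u with rfl | rfl <;> simp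

theorem FreeOp.mk_comp {M : SigmaData} {s t r : ℕ} {i j k : ℤ} (hr : r + 1 = s + t)
    (hk : i + j = k) (e : Fin s) (p : FreeTerm M s i) (q : FreeTerm M t j) :
    (mk (.comp hr hk e p q) : FreeOp M r k) = comp hr hk e (FreeOp.mk p) (mk q) := rfl

theorem FreeOp.mk_act {M : SigmaData} {r : ℕ} {i : ℤ} (σ : Perm (Fin r)) (p : FreeTerm M r i) :
    (mk (.act σ p) : FreeOp M r i) = act σ (mk p) := rfl

theorem FreeOp.mk_add {M : SigmaData} {r : ℕ} {i : ℤ} (p q : FreeTerm M r i) :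
    (mk (.add p q) : FreeOp M r i) = mk p + mk q := rfl

theorem FreeOp.mk_one {M : SigmaData} {i : ℤ} (hi : i = 0) :
    (mk (.one hi) : FreeOp M 1 i) = one hi := rfl

theorem derivTerm_par {M : SigmaData} (θ : GenDerivation M) {s t u a b r : ℕ}
    {i j k l m n : ℤ} (ha : a + 1 = s + t)
    (hra : r + 1 = a + u) (hb : b + 1 = s + u) (hrb : r + 1 = b + t) (hl : i + j = l)
    (hln : l + k = n) (hm : i + k = m) (hmn : m + j = n) (e f : Fin s) (g : Fin a) (h : Fin b)
    (hef : e < f) (hg : (g : ℕ) + 1 = f + t) (hh : (h : ℕ) = e)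
    (p : FreeTerm M s i) (q : FreeTerm M t j) (x : FreeTerm M u k) (n' : ℤ) (hn : n' + 1 = n) :
    derivTerm θ (.comp hra hln g (.comp ha hl e p q) x) n' hn =
      (j * k).negOnePow • derivTerm θ (.comp hrb hmn h (.comp hb hm f p x) q) n' hn := by
  have h₁ : i - 1 + k = m - 1 := by omega
  have h₂ : i + (k - 1) = m - 1 := by omega
  have h₃ : m - 1 + j = n' := by omega
  have h₄ : m + (j - 1) = n' := by omega
  simp only [derivTerm, FreeOp.mk_comp, map_add, LinearMap.add_apply, smul_add,
    units_smul_apply, map_units_smul, smul_smul]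
  rw [FreeOp.assoc_par ha hra hb hrb _ _ h₁ h₃ e f g h hef hg hh,
    FreeOp.assoc_par ha hra hb hrb _ _ hm h₄ e f g h hef hg hh,
    FreeOp.assoc_par ha hra hb hrb hl _ h₂ h₃ e f g h hef hg hh]
  simp only [smul_smul, ← Int.negOnePow_add]
  have e₁ : (i + (j - 1) * k).negOnePow = (j * k + m).negOnePow := by
    rw [Int.negOnePow_eq_iff]
    exact ⟨-k, by rw [← hm]; ring⟩
  have e₂ : l + j * (k - 1) = j * k + i := by rw [← hl]; ring
  rw [e₁, e₂, add_assoc, add_assoc]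
  congr 1
  exact add_comm _ _

theorem derivTerm_rel {M : SigmaData} (θ : GenDerivation M) {r : ℕ} {i : ℤ}
    {p q : FreeTerm M r i} (hpq : FreeRel M p q) (j : ℤ) (h : j + 1 = i) :
    derivTerm θ p j h = derivTerm θ q j h := by
  induction hpq generalizing j with
  | add_left q _ ih => simp only [derivTerm, ih]
  | add_right p _ ih => simp only [derivTerm, ih]
  | neg_congr _ ih => simp only [derivTerm, ih]
  | act_congr σ _ ih => simp only [derivTerm, ih]
  | comp_left hr hk e q hp ih =>
    simp only [derivTerm, ih, FreeOp.sound hp]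
  | comp_right hr hk e p hq ih =>
    simp only [derivTerm, ih, FreeOp.sound hq]
  | add_assoc p q x => simp only [derivTerm, _root_.add_assoc]
  | add_comm p q => simp only [derivTerm]; exact _root_.add_comm _ _
  | zero_add p => simp only [derivTerm, _root_.zero_add]
  | neg_add p => simp only [derivTerm, neg_add_cancel]
  | gen_add hr x y => simp only [derivTerm, map_add]
  | gen_act hr σ x => simp only [derivTerm, θ.map_act]
  | act_add σ p q => simp only [derivTerm, map_add]
  | act_one p => simp only [derivTerm, FreeOp.act_one]
  | act_mul σ τ p => simp only [derivTerm, FreeOp.act_mul]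
  | comp_add_left hr hk e p p' q => simp only [derivTerm, FreeOp.mk_add, map_add, LinearMap.add_apply, smul_add]; abel
  | comp_add_right hr hk e p q q' => simp only [derivTerm, FreeOp.mk_add, map_add, smul_add]; abel
  | one_comp hr hk e q =>
    simp only [derivTerm, map_zero, LinearMap.zero_apply, _root_.zero_add, Int.negOnePow_zero,
      one_smul, FreeOp.mk_one]
    obtain rfl := eq_sub_of_add_eq h
    exact FreeOp.one_comp hr _ e _
  | comp_one hr hk e p =>
    simp only [derivTerm, map_zero, smul_zero, _root_.add_zero, FreeOp.mk_one]
    obtain rfl := eq_sub_of_add_eq h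
    exact FreeOp.comp_one hr _ e _
  | @assoc_seq s t u a b r i j' k l m n ha hra hb hrb hl hln hm hmn e f g hg p q x =>
    have h₁ : j' - 1 + k = m - 1 := by omega
    have h₂ : j' + (k - 1) = m - 1 := by omega
    have h₃ : i + (m - 1) = j := by omega
    have h₄ : i - 1 + m = j := by omega
    simp only [derivTerm, FreeOp.mk_comp, map_add, LinearMap.add_apply, smul_add,
      units_smul_apply, map_units_smul, smul_smul]
    rw [FreeOp.assoc_seq ha hra hb hrb _ _ hm h₄ e f g hg,
      FreeOp.assoc_seq ha hra hb hrb _ _ h₁ h₃ e f g hg,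
      FreeOp.assoc_seq ha hra hb hrb hl _ h₂ h₃ e f g hg,
      ← hl, Int.negOnePow_add, _root_.add_assoc]
  | @assoc_par_even s t u a b r i j' k l m n ha hra hb hrb hl hln hm hmn e f g h' hef hg hh hjk
      p q x =>
    rw [derivTerm_par θ ha hra hb hrb hl hln hm hmn e f g h' hef hg hh p q x j h,
      Int.negOnePow_even _ hjk, one_smul]
  | @assoc_par_odd s t u a b r i j' k l m n ha hra hb hrb hl hln hm hmn e f g h' hef hg hh hjk
      p q x =>
    rw [derivTerm_par θ ha hra hb hrb hl hln hm hmn e f g h' hef hg hh p q x j h,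
      Int.negOnePow_odd _ hjk, Units.neg_smul, one_smul]
    simp only [derivTerm]
  | equivariance hr hk e σ τ p q =>
    simp only [derivTerm, FreeOp.mk_act, map_add, map_units_smul, FreeOp.equivariance]

namespace FreeOp

variable {M : SigmaData}

/-- The derivation of the free operad which extends `θ`. -/
def deriv (θ : GenDerivation M) {r : ℕ} {i j : ℤ} (h : j + 1 = i) :
    FreeOp M r i →ₗ[ℤ] FreeOp M r j :=
  AddMonoidHom.toIntLinearMap
    (AddMonoidHom.mk' (Quot.lift (fun p => derivTerm θ p j h) fun _ _ hpq =>
      derivTerm_rel θ hpq j h) (by rintro ⟨p⟩ ⟨q⟩; rfl))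

end FreeOp

/-- The quasi-free operad: the free operad on the components of arity at least `2` of `M`, with the
differential given by the derivation which extends `θ`. -/
def quasiFree (M : SigmaData) (θ : GenDerivation M) : OperadData where
  X := FreeOp M
  d h := FreeOp.deriv θ h
  act σ := FreeOp.act σ
  one h := FreeOp.one h
  comp hr hk e := FreeOp.comp hr hk e

/-! ### The cobar construction -/

/-- The desuspension `Σ⁻¹M`. -/
def desusp (M : SigmaData) : SigmaData where
  X r i := M.X r (i + 1)
  d h := -M.d (by omega)
  act σ := M.act σ

/-- For a subset `J` of the inputs, with `t` elements, the permutation which maps `0, …, t - 1` to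
the elements of `J` and the other inputs to the elements of the complement, in increasing order. -/
def subsetPerm {r : ℕ} (J : Finset (Fin r)) : Perm (Fin r) :=
  (finCongr (show r = J.card + Jᶜ.card by
    rw [Finset.card_add_card_compl, Fintype.card_fin])).trans
    (finSumFinEquiv.symm.trans (finSumEquivOfFinset (s := J) rfl rfl))

section Cobar

variable {D : CooperadData}

/-- The generator `Σ⁻¹c` of the free operad on `Σ⁻¹D`. -/
def genDesusp {r : ℕ} {i : ℤ} (hr : 2 ≤ r) :
    D.X r (i + 1) →ₗ[ℤ] FreeOp (desusp D.toSigmaData) r i :=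
  FreeOp.gen (M := desusp D.toSigmaData) hr

/-- The homomorphism `c ↦ ∑ (-1)^{|c'|} Σ⁻¹c' ∘_0 Σ⁻¹c''`, for `∑ c' ⊗ c''` the component of degree
`(a + 1, b + 1)` of the decomposition of `c` dual to `∘_0`, in given arities. -/
def rootCompAux {s t r : ℕ} {a b i j : ℤ} (hr : r + 1 = s + t) (hs : 2 ≤ s) (ht : 2 ≤ t)
    (hab : a + b = j) (h : j + 1 = i) : D.X r (i + 1) →ₗ[ℤ] FreeOp (desusp D.toSigmaData) r j :=
  ((a + 1).negOnePow : ℤ) •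
    (TensorProduct.lift ((FreeOp.comp hr hab ⟨0, by omega⟩).compl₁₂ (genDesusp hs) (genDesusp ht)) ∘ₗ
      D.decomp hr (show a + 1 + (b + 1) = i + 1 by omega) ⟨0, by omega⟩)

theorem rootCompAux_finite (hD : IsCooperad D) {s t r : ℕ} {i j : ℤ} (hr : r + 1 = s + t)
    (hs : 2 ≤ s) (ht : 2 ≤ t) (h : j + 1 = i) (c : D.X r (i + 1)) :
    (Function.support fun a : ℤ =>
      rootCompAux hr hs ht (show a + (j - a) = j by omega) h c).Finite := by
  refine ((hD.finite hr ⟨0, by omega⟩ c).preimage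
    (f := fun a : ℤ => (a + 1, j - a + 1)) ?_).subset ?_
  · intro a _ b _ hab
    simpa using congrArg Prod.fst hab
  · intro a ha
    refine ⟨show a + 1 + (j - a + 1) = i + 1 by omega, fun h0 => ha ?_⟩
    simp only [rootCompAux, LinearMap.smul_apply, LinearMap.comp_apply, h0, map_zero, smul_zero]

/-- The sum of the previous homomorphisms over all degrees. -/
def rootComp (hD : IsCooperad D) {s t r : ℕ} {i j : ℤ} (hr : r + 1 = s + t) (hs : 2 ≤ s)
    (ht : 2 ≤ t) (h : j + 1 = i) : D.X r (i + 1) →ₗ[ℤ] FreeOp (desusp D.toSigmaData) r j :=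
  AddMonoidHom.toIntLinearMap
    (AddMonoidHom.mk' (fun c => ∑ᶠ a : ℤ, rootCompAux hr hs ht (show a + (j - a) = j by omega) h c)
      (by
        intro x y
        simp only [map_add]
        exact finsum_add_distrib (rootCompAux_finite hD hr hs ht h x)
          (rootCompAux_finite hD hr hs ht h y)))

/-- The component of the quadratic differential of `Σ⁻¹c` for the tree with two vertices where the
`t` inputs of the upper vertex are `w 0, …, w (t - 1)`. -/
def treeComp (hD : IsCooperad D) {s t r : ℕ} {i j : ℤ} (hr : r + 1 = s + t) (hs : 2 ≤ s)
    (ht : 2 ≤ t) (h : j + 1 = i) (w : Perm (Fin r)) :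
    D.X r (i + 1) →ₗ[ℤ] FreeOp (desusp D.toSigmaData) r j :=
  FreeOp.act w ∘ₗ rootComp hD hr hs ht h ∘ₗ D.act w⁻¹

/-- The quadratic part `∂` of the cobar differential on the generators: the sum, over the reduced
trees with two vertices and `r` inputs (indexed by the set `J` of inputs of the upper vertex), of
the desuspended components of the decomposition of the cooperad. -/
def quadraticDiff (hD : IsCooperad D) {r : ℕ} {i j : ℤ} (h : j + 1 = i) :
    D.X r (i + 1) →ₗ[ℤ] FreeOp (desusp D.toSigmaData) r j :=
  ∑ J : Finset (Fin r), if hJ : 2 ≤ J.card ∧ J.card < r then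
    treeComp hD (show r + 1 = (r + 1 - J.card) + J.card by omega) (by omega) hJ.1 h (subsetPerm J)
  else 0

theorem genDesusp_act {r : ℕ} {i : ℤ} (hr : 2 ≤ r) (σ : Perm (Fin r)) (c : D.X r (i + 1)) :
    genDesusp hr (D.act σ c) = FreeOp.act σ (genDesusp hr c) :=
  FreeOp.sound (FreeRel.gen_act (M := desusp D.toSigmaData) hr σ c)

theorem rootComp_blockPerm (hD : IsCooperad D) {s t r : ℕ} {i j : ℤ} (hr : r + 1 = s + t)
    (hs : 2 ≤ s) (ht : 2 ≤ t) (h : j + 1 = i) (σ : Perm (Fin s)) (hσ : σ ⟨0, by omega⟩ = ⟨0, by omega⟩)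
    (τ : Perm (Fin t)) (c : D.X r (i + 1)) :
    rootComp hD hr hs ht h (D.act (blockPerm hr ⟨0, by omega⟩ σ τ) c) =
      FreeOp.act (blockPerm hr ⟨0, by omega⟩ σ τ) (rootComp hD hr hs ht h c) := by
  have h1 : ∀ a : ℤ, rootCompAux hr hs ht (show a + (j - a) = j by omega) h
      (D.act (blockPerm hr ⟨0, by omega⟩ σ τ) c) =
      FreeOp.act (blockPerm hr ⟨0, by omega⟩ σ τ)
        (rootCompAux hr hs ht (show a + (j - a) = j by omega) h c) := by
    intro a
    have h2 := hD.equivariance hr (show a + 1 + (j - a + 1) = i + 1 by omega) ⟨0, by omega⟩ σ τ c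
    rw [hσ] at h2
    simp only [rootCompAux, LinearMap.smul_apply, LinearMap.comp_apply, h2, map_smul]
    congr 1
    generalize D.decomp hr _ _ c = y
    induction y with
    | zero => simp only [map_zero]
    | add y z hy hz => simp only [map_add, hy, hz]
    | tmul y z =>
      simp only [TensorProduct.map_tmul, TensorProduct.lift.tmul, LinearMap.compl₁₂_apply,
        genDesusp_act]
      have h3 := FreeOp.equivariance hr (show a + (j - a) = j by omega) ⟨0, by omega⟩ σ τ
        (genDesusp hs y : FreeOp (desusp D.toSigmaData) s a) (genDesusp ht z)
      rw [hσ] at h3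
      exact h3
  change (∑ᶠ a : ℤ, _) = FreeOp.act _ (∑ᶠ a : ℤ, _)
  rw [finsum_congr h1]
  exact ((FreeOp.act (M := desusp D.toSigmaData)
    (blockPerm hr ⟨0, by omega⟩ σ τ)).toAddMonoidHom.map_finsum
      (rootCompAux_finite hD hr hs ht h c)).symm

theorem insFun_inl_congr {s t r : ℕ} (hr : r + 1 = s + t) {e e' : Fin s} (he : e = e') (i : Fin s)
    (h : i ≠ e) (h' : i ≠ e') : insFun hr e (Sum.inl ⟨i, h⟩) = insFun hr e' (Sum.inl ⟨i, h'⟩) := by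
  subst he; rfl

theorem insFun_inr_congr {s t r : ℕ} (hr : r + 1 = s + t) {e e' : Fin s} (he : e = e')
    (j : Fin t) : insFun hr e (Sum.inr j) = insFun hr e' (Sum.inr j) := by
  subst he; rfl

theorem blockPerm_inl {s t r : ℕ} (hr : r + 1 = s + t) (e : Fin s) (σ : Perm (Fin s))
    (τ : Perm (Fin t)) (i : Fin s) (hi : i ≠ e) :
    blockPerm hr e σ τ (insFun hr e (Sum.inl ⟨i, hi⟩)) =
      insFun hr (σ e) (Sum.inl ⟨σ i, σ.injective.ne hi⟩) := by
  have : (insEquiv hr e).symm (insFun hr e (Sum.inl ⟨i, hi⟩)) = Sum.inl ⟨i, hi⟩ :=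
    (insEquiv hr e).symm_apply_apply (Sum.inl ⟨i, hi⟩)
  simp only [blockPerm, Equiv.trans_apply, this]
  rfl

theorem blockPerm_inr {s t r : ℕ} (hr : r + 1 = s + t) (e : Fin s) (σ : Perm (Fin s))
    (τ : Perm (Fin t)) (j : Fin t) :
    blockPerm hr e σ τ (insFun hr e (Sum.inr j)) = insFun hr (σ e) (Sum.inr (τ j)) := by
  have : (insEquiv hr e).symm (insFun hr e (Sum.inr j)) = Sum.inr j :=
    (insEquiv hr e).symm_apply_apply (Sum.inr j)
  simp only [blockPerm, Equiv.trans_apply, this]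
  rfl

theorem exists_blockPerm {s t r : ℕ} (hr : r + 1 = s + t) (hs : 0 < s) (g : Perm (Fin r))
    (hg : ∀ m : Fin r, (m : ℕ) < t → ((g m : Fin r) : ℕ) < t) :
    ∃ (σ : Perm (Fin s)) (τ : Perm (Fin t)), σ ⟨0, hs⟩ = ⟨0, hs⟩ ∧
      g = blockPerm hr ⟨0, hs⟩ σ τ := by
  let e : Fin s := ⟨0, hs⟩
  let φ : Fin t ⊕ {i : Fin s // i ≠ e} ≃ Fin r := (Equiv.sumComm _ _).trans (insEquiv hr e)
  have hφ : ∀ j : Fin t, (φ (Sum.inl j) : ℕ) = j := fun j => Nat.zero_add _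
  let g' : Perm (Fin t ⊕ {i : Fin s // i ≠ e}) := (φ.trans g).trans φ.symm
  have hg' : Set.MapsTo g' (Set.range Sum.inl) (Set.range Sum.inl) := by
    rintro _ ⟨j, rfl⟩
    have h1 := hg (φ (Sum.inl j)) (by rw [hφ]; exact j.2)
    refine ⟨⟨_, h1⟩, ?_⟩
    change _ = φ.symm (g (φ (Sum.inl j)))
    rw [Equiv.eq_symm_apply]
    exact Fin.ext (hφ _)
  obtain ⟨⟨τ, α⟩, hτα⟩ := Equiv.Perm.mem_sumCongrHom_range_of_perm_mapsTo_inl hg'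
  have key : ∀ x, g (φ x) = φ (Equiv.sumCongr τ α x) := by
    intro x
    have : Equiv.sumCongr τ α x = g' x := by rw [← hτα]; rfl
    rw [this]
    exact (φ.apply_symm_apply _).symm
  have he : Equiv.Perm.ofSubtype α e = e :=
    Equiv.Perm.ofSubtype_apply_of_not_mem α (by simp)
  refine ⟨Equiv.Perm.ofSubtype α, τ, he, ?_⟩
  ext1 m
  obtain ⟨x, rfl⟩ := φ.surjective m
  rw [key]
  rcases x with j | ⟨i, hi⟩
  · exact (insFun_inr_congr hr he.symm _).trans (blockPerm_inr hr e _ τ j).symm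
  · refine Eq.trans ?_ (blockPerm_inl hr e _ τ i hi).symm
    have h1 : Equiv.Perm.ofSubtype α i = α ⟨i, hi⟩ := Equiv.Perm.ofSubtype_apply_of_mem α hi
    refine Eq.trans ?_ (insFun_inl_congr hr he.symm _
      (fun h2 => (Equiv.Perm.ofSubtype α).injective.ne hi (h2.trans he.symm)) _)
    change insFun hr e (Sum.inl (α ⟨i, hi⟩)) = _
    congr 2
    exact Subtype.ext h1.symm

theorem mem_subsetPerm {r : ℕ} (J : Finset (Fin r)) (m : Fin r) :
    subsetPerm J m ∈ J ↔ (m : ℕ) < J.card := by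
  obtain ⟨x, rfl⟩ := ((finCongr (show r = J.card + Jᶜ.card by
    rw [Finset.card_add_card_compl, Fintype.card_fin])).trans finSumFinEquiv.symm).symm.surjective m
  rcases x with x | x
  · have h1 := Finset.orderEmbOfFin_mem J rfl x
    rw [← finSumEquivOfFinset_inl (m := J.card) (n := Jᶜ.card) rfl rfl] at h1
    simpa [subsetPerm, -finSumEquivOfFinset_inl] using h1
  · have h1 := Finset.mem_compl.1 (Finset.orderEmbOfFin_mem Jᶜ rfl x)
    rw [← finSumEquivOfFinset_inr (m := J.card) (n := Jᶜ.card) rfl rfl] at h1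
    simpa [subsetPerm, -finSumEquivOfFinset_inr] using h1

theorem treeComp_congr (hD : IsCooperad D) {s t s' t' r : ℕ} {i j : ℤ} (hr : r + 1 = s + t)
    (hs : 2 ≤ s) (ht : 2 ≤ t) (hr' : r + 1 = s' + t') (hs' : 2 ≤ s') (ht' : 2 ≤ t')
    (h : j + 1 = i) (htt' : t = t') (w w' : Perm (Fin r)) (J : Finset (Fin r))
    (hw : ∀ m, w m ∈ J ↔ (m : ℕ) < t) (hw' : ∀ m, w' m ∈ J ↔ (m : ℕ) < t') :
    treeComp hD hr hs ht h w = treeComp hD hr' hs' ht' h w' := by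
  subst htt'
  obtain rfl : s = s' := by omega
  obtain ⟨σ, τ, hσ, hb⟩ := exists_blockPerm hr (by omega) (w⁻¹ * w') (fun m hm => by
    rw [← hw]; simpa using (hw' m).2 hm)
  obtain rfl : w' = w * blockPerm hr ⟨0, by omega⟩ σ τ := by rw [← hb]; simp
  ext c
  have h1 := rootComp_blockPerm hD hr hs ht h σ hσ τ
    (D.act (blockPerm hr ⟨0, by omega⟩ σ τ)⁻¹ (D.act w⁻¹ c))
  rw [← hD.isSigma.act_mul, mul_inv_cancel, hD.isSigma.act_one] at h1
  simp only [treeComp, LinearMap.comp_apply, FreeOp.act_mul, mul_inv_rev, hD.isSigma.act_mul]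
  rw [h1]

theorem quadraticDiff_act (hD : IsCooperad D) {r : ℕ} {i j : ℤ} (h : j + 1 = i) (g : Perm (Fin r))
    (c : D.X r (i + 1)) :
    quadraticDiff hD h (D.act g c) = FreeOp.act g (quadraticDiff hD h c) := by
  simp only [quadraticDiff, LinearMap.sum_apply, map_sum]
  refine Fintype.sum_equiv (Equiv.finsetCongr g.symm) _ _ fun J => ?_
  have hc : (Equiv.finsetCongr g.symm J).card = J.card := by simp
  by_cases hJ : 2 ≤ J.card ∧ J.card < r
  · rw [dif_pos hJ, dif_pos (by rwa [hc])]
    rw [treeComp_congr hD _ _ _ (show r + 1 = (r + 1 - J.card) + J.card by omega) (by omega) hJ.1 h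
      hc (subsetPerm (Equiv.finsetCongr g.symm J)) (g⁻¹ * subsetPerm J)
      (Equiv.finsetCongr g.symm J) (mem_subsetPerm _) (fun m => by
        rw [← mem_subsetPerm J m]; simp)]
    simp only [treeComp, LinearMap.comp_apply, FreeOp.act_mul, mul_inv_rev, inv_inv,
      hD.isSigma.act_mul]
    rw [← FreeOp.act_mul g, mul_inv_cancel, FreeOp.act_one]
  · rw [dif_neg hJ, dif_neg (by rwa [hc])]
    simp

/-- The restriction of the differential of the cobar construction to the generators:
`Σ⁻¹c ↦ -Σ⁻¹(δ c) + ∂(Σ⁻¹c)`. -/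
def cobarGen (hD : IsCooperad D) : GenDerivation (desusp D.toSigmaData) where
  toFun {r i j} hr h :=
    show D.X r (i + 1) →ₗ[ℤ] FreeOp (desusp D.toSigmaData) r j from
      genDesusp hr ∘ₗ (-D.d (by omega)) + quadraticDiff hD h
  map_act {r i j} hr h σ x := by
    change D.X r (i + 1) at x
    change genDesusp hr (-D.d _ (D.act σ x)) + quadraticDiff hD h (D.act σ x) =
      FreeOp.act σ (genDesusp hr (-D.d _ x) + quadraticDiff hD h x)
    rw [hD.isSigma.d_act, ← map_neg, genDesusp_act, quadraticDiff_act, ← map_add]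

/-- The cobar construction `B^c(D) = (F(Σ⁻¹D̄), ∂)` of a connected cooperad. -/
def cobar (D : CooperadData) (hD : IsCooperad D) : OperadData :=
  quasiFree (desusp D.toSigmaData) (cobarGen hD)

end Cobar

end EnKoszul

end

open scoped TensorProduct

noncomputable section

namespace EnKoszul

open Equiv (Perm)

attribute [local instance 2000] TensorProduct.instModule

/-! ### Lifting against acyclic fibrations -/

/-! The homotopical input is that each `σ^*` is, in every arity `r`, a degreewise split injection
between bounded below complexes of projective `Σ_r`-modules. Three facts about `E_n` give this.
First, `Σ_r` permutes the simplices of `E_n(r)` freely, so the projection `π` onto those that begin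
with the identity satisfies `∑ τ π τ⁻¹ = 1`; this form of projectivity passes to suspensions and
duals (`hasNormOne_barrattEccles`). Second, every step of a non-degenerate simplex changes the order
of some pair, while each pair changes fewer than `n` times; hence `E_n(r)` vanishes in high degrees
and `D_n(r)` in low degrees (`bounded_above_barrattEccles`). Third, the cap product with `sgn` has
an equivariant section in every degree: prepend to a simplex the translates of the successive
reversals of the first positions (`hasSection_suspension`). Its transpose is an equivariant
retraction of `σ^*`.

Thus `D_∞` is a union of projective extensions. Against an acyclic fibration one can solve not only
the lifting problem but the twisted one, `d g = g d + θ`. Acyclicity gives a solution that is merely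
linear, averaging with `π` makes it equivariant, the retraction makes it extend the previous stage,
and one proceeds degree by degree, then stage by stage (`IsProjectiveFiltration.exists_lift`). The
lower bounds depend on `n`, which is why the stages are treated one after the other. The case `θ =
0` is the cofibrancy of `D_∞` as a `Σ_*`-object.

For the cobar construction, a morphism `B^c(D) → P` is an equivariant family `φ : Σ⁻¹D̄ → P`
satisfying a twisting equation, whose quadratic term is the sum over the trees with two vertices in
the convolution pseudo-operad `Hom(D, P)`. By connectedness, this term in arity `r` involves only
smaller arities. A lifting of operads is therefore built by induction on the arity, each step being
a twisted lifting problem for `Σ⁻¹D(r)` with `θ` the quadratic term. Its consistency is `d_treeSum`: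
in the differential of the quadratic term, the trees with three vertices cancel, nested ones by
associativity and parallel ones by the sign rule for elements of odd degree. The same identity for
the inclusion of the generators gives `∂² = 0`.

The algebraic statements rest on explicit models. The operad `E_n` embeds in formal sums of
sequences of permutations, where faces, shuffles and substitutions obey simple recursions, and `nrm`
kills degeneracies. That `σ` respects composites is `cap_sh`: only one pattern of shuffle path has
first values that form a permutation. Duality is checked by evaluating on elements, and the colimit
is computed degreewise and compared with an arbitrary one by the universal property. -/

theorem exists_stable {α : Type*} {β : α → Type*} (rank : α → ℕ) (S : ℕ → (∀ a, β a) → Prop)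
    (h0 : ∃ g, S 0 g)
    (step : ∀ k g, S k g → ∃ g', S (k + 1) g' ∧ ∀ a, rank a < k → g' a = g a)
    (loc : ∀ k g g', (∀ a, rank a < k → g a = g' a) → S k g → S k g') :
    ∃ g, ∀ k, S k g := by
  obtain ⟨g0, h0⟩ := h0
  choose F hF hF' using step
  let seq : ∀ k, {g // S k g} := fun k =>
    Nat.rec ⟨g0, h0⟩ (fun k g => ⟨F k g.1 g.2, hF k g.1 g.2⟩) k
  have hs : ∀ k a, rank a < k → (seq (k + 1)).1 a = (seq k).1 a :=
    fun k a h => hF' k (seq k).1 (seq k).2 a h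
  -- The value at `a` is frozen from stage `rank a + 1` on, so this diagonal choice agrees with
  -- stage `k` on all elements of rank less than `k`, and `loc` applies.
  refine ⟨fun a => (seq (rank a + 1)).1 a, fun k => loc k _ _ (fun a ha => ?_) (seq k).2⟩
  induction k with
  | zero => omega
  | succ k ih =>
    rcases Nat.lt_or_ge (rank a) k with h | h
    · rw [hs k a h, ih h]
    · obtain rfl : rank a = k := by omega
      rfl

/-- An arbitrary lift `a₀` of `b` has the wrong boundary. The error `z - d a₀` is a cycle over zero,
hence a boundary `d a₁` by injectivity on homology. The element `a₁` need not lie over zero, but its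
image is a cycle; surjectivity on homology corrects it by a cycle and a boundary, neither of which
affects `d`. -/
theorem exists_lift_of_acyclic {A B : SigmaData} (hA : IsSigma A)
    {p : GradedMap A B} (hp : IsSigmaHom p) (hf : IsFibration p) (hw : IsWeakEquivalence p)
    {r : ℕ} {i j : ℤ} (h : j + 1 = i) (b : B.X r i) (z : A.X r j)
    (hz : ∀ (k : ℤ) (hk : k + 1 = j), A.d hk z = 0) (hpz : p r j z = B.d h b) :
    ∃ a, p r i a = b ∧ A.d h a = z := by
  subst h
  obtain ⟨a₀, ha₀⟩ := hf r (j + 1) b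
  obtain ⟨a₁, ha₁⟩ := (hw r j).1 (z - A.d rfl a₀)
    (by rw [map_sub, hz, hA.d_d, sub_zero])
    ⟨0, by rw [map_zero, map_sub, hpz, hp.map_d, ha₀, sub_self]⟩
  have hc : ∀ (k : ℤ) (hk : k + 1 = j + 1), B.d hk (p r (j + 1) a₁) = 0 := by
    intro k hk
    obtain rfl : k = j := by omega
    rw [← hp.map_d, ha₁, map_sub, hpz, hp.map_d, ha₀, sub_self]
  obtain ⟨a₂, ha₂, b', hb'⟩ := (hw r (j + 1)).2 (p r (j + 1) a₁) (hc _ _)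
  obtain ⟨a', ha'⟩ := hf r _ b'
  have ha₂' : ∀ (k : ℤ) (hk : k + 1 = j + 1), A.d hk a₂ = 0 := by
    intro k hk
    obtain rfl : k = j + 1 - 1 := by omega
    exact ha₂
  refine ⟨a₀ + (a₁ - a₂ - A.d rfl a'), ?_, ?_⟩
  · rw [map_add, map_sub, map_sub, hp.map_d, ha', ← hb', ha₀]
    abel
  · rw [map_add, map_sub, map_sub, ha₁, ha₂', hA.d_d]
    abel

theorem exists_linear_lift_of_acyclic {A B : SigmaData} (hA : IsSigma A)
    {p : GradedMap A B} (hp : IsSigmaHom p) (hf : IsFibration p) (hw : IsWeakEquivalence p)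
    {r : ℕ} {i j : ℤ} (h : j + 1 = i) {Y : Type} [AddCommGroup Y] [Module.Free ℤ Y]
    (f : Y →ₗ[ℤ] B.X r i) (ζ : Y →ₗ[ℤ] A.X r j)
    (hζ : ∀ (k : ℤ) (hk : k + 1 = j) (y : Y), A.d hk (ζ y) = 0)
    (hpζ : ∀ y, p r j (ζ y) = B.d h (f y)) :
    ∃ g : Y →ₗ[ℤ] A.X r i, (∀ y, p r i (g y) = f y) ∧ ∀ y, A.d h (g y) = ζ y := by
  let b := Module.Free.chooseBasis ℤ Y
  choose v hv hv' using fun m => exists_lift_of_acyclic hA hp hf hw h (f (b m)) (ζ (b m))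
    (fun k hk => hζ k hk _) (hpζ _)
  refine ⟨b.constr ℤ v, fun y => ?_, fun y => ?_⟩
  · have : (p r i) ∘ₗ b.constr ℤ v = f := b.ext fun m => by simp [hv]
    exact LinearMap.congr_fun this y
  · have : (A.d h) ∘ₗ b.constr ℤ v = ζ := b.ext fun m => by simp [hv']
    exact LinearMap.congr_fun this y

/-- Equivariant families `f`, `θ` such that the equation `d g = g d + θ` for a lifting `g` of `f`
is consistent. -/
structure IsTwistedDatum (r : ℕ) {Y A B : SigmaData} (p : GradedMap A B)
    (f : ∀ i, Y.X r i →ₗ[ℤ] B.X r i) (θ : ∀ {i j : ℤ}, j + 1 = i → Y.X r i →ₗ[ℤ] A.X r j) :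
    Prop where
  f_act : ∀ {i : ℤ} (σ : Perm (Fin r)) (y : Y.X r i), f i (Y.act σ y) = B.act σ (f i y)
  θ_act : ∀ {i j : ℤ} (h : j + 1 = i) (σ : Perm (Fin r)) (y : Y.X r i),
    θ h (Y.act σ y) = A.act σ (θ h y)
  f_d : ∀ {i j : ℤ} (h : j + 1 = i) (y : Y.X r i),
    B.d h (f i y) = f j (Y.d h y) + p r j (θ h y)
  θ_d : ∀ {i j k : ℤ} (hij : j + 1 = i) (hjk : k + 1 = j) (y : Y.X r i),
    A.d hjk (θ hij y) + θ hjk (Y.d hij y) = 0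

/-- Equivariant liftings `g` of `f` such that `d g = g d + θ`. -/
structure IsTwistedLift (r : ℕ) {Y A B : SigmaData} (p : GradedMap A B)
    (f : ∀ i, Y.X r i →ₗ[ℤ] B.X r i) (θ : ∀ {i j : ℤ}, j + 1 = i → Y.X r i →ₗ[ℤ] A.X r j)
    (g : ∀ i, Y.X r i →ₗ[ℤ] A.X r i) : Prop where
  map_act : ∀ {i : ℤ} (σ : Perm (Fin r)) (y : Y.X r i), g i (Y.act σ y) = A.act σ (g i y)
  proj : ∀ {i : ℤ} (y : Y.X r i), p r i (g i y) = f i y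
  map_d : ∀ {i j : ℤ} (h : j + 1 = i) (y : Y.X r i), A.d h (g i y) = g j (Y.d h y) + θ h y

/-- The component of arity `r` of an extension `φ : X → Y` of `Σ_*`-objects by a bounded below
complex of projective modules: `φ` has an equivariant retraction in every degree, and `Y` is free
over `ℤ` with an endomorphism `π` of norm one. -/
structure IsProjectiveExtension (r : ℕ) {X Y : SigmaData} (φ : GradedMap X Y) : Prop where
  isSigmaHom : IsSigmaHom φ
  free : ∀ i, Module.Free ℤ (Y.X r i)
  retraction : ∀ i, ∃ ρ : Y.X r i →ₗ[ℤ] X.X r i, (∀ x, ρ (φ r i x) = x) ∧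
    ∀ σ y, ρ (Y.act σ y) = X.act σ (ρ y)
  norm_one : ∀ i, ∃ π : Y.X r i →ₗ[ℤ] Y.X r i, ∀ y, ∑ τ, Y.act τ (π (Y.act τ⁻¹ y)) = y
  bounded : ∃ N : ℤ, ∀ i < N, Subsingleton (Y.X r i)

/-- One degree of the induction, `u` being the lifting already built in the degree below. Freeness
over `ℤ` gives a linear solution `g₀`; the sum `∑ τ g₀ π τ⁻¹` is equivariant and still a solution,
because the maps in the equations are equivariant and `π` has norm one; the retraction `ρ` then
imposes the values `gX` on the image of `φ`. -/
theorem IsProjectiveExtension.exists_lift_degree {r : ℕ} {X Y A B : SigmaData} {φ : GradedMap X Y}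
    (hφ : IsProjectiveExtension r φ) (hY : IsSigma Y) (hA : IsSigma A)
    {p : GradedMap A B} (hp : IsSigmaHom p) (hf : IsFibration p) (hw : IsWeakEquivalence p)
    {f : ∀ i, Y.X r i →ₗ[ℤ] B.X r i} {θ : ∀ {i j : ℤ}, j + 1 = i → Y.X r i →ₗ[ℤ] A.X r j}
    (hfθ : IsTwistedDatum r p f θ) {gX : ∀ i, X.X r i →ₗ[ℤ] A.X r i}
    (hg : IsTwistedLift r p (fun i => f i ∘ₗ φ r i) (fun h => θ h ∘ₗ φ r _) gX)
    {i j : ℤ} (h : j + 1 = i) (u : Y.X r j →ₗ[ℤ] A.X r j)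
    (u_act : ∀ σ y, u (Y.act σ y) = A.act σ (u y)) (u_proj : ∀ y, p r j (u y) = f j y)
    (u_φ : ∀ x, u (φ r j x) = gX j x)
    (u_d : ∀ (k : ℤ) (hk : k + 1 = j) (y : Y.X r i),
      A.d hk (u (Y.d h y)) = θ hk (Y.d h y)) :
    ∃ g : Y.X r i →ₗ[ℤ] A.X r i, (∀ σ y, g (Y.act σ y) = A.act σ (g y)) ∧
      (∀ y, p r i (g y) = f i y) ∧ (∀ x, g (φ r i x) = gX i x) ∧
      ∀ y, A.d h (g y) = u (Y.d h y) + θ h y := by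
  have := hφ.free i
  obtain ⟨ρ, hρφ, hρ⟩ := hφ.retraction i
  obtain ⟨π, hπ⟩ := hφ.norm_one i
  -- The prescribed boundary `u d + θ` is a cycle by `u_d` and the consistency condition `θ_d`.
  obtain ⟨g₀, hg₀, hg₀'⟩ := exists_linear_lift_of_acyclic hA hp hf hw h (f i)
    (u ∘ₗ Y.d h + θ h)
    (fun k hk y => by
      rw [LinearMap.add_apply, map_add, LinearMap.comp_apply, u_d, add_comm, hfθ.θ_d h hk])
    (fun y => by
      rw [LinearMap.add_apply, map_add, LinearMap.comp_apply, u_proj, hfθ.f_d h])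
  let g₁ : Y.X r i →ₗ[ℤ] A.X r i := ∑ τ, A.act τ ∘ₗ g₀ ∘ₗ π ∘ₗ Y.act τ⁻¹
  have hg₁ : ∀ y, g₁ y = ∑ τ, A.act τ (g₀ (π (Y.act τ⁻¹ y))) := fun y => by
    simp [g₁, LinearMap.sum_apply]
  have g₁_act : ∀ σ y, g₁ (Y.act σ y) = A.act σ (g₁ y) := by
    intro σ y
    rw [hg₁, hg₁, map_sum]
    refine Fintype.sum_equiv (Equiv.mulLeft σ⁻¹) _ _ fun τ => ?_
    rw [Equiv.coe_mulLeft, ← hA.act_mul, mul_inv_cancel_left, ← hY.act_mul, mul_inv_rev, inv_inv]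
  have g₁_proj : ∀ y, p r i (g₁ y) = f i y := by
    intro y
    rw [hg₁, map_sum]
    conv_rhs => rw [← hπ y, map_sum]
    exact Finset.sum_congr rfl fun τ _ => by rw [hp.map_act, hg₀, hfθ.f_act]
  have g₁_d : ∀ y, A.d h (g₁ y) = u (Y.d h y) + θ h y := by
    intro y
    rw [hg₁, map_sum]
    conv_rhs => rw [← hπ y]
    rw [map_sum, map_sum, map_sum, ← Finset.sum_add_distrib]
    refine Finset.sum_congr rfl fun τ _ => ?_
    rw [hA.d_act, hg₀', hY.d_act, u_act, hfθ.θ_act, LinearMap.add_apply, map_add,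
      LinearMap.comp_apply]
  -- The retraction is not assumed to be a chain map. In the boundary, the term `gX (d (ρ y))`
  -- equals `u (d (φ (ρ y)))` and cancels the one coming from `g₁`.
  refine ⟨g₁ ∘ₗ (LinearMap.id - φ r i ∘ₗ ρ) + gX i ∘ₗ ρ, fun σ y => ?_, fun y => ?_, fun x => ?_,
    fun y => ?_⟩
  · simp only [LinearMap.add_apply, LinearMap.comp_apply, LinearMap.sub_apply, LinearMap.id_apply,
      map_add, map_sub, hρ, hφ.isSigmaHom.map_act, g₁_act, hg.map_act]
  · simp only [LinearMap.add_apply, LinearMap.comp_apply, LinearMap.sub_apply, LinearMap.id_apply,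
      map_add, map_sub, g₁_proj]
    rw [hg.proj]
    simp
  · simp [hρφ]
  · simp only [LinearMap.add_apply, LinearMap.comp_apply, LinearMap.sub_apply, LinearMap.id_apply,
      map_add, map_sub, g₁_d]
    rw [hg.map_d h, ← u_φ, hφ.isSigmaHom.map_d]
    simp only [LinearMap.comp_apply]
    abel

/-- Induction on the degree, which can start because `Y(r)` vanishes below some `N`; at stage `k`
the degrees less than `N + k` are settled. -/
theorem IsProjectiveExtension.exists_lift {r : ℕ} {X Y A B : SigmaData} {φ : GradedMap X Y}
    (hφ : IsProjectiveExtension r φ) (hY : IsSigma Y) (hA : IsSigma A)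
    {p : GradedMap A B} (hp : IsSigmaHom p) (hf : IsFibration p) (hw : IsWeakEquivalence p)
    {f : ∀ i, Y.X r i →ₗ[ℤ] B.X r i} {θ : ∀ {i j : ℤ}, j + 1 = i → Y.X r i →ₗ[ℤ] A.X r j}
    (hfθ : IsTwistedDatum r p f θ) {gX : ∀ i, X.X r i →ₗ[ℤ] A.X r i}
    (hg : IsTwistedLift r p (fun i => f i ∘ₗ φ r i) (fun h => θ h ∘ₗ φ r _) gX) :
    ∃ g : ∀ i, Y.X r i →ₗ[ℤ] A.X r i, IsTwistedLift r p f θ g ∧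
      ∀ i x, g i (φ r i x) = gX i x := by
  obtain ⟨N, hN⟩ := hφ.bounded
  have key := exists_stable (α := ℤ) (β := fun i => Y.X r i →ₗ[ℤ] A.X r i)
    (fun i => (i - N).toNat)
    (fun k g => ∀ i < N + k, (∀ σ y, g i (Y.act σ y) = A.act σ (g i y)) ∧
      (∀ y, p r i (g i y) = f i y) ∧ (∀ x, g i (φ r i x) = gX i x) ∧
      ∀ (j : ℤ) (h : j + 1 = i) (y), A.d h (g i y) = g j (Y.d h y) + θ h y)
    ⟨fun _ => 0, fun i hi => by
      have := hN i (by simpa using hi)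
      refine ⟨fun σ y => ?_, fun y => ?_, fun x => ?_, fun j h y => ?_⟩
      · simp
      · rw [Subsingleton.elim y 0]; simp
      -- Below `N` the retraction forces `X(r)_i` to vanish as well, so `gX` imposes no condition
      -- there.
      · have hx : gX i x = gX i 0 := by
          congr 1
          obtain ⟨ρ, hρ, -⟩ := hφ.retraction i
          rw [← hρ x, Subsingleton.elim (φ r i x) 0, map_zero]
        rw [hx]; simp
      · rw [Subsingleton.elim y 0]; simp⟩
    (fun k g hk => by
      obtain ⟨g', h₁, h₂, h₃, h₄⟩ := hφ.exists_lift_degree hY hA hp hf hw hfθ hg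
        (show N + k - 1 + 1 = N + k by omega) (g (N + k - 1)) (hk _ (by omega)).1
        (hk _ (by omega)).2.1 (hk _ (by omega)).2.2.1 (fun l hl y => by
          rw [(hk (N + k - 1) (by omega)).2.2.2 l hl, hY.d_d, map_zero, zero_add])
      refine ⟨Function.update g (N + k) g', fun i hi => ?_, fun i hi => ?_⟩
      · rcases (show i ≤ N + k by push_cast at hi; omega).lt_or_eq with hi | rfl
        · rw [Function.update_of_ne hi.ne]
          obtain ⟨h₁, h₂, h₃, h₄⟩ := hk i hi
          refine ⟨h₁, h₂, h₃, fun j h y => ?_⟩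
          rw [Function.update_of_ne (by omega)]
          exact h₄ j h y
        · rw [Function.update_self]
          refine ⟨h₁, h₂, h₃, fun j h y => ?_⟩
          obtain rfl : j = N + k - 1 := by omega
          rw [Function.update_of_ne (by omega)]
          exact h₄ y
      · exact Function.update_of_ne (by omega) _ _)
    (fun k g g' hgg' hk i hi => by
      have e : ∀ i < N + k, g i = g' i := fun i hi => by
        by_cases h : i < N
        · have := hN i h
          ext y
          rw [Subsingleton.elim y 0, map_zero, map_zero]
        · exact hgg' i (show (i - N).toNat < k by omega)
      obtain ⟨h₁, h₂, h₃, h₄⟩ := hk i hi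
      rw [← e i hi]
      exact ⟨h₁, h₂, h₃, fun j h y => by rw [← e j (by omega)]; exact h₄ j h y⟩)
  obtain ⟨g, hg⟩ := key
  have hg' := fun i => hg (i - N + 1).toNat i (by omega)
  exact ⟨g, ⟨fun σ y => (hg' _).1 σ y, fun y => (hg' _).2.1 y, fun h y => (hg' _).2.2.2 _ h y⟩,
    fun i x => (hg' i).2.2.1 x⟩

/-- The `Σ_*`-object which vanishes in every arity and degree. -/
def zeroSigma : SigmaData where
  X _ _ := PUnit
  d _ := 0
  act _ := 0

/-- `L` is, in arity `r`, the union of a sequence of projective extensions. -/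
structure IsProjectiveFiltration (r : ℕ) (D : ℕ → SigmaData)
    (φ : ∀ n, GradedMap (D n) (D (n + 1))) (L : SigmaData) (ι : ∀ n, GradedMap (D n) L) :
    Prop where
  isSigma : ∀ n, IsSigma (D n)
  zero : IsProjectiveExtension r (X := zeroSigma) (Y := D 0) fun _ _ => 0
  succ : ∀ n, IsProjectiveExtension r (φ n)
  isSigmaHom : ∀ n, IsSigmaHom (ι n)
  comm : ∀ n i (x : (D n).X r i), ι (n + 1) r i (φ n r i x) = ι n r i x
  injective : ∀ n i, Function.Injective (ι n r i)
  exhaustive : ∀ i (x : L.X r i), ∃ n y, ι n r i y = x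

/-! ### Desuspension, gluing and lifting for projective filtrations. -/

theorem IsSigma.desusp {A : SigmaData} (h : IsSigma A) : IsSigma (desusp A) where
  d_d hij hjk x := by
    refine (congrArg (-A.d _) (LinearMap.neg_apply (A.d _) x)).trans ?_
    exact (neg_eq_zero.2 ((map_neg (A.d _) _).trans (neg_eq_zero.2 (h.d_d _ _ x))))
  act_one x := h.act_one x
  act_mul σ τ x := h.act_mul σ τ x
  d_act hh σ x := by
    exact (congrArg Neg.neg (h.d_act _ σ x)).trans (map_neg (A.act σ) _).symm

theorem IsSigmaHom.desusp {A B : SigmaData} {f : GradedMap A B} (h : IsSigmaHom f) :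
    IsSigmaHom (A := desusp A) (B := desusp B) fun r i => f r (i + 1) where
  map_d hh x := by
    exact (map_neg (f _ _) _).trans (congrArg Neg.neg (h.map_d _ x))
  map_act σ x := h.map_act σ x

theorem IsProjectiveExtension.desusp {r : ℕ} {X Y : SigmaData} {φ : GradedMap X Y}
    (h : IsProjectiveExtension r φ) :
    IsProjectiveExtension r (X := desusp X) (Y := desusp Y) fun r i => φ r (i + 1) where
  isSigmaHom := h.isSigmaHom.desusp
  free i := h.free (i + 1)
  retraction i := h.retraction (i + 1)
  norm_one i := h.norm_one (i + 1)
  bounded := by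
    obtain ⟨N, hN⟩ := h.bounded
    exact ⟨N - 1, fun i hi => hN (i + 1) (by omega)⟩

theorem IsProjectiveFiltration.desusp {r : ℕ} {D : ℕ → SigmaData}
    {φ : ∀ n, GradedMap (D n) (D (n + 1))} {L : SigmaData} {ι : ∀ n, GradedMap (D n) L}
    (h : IsProjectiveFiltration r D φ L ι) :
    IsProjectiveFiltration r (fun n => EnKoszul.desusp (D n)) (fun n r i => φ n r (i + 1))
      (EnKoszul.desusp L) (fun n r i => ι n r (i + 1)) where
  isSigma n := (h.isSigma n).desusp
  zero :=
    { isSigmaHom := ⟨fun _ _ => (map_zero _).symm, fun _ _ => (map_zero _).symm⟩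
      free := h.zero.desusp.free
      retraction := h.zero.desusp.retraction
      norm_one := h.zero.desusp.norm_one
      bounded := h.zero.desusp.bounded }
  succ n := (h.succ n).desusp
  isSigmaHom n := (h.isSigmaHom n).desusp
  comm n i x := h.comm n (i + 1) x
  injective n i := h.injective n (i + 1)
  exhaustive i x := h.exhaustive (i + 1) x

/-- The universal property of an increasing union, for linear maps in a single degree. Two
representatives of an element are pushed to a common stage, where `ι` is injective. -/
theorem IsProjectiveFiltration.exists_desc {r : ℕ} {D : ℕ → SigmaData}
    {φ : ∀ n, GradedMap (D n) (D (n + 1))} {L : SigmaData} {ι : ∀ n, GradedMap (D n) L}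
    (h : IsProjectiveFiltration r D φ L ι) {i : ℤ} {T : Type} [AddCommGroup T]
    (g : ∀ n, (D n).X r i →ₗ[ℤ] T) (hg : ∀ n x, g (n + 1) (φ n r i x) = g n x) :
    ∃ G : L.X r i →ₗ[ℤ] T, ∀ n x, G (ι n r i x) = g n x := by
  have up : ∀ k n (x : (D n).X r i), ∃ y : (D (n + k)).X r i,
      ι (n + k) r i y = ι n r i x ∧ g (n + k) y = g n x := by
    intro k n x
    induction k with
    | zero => exact ⟨x, rfl, rfl⟩
    | succ k ih =>
      obtain ⟨y, hy, hy'⟩ := ih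
      exact ⟨φ (n + k) r i y, (h.comm _ _ _).trans hy, (hg _ _).trans hy'⟩
  have up' : ∀ m n (x : (D n).X r i), n ≤ m → ∃ y : (D m).X r i,
      ι m r i y = ι n r i x ∧ g m y = g n x := by
    intro m n x hnm
    obtain ⟨k, rfl⟩ := Nat.exists_eq_add_of_le hnm
    exact up k n x
  have wd : ∀ m n (x : (D m).X r i) (y : (D n).X r i), ι m r i x = ι n r i y → g m x = g n y := by
    intro m n x y hxy
    obtain ⟨x', hx', hx⟩ := up' (max m n) m x (le_max_left _ _)
    obtain ⟨y', hy', hy⟩ := up' (max m n) n y (le_max_right _ _)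
    rw [← hx, ← hy, h.injective _ _ ((hx'.trans hxy).trans hy'.symm)]
  choose N Y hY using h.exhaustive i
  refine ⟨AddMonoidHom.toIntLinearMap (AddMonoidHom.mk' (fun x => g (N x) (Y x)) fun x y => ?_),
    fun n x => wd _ _ _ _ (hY _)⟩
  obtain ⟨x', hx', hx⟩ := up' (max (N x) (N y)) _ (Y x) (le_max_left _ _)
  obtain ⟨y', hy', hy⟩ := up' (max (N x) (N y)) _ (Y y) (le_max_right _ _)
  rw [← hx, ← hy, ← map_add]
  exact wd _ _ _ _ (by rw [hY, map_add, hx', hy', hY, hY])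

/-- Each stage is lifted so as to extend the lifting of the preceding one strictly, and the results
are glued over the union. No lower bound on the degrees common to all stages is required. -/
theorem IsProjectiveFiltration.exists_lift {r : ℕ} {D : ℕ → SigmaData}
    {φ : ∀ n, GradedMap (D n) (D (n + 1))} {L : SigmaData} {ι : ∀ n, GradedMap (D n) L}
    (h : IsProjectiveFiltration r D φ L ι) {A B : SigmaData} (hA : IsSigma A)
    {p : GradedMap A B} (hp : IsSigmaHom p) (hf : IsFibration p) (hw : IsWeakEquivalence p)
    {f : ∀ i, L.X r i →ₗ[ℤ] B.X r i} {θ : ∀ {i j : ℤ}, j + 1 = i → L.X r i →ₗ[ℤ] A.X r j}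
    (hfθ : IsTwistedDatum r p f θ) :
    ∃ g : ∀ i, L.X r i →ₗ[ℤ] A.X r i, IsTwistedLift r p f θ g := by
  have datum : ∀ n, IsTwistedDatum r p (fun i => f i ∘ₗ ι n r i) (fun h => θ h ∘ₗ ι n r _) :=
    fun n =>
    { f_act := fun σ y => by
        simp only [LinearMap.comp_apply, (h.isSigmaHom n).map_act, hfθ.f_act]
      θ_act := fun hh σ y => by
        simp only [LinearMap.comp_apply, (h.isSigmaHom n).map_act, hfθ.θ_act]
      f_d := fun hh y => by
        simp only [LinearMap.comp_apply, (h.isSigmaHom n).map_d, hfθ.f_d hh]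
      θ_d := fun hij hjk y => by
        simp only [LinearMap.comp_apply, (h.isSigmaHom n).map_d, hfθ.θ_d hij hjk] }
  obtain ⟨g, hg⟩ := exists_stable (α := ℕ) (β := fun n => ∀ i, (D n).X r i →ₗ[ℤ] A.X r i) id
    (fun k g => ∀ n < k,
      IsTwistedLift r p (fun i => f i ∘ₗ ι n r i) (fun h => θ h ∘ₗ ι n r _) (g n) ∧
      ∀ m (_ : m + 1 = n) i x, g (m + 1) i (φ m r i x) = g m i x)
    ⟨fun _ _ => 0, fun n hn => absurd hn (Nat.not_lt_zero n)⟩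
    (fun k g hk => by
      -- Compatibility with the predecessor is expressed through an equation `m + 1 = k`, so that
      -- the first stage, extended from zero, is covered by the same statement.
      obtain ⟨g', hg', hφ⟩ : ∃ g' : ∀ i, (D k).X r i →ₗ[ℤ] A.X r i,
          IsTwistedLift r p (fun i => f i ∘ₗ ι k r i) (fun h => θ h ∘ₗ ι k r _) g' ∧
          ∀ m (e : m + 1 = k) i x, g' i (e ▸ φ m r i x) = g m i x := by
        rcases k with _ | k
        · obtain ⟨g', hg', -⟩ := h.zero.exists_lift (h.isSigma 0) hA hp hf hw (datum 0)
            (gX := fun _ => 0)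
            ⟨fun _ _ => by simp, fun _ => by simp, fun _ _ => by simp⟩
          exact ⟨g', hg', fun m e => absurd e (by omega)⟩
        · obtain ⟨g', hg', hφ⟩ := (h.succ k).exists_lift (h.isSigma _) hA hp hf hw (datum (k + 1))
            (gX := g k) (by
              have e := (hk k (by omega)).1
              refine ⟨e.map_act, fun y => ?_, fun hh y => ?_⟩
              · rw [e.proj]; simp [h.comm]
              · rw [e.map_d hh]; simp [h.comm])
          refine ⟨g', hg', fun m e i x => ?_⟩
          obtain rfl : m = k := by omega
          exact hφ i x
      refine ⟨Function.update g k g', fun n hn => ?_, fun n hn =>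
        Function.update_of_ne (show n ≠ k from Nat.ne_of_lt hn) _ _⟩
      rcases (Nat.lt_succ_iff.1 hn).lt_or_eq with hn | rfl
      · rw [Function.update_of_ne hn.ne]
        refine ⟨(hk n hn).1, fun m hm i x => ?_⟩
        rw [Function.update_of_ne (by omega), Function.update_of_ne (by omega)]
        exact (hk n hn).2 m hm i x
      · refine ⟨by rw [Function.update_self]; exact hg', fun m hm i x => ?_⟩
        subst hm
        rw [Function.update_self, Function.update_of_ne (by omega)]
        exact hφ m rfl i x)
    (fun k g g' hgg' hk n hn => by
      refine ⟨hgg' n hn ▸ (hk n hn).1, fun m hm i x => ?_⟩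
      rw [← hgg' m (show m < k by omega), ← hgg' (m + 1) (show m + 1 < k by omega)]
      exact (hk n hn).2 m hm i x)
  have hg' := fun n => (hg (n + 1) n (by omega)).1
  choose G hG using fun i => h.exists_desc (fun n => g n i)
    (fun n x => (hg (n + 2) (n + 1) (by omega)).2 n rfl i x)
  refine ⟨G, fun {i} σ y => ?_, fun {i} y => ?_, fun {i j} hh y => ?_⟩ <;>
    obtain ⟨n, y, rfl⟩ := h.exhaustive _ y
  · rw [← (h.isSigmaHom n).map_act, hG, hG, (hg' n).map_act]
  · rw [hG, (hg' n).proj]; rfl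
  · rw [hG, ← (h.isSigmaHom n).map_d, hG, (hg' n).map_d hh]; rfl

/-! ### Block permutations -/

theorem insFun_inl_val {s t r : ℕ} (hr : r + 1 = s + t) (e i : Fin s) (hi : i ≠ e) :
    (insFun hr e (Sum.inl ⟨i, hi⟩) : ℕ) = if (i : ℕ) < e then (i : ℕ) else i + t - 1 := by
  simp only [insFun, Fin.lt_def]
  split_ifs <;> rfl

theorem insFun_inr_val {s t r : ℕ} (hr : r + 1 = s + t) (e : Fin s) (j : Fin t) :
    (insFun hr e (Sum.inr j) : ℕ) = e + j := rfl

theorem insFun_cases {s t r : ℕ} (hr : r + 1 = s + t) (e : Fin s) (x : Fin r) :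
    (∃ i hi, x = insFun hr e (Sum.inl ⟨i, hi⟩)) ∨ ∃ j, x = insFun hr e (Sum.inr j) := by
  obtain ⟨(⟨i, hi⟩ | j), rfl⟩ := (insFun_bijective hr e).2 x
  exacts [Or.inl ⟨i, hi, rfl⟩, Or.inr ⟨j, rfl⟩]

theorem blockPerm_ext {s t r : ℕ} (hr : r + 1 = s + t) (e : Fin s) {f g : Perm (Fin r)}
    (h₁ : ∀ i hi, f (insFun hr e (Sum.inl ⟨i, hi⟩)) = g (insFun hr e (Sum.inl ⟨i, hi⟩)))
    (h₂ : ∀ j, f (insFun hr e (Sum.inr j)) = g (insFun hr e (Sum.inr j))) : f = g := by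
  ext1 x
  rcases insFun_cases hr e x with ⟨i, hi, rfl⟩ | ⟨j, rfl⟩
  exacts [h₁ i hi, h₂ j]

/-- The factor applied second sees the block where `σ'` has put it, at `σ' e`: block permutations
compose like a groupoid. -/
theorem blockPerm_mul {s t r : ℕ} (hr : r + 1 = s + t) (e : Fin s) (σ σ' : Perm (Fin s))
    (τ τ' : Perm (Fin t)) :
    blockPerm hr e (σ * σ') (τ * τ') = blockPerm hr (σ' e) σ τ * blockPerm hr e σ' τ' := by
  refine blockPerm_ext hr e (fun i hi => ?_) fun j => ?_
  · rw [Equiv.Perm.mul_apply, blockPerm_inl, blockPerm_inl, blockPerm_inl]; rfl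
  · rw [Equiv.Perm.mul_apply, blockPerm_inr, blockPerm_inr, blockPerm_inr]; rfl

theorem blockPerm_one {s t r : ℕ} (hr : r + 1 = s + t) (e : Fin s) :
    blockPerm hr e 1 1 = 1 := by
  refine blockPerm_ext hr e (fun i hi => ?_) fun j => ?_
  · rw [blockPerm_inl]; rfl
  · rw [blockPerm_inr]; rfl

theorem blockPerm_inv {s t r : ℕ} (hr : r + 1 = s + t) (e : Fin s) (σ : Perm (Fin s))
    (τ : Perm (Fin t)) : (blockPerm hr e σ τ)⁻¹ = blockPerm hr (σ e) σ⁻¹ τ⁻¹ := by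
  rw [inv_eq_iff_mul_eq_one, ← blockPerm_one hr (σ e)]
  have := blockPerm_mul hr (σ e) σ σ⁻¹ τ τ⁻¹
  rw [mul_inv_cancel, mul_inv_cancel] at this
  rw [this]
  congr 2
  simp

/-- If the block stays in place, the permutation is conjugate to the disjoint sum of `τ` and of `σ`
deprived of its fixed point `e`. -/
theorem sign_blockPerm_of_fixed {s t r : ℕ} (hr : r + 1 = s + t) (e : Fin s) (σ : Perm (Fin s))
    (τ : Perm (Fin t)) (h : σ e = e) :
    Perm.sign (blockPerm hr e σ τ) = Perm.sign σ * Perm.sign τ := by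
  have h1 : ∀ i, σ i ≠ e ↔ i ≠ e := fun i => by
    conv_lhs => rw [← h]
    exact σ.injective.ne_iff
  have h2 : blockPerm hr e σ τ = ((insEquiv hr e).symm.trans
      (Equiv.sumCongr (Perm.subtypePerm (p := fun i => i ≠ e) σ h1) τ)).trans (insEquiv hr e) := by
    refine blockPerm_ext hr e (fun i hi => ?_) fun j => ?_
    · rw [blockPerm_inl]
      have : (insEquiv hr e).symm (insFun hr e (Sum.inl ⟨i, hi⟩)) = Sum.inl ⟨i, hi⟩ :=
        (insEquiv hr e).symm_apply_apply (Sum.inl ⟨i, hi⟩)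
      simp only [Equiv.trans_apply, this]
      exact insFun_inl_congr hr h _ _ _
    · rw [blockPerm_inr]
      have : (insEquiv hr e).symm (insFun hr e (Sum.inr j)) = Sum.inr j :=
        (insEquiv hr e).symm_apply_apply (Sum.inr j)
      simp only [Equiv.trans_apply, this]
      exact insFun_inr_congr hr h _
  have h3 : Perm.sign (Perm.subtypePerm (p := fun i => i ≠ e) σ h1) = Perm.sign σ := by
    refine Equiv.Perm.sign_subtypePerm (p := fun i => i ≠ e) σ h1 fun x hx he => hx ?_
    rw [he, h]
  rw [h2, Equiv.Perm.sign_symm_trans_trans, ← h3]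
  exact Equiv.Perm.sign_sumCongr _ _

/-- Moving one input across a block of `t` inputs is a cycle of length `t + 1`. -/
theorem sign_blockPerm_swap {s t r : ℕ} (hr : r + 1 = s + t) (e f : Fin s)
    (hef : (f : ℕ) = e + 1) :
    Perm.sign (blockPerm hr e (Equiv.swap e f) (1 : Perm (Fin t))) = (-1) ^ t := by
  have hf := f.2
  obtain ⟨n, rfl⟩ : ∃ n, r = n + 1 := ⟨r - 1, by omega⟩
  let a : Fin (n + 1) := ⟨e, by omega⟩
  let b : Fin (n + 1) := ⟨e + t, by omega⟩
  have hab : a ≤ b := Fin.mk_le_mk.2 (by omega)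
  have : blockPerm hr e (Equiv.swap e f) (1 : Perm (Fin t)) = Fin.cycleIcc a b := by
    refine blockPerm_ext hr e (fun i hi => ?_) fun j => ?_
    · rw [blockPerm_inl]
      have hie : (i : ℕ) ≠ e := fun h => hi (Fin.ext h)
      by_cases hif : i = f
      · subst hif
        have h1 : insFun hr e (Sum.inl ⟨i, hi⟩) = b := by
          ext; rw [insFun_inl_val]; simp only [b]; split_ifs <;> omega
        rw [h1, Fin.cycleIcc_of_last hab]
        ext
        rw [insFun_inl_val]
        simp only [Equiv.swap_apply_left, Equiv.swap_apply_right, a]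
        rw [if_pos (by omega)]
      · have hif' : (i : ℕ) ≠ f := fun h => hif (Fin.ext h)
        have h2 : Fin.cycleIcc a b (insFun hr e (Sum.inl ⟨i, hi⟩)) =
            insFun hr e (Sum.inl ⟨i, hi⟩) := by
          rcases Nat.lt_or_ge i e with h | h
          · refine Fin.cycleIcc_of_lt ?_
            rw [Fin.lt_def, insFun_inl_val, if_pos h]; exact h
          · refine Fin.cycleIcc_of_gt ?_
            rw [Fin.lt_def, insFun_inl_val, if_neg (by omega)]; simp only [b]; omega
        rw [h2]
        ext
        rw [insFun_inl_val, insFun_inl_val]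
        simp only [Equiv.swap_apply_left, Equiv.swap_apply_of_ne_of_ne hi hif]
        split_ifs <;> omega
    · rw [blockPerm_inr]
      have hj := j.2
      rw [Fin.cycleIcc_of_ge_of_lt (Fin.le_def.2 (by rw [insFun_inr_val]; simp only [a]; omega))
        (Fin.lt_def.2 (by rw [insFun_inr_val]; simp only [b]; omega))]
      ext
      rw [insFun_inr_val, Fin.val_add_one_of_lt (Fin.lt_def.2 (by
        rw [insFun_inr_val, Fin.val_last]; omega)), insFun_inr_val, Equiv.swap_apply_left, hef,
        Equiv.Perm.one_apply]
      omega
  rw [this, Fin.sign_cycleIcc_of_le hab]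
  congr 1
  simp only [a, b]
  omega

/-- Besides the signs of `σ` and `τ`, only the displacement of the block matters. The formula is
multiplicative in `σ` by `blockPerm_mul`, and for an adjacent transposition, a generator, it is one
of the two preceding cases. It is the sign that makes the operadic suspension equivariant. -/
theorem sign_blockPerm {s t r : ℕ} (hr : r + 1 = s + t) (e : Fin s) (σ : Perm (Fin s))
    (τ : Perm (Fin t)) :
    Perm.sign (blockPerm hr e σ τ) =
      Perm.sign σ * Perm.sign τ * (((t : ℤ) - 1) * ((e : ℤ) + (σ e : ℕ))).negOnePow := by
  have key : ∀ (σ : Perm (Fin s)) (e : Fin s), Perm.sign (blockPerm hr e σ (1 : Perm (Fin t))) =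
      Perm.sign σ * (((t : ℤ) - 1) * ((e : ℤ) + (σ e : ℕ))).negOnePow := by
    obtain ⟨n, rfl⟩ : ∃ n, s = n + 1 := ⟨s - 1, by have := e.2; omega⟩
    intro σ
    induction (Equiv.Perm.mclosure_swap_castSucc_succ n).symm ▸ Submonoid.mem_top σ using
      Submonoid.closure_induction with
    | mem x hx =>
      obtain ⟨k, rfl⟩ := hx
      dsimp only
      have hk : k.castSucc ≠ k.succ := (Fin.castSucc_lt_succ).ne
      -- The block moves by one place, so the exponent `(t - 1)(2k + 1)` has the parity of `t + 1`;
      -- the extra `-1` is compensated by the sign of the transposition.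
      have h1 : (((t : ℤ) - 1) * ((k : ℤ) + ((k + 1 : ℕ) : ℤ))).negOnePow = -(-1) ^ t := by
        have : (((t : ℤ) - 1) * ((k : ℤ) + ((k + 1 : ℕ) : ℤ))).negOnePow =
            ((t : ℤ) + 1).negOnePow := by
          rw [Int.negOnePow_eq_iff]
          exact ⟨k * t - k - 1, by push_cast; ring⟩
        rw [this, Int.negOnePow_succ, Int.negOnePow_def, zpow_natCast]
      intro e
      by_cases h₁ : e = k.castSucc
      · subst h₁
        rw [sign_blockPerm_swap hr _ _ (by simp), Equiv.Perm.sign_swap hk, Equiv.swap_apply_left]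
        simp only [Fin.val_castSucc, Fin.val_succ, h1]
        simp
      · by_cases h₂ : e = k.succ
        · subst h₂
          have h3 := sign_blockPerm_swap hr k.castSucc k.succ (by simp)
          rw [← Equiv.Perm.sign_inv, blockPerm_inv, Equiv.swap_apply_left, Equiv.swap_inv,
            inv_one] at h3
          rw [h3, Equiv.Perm.sign_swap hk, Equiv.swap_apply_right, add_comm (Fin.val _ : ℤ)]
          simp only [Fin.val_castSucc, Fin.val_succ, h1]
          simp
        · have h3 := Equiv.swap_apply_of_ne_of_ne h₁ h₂
          rw [sign_blockPerm_of_fixed hr e _ _ h3, h3, map_one, mul_one,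
            Int.negOnePow_even _ (((Even.add_self (e : ℤ))).mul_left _), mul_one]
    | one =>
      intro e
      rw [blockPerm_one, Equiv.Perm.one_apply,
        Int.negOnePow_even _ (((Even.add_self (e : ℤ))).mul_left _)]
      simp
    | mul x y _ _ hx hy =>
      intro e
      have := blockPerm_mul hr e x y (1 : Perm (Fin t)) 1
      rw [mul_one] at this
      rw [this, Equiv.Perm.sign_mul, Equiv.Perm.sign_mul, hx, hy, mul_mul_mul_comm,
        ← Int.negOnePow_add]
      congr 1
      rw [Int.negOnePow_eq_iff, Equiv.Perm.mul_apply]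
      exact ⟨((t : ℤ) - 1) * (y e : ℕ), by ring⟩
  have := blockPerm_mul hr e σ 1 (1 : Perm (Fin t)) τ
  rw [mul_one, one_mul] at this
  rw [this, Equiv.Perm.sign_mul, Equiv.Perm.one_apply, key,
    sign_blockPerm_of_fixed hr e 1 τ (by simp)]
  simp only [map_one, one_mul]
  exact mul_right_comm _ _ _

/-! ### The operadic suspension -/

theorem negOnePow_congr {m n : ℤ} (h : Even (m - n)) :
    (m.negOnePow : ℤ) = (n.negOnePow : ℤ) :=
  congrArg Units.val ((Int.negOnePow_eq_iff m n).2 h)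

theorem negOnePow_mul_negOnePow (m n : ℤ) :
    (m.negOnePow : ℤ) * (n.negOnePow : ℤ) = ((m + n).negOnePow : ℤ) := by
  rw [Int.negOnePow_add, Units.val_mul]

theorem lam_comp_apply (P : OperadData) {s t r : ℕ} {i j k : ℤ} (hr : r + 1 = s + t)
    (hk : i + j = k) (e : Fin s) (p : P.X s (i + (s - 1))) (q : P.X t (j + (t - 1))) :
    (lam P).comp hr hk e p q =
      ((((t : ℤ) - 1) * (i + (s - 1) + e)).negOnePow : ℤ) •
        P.comp hr (show i + (s - 1) + (j + (t - 1)) = k + (r - 1) by omega) e p q := rfl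

theorem lam_d_apply (P : OperadData) {r : ℕ} {i j : ℤ} (h : j + 1 = i)
    (p : P.X r (i + (r - 1))) :
    (lam P).d h p = (((r : ℤ) - 1).negOnePow : ℤ) •
      P.d (show j + (r - 1) + 1 = i + (r - 1) by omega) p := rfl

theorem lam_act_apply (P : OperadData) {r : ℕ} {i : ℤ} (σ : Perm (Fin r))
    (p : P.X r (i + (r - 1))) :
    (lam P).act (i := i) σ p = (Perm.sign σ : ℤ) • P.act σ p := rfl

theorem IsSigma.lam {P : OperadData} (hP : IsSigma P.toSigmaData) :
    IsSigma (lam P).toSigmaData where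
  d_d {r i j k} hij hjk x := by
    change P.X r (i + (r - 1)) at x
    refine (lam_d_apply P hjk _).trans ?_
    rw [lam_d_apply P hij x, map_smul, hP.d_d, smul_zero, smul_zero]
    rfl
  act_one {r i} x := by
    change P.X r (i + (r - 1)) at x
    refine (lam_act_apply P 1 x).trans ?_
    rw [hP.act_one, map_one, Units.val_one, one_smul]
  act_mul {r i} σ τ x := by
    change P.X r (i + (r - 1)) at x
    refine (lam_act_apply P _ x).trans ?_
    refine Eq.trans ?_ (lam_act_apply P σ _).symm
    rw [lam_act_apply P τ x, map_smul, smul_smul, hP.act_mul, Equiv.Perm.sign_mul, Units.val_mul]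
  d_act {r i j} h σ x := by
    change P.X r (i + (r - 1)) at x
    refine (lam_d_apply P h _).trans ?_
    refine Eq.trans ?_ (lam_act_apply P σ _).symm
    rw [lam_d_apply P h x, lam_act_apply P σ x, map_smul, map_smul, smul_smul, smul_smul,
      hP.d_act, mul_comm]

/-- Each relation is that of `P` up to signs, and the signs agree because their exponents do modulo
two. For equivariance, `sign_blockPerm` matches the signature of the block permutation with the
change of position from `e` to `σ e` in the sign of the composite. -/
theorem IsOperad.lam {P : OperadData} (hP : IsOperad P) : IsOperad (lam P) where
  isSigma := hP.isSigma.lam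
  arity_zero i := hP.arity_zero _
  arity_one i hi := hP.arity_one _ (by simpa using hi)
  arity_one_zero := hP.arity_one_zero
  one_comp {r k} hr hk e q := by
    change P.X r (k + (r - 1)) at q
    have h : ∀ {a : ℤ} (ha : a = 0) (ha' : a + (k + (r - 1)) = k + (r - 1)),
        P.comp hr ha' e (P.one ha) q = q := by
      rintro a rfl ha'; exact hP.one_comp hr ha' e q
    refine (lam_comp_apply P hr hk e _ q).trans ?_
    have h0 : (e : ℕ) = 0 := by omega
    refine Eq.trans (congrArg₂ _ ?_ (h _ _)) (one_smul ℤ _)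
    rw [h0, Int.negOnePow_even _ (by simp), Units.val_one]
  comp_one {r k} hr hk e p := by
    change P.X r (k + (r - 1)) at p
    have h : ∀ {a : ℤ} (ha : a = 0) (ha' : k + (r - 1) + a = k + (r - 1)),
        P.comp hr ha' e p (P.one ha) = p := by
      rintro a rfl ha'; exact hP.comp_one hr ha' e p
    refine (lam_comp_apply P hr hk e p _).trans ?_
    refine Eq.trans (congrArg₂ _ ?_ (h _ _)) (one_smul ℤ _)
    rw [Int.negOnePow_even _ (by simp), Units.val_one]
  assoc_seq {s t u a b r i j k l m n} ha hra hb hrb hl hln hm hmn e f g hg p q x := by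
    change P.X s (i + (s - 1)) at p
    change P.X t (j + (t - 1)) at q
    change P.X u (k + (u - 1)) at x
    refine (lam_comp_apply P hra hln g _ x).trans ?_
    refine Eq.trans ?_ (lam_comp_apply P hrb hmn e p _).symm
    rw [lam_comp_apply P ha hl e p q, lam_comp_apply P hb hm f q x]
    simp only [map_smul, LinearMap.smul_apply, smul_smul]
    rw [hP.assoc_seq ha hra hb hrb _ _ (m := m + ((b : ℤ) - 1)) (by omega) (by omega) e f g hg]
    refine congrArg₂ _ ?_ rfl
    rw [negOnePow_mul_negOnePow, negOnePow_mul_negOnePow]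
    apply negOnePow_congr
    have h1 : (a : ℤ) = s + t - 1 := by omega
    have h2 : (b : ℤ) = t + u - 1 := by omega
    have h3 : (g : ℤ) = e + f := by exact_mod_cast hg
    subst hl hm
    rw [h1, h2, h3]
    exact ⟨0, by ring⟩
  assoc_par {s t u a b r i j k l m n} ha hra hb hrb hl hln hm hmn e f g h hef hg hh p q x := by
    change P.X s (i + (s - 1)) at p
    change P.X t (j + (t - 1)) at q
    change P.X u (k + (u - 1)) at x
    refine (lam_comp_apply P hra hln g _ x).trans ?_
    refine Eq.trans ?_ (congrArg _ (lam_comp_apply P hrb hmn h _ q).symm)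
    rw [lam_comp_apply P ha hl e p q, lam_comp_apply P hb hm f p x]
    refine Eq.trans ?_ (Units.smul_def _ _).symm
    simp only [map_smul, LinearMap.smul_apply, smul_smul]
    rw [hP.assoc_par ha hra hb hrb _ _ (m := m + ((b : ℤ) - 1)) (by omega) (by omega) e f g h hef hg hh]
    rw [Units.smul_def, smul_smul]
    refine (Eq.trans (congrArg₂ _ ?_ rfl) (smul_smul _ _ _).symm)
    simp only [negOnePow_mul_negOnePow]
    apply negOnePow_congr
    have h1 : (a : ℤ) = s + t - 1 := by omega
    have h2 : (b : ℤ) = s + u - 1 := by omega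
    have h3 : (g : ℤ) = f + t - 1 := by omega
    have h4 : (h : ℤ) = e := by exact_mod_cast hh
    subst hl hm
    rw [h1, h2, h3, h4]
    exact ⟨(u - 1) * (t - 1 + j), by ring⟩
  equivariance {s t r i j k} hr hk e σ τ p q := by
    change P.X s (i + (s - 1)) at p
    change P.X t (j + (t - 1)) at q
    refine (lam_comp_apply P hr hk _ _ _).trans ?_
    refine Eq.trans ?_ (lam_act_apply P _ _).symm
    rw [lam_act_apply P σ p, lam_act_apply P τ q, lam_comp_apply P hr hk e p q]
    simp only [map_smul, LinearMap.smul_apply, smul_smul]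
    rw [hP.equivariance, sign_blockPerm]
    congr 1
    rw [Units.val_mul, Units.val_mul, mul_assoc _ _ (Units.val _), negOnePow_mul_negOnePow,
      mul_comm (Perm.sign σ : ℤ), mul_comm, mul_comm (Perm.sign τ : ℤ)]
    congr 1
    apply negOnePow_congr
    exact ⟨-((t - 1) * e), by ring⟩
  leibniz {s t r i i' j j' k k'} hr hk hi hj hk' h₁ h₂ e p q := by
    change P.X s (i + (s - 1)) at p
    change P.X t (j + (t - 1)) at q
    refine (lam_d_apply P hk' _).trans ?_
    refine Eq.trans ?_ (congrArg₂ _ (lam_comp_apply P hr h₁ e _ q).symm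
      (congrArg _ (lam_comp_apply P hr h₂ e p _).symm))
    rw [lam_comp_apply P hr hk e p q, lam_d_apply P hi p, lam_d_apply P hj q]
    refine Eq.trans ?_ (congrArg₂ _ rfl (Units.smul_def _ _).symm)
    simp only [map_smul, LinearMap.smul_apply, smul_smul]
    rw [hP.leibniz hr _ (show i' + (s - 1 : ℤ) + 1 = i + (s - 1) by omega)
      (show j' + (t - 1 : ℤ) + 1 = j + (t - 1) by omega) _ (by omega) (by omega), Units.smul_def,
      smul_add, smul_smul]
    have h1 : (r : ℤ) = s + t - 1 := by omega
    refine congrArg₂ _ (congrArg₂ _ ?_ rfl) ((congrArg₂ _ ?_ rfl).trans (smul_smul _ _ _).symm) <;>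
    · simp only [negOnePow_mul_negOnePow]
      apply negOnePow_congr
      subst hi hj
      rw [h1]
      first | exact ⟨t - 1, by ring1⟩ | exact ⟨s - 1, by ring1⟩

theorem IsOperadHom.lamMap {P Q : OperadData} {f : GradedMap P.toSigmaData Q.toSigmaData}
    (hf : IsOperadHom f) : IsOperadHom (P := lam P) (Q := lam Q) (lamMap f) where
  isSigmaHom :=
    { map_d := fun {r i j} h x => by
        change P.X r (i + (r - 1)) at x
        refine (congrArg (f _ _) (lam_d_apply P h x)).trans ?_
        rw [map_smul, hf.isSigmaHom.map_d]
        exact (lam_d_apply Q h _).symm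
      map_act := fun {r i} σ x => by
        change P.X r (i + (r - 1)) at x
        refine (congrArg (f _ _) (lam_act_apply P σ x)).trans ?_
        rw [map_smul, hf.isSigmaHom.map_act]
        exact (lam_act_apply Q σ _).symm }
  map_one := by
    have h : ∀ {a : ℤ} (ha : a = 0), f 1 a (P.one ha) = Q.one ha := by
      rintro a rfl; exact hf.map_one
    exact h _
  map_comp {s t r i j k} hr hk e p q := by
    change P.X s (i + (s - 1)) at p
    change P.X t (j + (t - 1)) at q
    refine (congrArg (f _ _) (lam_comp_apply P hr hk e p q)).trans ?_
    rw [map_smul, hf.map_comp]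
    exact (lam_comp_apply Q hr hk e _ _).symm

theorem IsOperad.lamPow {P : OperadData} (hP : IsOperad P) (n : ℕ) : IsOperad (EnKoszul.lam^[n] P) := by
  induction n generalizing P with
  | zero => exact hP
  | succ n ih => exact ih hP.lam

theorem IsOperadHom.lamPowMap (n : ℕ) {P Q : OperadData}
    {f : GradedMap P.toSigmaData Q.toSigmaData} (hf : IsOperadHom f) :
    IsOperadHom (EnKoszul.lamPowMap n f) := by
  induction n generalizing P Q with
  | zero => exact hf
  | succ n ih => exact ih hf.lamMap

/-! ### Pairings with tensor products of duals -/

section Pairing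

variable {M N K L : Type} [AddCommGroup M] [AddCommGroup N] [AddCommGroup K] [AddCommGroup L]

open Module (Dual)

/-- The value of an element of `M* ⊗ N*` on a pair. -/
def pair₂ (p : M) (q : N) : Dual ℤ M ⊗[ℤ] Dual ℤ N →ₗ[ℤ] ℤ :=
  LinearMap.mul' ℤ ℤ ∘ₗ TensorProduct.map (Dual.eval ℤ M p) (Dual.eval ℤ N q)

/-- The value of an element of `(M* ⊗ N*) ⊗ K*` on a triple. -/
def pair₃ (p : M) (q : N) (x : K) : (Dual ℤ M ⊗[ℤ] Dual ℤ N) ⊗[ℤ] Dual ℤ K →ₗ[ℤ] ℤ :=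
  LinearMap.mul' ℤ ℤ ∘ₗ TensorProduct.map (pair₂ p q) (Dual.eval ℤ K x)

/-- The value of an element of `M* ⊗ (N* ⊗ K*)` on a triple. -/
def pair₃' (p : M) (q : N) (x : K) : Dual ℤ M ⊗[ℤ] (Dual ℤ N ⊗[ℤ] Dual ℤ K) →ₗ[ℤ] ℤ :=
  LinearMap.mul' ℤ ℤ ∘ₗ TensorProduct.map (Dual.eval ℤ M p) (pair₂ q x)

theorem pair₂_tmul (p : M) (q : N) (a : Dual ℤ M) (b : Dual ℤ N) :
    pair₂ p q (a ⊗ₜ b) = a p * b q := by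
  simp [pair₂]

theorem pair₃_tmul (p : M) (q : N) (x : K) (a : Dual ℤ M ⊗[ℤ] Dual ℤ N) (b : Dual ℤ K) :
    pair₃ p q x (a ⊗ₜ b) = pair₂ p q a * b x := by
  simp [pair₃]

theorem pair₃'_tmul (p : M) (q : N) (x : K) (a : Dual ℤ M) (b : Dual ℤ N ⊗[ℤ] Dual ℤ K) :
    pair₃' p q x (a ⊗ₜ b) = a p * pair₂ q x b := by
  simp [pair₃']

theorem dualDistrib_tmul_eq_pair₂ (z : Dual ℤ M ⊗[ℤ] Dual ℤ N) (p : M) (q : N) :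
    TensorProduct.dualDistrib ℤ M N z (p ⊗ₜ q) = pair₂ p q z := by
  induction z with
  | zero => simp
  | add y z hy hz => simp [hy, hz]
  | tmul a b => rw [pair₂_tmul, TensorProduct.dualDistrib_apply]

/-- For finitely generated free modules, `M* ⊗ N*` is the dual of `M ⊗ N`, so its elements are
separated by pure tensors. Together with the version for triples, this turns the axioms of the dual
cooperad into identities between integers. -/
theorem pair₂_ext [Module.Finite ℤ M] [Module.Free ℤ M] [Module.Finite ℤ N] [Module.Free ℤ N]
    {z z' : Dual ℤ M ⊗[ℤ] Dual ℤ N} (h : ∀ p q, pair₂ p q z = pair₂ p q z') : z = z' := by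
  apply (TensorProduct.dualDistribEquiv ℤ M N).injective
  refine TensorProduct.ext' fun p q => ?_
  exact (dualDistrib_tmul_eq_pair₂ z p q).trans ((h p q).trans
    (dualDistrib_tmul_eq_pair₂ z' p q).symm)

/-- Expanding along a basis of `K` reduces separation by triples to separation by pairs. The module
structure `mT` is a variable, so that `T` can be a tensor product with its own structure. -/
theorem sum_contract_tmul_coord {T ι : Type} [AddCommGroup T] [mT : Module ℤ T] [Fintype ι]
    (b : Module.Basis ι ℤ K) (z : T ⊗[ℤ] Dual ℤ K) :
    ∑ k, TensorProduct.rid ℤ T ((Dual.eval ℤ K (b k)).lTensor T z) ⊗ₜ[ℤ] b.coord k = z := by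
  induction z with
  | zero => simp
  | add y z hy hz =>
    conv_rhs => rw [← hy, ← hz]
    simp only [map_add, TensorProduct.add_tmul, Finset.sum_add_distrib]
  | tmul t φ =>
    have h : ∀ (n : ℤ) (ψ : Dual ℤ K), TensorProduct.rid ℤ T (t ⊗ₜ n) ⊗ₜ[ℤ] ψ = t ⊗ₜ[ℤ] (n • ψ) := by
      intro n ψ
      have h₁ : ∀ m n : ℤ, TensorProduct.rid ℤ T (t ⊗ₜ (m + n)) ⊗ₜ[ℤ] ψ =
          TensorProduct.rid ℤ T (t ⊗ₜ m) ⊗ₜ[ℤ] ψ + TensorProduct.rid ℤ T (t ⊗ₜ n) ⊗ₜ[ℤ] ψ := by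
        intro m n
        rw [TensorProduct.tmul_add, map_add, TensorProduct.add_tmul]
      -- Scalars are moved by additivity alone, which does not depend on the choice of module
      -- structure.
      have h₂ := map_zsmul (AddMonoidHom.mk'
        (fun m : ℤ => TensorProduct.rid ℤ T (t ⊗ₜ m) ⊗ₜ[ℤ] ψ) h₁) n 1
      simp only [smul_eq_mul, mul_one, AddMonoidHom.mk'_apply] at h₂
      have h₃ := map_zsmul (AddMonoidHom.mk' (fun ψ : Dual ℤ K => t ⊗ₜ[ℤ] ψ)
        fun _ _ => TensorProduct.tmul_add _ _ _) n ψ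
      simp only [AddMonoidHom.mk'_apply] at h₃
      refine h₂.trans (Eq.trans ?_ h₃.symm)
      congr 2
      exact (TensorProduct.rid_tmul _ _).trans (@one_smul ℤ T _ mT.toDistribMulAction.toMulAction t)
    simp only [LinearMap.lTensor_tmul, h]
    rw [← TensorProduct.tmul_sum]
    congr 1
    exact b.ext fun k => by classical simp

theorem pair₂_contract (z : (Dual ℤ M ⊗[ℤ] Dual ℤ N) ⊗[ℤ] Dual ℤ K) (p : M) (q : N) (x : K) :
    pair₂ p q (TensorProduct.rid ℤ _ ((Dual.eval ℤ K x).lTensor _ z)) = pair₃ p q x z := by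
  induction z with
  | zero => simp
  | add y z hy hz => simp only [map_add, hy, hz]
  | tmul a b =>
    rw [LinearMap.lTensor_tmul, TensorProduct.rid_tmul, map_smul, pair₃_tmul, smul_eq_mul, mul_comm]
    rfl

theorem pair₃_ext [Module.Finite ℤ M] [Module.Free ℤ M] [Module.Finite ℤ N] [Module.Free ℤ N]
    [Module.Finite ℤ K] [Module.Free ℤ K]
    {z z' : (Dual ℤ M ⊗[ℤ] Dual ℤ N) ⊗[ℤ] Dual ℤ K}
    (h : ∀ p q x, pair₃ p q x z = pair₃ p q x z') : z = z' := by
  let b := Module.Free.chooseBasis ℤ K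
  rw [← sum_contract_tmul_coord b z, ← sum_contract_tmul_coord b z']
  refine Finset.sum_congr rfl fun k _ => ?_
  congr 1
  exact pair₂_ext fun p q => (pair₂_contract z p q (b k)).trans
    ((h p q (b k)).trans (pair₂_contract z' p q (b k)).symm)

theorem pair₃'_assoc (p : M) (q : N) (x : K) (z : (Dual ℤ M ⊗[ℤ] Dual ℤ N) ⊗[ℤ] Dual ℤ K) :
    pair₃' p q x (TensorProduct.assoc ℤ _ _ _ z) = pair₃ p q x z := by
  induction z with
  | zero => simp
  | add y z hy hz => simp only [map_add, hy, hz]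
  | tmul a b =>
    induction a with
    | zero => simp
    | add y z hy hz => simp only [TensorProduct.add_tmul, map_add, hy, hz]
    | tmul a a' =>
      rw [TensorProduct.assoc_tmul, pair₃'_tmul, pair₃_tmul, pair₂_tmul, pair₂_tmul, mul_assoc]

theorem pair₃_rightComm (p : M) (q : N) (x : K) (z : (Dual ℤ M ⊗[ℤ] Dual ℤ K) ⊗[ℤ] Dual ℤ N) :
    pair₃ p q x (TensorProduct.rightComm ℤ _ _ _ z) = pair₃ p x q z := by
  induction z with
  | zero => simp
  | add y z hy hz => simp only [map_add, hy, hz]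
  | tmul a b =>
    induction a with
    | zero => simp
    | add y z hy hz => simp only [TensorProduct.add_tmul, map_add, hy, hz]
    | tmul a a' =>
      rw [TensorProduct.rightComm_tmul, pair₃_tmul, pair₃_tmul, pair₂_tmul, pair₂_tmul,
        mul_right_comm]

theorem pair₃'_ext [Module.Finite ℤ M] [Module.Free ℤ M] [Module.Finite ℤ N] [Module.Free ℤ N]
    [Module.Finite ℤ K] [Module.Free ℤ K]
    {z z' : Dual ℤ M ⊗[ℤ] (Dual ℤ N ⊗[ℤ] Dual ℤ K)}
    (h : ∀ p q x, pair₃' p q x z = pair₃' p q x z') : z = z' := by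
  obtain ⟨z, rfl⟩ := (TensorProduct.assoc ℤ _ _ _).surjective z
  obtain ⟨z', rfl⟩ := (TensorProduct.assoc ℤ _ _ _).surjective z'
  congr 1
  exact pair₃_ext fun p q x => by rw [← pair₃'_assoc, ← pair₃'_assoc, h]

theorem pair₃_rTensor (F : Dual ℤ L →ₗ[ℤ] Dual ℤ M ⊗[ℤ] Dual ℤ N) (u : ℤ) (p : M) (q : N) (l : L)
    (hF : ∀ a, pair₂ p q (F a) = u * a l) (x : K) (z : Dual ℤ L ⊗[ℤ] Dual ℤ K) :
    pair₃ p q x (F.rTensor _ z) = u * pair₂ l x z := by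
  induction z with
  | zero => simp
  | add y z hy hz => simp only [map_add, hy, hz, mul_add]
  | tmul a b => rw [LinearMap.rTensor_tmul, pair₃_tmul, pair₂_tmul, hF, mul_assoc]

theorem pair₃'_lTensor (F : Dual ℤ L →ₗ[ℤ] Dual ℤ N ⊗[ℤ] Dual ℤ K) (u : ℤ) (q : N) (x : K) (l : L)
    (hF : ∀ a, pair₂ q x (F a) = u * a l) (p : M) (z : Dual ℤ M ⊗[ℤ] Dual ℤ L) :
    pair₃' p q x (F.lTensor _ z) = u * pair₂ p l z := by
  induction z with
  | zero => simp
  | add y z hy hz => simp only [map_add, hy, hz, mul_add]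
  | tmul a b => rw [LinearMap.lTensor_tmul, pair₃'_tmul, pair₂_tmul, hF, mul_left_comm]

theorem pair₂_map (f : Dual ℤ K →ₗ[ℤ] Dual ℤ M) (g : Dual ℤ L →ₗ[ℤ] Dual ℤ N) (p : M) (q : N)
    (k : K) (l : L) (u v : ℤ) (hf : ∀ a, f a p = u * a k) (hg : ∀ a, g a q = v * a l)
    (z : Dual ℤ K ⊗[ℤ] Dual ℤ L) :
    pair₂ p q (TensorProduct.map f g z) = u * v * pair₂ k l z := by
  induction z with
  | zero => simp
  | add y z hy hz => simp only [map_add, hy, hz, mul_add]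
  | tmul a b =>
    rw [TensorProduct.map_tmul, pair₂_tmul, pair₂_tmul, hf, hg]
    ring

theorem lid_rTensor_eval (p : M) (q : N) (z : Dual ℤ M ⊗[ℤ] Dual ℤ N) :
    TensorProduct.lid ℤ _ ((Dual.eval ℤ M p).rTensor _ z) q = pair₂ p q z := by
  induction z with
  | zero => simp
  | add y z hy hz => simp only [map_add, hy, hz, LinearMap.add_apply]
  | tmul a b => simp [pair₂_tmul]

theorem rid_lTensor_eval (p : M) (q : N) (z : Dual ℤ M ⊗[ℤ] Dual ℤ N) :
    TensorProduct.rid ℤ _ ((Dual.eval ℤ N q).lTensor _ z) p = pair₂ p q z := by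
  induction z with
  | zero => simp
  | add y z hy hz => simp only [map_add, hy, hz, LinearMap.add_apply]
  | tmul a b => simp [pair₂_tmul, mul_comm]

end Pairing

/-! ### The dual cooperad -/

section Dual

variable (P : OperadData) [hfin : FiniteFree P.toSigmaData]

/-- Determines the dual decomposition by its values; the axioms below are all derived from this
formula. -/
theorem dual_decomp_pair₂ {s t r : ℕ} {i j k : ℤ} (hr : r + 1 = s + t) (hk : i + j = k)
    (e : Fin s) (p : P.X s (-i)) (q : P.X t (-j)) (c : Module.Dual ℤ (P.X r (-k))) :
    pair₂ p q ((dual P).decomp hr hk e c) =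
      ((i * j).negOnePow : ℤ) * c (P.comp hr (show -i + -j = -k by omega) e p q) := by
  have := hfin.finite s (-i)
  have := hfin.finite t (-j)
  have := hfin.free s (-i)
  have := hfin.free t (-j)
  let w : Module.Dual ℤ (P.X s (-i) ⊗[ℤ] P.X t (-j)) :=
    (TensorProduct.lift (P.comp hr (show -i + -j = -k by omega) e)).dualMap c
  have h1 : (dual P).decomp hr hk e c = ((i * j).negOnePow : ℤ) •
      (TensorProduct.dualDistribEquiv ℤ (P.X s (-i)) (P.X t (-j))).symm w := rfl
  refine (congrArg (pair₂ p q) h1).trans ?_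
  rw [map_smul, smul_eq_mul, ← dualDistrib_tmul_eq_pair₂]
  congr 1
  have h2 := LinearEquiv.apply_symm_apply
    (TensorProduct.dualDistribEquiv ℤ (P.X s (-i)) (P.X t (-j))) w
  refine (LinearMap.congr_fun h2 (p ⊗ₜ q)).trans ?_
  simp [w]

theorem dual_d_apply {r : ℕ} {i j : ℤ} (h : j + 1 = i) (c : Module.Dual ℤ (P.X r (-i)))
    (p : P.X r (-j)) :
    @DFunLike.coe (Module.Dual ℤ (P.X r (-j))) _ _ _ ((dual P).d h c) p =
      -(i.negOnePow : ℤ) * c (P.d (show -i + 1 = -j by omega) p) := rfl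

theorem dual_act_apply {r : ℕ} {i : ℤ} (σ : Perm (Fin r)) (c : Module.Dual ℤ (P.X r (-i)))
    (p : P.X r (-i)) :
    @DFunLike.coe (Module.Dual ℤ (P.X r (-i))) _ _ _ ((dual P).act (i := i) σ c) p = c (P.act σ⁻¹ p) := rfl

theorem IsSigma.dual (hP : IsSigma P.toSigmaData) : IsSigma (dual P).toSigmaData where
  d_d {r i j k} hij hjk c := by
    change Module.Dual ℤ (P.X r (-i)) at c
    refine LinearMap.ext fun p => ?_
    refine (dual_d_apply P hjk _ p).trans ?_
    rw [dual_d_apply P hij c, hP.d_d, map_zero, mul_zero, mul_zero]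
    rfl
  act_one c := by
    refine LinearMap.ext fun p => ?_
    refine (dual_act_apply P 1 c p).trans ?_
    rw [inv_one, hP.act_one]
  act_mul σ τ c := by
    refine LinearMap.ext fun p => ?_
    refine (dual_act_apply P _ c p).trans ?_
    rw [mul_inv_rev, hP.act_mul]
    rfl
  d_act {r i j} h σ c := by
    refine LinearMap.ext fun p => ?_
    refine (dual_d_apply P h _ p).trans ?_
    refine Eq.trans ?_ (dual_act_apply P σ _ p).symm
    rw [dual_act_apply P σ c, dual_d_apply P h c, hP.d_act]

/-- Evaluated on elements of `P`, each axiom is the corresponding operad axiom, with signs that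
agree modulo two. The lower bounds `hb` serve only for `finite`: a component of degree `(i, j)`
involves `P(s)_{-i}` and `P(t)_{-j}`, so both `i` and `j` are bounded above while their sum is
fixed. -/
theorem IsOperad.dual (hP : IsOperad P)
    (hb : ∀ r, ∃ N : ℤ, ∀ i < N, Subsingleton (P.X r i)) : IsCooperad (dual P) where
  isSigma := hP.isSigma.dual
  arity_zero i := by
    have := hP.arity_zero (-i)
    exact inferInstanceAs (Subsingleton (Module.Dual ℤ (P.X 0 (-i))))
  arity_one i hi := by
    have := hP.arity_one (-i) (by omega)
    exact inferInstanceAs (Subsingleton (Module.Dual ℤ (P.X 1 (-i))))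
  arity_one_zero := by
    have h : Function.Bijective
        (Module.Dual.eval ℤ _ (P.one rfl) : Module.Dual ℤ (P.X 1 0) →ₗ[ℤ] ℤ) := by
      let φ : ℤ ≃ₗ[ℤ] P.X 1 0 :=
        LinearEquiv.ofBijective (LinearMap.toSpanSingleton ℤ _ (P.one rfl)) hP.arity_one_zero
      have hφ : φ 1 = P.one rfl := one_smul ℤ _
      refine ⟨fun a b hab => LinearMap.ext fun x => ?_, fun n => ⟨n • φ.symm.toLinearMap, ?_⟩⟩
      · obtain ⟨m, rfl⟩ := φ.surjective x
        have : φ m = m • P.one rfl := rfl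
        rw [this, map_smul, map_smul]
        exact congrArg _ hab
      · simp [← hφ]
    exact h
  finite {s t r k} hr e c := by
    obtain ⟨N, hN⟩ := hb s
    obtain ⟨N', hN'⟩ := hb t
    -- Non-vanishing requires `-i ≥ N` and `-(k - i) ≥ N'`.
    refine ((Set.finite_Icc (k + N') (-N)).image (fun i => (i, k - i))).subset ?_
    rintro ⟨i, j⟩ ⟨hk, hne⟩
    dsimp only at hk hne
    have zl : ∀ z : Module.Dual ℤ (P.X s (-i)) ⊗[ℤ] Module.Dual ℤ (P.X t (-j)),
        Subsingleton (P.X s (-i)) ∨ Subsingleton (P.X t (-j)) → z = 0 := by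
      intro z h
      have := hfin.finite s (-i)
      have := hfin.finite t (-j)
      have := hfin.free s (-i)
      have := hfin.free t (-j)
      refine pair₂_ext fun p q => ?_
      rcases h with h | h
      · rw [Subsingleton.elim p 0]; simp [pair₂]
      · rw [Subsingleton.elim q 0]; simp [pair₂]
    refine ⟨i, ⟨?_, ?_⟩, by simp; omega⟩ <;> by_contra hlt
    · exact hne (zl _ (Or.inr (hN' _ (by omega))))
    · exact hne (zl _ (Or.inl (hN _ (by omega))))
  counit_decomp {r k} hr hk e c := by
    change Module.Dual ℤ (P.X r (-k)) at c
    refine LinearMap.ext fun q => ?_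
    refine (lid_rTensor_eval _ q _).trans ?_
    refine (dual_decomp_pair₂ P hr hk e _ q c).trans ?_
    rw [zero_mul, Int.negOnePow_zero, Units.val_one, one_mul]
    exact congrArg c (hP.one_comp hr _ e q)
  decomp_counit {r k} hr hk e c := by
    change Module.Dual ℤ (P.X r (-k)) at c
    refine LinearMap.ext fun q => ?_
    refine (rid_lTensor_eval q _ _).trans ?_
    refine (dual_decomp_pair₂ P hr hk e q _ c).trans ?_
    rw [mul_zero, Int.negOnePow_zero, Units.val_one, one_mul]
    exact congrArg c (hP.comp_one hr _ e q)
  coassoc_seq {s t u a b r i j k l m n} ha hra hb hrb hl hln hm hmn e f g hg c := by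
    change Module.Dual ℤ (P.X r (-n)) at c
    have := hfin.finite
    have := hfin.free
    refine pair₃'_ext fun p q x => ?_
    refine (pair₃'_assoc p q x _).trans ?_
    refine (pair₃_rTensor _ _ p q _ (fun a => dual_decomp_pair₂ P ha hl e p q a) x _).trans ?_
    refine Eq.trans ?_
      (pair₃'_lTensor _ _ q x _ (fun a => dual_decomp_pair₂ P hb hm f q x a) p _).symm
    refine (congrArg _ (dual_decomp_pair₂ P hra hln g _ x c)).trans ?_
    refine Eq.trans ?_ (congrArg _ (dual_decomp_pair₂ P hrb hmn e p _ c)).symm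
    rw [← mul_assoc, ← mul_assoc, negOnePow_mul_negOnePow, negOnePow_mul_negOnePow,
      hP.assoc_seq ha hra hb hrb _ _ (show -j + -k = -m by omega) (by omega) e f g hg]
    congr 1
    apply negOnePow_congr
    subst hl hm
    exact ⟨0, by ring⟩
  coassoc_par {s t u a b r i j k l m n} ha hra hb hrb hl hln hm hmn e f g h hef hg hh c := by
    change Module.Dual ℤ (P.X r (-n)) at c
    have := hfin.finite
    have := hfin.free
    refine pair₃_ext fun p x q => ?_
    refine (pair₃_rightComm p x q _).trans ?_
    refine (pair₃_rTensor _ _ p q _ (fun a => dual_decomp_pair₂ P ha hl e p q a) x _).trans ?_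
    refine Eq.trans ?_ (map_units_smul _ _ _).symm
    refine Eq.trans ?_ (congrArg _
      (pair₃_rTensor _ _ p x _ (fun a => dual_decomp_pair₂ P hb hm f p x a) q _).symm)
    refine (congrArg _ (dual_decomp_pair₂ P hra hln g _ x c)).trans ?_
    refine Eq.trans ?_ (congrArg (fun y => _ • (_ * y)) (dual_decomp_pair₂ P hrb hmn h _ q c)).symm
    rw [← mul_assoc, ← mul_assoc, negOnePow_mul_negOnePow,
      negOnePow_mul_negOnePow,
      hP.assoc_par ha hra hb hrb _ _ (show -i + -k = -m by omega) (by omega) e f g h hef hg hh,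
      map_units_smul, Units.smul_def, Units.smul_def, smul_eq_mul, smul_eq_mul, ← mul_assoc,
      ← mul_assoc, negOnePow_mul_negOnePow, negOnePow_mul_negOnePow]
    congr 1
    apply negOnePow_congr
    subst hl hm
    exact ⟨0, by ring⟩
  equivariance {s t r i j k} hr hk e σ τ c := by
    change Module.Dual ℤ (P.X r (-k)) at c
    have := hfin.finite
    have := hfin.free
    refine pair₂_ext fun p q => ?_
    refine (dual_decomp_pair₂ P hr hk (σ e) p q _).trans ?_
    refine Eq.trans ?_ (pair₂_map _ _ p q (P.act σ⁻¹ p) (P.act τ⁻¹ q) 1 1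
      (fun a => (dual_act_apply P σ a p).trans (one_mul _).symm)
      (fun a => (dual_act_apply P τ a q).trans (one_mul _).symm) _).symm
    refine Eq.trans ?_ (congrArg _ (dual_decomp_pair₂ P hr hk e _ _ c)).symm
    rw [one_mul, one_mul]
    refine congrArg _ ?_
    refine (dual_act_apply P _ c _).trans (congrArg c ?_)
    rw [blockPerm_inv, ← hP.equivariance, show σ⁻¹ (σ e) = e from σ.symm_apply_apply e]
  leibniz {s t r i i' j j' k k'} hr hi hj hk h h₁ h₂ e c := by
    change Module.Dual ℤ (P.X r (-k')) at c
    have := hfin.finite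
    have := hfin.free
    refine pair₂_ext fun p q => ?_
    refine (dual_decomp_pair₂ P hr h e p q _).trans ?_
    refine Eq.trans ?_ ((map_add _ _ _).trans (congrArg _ (map_units_smul _ _ _))).symm
    refine Eq.trans ?_ (congrArg₂ _
      (pair₂_map _ _ p q (P.d (show -i' + 1 = -i by omega) p) q (-(i'.negOnePow : ℤ)) 1
        (fun a => dual_d_apply P hi a p) (fun a => (one_mul _).symm) _).symm
      (congrArg _ (pair₂_map _ _ p q p (P.d (show -j' + 1 = -j by omega) q) 1
        (-(j'.negOnePow : ℤ)) (fun a => (one_mul _).symm) (fun a => dual_d_apply P hj a q) _).symm))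
    refine Eq.trans ?_ (congrArg₂ _ (congrArg _ (dual_decomp_pair₂ P hr h₁ e _ q c))
      (congrArg (fun y => _ • (_ * y)) (dual_decomp_pair₂ P hr h₂ e p _ c))).symm
    refine (congrArg _ (dual_d_apply P hk c _)).trans ?_
    rw [hP.leibniz hr _ (show -i' + 1 = -i by omega) (show -j' + 1 = -j by omega) _ (by omega)
      (by omega), map_add, map_units_smul, Units.smul_def, Units.smul_def, smul_eq_mul, smul_eq_mul,
      mul_add, mul_add]
    have e₁ : ((i * j).negOnePow : ℤ) * (k'.negOnePow : ℤ) =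
        (i'.negOnePow : ℤ) * ((i' * j).negOnePow : ℤ) := by
      rw [negOnePow_mul_negOnePow, negOnePow_mul_negOnePow]
      apply negOnePow_congr
      subst hi hk h
      exact ⟨0, by ring⟩
    have e₂ : ((i * j).negOnePow : ℤ) * (k'.negOnePow : ℤ) * ((-i).negOnePow : ℤ) =
        (i.negOnePow : ℤ) * ((j'.negOnePow : ℤ) * ((i * j').negOnePow : ℤ)) := by
      simp only [negOnePow_mul_negOnePow]
      apply negOnePow_congr
      subst hj hk h
      exact ⟨-i, by ring⟩
    congr 1
    · generalize c _ = y
      linear_combination (-y) * e₁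
    · generalize c _ = y
      linear_combination (-y) * e₂

theorem IsOperadHom.dualMap {P Q : OperadData} [hP : FiniteFree P.toSigmaData]
    [FiniteFree Q.toSigmaData]
    {f : GradedMap P.toSigmaData Q.toSigmaData} (hf : IsOperadHom f) :
    IsCooperadHom (C := EnKoszul.dual Q) (D := EnKoszul.dual P) (dualMap f) where
  isSigmaHom :=
    { map_d := fun {r i j} h c => by
        change Module.Dual ℤ (Q.X r (-i)) at c
        refine LinearMap.ext fun p => ?_
        refine (dual_d_apply Q h c _).trans ?_
        refine Eq.trans ?_ (dual_d_apply P h _ p).symm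
        rw [← hf.isSigmaHom.map_d]
        rfl
      map_act := fun {r i} σ c => by
        change Module.Dual ℤ (Q.X r (-i)) at c
        refine LinearMap.ext fun p => ?_
        refine (dual_act_apply Q σ c _).trans ?_
        refine Eq.trans ?_ (dual_act_apply P σ _ p).symm
        rw [← hf.isSigmaHom.map_act]
        rfl }
  map_counit c := by
    change Module.Dual ℤ (Q.X 1 (-0)) at c
    have h : ∀ {a : ℤ} (ha : a = 0), f 1 a (P.one ha) = Q.one ha := by
      rintro a rfl; exact hf.map_one
    exact congrArg c (h _)
  map_decomp {s t r i j k} hr hk e c := by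
    change Module.Dual ℤ (Q.X r (-k)) at c
    have := hP.finite
    have := hP.free
    refine pair₂_ext fun p q => ?_
    refine (dual_decomp_pair₂ P hr hk e p q _).trans ?_
    refine Eq.trans ?_ (pair₂_map _ _ p q (f s (-i) p) (f t (-j) q) 1 1
      (fun a => (one_mul _).symm) (fun a => (one_mul _).symm) _).symm
    refine Eq.trans ?_ (congrArg _ (dual_decomp_pair₂ Q hr hk e _ _ c)).symm
    rw [one_mul, one_mul, ← hf.map_comp]
    rfl

end Dual

/-! ### Sequential colimits -/

section SeqColim

variable {G : ℕ → Type} [∀ n, AddCommGroup (G n)] (φ : ∀ n, G n →ₗ[ℤ] G (n + 1))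

/-- The composites of the maps of a sequence. -/
def seqMap (m n : ℕ) (h : m ≤ n) : G m →ₗ[ℤ] G n :=
  Nat.leRec (motive := fun n _ => G m →ₗ[ℤ] G n) LinearMap.id (fun n _ f => φ n ∘ₗ f) h

theorem seqMap_self (m : ℕ) (x : G m) : seqMap φ m m le_rfl x = x := by
  rw [seqMap, Nat.leRec_self]; rfl

theorem seqMap_succ (m n : ℕ) (h : m ≤ n) (x : G m) :
    seqMap φ m (n + 1) (h.trans n.le_succ) x = φ n (seqMap φ m n h x) := by
  rw [seqMap, Nat.leRec_succ (motive := fun n _ => G m →ₗ[ℤ] G n) _ _ h]; rfl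

instance directedSystem_seqMap : DirectedSystem G fun _ _ h => seqMap φ _ _ h where
  map_self i x := seqMap_self φ i x
  map_map k j i hij hjk x := by
    induction k, hjk using Nat.le_induction with
    | base => rw [seqMap_self]
    | succ k hjk ih => rw [seqMap_succ φ j k hjk, ih, seqMap_succ φ i k (hij.trans hjk)]

/-- The colimit of a sequence of abelian groups. -/
def SeqColim : Type := Module.DirectLimit G (seqMap φ)

instance : AddCommGroup (SeqColim φ) := inferInstanceAs (AddCommGroup (Module.DirectLimit G (seqMap φ)))

/-- The canonical maps to the colimit of a sequence. -/
def seqι (n : ℕ) : G n →ₗ[ℤ] SeqColim φ :=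
  AddMonoidHom.toIntLinearMap (Module.DirectLimit.of ℤ ℕ G (seqMap φ) n).toAddMonoidHom

theorem seqι_comm (n : ℕ) (x : G n) : seqι φ (n + 1) (φ n x) = seqι φ n x := by
  have := seqMap_succ φ n n le_rfl x
  rw [seqMap_self] at this
  rw [← this]
  exact Module.DirectLimit.of_f

theorem exists_seqι_eq (z : SeqColim φ) : ∃ n x, seqι φ n x = z :=
  Module.DirectLimit.exists_of z

theorem seqι_injective (h : ∀ n, Function.Injective (φ n)) (n : ℕ) :
    Function.Injective (seqι φ n) := by
  refine (injective_iff_map_eq_zero _).2 fun x hx => ?_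
  obtain ⟨k, hk, hx⟩ := Module.DirectLimit.of.zero_exact (f := seqMap φ) hx
  induction k, hk using Nat.le_induction with
  | base => rwa [seqMap_self] at hx
  | succ k hk ih =>
    rw [seqMap_succ φ n k hk] at hx
    exact ih ((injective_iff_map_eq_zero _).1 (h k) _ hx)

variable {T : Type} [AddCommGroup T] [Module ℤ T]

/-- The map from the colimit induced by a compatible family. -/
def seqLift (g : ∀ n, G n →ₗ[ℤ] T) (hg : ∀ n x, g (n + 1) (φ n x) = g n x) :
    SeqColim φ →ₗ[ℤ] T :=
  let f := (Module.DirectLimit.lift ℤ ℕ G (seqMap φ) g (fun i j hij x => by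
    induction j, hij using Nat.le_induction with
    | base => rw [seqMap_self]
    | succ k hk ih => rw [seqMap_succ φ i k hk, hg, ih])).toAddMonoidHom
  -- The target may be a tensor product with its own `ℤ`-module structure, for which any additive
  -- map is linear.
  { f with map_smul' := fun n x => map_intCast_smul f ℤ ℤ n x }

theorem seqLift_seqι (g : ∀ n, G n →ₗ[ℤ] T) (hg : ∀ n x, g (n + 1) (φ n x) = g n x) (n : ℕ)
    (x : G n) : seqLift φ g hg (seqι φ n x) = g n x :=
  Module.DirectLimit.lift_of (f := seqMap φ) g (fun i j hij x => by
    induction j, hij using Nat.le_induction with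
    | base => rw [seqMap_self]
    | succ k hk ih => rw [seqMap_succ φ i k hk, hg, ih]) x

end SeqColim

/-! ### Naturality of the structure isomorphisms of tensor products. -/

section TensorMap

variable {M M' N N' K K' T T' : Type} [AddCommGroup M] [AddCommGroup M'] [AddCommGroup N]
  [AddCommGroup N'] [AddCommGroup K] [AddCommGroup K'] [AddCommGroup T] [AddCommGroup T']

theorem rTensor_map_of_comm (f : M →ₗ[ℤ] M') (g : N →ₗ[ℤ] N') (h : K →ₗ[ℤ] K')
    (k : T →ₗ[ℤ] T') (F' : M' →ₗ[ℤ] N' ⊗[ℤ] K') (F : M →ₗ[ℤ] N ⊗[ℤ] K)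
    (hF : ∀ x, F' (f x) = TensorProduct.map g h (F x)) (z : M ⊗[ℤ] T) :
    F'.rTensor _ (TensorProduct.map f k z) =
      TensorProduct.map (TensorProduct.map g h) k (F.rTensor _ z) := by
  induction z with
  | zero => simp only [map_zero]
  | add y z hy hz => simp only [map_add, hy, hz]
  | tmul a b => simp only [TensorProduct.map_tmul, LinearMap.rTensor_tmul, hF]

theorem lTensor_map_of_comm (f : M →ₗ[ℤ] M') (g : N →ₗ[ℤ] N') (h : K →ₗ[ℤ] K')
    (k : T →ₗ[ℤ] T') (F' : M' →ₗ[ℤ] N' ⊗[ℤ] K') (F : M →ₗ[ℤ] N ⊗[ℤ] K)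
    (hF : ∀ x, F' (f x) = TensorProduct.map g h (F x)) (z : T ⊗[ℤ] M) :
    F'.lTensor _ (TensorProduct.map k f z) =
      TensorProduct.map k (TensorProduct.map g h) (F.lTensor _ z) := by
  induction z with
  | zero => simp only [map_zero]
  | add y z hy hz => simp only [map_add, hy, hz]
  | tmul a b => simp only [TensorProduct.map_tmul, LinearMap.lTensor_tmul, hF]

theorem assoc_map (f : M →ₗ[ℤ] M') (g : N →ₗ[ℤ] N') (h : K →ₗ[ℤ] K')
    (z : (M ⊗[ℤ] N) ⊗[ℤ] K) :
    TensorProduct.assoc ℤ _ _ _ (TensorProduct.map (TensorProduct.map f g) h z) =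
      TensorProduct.map f (TensorProduct.map g h) (TensorProduct.assoc ℤ _ _ _ z) := by
  induction z with
  | zero => simp only [map_zero]
  | add y z hy hz => simp only [map_add, hy, hz]
  | tmul a b =>
    induction a with
    | zero => simp only [TensorProduct.zero_tmul, map_zero]
    | add y z hy hz => simp only [TensorProduct.add_tmul, map_add, hy, hz]
    | tmul a a' => simp only [TensorProduct.map_tmul, TensorProduct.assoc_tmul]

theorem rightComm_map (f : M →ₗ[ℤ] M') (g : N →ₗ[ℤ] N') (h : K →ₗ[ℤ] K')
    (z : (M ⊗[ℤ] N) ⊗[ℤ] K) :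
    TensorProduct.rightComm ℤ _ _ _ (TensorProduct.map (TensorProduct.map f g) h z) =
      TensorProduct.map (TensorProduct.map f h) g (TensorProduct.rightComm ℤ _ _ _ z) := by
  induction z with
  | zero => simp only [map_zero]
  | add y z hy hz => simp only [map_add, hy, hz]
  | tmul a b =>
    induction a with
    | zero => simp only [TensorProduct.zero_tmul, map_zero]
    | add y z hy hz => simp only [TensorProduct.add_tmul, map_add, hy, hz]
    | tmul a a' => simp only [TensorProduct.map_tmul, TensorProduct.rightComm_tmul]

theorem map_map_of_comm (f : M →ₗ[ℤ] M') (g : N →ₗ[ℤ] N') (h : M' →ₗ[ℤ] K) (k : N' →ₗ[ℤ] K')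
    (f' : M →ₗ[ℤ] K) (g' : N →ₗ[ℤ] K') (hf : ∀ x, h (f x) = f' x) (hg : ∀ x, k (g x) = g' x)
    (z : M ⊗[ℤ] N) :
    TensorProduct.map h k (TensorProduct.map f g z) = TensorProduct.map f' g' z := by
  induction z with
  | zero => simp only [map_zero]
  | add y z hy hz => simp only [map_add, hy, hz]
  | tmul a b => simp only [TensorProduct.map_tmul, hf, hg]

theorem map_map_comp (f : M →ₗ[ℤ] M') (g : N →ₗ[ℤ] N') (h : M' →ₗ[ℤ] K) (k : N' →ₗ[ℤ] K')
    (z : M ⊗[ℤ] N) :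
    TensorProduct.map h k (TensorProduct.map f g z) = TensorProduct.map (h ∘ₗ f) (k ∘ₗ g) z :=
  map_map_of_comm _ _ _ _ _ _ (fun _ => rfl) (fun _ => rfl) z

theorem map_eq_of_units_smul {F : Type} [FunLike F M N] [AddMonoidHomClass F M N] (f : F) {u : ℤˣ}
    {x y : M} (h : x = u • y) : f x = u • f y := by
  subst h
  rcases Int.units_eq_one_or u with rfl | rfl <;> simp

end TensorMap

/-! ### Sequential colimits of cooperads -/

section SeqCooperad

theorem seqι_d_compat (D : ℕ → CooperadData)
    (φ : ∀ n, GradedMap (D n).toSigmaData (D (n + 1)).toSigmaData) (hφ : ∀ n, IsCooperadHom (φ n))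
    {r : ℕ} {i j : ℤ} (h : j + 1 = i) (n : ℕ) (x : (D n).X r i) :
    (seqι (fun n => φ n r j) (n + 1) ∘ₗ (D (n + 1)).d h) (φ n r i x) =
      (seqι (fun n => φ n r j) n ∘ₗ (D n).d h) x := by
  rw [LinearMap.comp_apply, ← (hφ n).isSigmaHom.map_d]
  exact seqι_comm (fun n => φ n r j) n _

theorem seqι_act_compat (D : ℕ → CooperadData)
    (φ : ∀ n, GradedMap (D n).toSigmaData (D (n + 1)).toSigmaData) (hφ : ∀ n, IsCooperadHom (φ n))
    {r : ℕ} {i : ℤ} (σ : Perm (Fin r)) (n : ℕ) (x : (D n).X r i) :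
    (seqι (fun n => φ n r i) (n + 1) ∘ₗ (D (n + 1)).act σ) (φ n r i x) =
      (seqι (fun n => φ n r i) n ∘ₗ (D n).act σ) x := by
  rw [LinearMap.comp_apply, ← (hφ n).isSigmaHom.map_act]
  exact seqι_comm (fun n => φ n r i) n _

theorem counit_compat (D : ℕ → CooperadData)
    (φ : ∀ n, GradedMap (D n).toSigmaData (D (n + 1)).toSigmaData) (hφ : ∀ n, IsCooperadHom (φ n))
    {i : ℤ} (h : i = 0) (n : ℕ) (x : (D n).X 1 i) :
    (D (n + 1)).counit h (φ n 1 i x) = (D n).counit h x := by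
  subst h
  exact (hφ n).map_counit x

theorem seqι_decomp_compat (D : ℕ → CooperadData)
    (φ : ∀ n, GradedMap (D n).toSigmaData (D (n + 1)).toSigmaData) (hφ : ∀ n, IsCooperadHom (φ n))
    {s t r : ℕ} {i j k : ℤ} (hr : r + 1 = s + t) (hk : i + j = k)
    (e : Fin s) (n : ℕ) (x : (D n).X r k) :
    (TensorProduct.map (seqι (fun n => φ n s i) (n + 1)) (seqι (fun n => φ n t j) (n + 1)) ∘ₗ
      (D (n + 1)).decomp hr hk e) (φ n r k x) =
    (TensorProduct.map (seqι (fun n => φ n s i) n) (seqι (fun n => φ n t j) n) ∘ₗ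
      (D n).decomp hr hk e) x := by
  rw [LinearMap.comp_apply, (hφ n).map_decomp]
  exact map_map_of_comm _ _ _ _ _ _
    (seqι_comm (fun n => φ n s i) n) (seqι_comm (fun n => φ n t j) n) _

variable (D : ℕ → CooperadData)
  (φ : ∀ n, GradedMap (D n).toSigmaData (D (n + 1)).toSigmaData) (hφ : ∀ n, IsCooperadHom (φ n))

/-- The colimit of a sequence of cooperads. -/
def seqColimit : CooperadData where
  X r i := SeqColim fun n => φ n r i
  d {r _ j} h := seqLift _ (fun n => seqι (fun n => φ n r j) n ∘ₗ (D n).d h)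
    (seqι_d_compat D φ hφ h)
  act {r i} σ := seqLift _ (fun n => seqι (fun n => φ n r i) n ∘ₗ (D n).act σ)
    (seqι_act_compat D φ hφ σ)
  counit h := seqLift _ (fun n => (D n).counit h) (counit_compat D φ hφ h)
  decomp {s t _ i j _} hr hk e := seqLift _
    (fun n => TensorProduct.map (seqι (fun n => φ n s i) n) (seqι (fun n => φ n t j) n) ∘ₗ
      (D n).decomp hr hk e) (seqι_decomp_compat D φ hφ hr hk e)

/-- The canonical morphisms to the colimit of a sequence of cooperads. -/
def seqColimitι (n : ℕ) : GradedMap (D n).toSigmaData (seqColimit D φ hφ).toSigmaData :=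
  fun r i => seqι (fun n => φ n r i) n

variable {D φ}

theorem isCooperadHom_seqColimitι (n : ℕ) : IsCooperadHom (seqColimitι D φ hφ n) where
  isSigmaHom :=
    { map_d := fun {r i j} h x => (seqLift_seqι (fun n => φ n r i)
        (fun n => seqι (fun n => φ n r j) n ∘ₗ (D n).d h) (seqι_d_compat D φ hφ h) n x).symm
      map_act := fun {r i} σ x => (seqLift_seqι (fun n => φ n r i)
        (fun n => seqι (fun n => φ n r i) n ∘ₗ (D n).act σ) (seqι_act_compat D φ hφ σ) n x).symm }
  map_counit x := seqLift_seqι (fun n => φ n 1 0) (fun n => (D n).counit rfl)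
    (counit_compat D φ hφ rfl) n x
  map_decomp {s t r i j k} hr hk e x := seqLift_seqι (fun n => φ n r k)
    (fun n => TensorProduct.map (seqι (fun n => φ n s i) n) (seqι (fun n => φ n t j) n) ∘ₗ
      (D n).decomp hr hk e) (seqι_decomp_compat D φ hφ hr hk e) n x

theorem seqColimitι_comm (n r : ℕ) (i : ℤ) (x : (D n).X r i) :
    seqColimitι D φ hφ (n + 1) r i (φ n r i x) = seqColimitι D φ hφ n r i x :=
  seqι_comm (fun n => φ n r i) n x

theorem exists_seqColimitι_eq {r : ℕ} {i : ℤ} (z : (seqColimit D φ hφ).X r i) :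
    ∃ n x, seqColimitι D φ hφ n r i x = z :=
  exists_seqι_eq _ z

/-- Every element comes from some stage and the canonical maps commute with all operations, so each
axiom is the image of the axiom at that stage. Naturality of the tensor product suffices; the tensor
product of two colimits never has to be described. -/
theorem isCooperad_seqColimit (hD : ∀ n, IsCooperad (D n)) : IsCooperad (seqColimit D φ hφ) := by
  have hι := isCooperadHom_seqColimitι hφ
  have hd := fun n => @(hι n).isSigmaHom.map_d
  have ha := fun n => @(hι n).isSigmaHom.map_act
  have hdec := fun n => @(hι n).map_decomp
  refine
    { isSigma := ⟨fun hij hjk x => ?_, fun x => ?_, fun σ τ x => ?_, fun h σ x => ?_⟩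
      arity_zero := fun i => ⟨fun x y => ?_⟩
      arity_one := fun i hi => ⟨fun x y => ?_⟩
      arity_one_zero := ⟨?_, fun z => ?_⟩
      finite := fun hr e x => ?_
      counit_decomp := fun hr hk e x => ?_
      decomp_counit := fun hr hk e x => ?_
      coassoc_seq := fun ha hra hb hrb hl hln hm hmn e f g hg x => ?_
      coassoc_par := fun ha hra hb hrb hl hln hm hmn e f g h hef hg hh x => ?_
      equivariance := fun hr hk e σ τ x => ?_
      leibniz := fun hr hi hj hk h h₁ h₂ e x => ?_ }
  · obtain ⟨n, x, rfl⟩ := exists_seqColimitι_eq hφ x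
    rw [← hd, ← hd, (hD n).isSigma.d_d, map_zero]
  · obtain ⟨n, x, rfl⟩ := exists_seqColimitι_eq hφ x
    rw [← ha, (hD n).isSigma.act_one]
  · obtain ⟨n, x, rfl⟩ := exists_seqColimitι_eq hφ x
    rw [← ha, ← ha, ← ha, (hD n).isSigma.act_mul]
  · obtain ⟨n, x, rfl⟩ := exists_seqColimitι_eq hφ x
    rw [← ha, ← hd, ← hd, ← ha, (hD n).isSigma.d_act]
  · obtain ⟨n, x, rfl⟩ := exists_seqColimitι_eq hφ x
    obtain ⟨m, y, rfl⟩ := exists_seqColimitι_eq hφ y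
    have := (hD n).arity_zero i
    have := (hD m).arity_zero i
    rw [Subsingleton.elim x 0, Subsingleton.elim y 0, map_zero, map_zero]
  · obtain ⟨n, x, rfl⟩ := exists_seqColimitι_eq hφ x
    obtain ⟨m, y, rfl⟩ := exists_seqColimitι_eq hφ y
    have := (hD n).arity_one i hi
    have := (hD m).arity_one i hi
    rw [Subsingleton.elim x 0, Subsingleton.elim y 0, map_zero, map_zero]
  · refine (injective_iff_map_eq_zero _).2 fun x hx => ?_
    obtain ⟨n, x, rfl⟩ := exists_seqColimitι_eq hφ x
    rw [(hι n).map_counit] at hx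
    rw [(injective_iff_map_eq_zero _).1 (hD n).arity_one_zero.1 _ hx, map_zero]
  · obtain ⟨x, hx⟩ := (hD 0).arity_one_zero.2 z
    exact ⟨seqColimitι D φ hφ 0 1 0 x, ((hι 0).map_counit x).trans hx⟩
  · obtain ⟨n, x, rfl⟩ := exists_seqColimitι_eq hφ x
    refine ((hD n).finite hr e x).subset ?_
    rintro p ⟨hk, h⟩
    refine ⟨hk, fun h0 => h ?_⟩
    rw [hdec, h0, map_zero]
  · obtain ⟨n, x, rfl⟩ := exists_seqColimitι_eq hφ x
    conv_rhs => rw [← (hD n).counit_decomp hr hk e x]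
    rw [hdec]
    induction (D n).decomp hr hk e x with
    | zero => simp only [map_zero]
    | add y z hy hz => simp only [map_add, hy, hz]
    | tmul a b =>
      rw [TensorProduct.map_tmul, LinearMap.rTensor_tmul, LinearMap.rTensor_tmul,
        TensorProduct.lid_tmul, TensorProduct.lid_tmul, map_smul, (hι n).map_counit]
  · obtain ⟨n, x, rfl⟩ := exists_seqColimitι_eq hφ x
    conv_rhs => rw [← (hD n).decomp_counit hr hk e x]
    rw [hdec]
    induction (D n).decomp hr hk e x with
    | zero => simp only [map_zero]
    | add y z hy hz => simp only [map_add, hy, hz]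
    | tmul a b =>
      rw [TensorProduct.map_tmul, LinearMap.lTensor_tmul, LinearMap.lTensor_tmul,
        TensorProduct.rid_tmul, TensorProduct.rid_tmul, map_smul, (hι n).map_counit]
  · obtain ⟨n, x, rfl⟩ := exists_seqColimitι_eq hφ x
    rw [hdec, hdec, rTensor_map_of_comm _ _ _ _ _ _ (hdec n ha hl e),
      lTensor_map_of_comm _ _ _ _ _ _ (hdec n hb hm f), assoc_map,
      (hD n).coassoc_seq ha hra hb hrb hl hln hm hmn e f g hg]
  · obtain ⟨n, x, rfl⟩ := exists_seqColimitι_eq hφ x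
    rw [hdec, hdec, rTensor_map_of_comm _ _ _ _ _ _ (hdec n ha hl e),
      rTensor_map_of_comm _ _ _ _ _ _ (hdec n hb hm f), rightComm_map]
    exact map_eq_of_units_smul _
      ((hD n).coassoc_par ha hra hb hrb hl hln hm hmn e f g h hef hg hh x)
  · obtain ⟨n, x, rfl⟩ := exists_seqColimitι_eq hφ x
    rw [← ha, hdec, hdec, (hD n).equivariance,
      map_map_comp, map_map_comp]
    exact congrFun (congrArg _ (congrArg₂ _ (LinearMap.ext fun y => ha n σ y)
      (LinearMap.ext fun y => ha n τ y))) _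
  · obtain ⟨n, x, rfl⟩ := exists_seqColimitι_eq hφ x
    rw [← hd, hdec, hdec, hdec, (hD n).leibniz hr hi hj hk h h₁ h₂, map_add,
      map_eq_of_units_smul (TensorProduct.map _ _) rfl]
    congr 1
    · rw [LinearMap.rTensor, LinearMap.rTensor,
        map_map_comp, map_map_comp]
      exact congrFun (congrArg _ (congrArg₂ _ (LinearMap.ext fun y => hd n hi y) rfl)) _
    · congr 1
      rw [LinearMap.lTensor, LinearMap.lTensor,
        map_map_comp, map_map_comp]
      exact congrFun (congrArg _ (congrArg₂ _ rfl (LinearMap.ext fun y => hd n hj y))) _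

theorem isSeqColimit_seqColimit (hD : ∀ n, IsCooperad (D n)) :
    IsSeqColimit D φ (seqColimit D φ hφ) (seqColimitι D φ hφ) where
  isCooperad := isCooperad_seqColimit hφ hD
  isHom := isCooperadHom_seqColimitι hφ
  comm := seqColimitι_comm hφ
  existsUnique T _ f hf hfφ := by
    have hι := isCooperadHom_seqColimitι hφ
    let g : GradedMap (seqColimit D φ hφ).toSigmaData T.toSigmaData := fun r i =>
      seqLift (fun n => φ n r i) (fun n => f n r i) fun n x => hfφ n r i x
    have hg : ∀ n r i (x : (D n).X r i), g r i (seqColimitι D φ hφ n r i x) = f n r i x :=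
      fun n r i x => seqLift_seqι _ _ _ _ _
    refine ⟨g, ⟨⟨⟨fun h x => ?_, fun σ x => ?_⟩, fun x => ?_, fun hr hk e x => ?_⟩, hg⟩,
      fun g' ⟨_, hg'⟩ => ?_⟩
    · obtain ⟨n, x, rfl⟩ := exists_seqColimitι_eq hφ x
      rw [← (hι n).isSigmaHom.map_d, hg, hg, (hf n).isSigmaHom.map_d]
    · obtain ⟨n, x, rfl⟩ := exists_seqColimitι_eq hφ x
      rw [← (hι n).isSigmaHom.map_act, hg, hg, (hf n).isSigmaHom.map_act]
    · obtain ⟨n, x, rfl⟩ := exists_seqColimitι_eq hφ x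
      rw [(hι n).map_counit, hg, (hf n).map_counit]
    · obtain ⟨n, x, rfl⟩ := exists_seqColimitι_eq hφ x
      rw [(hι n).map_decomp, hg, (hf n).map_decomp]
      exact (map_map_of_comm _ _ _ _ _ _ (hg n _ _) (hg n _ _) _).symm
    · funext r i
      refine LinearMap.ext fun x => ?_
      obtain ⟨n, x, rfl⟩ := exists_seqColimitι_eq hφ x
      rw [hg, hg']

end SeqCooperad

/-- Any two colimits of a sequence of cooperads are isomorphic. -/
theorem IsSeqColimit.exists_iso {D : ℕ → CooperadData}
    {φ : ∀ n, GradedMap (D n).toSigmaData (D (n + 1)).toSigmaData} {L L' : CooperadData}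
    {ι : ∀ n, GradedMap (D n).toSigmaData L.toSigmaData}
    {ι' : ∀ n, GradedMap (D n).toSigmaData L'.toSigmaData}
    (h : IsSeqColimit D φ L ι) (h' : IsSeqColimit D φ L' ι') :
    ∃ (f : GradedMap L.toSigmaData L'.toSigmaData) (g : GradedMap L'.toSigmaData L.toSigmaData),
      (∀ r i x, g r i (f r i x) = x) ∧ (∀ r i x, f r i (g r i x) = x) ∧
      (∀ n r i x, f r i (ι n r i x) = ι' n r i x) ∧ ∀ n r i x, g r i (ι' n r i x) = ι n r i x := by
  have comp : ∀ {A B C : CooperadData} {f : GradedMap A.toSigmaData B.toSigmaData}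
      {g : GradedMap B.toSigmaData C.toSigmaData}, IsCooperadHom f → IsCooperadHom g →
      IsCooperadHom (C := A) (D := C) fun r i => g r i ∘ₗ f r i := by
    intro A B C f g hf hg
    refine ⟨⟨fun h x => ?_, fun σ x => ?_⟩, fun x => ?_, fun hr hk e x => ?_⟩
    · rw [LinearMap.comp_apply, hf.isSigmaHom.map_d, hg.isSigmaHom.map_d]; rfl
    · rw [LinearMap.comp_apply, hf.isSigmaHom.map_act, hg.isSigmaHom.map_act]; rfl
    · rw [LinearMap.comp_apply, hg.map_counit, hf.map_counit]
    · rw [LinearMap.comp_apply, hg.map_decomp, hf.map_decomp]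
      exact map_map_of_comm _ _ _ _ _ _ (fun _ => rfl) (fun _ => rfl) _
  have id : ∀ A : CooperadData, IsCooperadHom (C := A) (D := A) fun _ _ => LinearMap.id :=
    fun A => ⟨⟨fun _ _ => rfl, fun _ _ => rfl⟩, fun _ => rfl, fun _ _ _ _ => by
      rw [TensorProduct.map_id]; rfl⟩
  obtain ⟨f, ⟨hf, hfι⟩, -⟩ := h.existsUnique L' h'.isCooperad ι' h'.isHom h'.comm
  obtain ⟨g, ⟨hg, hgι⟩, -⟩ := h'.existsUnique L h.isCooperad ι h.isHom h.comm
  refine ⟨f, g, fun r i x => ?_, fun r i x => ?_, hfι, hgι⟩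
  · have := (h.existsUnique L h.isCooperad ι h.isHom h.comm).unique
      ⟨comp hf hg, fun n r i x => by rw [LinearMap.comp_apply, hfι, hgι]⟩
      ⟨id L, fun _ _ _ _ => rfl⟩
    exact LinearMap.congr_fun (congrFun (congrFun this r) i) x
  · have := (h'.existsUnique L' h'.isCooperad ι' h'.isHom h'.comm).unique
      ⟨comp hg hf, fun n r i x => by rw [LinearMap.comp_apply, hgι, hfι]⟩
      ⟨id L', fun _ _ _ _ => rfl⟩
    exact LinearMap.congr_fun (congrFun (congrFun this r) i) x

/-- A colimit is known only by its universal property; the isomorphism with the model `seqColimit`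
gives access to its elements. The next lemma does the same for injectivity. -/
theorem IsSeqColimit.exhaustive {D : ℕ → CooperadData}
    {φ : ∀ n, GradedMap (D n).toSigmaData (D (n + 1)).toSigmaData} {L : CooperadData}
    {ι : ∀ n, GradedMap (D n).toSigmaData L.toSigmaData} (h : IsSeqColimit D φ L ι)
    (hD : ∀ n, IsCooperad (D n)) (hφ : ∀ n, IsCooperadHom (φ n)) {r : ℕ} {i : ℤ} (x : L.X r i) :
    ∃ n y, ι n r i y = x := by
  obtain ⟨f, g, hgf, -, -, hg⟩ := h.exists_iso (isSeqColimit_seqColimit hφ hD)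
  obtain ⟨n, y, hy⟩ := exists_seqColimitι_eq hφ (f r i x)
  exact ⟨n, y, by rw [← hg, hy, hgf]⟩

theorem IsSeqColimit.injective {D : ℕ → CooperadData}
    {φ : ∀ n, GradedMap (D n).toSigmaData (D (n + 1)).toSigmaData} {L : CooperadData}
    {ι : ∀ n, GradedMap (D n).toSigmaData L.toSigmaData} (h : IsSeqColimit D φ L ι)
    (hD : ∀ n, IsCooperad (D n)) (hφ : ∀ n, IsCooperadHom (φ n)) {r : ℕ} {i : ℤ}
    (hinj : ∀ n, Function.Injective (φ n r i)) (n : ℕ) : Function.Injective (ι n r i) := by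
  obtain ⟨f, g, -, -, hf, -⟩ := h.exists_iso (isSeqColimit_seqColimit hφ hD)
  intro x y hxy
  have := congrArg (f r i) hxy
  rw [hf, hf] at this
  exact seqι_injective _ hinj n this

/-! ### Chains on sequences -/

section Chains

variable {G H K : Type}

theorem finsupp_int_induction {α : Type} {p : (α →₀ ℤ) → Prop} (X : α →₀ ℤ) (zero : p 0)
    (add : ∀ X Y, p X → p Y → p (X + Y)) (neg : ∀ X, p X → p (-X))
    (single : ∀ w, p (Finsupp.single w 1)) : p X := by
  induction X using Finsupp.induction_linear with
  | zero => exact zero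
  | add X Y hX hY => exact add _ _ hX hY
  | single w c =>
    have hn : ∀ n : ℕ, p (Finsupp.single w (n : ℤ)) := by
      intro n
      induction n with
      | zero => simpa using zero
      | succ n ih => rw [Nat.cast_succ, Finsupp.single_add]; exact add _ _ ih (single w)
    obtain ⟨n, rfl | rfl⟩ := c.eq_nat_or_neg
    · exact hn n
    · rw [Finsupp.single_neg]; exact neg _ (hn n)

/-- Formal sums of sequences of elements of `G`. -/
abbrev ListChain (G : Type) : Type := List G →₀ ℤ

namespace ListChain

/-- A sequence as a formal sum. -/
abbrev of (w : List G) : ListChain G := Finsupp.single w 1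

theorem induction {p : ListChain G → Prop} (X : ListChain G) (zero : p 0)
    (add : ∀ X Y, p X → p Y → p (X + Y)) (neg : ∀ X, p X → p (-X)) (of : ∀ w, p (of w)) : p X :=
  finsupp_int_induction X zero add neg of

/-- Adding a first element to the sequences. -/
def cons (a : G) : ListChain G →ₗ[ℤ] ListChain G := Finsupp.lmapDomain ℤ ℤ (a :: ·)

theorem cons_of (a : G) (w : List G) : cons a (of w) = of (a :: w) := Finsupp.mapDomain_single

/-- The map of formal sums induced by a map of sets. -/
def map (f : G → H) : ListChain G →ₗ[ℤ] ListChain H := Finsupp.lmapDomain ℤ ℤ (List.map f)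

theorem map_of (f : G → H) (w : List G) : map f (of w) = of (w.map f) := Finsupp.mapDomain_single

theorem map_cons (f : G → H) (a : G) (X : ListChain G) :
    map f (cons a X) = cons (f a) (map f X) := by
  induction X using induction with
  | zero => simp only [map_zero]
  | add X Y hX hY => simp only [map_add, hX, hY]
  | neg X hX => simp only [map_neg, hX]
  | of w => rw [cons_of, map_of, map_of, cons_of, List.map_cons]

theorem map_map (f : G → H) (g : H → K) (X : ListChain G) : map g (map f X) = map (g ∘ f) X := by
  induction X using induction with
  | zero => simp only [map_zero]
  | add X Y hX hY => simp only [map_add, hX, hY]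
  | neg X hX => simp only [map_neg, hX]
  | of w => rw [map_of, map_of, map_of, List.map_map]

theorem map_id (X : ListChain G) : map id X = X := by
  induction X using induction with
  | zero => simp only [map_zero]
  | add X Y hX hY => simp only [map_add, hX, hY]
  | neg X hX => simp only [map_neg, hX]
  | of w => rw [map_of, List.map_id]

/-- The sign `(-1)^l` on sequences of length `l`. -/
def alt : ListChain G →ₗ[ℤ] ListChain G :=
  Finsupp.linearCombination ℤ fun w => (-1 : ℤ) ^ w.length • of w

theorem alt_of (w : List G) : alt (of w) = (-1 : ℤ) ^ w.length • of w := by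
  rw [alt, Finsupp.linearCombination_single, one_smul]

theorem alt_cons (a : G) (X : ListChain G) : alt (cons a X) = -cons a (alt X) := by
  induction X using induction with
  | zero => simp only [map_zero, neg_zero]
  | add X Y hX hY => simp only [map_add, hX, hY, neg_add]
  | neg X hX => simp only [map_neg, hX]
  | of w => rw [cons_of, alt_of, alt_of, map_smul, cons_of, List.length_cons, pow_succ, mul_neg_one,
      neg_smul]

/-- The boundary of a sequence. -/
def bdList : List G → ListChain G
  | [] => 0
  | a :: w => of w - cons a (bdList w)

/-- The boundary: the alternating sum of the sequences with one element omitted. -/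
def bd : ListChain G →ₗ[ℤ] ListChain G := Finsupp.linearCombination ℤ bdList

theorem bd_of (w : List G) : bd (of w) = bdList w := by
  rw [bd, Finsupp.linearCombination_single, one_smul]

theorem bd_nil : bd (of ([] : List G)) = 0 := bd_of _

/-- The empty sequence plays the role of an augmentation: the boundary of a one-term sequence is
`[]` and not zero. A sequence of length `l` has degree `l - 1`, so `alt` is minus the usual degree
sign. -/
theorem bd_cons (a : G) (X : ListChain G) : bd (cons a X) = X - cons a (bd X) := by
  induction X using induction with
  | zero => simp only [map_zero, sub_zero]
  | add X Y hX hY => simp only [map_add, hX, hY]; abel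
  | neg X hX => simp only [map_neg, hX]; abel
  | of w => rw [cons_of, bd_of, bd_of, bdList]

theorem bd_of_eq_sum (w : List G) :
    bd (of w) = ∑ m ∈ Finset.range w.length, (-1 : ℤ) ^ m • of (w.eraseIdx m) := by
  induction w with
  | nil => rw [bd_nil]; rfl
  | cons a w ih =>
    rw [← cons_of, bd_cons, ih, List.length_cons, Finset.sum_range_succ', map_sum, sub_eq_add_neg,
      ← Finset.sum_neg_distrib, add_comm]
    congr 1
    · refine Finset.sum_congr rfl fun m _ => ?_
      rw [map_smul, cons_of, pow_succ, mul_neg_one, neg_smul, List.eraseIdx_cons_succ]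
    · rw [pow_zero, one_smul, List.eraseIdx_cons_zero]

theorem bd_bd (X : ListChain G) : bd (bd X) = 0 := by
  induction X using induction with
  | zero => simp only [map_zero]
  | add X Y hX hY => simp only [map_add, hX, hY, add_zero]
  | neg X hX => simp only [map_neg, hX, neg_zero]
  | of w =>
    induction w with
    | nil => rw [bd_nil, map_zero]
    | cons a w ih => rw [← cons_of, bd_cons, map_sub, bd_cons, ih, map_zero, sub_zero, sub_self]

theorem bd_map (f : G → H) (X : ListChain G) : bd (map f X) = map f (bd X) := by
  induction X using induction with
  | zero => simp only [map_zero]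
  | add X Y hX hY => simp only [map_add, hX, hY]
  | neg X hX => simp only [map_neg, hX]
  | of w =>
    induction w with
    | nil => rw [map_of, List.map_nil, bd_nil, bd_nil, map_zero]
    | cons a w ih => rw [← cons_of, map_cons, bd_cons, bd_cons, ih, map_sub, map_cons]

theorem bd_alt (X : ListChain G) : bd (alt X) = -alt (bd X) := by
  induction X using induction with
  | zero => simp only [map_zero, neg_zero]
  | add X Y hX hY => simp only [map_add, hX, hY, neg_add]
  | neg X hX => simp only [map_neg, hX]
  | of w =>
    induction w with
    | nil => rw [alt_of, map_smul, bd_nil, map_zero, smul_zero, neg_zero]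
    | cons a w ih =>
      rw [← cons_of, alt_cons, map_neg, bd_cons, bd_cons, ih, map_sub, alt_cons, map_neg]

/-- The product of the coefficients of the empty sequence. -/
def nilCoeff (X : ListChain G) (Y : ListChain H) : ListChain (G × H) := (X [] * Y []) • of []

theorem nilCoeff_of_nil : nilCoeff (of ([] : List G)) (of ([] : List H)) = of [] := by
  simp [nilCoeff]

theorem nilCoeff_cons_left (a : G) (X : ListChain G) (Y : ListChain H) :
    nilCoeff (cons a X) Y = 0 := by
  have : cons a X [] = 0 := Finsupp.mapDomain_of_notMem_range _ _ (by simp)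
  rw [nilCoeff, this, zero_mul, zero_smul]

theorem nilCoeff_cons_right (X : ListChain G) (b : H) (Y : ListChain H) :
    nilCoeff X (cons b Y) = 0 := by
  have : cons b Y [] = 0 := Finsupp.mapDomain_of_notMem_range _ _ (by simp)
  rw [nilCoeff, this, mul_zero, zero_smul]

theorem nilCoeff_add_left (X X' : ListChain G) (Y : ListChain H) :
    nilCoeff (X + X') Y = nilCoeff X Y + nilCoeff X' Y := by
  simp only [nilCoeff, Finsupp.add_apply, add_mul, add_smul]

theorem nilCoeff_add_right (X : ListChain G) (Y Y' : ListChain H) :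
    nilCoeff X (Y + Y') = nilCoeff X Y + nilCoeff X Y' := by
  simp only [nilCoeff, Finsupp.add_apply, mul_add, add_smul]

theorem nilCoeff_neg_left (X : ListChain G) (Y : ListChain H) :
    nilCoeff (-X) Y = -nilCoeff X Y := by
  simp only [nilCoeff, Finsupp.neg_apply, neg_mul, neg_smul]

theorem nilCoeff_neg_right (X : ListChain G) (Y : ListChain H) :
    nilCoeff X (-Y) = -nilCoeff X Y := by
  simp only [nilCoeff, Finsupp.neg_apply, mul_neg, neg_smul]

theorem nilCoeff_zero_left (Y : ListChain H) : nilCoeff (0 : ListChain G) Y = 0 := by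
  simp only [nilCoeff, Finsupp.zero_apply, zero_mul, zero_smul]

theorem nilCoeff_zero_right (X : ListChain G) : nilCoeff X (0 : ListChain H) = 0 := by
  simp only [nilCoeff, Finsupp.zero_apply, mul_zero, zero_smul]

theorem nilCoeff_smul_left (c : ℤ) (X : ListChain G) (Y : ListChain H) :
    nilCoeff (c • X) Y = c • nilCoeff X Y := by
  simp only [nilCoeff, Finsupp.smul_apply, smul_smul, smul_eq_mul, mul_assoc]

/-- The shuffles of two sequences as a formal sum. -/
def shList (x : List G) (y : List H) : ListChain (G × H) :=
  ((shuffles x y).map fun p => p.1 • of p.2).sum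

theorem sum_map_cons (c : G × H) (u : ℤ) (l : List (ℤ × List (G × H))) :
    ((l.map fun p => (u * p.1, c :: p.2)).map fun p => p.1 • of p.2).sum =
      cons c (u • (l.map fun p => p.1 • of p.2).sum) := by
  induction l with
  | nil => simp only [List.map_nil, List.sum_nil, smul_zero, map_zero]
  | cons p l ih =>
    simp only [List.map_cons, List.sum_cons, smul_add, map_add, ih, map_smul, cons_of, mul_smul]

theorem shList_nil_left (y : List H) : shList ([] : List G) y = 0 := by
  rw [shList, shuffles]; rfl

theorem shList_nil_right (x : List G) : shList x ([] : List H) = 0 := by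
  cases x <;> rw [shList, shuffles] <;> rfl

/-- A path starts at `(a, b)`, then stops if both sequences have a single term, which is the role of
`nilCoeff`, or moves in one of the two directions. A move in the second direction crosses the
`x.length` remaining moves in the first. -/
theorem shList_cons_cons (a : G) (x : List G) (b : H) (y : List H) :
    shList (a :: x) (b :: y) = cons (a, b) (nilCoeff (of x) (of y) + shList x (b :: y) +
      (-1 : ℤ) ^ x.length • shList (a :: x) y) := by
  have h1 : ∀ l : List (ℤ × List (G × H)), (l.map fun p => (p.1, (a, b) :: p.2)) =
      l.map fun p => (1 * p.1, (a, b) :: p.2) := fun l => by simp only [one_mul]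
  have hn : ∀ {A : Type} (c : A) (w : List A), (of (c :: w)) [] = 0 := fun c w =>
    Finsupp.single_eq_of_ne (by simp)
  rcases x with _ | ⟨a', x⟩ <;> rcases y with _ | ⟨b', y⟩
  · rw [nilCoeff_of_nil, shList_nil_left, shList_nil_right, smul_zero, add_zero, add_zero, cons_of,
      shList, shuffles]
    simp
  · rw [shList, shuffles, h1, sum_map_cons, shList_nil_left, nilCoeff, hn, List.length_nil,
      mul_zero, zero_smul, zero_add, zero_add, one_smul, pow_zero, one_smul, shList]
  · rw [shList, shuffles, h1, sum_map_cons, shList_nil_right, nilCoeff, hn,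
      zero_mul, zero_smul, zero_add, smul_zero, add_zero, one_smul, shList]
  · rw [shList, shuffles, h1, List.map_append, List.sum_append, sum_map_cons, sum_map_cons,
      nilCoeff, hn, zero_mul, zero_smul, zero_add, one_smul, map_add]
    rfl

/-- The shuffle product. -/
def sh : ListChain G →ₗ[ℤ] ListChain H →ₗ[ℤ] ListChain (G × H) :=
  Finsupp.linearCombination ℤ fun x => Finsupp.linearCombination ℤ fun y => shList x y

theorem sh_of (x : List G) (y : List H) : sh (of x) (of y) = shList x y := by
  rw [sh, Finsupp.linearCombination_single, one_smul, Finsupp.linearCombination_single, one_smul]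

theorem sh_nil_left (Y : ListChain H) : sh (of ([] : List G)) Y = 0 := by
  induction Y using induction with
  | zero => simp only [map_zero]
  | add X Y hX hY => simp only [map_add, hX, hY, add_zero]
  | neg X hX => simp only [map_neg, hX, neg_zero]
  | of w => rw [sh_of, shList_nil_left]

theorem sh_nil_right (X : ListChain G) : sh X (of ([] : List H)) = 0 := by
  induction X using induction with
  | zero => simp only [map_zero, LinearMap.zero_apply]
  | add X Y hX hY => simp only [map_add, LinearMap.add_apply, hX, hY, add_zero]
  | neg X hX => simp only [map_neg, LinearMap.neg_apply, hX, neg_zero]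
  | of w => rw [sh_of, shList_nil_right]

theorem sh_nilCoeff_left (X : ListChain G) (Y : ListChain H) (Z : ListChain K) :
    sh (nilCoeff X Y) Z = 0 := by
  rw [nilCoeff, map_smul, LinearMap.smul_apply, sh_nil_left, smul_zero]

theorem sh_nilCoeff_right (X : ListChain G) (Y : ListChain H) (Z : ListChain K) :
    sh Z (nilCoeff X Y) = 0 := by
  rw [nilCoeff, map_smul, sh_nil_right, smul_zero]

theorem sh_cons_cons (a : G) (X : ListChain G) (b : H) (Y : ListChain H) :
    sh (cons a X) (cons b Y) =
      cons (a, b) (nilCoeff X Y + sh X (cons b Y) + sh (cons a (alt X)) Y) := by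
  induction X using induction with
  | zero => simp only [map_zero, LinearMap.zero_apply, nilCoeff_zero_left, add_zero]
  | add X X' hX hY =>
    simp only [map_add, LinearMap.add_apply, nilCoeff_add_left, hX, hY]; abel
  | neg X hX => simp only [map_neg, LinearMap.neg_apply, nilCoeff_neg_left, hX, map_add]; abel
  | of x =>
    induction Y using induction with
    | zero => simp only [map_zero, nilCoeff_zero_right, add_zero]
    | add X X' hX hY => simp only [map_add, nilCoeff_add_right, hX, hY]; abel
    | neg X hX => simp only [map_neg, nilCoeff_neg_right, hX, map_add]; abel
    | of y =>
      rw [cons_of, cons_of, sh_of, shList_cons_cons, sh_of, alt_of, map_smul, map_smul,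
        LinearMap.smul_apply, cons_of, sh_of]

theorem sh_map_map {G' H' : Type} (f : G → G') (g : H → H') (X : ListChain G) (Y : ListChain H) :
    sh (map f X) (map g Y) = map (Prod.map f g) (sh X Y) := by
  induction X using induction with
  | zero => simp only [map_zero, LinearMap.zero_apply]
  | add X X' hX hY => simp only [map_add, LinearMap.add_apply, hX, hY]
  | neg X hX => simp only [map_neg, LinearMap.neg_apply, hX]
  | of x =>
    induction Y using induction with
    | zero => simp only [map_zero]
    | add X X' hX hY => simp only [map_add, hX, hY]
    | neg X hX => simp only [map_neg, hX]
    | of y =>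
      rw [map_of, map_of, sh_of, sh_of]
      induction x generalizing y with
      | nil => rw [List.map_nil, shList_nil_left, shList_nil_left, map_zero]
      | cons a x ihx =>
        induction y with
        | nil => rw [List.map_nil, shList_nil_right, shList_nil_right, map_zero]
        | cons b y ihy =>
          rw [List.map_cons] at ihy
          have h0 : nilCoeff (of (x.map f)) (of (y.map g)) =
              map (Prod.map f g) (nilCoeff (of x) (of y)) := by
            rw [nilCoeff, nilCoeff, map_smul, map_of, List.map_nil]
            congr 2 <;> rcases x with _ | _ <;> rcases y with _ | _ <;> simp
          rw [List.map_cons, List.map_cons, shList_cons_cons, shList_cons_cons, ihy, map_cons,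
            ← List.map_cons (f := g), ihx, List.length_map, h0]
          simp only [map_add, map_smul]
          rfl

theorem alt_alt (X : ListChain G) : alt (alt X) = X := by
  induction X using induction with
  | zero => simp only [map_zero]
  | add X X' hX hY => simp only [map_add, hX, hY]
  | neg X hX => simp only [map_neg, hX]
  | of x => rw [alt_of, map_smul, alt_of, smul_smul, ← pow_add, Even.neg_one_pow ⟨_, rfl⟩, one_smul]

theorem nilCoeff_alt_left (X : ListChain G) (Y : ListChain H) :
    nilCoeff (alt X) Y = nilCoeff X Y := by
  induction X using induction with
  | zero => simp only [map_zero]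
  | add X X' hX hY => simp only [map_add, nilCoeff_add_left, hX, hY]
  | neg X hX => simp only [map_neg, nilCoeff_neg_left, hX]
  | of x =>
    rcases x with _ | ⟨a, x⟩
    · rw [alt_of, List.length_nil, pow_zero, one_smul]
    · rw [← cons_of, alt_cons, nilCoeff_neg_left, nilCoeff_cons_left, nilCoeff_cons_left, neg_zero]

theorem nilCoeff_alt_right (X : ListChain G) (Y : ListChain H) :
    nilCoeff X (alt Y) = nilCoeff X Y := by
  induction Y using induction with
  | zero => simp only [map_zero]
  | add X X' hX hY => simp only [map_add, nilCoeff_add_right, hX, hY]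
  | neg X hX => simp only [map_neg, nilCoeff_neg_right, hX]
  | of x =>
    rcases x with _ | ⟨a, x⟩
    · rw [alt_of, List.length_nil, pow_zero, one_smul]
    · rw [← cons_of, alt_cons, nilCoeff_neg_right, nilCoeff_cons_right, nilCoeff_cons_right,
        neg_zero]

theorem alt_nilCoeff (X : ListChain G) (Y : ListChain H) :
    alt (nilCoeff X Y) = nilCoeff X Y := by
  rw [nilCoeff, map_smul, alt_of, List.length_nil, pow_zero, one_smul]

/-- Shuffles of sequences of lengths `l` and `m` have length `l + m - 1`, whence the minus sign. -/
theorem alt_sh_of (x : List G) (y : List H) :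
    alt (sh (of x) (of y)) = -sh (alt (of x)) (alt (of y)) := by
  induction x generalizing y with
  | nil => rw [sh_nil_left, alt_of, map_smul, LinearMap.smul_apply, sh_nil_left, smul_zero,
      map_zero, neg_zero]
  | cons a x ihx =>
    induction y with
    | nil => rw [sh_nil_right, alt_of ([] : List H), map_smul, sh_nil_right, smul_zero,
        map_zero, neg_zero]
    | cons b y ihy =>
      have ihx' := ihx (b :: y)
      have ihy' : alt (sh (cons a (alt (of x))) (of y)) =
          -sh (alt (cons a (alt (of x)))) (alt (of y)) := by
        rw [alt_of, map_smul, cons_of]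
        simp only [map_smul, LinearMap.smul_apply, ihy, smul_neg]
      rw [← cons_of] at ihx' ⊢
      rw [← cons_of, sh_cons_cons]
      simp only [alt_cons, map_neg, LinearMap.neg_apply, neg_neg, sh_cons_cons, map_add, ihx', ihy',
        alt_alt, nilCoeff_alt_left, nilCoeff_alt_right, alt_nilCoeff, neg_add]

theorem alt_sh (X : ListChain G) (Y : ListChain H) :
    alt (sh X Y) = -sh (alt X) (alt Y) := by
  induction X using induction with
  | zero => simp only [map_zero, LinearMap.zero_apply, neg_zero]
  | add X X' hX hY => simp only [map_add, LinearMap.add_apply, hX, hY, neg_add]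
  | neg X hX => simp only [map_neg, LinearMap.neg_apply, hX]
  | of x =>
    induction Y using induction with
    | zero => simp only [map_zero, neg_zero]
    | add X X' hX hY => simp only [map_add, hX, hY, neg_add]
    | neg X hX => simp only [map_neg, hX]
    | of y => exact alt_sh_of x y

/-- The shuffle map is a chain map: as `alt` is minus the degree sign, the second term is the usual
one. The last term is a trace of the augmentation, non-zero only for two one-term sequences; it is a
multiple of `[]` and disappears under normalization. -/
theorem bd_sh_of (x : List G) (y : List H) :
    bd (sh (of x) (of y)) = sh (bd (of x)) (of y) - sh (alt (of x)) (bd (of y)) +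
      nilCoeff (bd (of x)) (bd (of y)) := by
  induction x generalizing y with
  | nil =>
    rw [sh_nil_left, alt_of, map_smul, LinearMap.smul_apply, sh_nil_left, bd_nil, map_zero,
      smul_zero, nilCoeff_zero_left, map_zero, LinearMap.zero_apply, sub_zero, add_zero]
  | cons a x ihx =>
    induction y with
    | nil =>
      rw [sh_nil_right, sh_nil_right, bd_nil, map_zero, map_zero, nilCoeff_zero_right, sub_zero,
        add_zero]
    | cons b y ihy =>
      have ihx' := ihx (b :: y)
      -- The recursion replaces `x` by `alt x`, which on a basis element is only a sign, so the
      -- induction hypothesis still applies.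
      have ihy' : bd (sh (cons a (alt (of x))) (of y)) =
          sh (bd (cons a (alt (of x)))) (of y) - sh (alt (cons a (alt (of x)))) (bd (of y)) +
            nilCoeff (bd (cons a (alt (of x)))) (bd (of y)) := by
        rw [alt_of, map_smul, cons_of]
        simp only [map_smul, LinearMap.smul_apply, nilCoeff_smul_left, ihy, smul_sub, smul_add]
      rw [← cons_of] at ihx' ⊢
      rw [← cons_of, sh_cons_cons]
      simp only [map_add bd, ihx', ihy', bd_cons, alt_cons, bd_alt, alt_alt, map_sub, map_neg, LinearMap.sub_apply,
        LinearMap.neg_apply, sh_cons_cons, map_add]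
      have h0 : bd (nilCoeff (of x) (of y)) = 0 := by rw [nilCoeff, map_smul, bd_nil, smul_zero]
      have h1 : ∀ (X : ListChain G) (Y : ListChain H) c Z, nilCoeff X (Y - cons c Z) = nilCoeff X Y :=
        fun X Y c Z => by
          rw [sub_eq_add_neg, nilCoeff_add_right, nilCoeff_neg_right, nilCoeff_cons_right, neg_zero,
            add_zero]
      have h2 : ∀ (X : ListChain G) (Y : ListChain H) c Z, nilCoeff (X - cons c Z) Y = nilCoeff X Y :=
        fun X Y c Z => by
          rw [sub_eq_add_neg, nilCoeff_add_left, nilCoeff_neg_left, nilCoeff_cons_left, neg_zero,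
            add_zero]
      have h3 : ∀ (X : ListChain G) (Y : ListChain H) c Z, nilCoeff (X + cons c Z) Y = nilCoeff X Y :=
        fun X Y c Z => by
          rw [nilCoeff_add_left, nilCoeff_cons_left, add_zero]
      simp only [h0, h1, h2, h3, nilCoeff_alt_left, map_zero, sub_neg_eq_add]
      abel

theorem bd_sh (X : ListChain G) (Y : ListChain H) :
    bd (sh X Y) = sh (bd X) Y - sh (alt X) (bd Y) + nilCoeff (bd X) (bd Y) := by
  induction X using induction with
  | zero => simp only [map_zero, LinearMap.zero_apply, nilCoeff_zero_left, sub_zero, add_zero]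
  | add X X' hX hY =>
    simp only [map_add, LinearMap.add_apply, nilCoeff_add_left, hX, hY]
    abel
  | neg X hX =>
    simp only [map_neg, LinearMap.neg_apply, nilCoeff_neg_left, hX]
    abel
  | of x =>
    induction Y using induction with
    | zero => simp only [map_zero, nilCoeff_zero_right, sub_zero, add_zero]
    | add X X' hX hY => simp only [map_add, nilCoeff_add_right, hX, hY]; abel
    | neg X hX => simp only [map_neg, nilCoeff_neg_right, hX]; abel
    | of y => exact bd_sh_of x y

theorem sh_apply_nil (X : ListChain G) (Y : ListChain H) : sh X Y [] = 0 := by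
  induction X using induction with
  | zero => simp only [map_zero, LinearMap.zero_apply, Finsupp.zero_apply]
  | add X X' hX hY => rw [map_add, LinearMap.add_apply, Finsupp.add_apply, hX, hY, add_zero]
  | neg X hX => rw [map_neg, LinearMap.neg_apply, Finsupp.neg_apply, hX, neg_zero]
  | of x =>
    induction Y using induction with
    | zero => simp only [map_zero, Finsupp.zero_apply]
    | add X X' hX hY => rw [map_add, Finsupp.add_apply, hX, hY, add_zero]
    | neg X hX => rw [map_neg, Finsupp.neg_apply, hX, neg_zero]
    | of y =>
      rcases x with _ | ⟨a, x⟩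
      · rw [sh_nil_left, Finsupp.zero_apply]
      rcases y with _ | ⟨b, y⟩
      · rw [sh_nil_right, Finsupp.zero_apply]
      rw [sh_of, shList_cons_cons]
      exact Finsupp.mapDomain_of_notMem_range _ _ (by simp)

theorem nilCoeff_sh_left (X : ListChain G) (Y : ListChain H) (Z : ListChain K) :
    nilCoeff (sh X Y) Z = 0 := by
  rw [nilCoeff, sh_apply_nil, zero_mul, zero_smul]

theorem nilCoeff_sh_right (X : ListChain G) (Y : ListChain H) (Z : ListChain K) :
    nilCoeff Z (sh X Y) = 0 := by
  rw [nilCoeff, sh_apply_nil, mul_zero, zero_smul]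

/-- Both sides enumerate the paths in a triple product according to the first move. The equation
`h1` identifies the signs: `alt` applied to the tail of a shuffle is distributed over the tails of
its factors. -/
theorem sh_assoc_of (x : List G) (y : List H) (z : List K) :
    map (Equiv.prodAssoc G H K) (sh (sh (of x) (of y)) (of z)) =
      sh (of x) (sh (of y) (of z)) := by
  induction x generalizing y z with
  | nil => simp only [sh_nil_left, map_zero, LinearMap.zero_apply]
  | cons a x ihx =>
    induction y generalizing z with
    | nil => simp only [sh_nil_left, sh_nil_right, map_zero, LinearMap.zero_apply]
    | cons b y ihy =>
      induction z with
      | nil => simp only [sh_nil_right, map_zero]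
      | cons c z ihz =>
        have ihx' := ihx (b :: y) (c :: z)
        have ihy' : map (Equiv.prodAssoc G H K)
            (sh (sh (cons a (alt (of x))) (of y)) (of (c :: z))) =
            sh (cons a (alt (of x))) (sh (of y) (of (c :: z))) := by
          rw [alt_of, map_smul, cons_of]
          simp only [map_smul, LinearMap.smul_apply, ihy]
        have ihz' : map (Equiv.prodAssoc G H K)
            (sh (sh (cons a (alt (of x))) (cons b (alt (of y)))) (of z)) =
            sh (cons a (alt (of x))) (sh (cons b (alt (of y))) (of z)) := by
          rw [alt_of, alt_of, map_smul, map_smul (cons b), cons_of, cons_of]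
          simp only [map_smul, LinearMap.smul_apply, ihz]
        simp only [← cons_of] at ihx' ihy' ⊢
        have h1 : cons (a, b) (alt (nilCoeff (of x) (of y) + sh (of x) (cons b (of y)) +
            sh (cons a (alt (of x))) (of y))) =
            sh (cons a (alt (of x))) (cons b (alt (of y))) := by
          rw [← neg_inj, ← alt_cons, ← sh_cons_cons, alt_sh, alt_cons, alt_cons, map_neg, map_neg,
            LinearMap.neg_apply, neg_neg]
        have h2 : nilCoeff (nilCoeff (of x) (of y) + sh (of x) (cons b (of y)) +
            sh (cons a (alt (of x))) (of y)) (of z) = nilCoeff (nilCoeff (of x) (of y)) (of z) := by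
          simp only [nilCoeff_add_left, nilCoeff_sh_left, add_zero]
        have h3 : nilCoeff (of x) (nilCoeff (of y) (of z) + sh (of y) (cons c (of z)) +
            sh (cons b (alt (of y))) (of z)) = nilCoeff (of x) (nilCoeff (of y) (of z)) := by
          simp only [nilCoeff_add_right, nilCoeff_sh_right, add_zero]
        have h4 : map (Equiv.prodAssoc G H K) (nilCoeff (nilCoeff (of x) (of y)) (of z)) =
          nilCoeff (of x) (nilCoeff (of y) (of z)) := by
          simp only [nilCoeff, map_smul, map_of, Finsupp.smul_apply, Finsupp.single_eq_same,
            smul_eq_mul, mul_one, List.map_nil, mul_assoc]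
        rw [sh_cons_cons a, sh_cons_cons (a, b), sh_cons_cons b, sh_cons_cons a, h1, h2, h3,
          map_cons, ← sh_cons_cons b]
        simp only [map_add, LinearMap.add_apply, ihx', ihy', ihz', h4, sh_nilCoeff_left,
          sh_nilCoeff_right, zero_add]
        rw [Equiv.prodAssoc_apply]
        abel

theorem sh_assoc (X : ListChain G) (Y : ListChain H) (Z : ListChain K) :
    map (Equiv.prodAssoc G H K) (sh (sh X Y) Z) = sh X (sh Y Z) := by
  induction X using induction with
  | zero => simp only [map_zero, LinearMap.zero_apply]
  | add X X' hX hY => simp only [map_add, LinearMap.add_apply, hX, hY]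
  | neg X hX => simp only [map_neg, LinearMap.neg_apply, hX]
  | of x =>
    induction Y using induction with
    | zero => simp only [map_zero, LinearMap.zero_apply]
    | add X X' hX hY => simp only [map_add, LinearMap.add_apply, hX, hY]
    | neg X hX => simp only [map_neg, LinearMap.neg_apply, hX]
    | of y =>
      induction Z using induction with
      | zero => simp only [map_zero]
      | add X X' hX hY => simp only [map_add, hX, hY]
      | neg X hX => simp only [map_neg, hX]
      | of z => exact sh_assoc_of x y z

/-- Graded commutativity: `length + 1` has the parity of the degree. -/
theorem sh_comm (x : List G) (y : List H) :
    map Prod.swap (sh (of y) (of x)) =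
      (-1 : ℤ) ^ ((x.length + 1) * (y.length + 1)) • sh (of x) (of y) := by
  induction x generalizing y with
  | nil => rw [sh_nil_left, sh_nil_right, map_zero, smul_zero]
  | cons a x ihx =>
    induction y with
    | nil => rw [sh_nil_left, sh_nil_right, map_zero, smul_zero]
    | cons b y ihy =>
      have ihx' := ihx (b :: y)
      simp only [sh_of] at ihx' ihy ⊢
      have h0 : map Prod.swap (nilCoeff (of y) (of x)) =
          (-1 : ℤ) ^ (((a :: x).length + 1) * ((b :: y).length + 1)) •
            nilCoeff (of x) (of y) := by
        rcases x with _ | ⟨_, _⟩ <;> rcases y with _ | ⟨_, _⟩ <;>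
          simp [nilCoeff, map_of]
      have h1 : (-1 : ℤ) ^ (((a :: x).length + 1) * (y.length + 1)) =
          (-1 : ℤ) ^ (((a :: x).length + 1) * ((b :: y).length + 1)) * (-1 : ℤ) ^ x.length := by
        rw [← pow_add, List.length_cons, List.length_cons]
        refine neg_one_pow_congr ?_
        simp only [parity_simps]
        tauto
      have h2 : (-1 : ℤ) ^ y.length * (-1 : ℤ) ^ ((x.length + 1) * ((b :: y).length + 1)) =
          (-1 : ℤ) ^ (((a :: x).length + 1) * ((b :: y).length + 1)) := by
        rw [← pow_add, List.length_cons, List.length_cons]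
        refine neg_one_pow_congr ?_
        simp only [parity_simps]
        tauto
      rw [shList_cons_cons, shList_cons_cons, map_cons]
      simp only [map_add, map_smul, h0, ihx', ihy, smul_smul, h1, h2, smul_add]
      rw [Prod.swap_prod_mk]
      abel

end ListChain

end Chains

/-! ### Normalization of chains. -/

namespace ListChain

variable {G H K : Type}

open Classical in
/-- The projection which kills the degenerate sequences. -/
def nondeg : ListChain G →ₗ[ℤ] ListChain G :=
  Finsupp.linearCombination ℤ fun w => if w.IsChain (· ≠ ·) then of w else 0

open Classical in
theorem nondeg_of (w : List G) : nondeg (of w) = if w.IsChain (· ≠ ·) then of w else 0 := by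
  rw [nondeg, Finsupp.linearCombination_single, one_smul]

theorem nondeg_of_not {w : List G} (h : ¬ w.IsChain (· ≠ ·)) : nondeg (of w) = 0 := by
  rw [nondeg_of, if_neg h]

theorem nondeg_cons_nondeg (a : G) (X : ListChain G) :
    nondeg (cons a (nondeg X)) = nondeg (cons a X) := by
  induction X using induction with
  | zero => simp only [map_zero]
  | add X X' hX hY => simp only [map_add, hX, hY]
  | neg X hX => simp only [map_neg, hX]
  | of x =>
    by_cases h : x.IsChain (· ≠ ·)
    · rw [nondeg_of, if_pos h]
    · rw [nondeg_of_not h, map_zero, map_zero, cons_of, nondeg_of_not fun h' => h h'.tail]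

theorem nondeg_cons {a : G} {X : ListChain G} (h : nondeg X = 0) : nondeg (cons a X) = 0 := by
  rw [← nondeg_cons_nondeg, h, map_zero, map_zero]

theorem nondeg_cons_cons (a : G) (X : ListChain G) : nondeg (cons a (cons a X)) = 0 := by
  induction X using induction with
  | zero => simp only [map_zero]
  | add X X' hX hY => simp only [map_add, hX, hY, add_zero]
  | neg X hX => simp only [map_neg, hX, neg_zero]
  | of x => rw [cons_of, cons_of, nondeg_of_not (by simp)]

theorem not_isChain_cons {a : G} {w : List G} (h : ¬ (a :: w).IsChain (· ≠ ·)) :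
    (∃ w', w = a :: w') ∨ ¬ w.IsChain (· ≠ ·) := by
  rcases w with _ | ⟨b, w⟩
  · exact absurd (List.isChain_singleton a) h
  · by_cases hab : a = b
    · exact Or.inl ⟨w, by rw [hab]⟩
    · exact Or.inr fun h' => h (List.isChain_cons_cons.2 ⟨hab, h'⟩)

theorem nondeg_bd_of {w : List G} (h : ¬ w.IsChain (· ≠ ·)) : nondeg (bd (of w)) = 0 := by
  induction w with
  | nil => rw [bd_nil, map_zero]
  | cons a w ih =>
    rw [← cons_of, bd_cons, map_sub]
    rcases not_isChain_cons h with ⟨w, rfl⟩ | h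
    · rw [← cons_of, bd_cons, map_sub, map_sub, nondeg_cons_cons, sub_zero, sub_self]
    · rw [nondeg_cons (ih h), nondeg_of_not h, sub_zero]

theorem nondeg_map_of (f : G → H) {w : List G} (h : ¬ w.IsChain (· ≠ ·)) :
    nondeg (map f (of w)) = 0 := by
  rw [map_of]
  refine nondeg_of_not fun h' => h ?_
  rw [List.isChain_map] at h'
  exact h'.imp fun _ _ h e => h (congrArg f e)

theorem nondeg_map {f : G → H} {X : ListChain G} (h : nondeg X = 0) : nondeg (map f X) = 0 := by
  have : ∀ X : ListChain G, nondeg (map f X) = nondeg (map f (nondeg X)) := fun X => by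
    induction X using induction with
    | zero => simp only [map_zero]
    | add X X' hX hY => simp only [map_add, hX, hY]
    | neg X hX => simp only [map_neg, hX]
    | of x =>
      by_cases hx : x.IsChain (· ≠ ·)
      · rw [nondeg_of, if_pos hx]
      · rw [nondeg_of_not hx, nondeg_map_of f hx, map_zero, map_zero]
  rw [this, h, map_zero, map_zero]

/-- Every path makes the move between the two equal terms of the degenerate factor while the other
coordinate stands still, and thus repeats a pair. No cancellation between paths is involved. -/
theorem nondeg_sh_of (x : List G) (y : List H)
    (h : ¬ x.IsChain (· ≠ ·) ∨ ¬ y.IsChain (· ≠ ·)) : nondeg (sh (of x) (of y)) = 0 := by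
  induction x generalizing y with
  | nil => rw [sh_nil_left, map_zero]
  | cons a x ihx =>
    induction y with
    | nil => rw [sh_nil_right, map_zero]
    | cons b y ihy =>
      rw [sh_of] at ihy ⊢
      rw [shList_cons_cons, map_add, map_add, map_smul, map_add, map_add, map_smul]
      have h0 : nondeg (cons (a, b) (nilCoeff (of x) (of y))) = 0 := by
        rcases x with _ | ⟨c, x⟩
        · rcases y with _ | ⟨c, y⟩
          · exact (h.elim (· (List.isChain_singleton a)) (· (List.isChain_singleton b))).elim
          · rw [← cons_of, nilCoeff_cons_right, map_zero, map_zero]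
        · rw [← cons_of, nilCoeff_cons_left, map_zero, map_zero]
      have h1 : nondeg (cons (a, b) (shList x (b :: y))) = 0 := by
        rcases h with h | h
        · rcases not_isChain_cons h with ⟨w, rfl⟩ | h
          · rw [shList_cons_cons, nondeg_cons_cons]
          · rw [← sh_of]; exact nondeg_cons (ihx _ (Or.inl h))
        · rw [← sh_of]; exact nondeg_cons (ihx _ (Or.inr h))
      have h2 : nondeg (cons (a, b) (shList (a :: x) y)) = 0 := by
        rcases h with h | h
        · exact nondeg_cons (ihy (Or.inl h))
        · rcases not_isChain_cons h with ⟨w, rfl⟩ | h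
          · rw [shList_cons_cons, nondeg_cons_cons]
          · exact nondeg_cons (ihy (Or.inr h))
      rw [h0, h1, h2, smul_zero, add_zero, add_zero]

open Classical in
/-- The projection which kills the degenerate sequences and the empty sequence. -/
def nrm : ListChain G →ₗ[ℤ] ListChain G :=
  Finsupp.linearCombination ℤ fun w => if w ≠ [] ∧ w.IsChain (· ≠ ·) then of w else 0

theorem nrm_of {w : List G} (h0 : w ≠ []) (h : w.IsChain (· ≠ ·)) : nrm (of w) = of w := by
  rw [nrm, Finsupp.linearCombination_single, one_smul, if_pos ⟨h0, h⟩]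

theorem nrm_nil : nrm (of ([] : List G)) = 0 := by
  rw [nrm, Finsupp.linearCombination_single, one_smul, if_neg (by simp)]

theorem nrm_of_not {w : List G} (h : ¬ w.IsChain (· ≠ ·)) : nrm (of w) = 0 := by
  rw [nrm, Finsupp.linearCombination_single, one_smul, if_neg fun h' => h h'.2]

theorem nrm_of_cases (w : List G) :
    (w = [] ∧ nrm (of w) = 0) ∨ (¬ w.IsChain (· ≠ ·) ∧ nrm (of w) = 0) ∨ nrm (of w) = of w := by
  rcases eq_or_ne w [] with rfl | h0
  · exact Or.inl ⟨rfl, nrm_nil⟩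
  · by_cases h : w.IsChain (· ≠ ·)
    · exact Or.inr (Or.inr (nrm_of h0 h))
    · exact Or.inr (Or.inl ⟨h, nrm_of_not h⟩)

theorem nrm_eq_zero {X : ListChain G} (h : nondeg X = 0) : nrm X = 0 := by
  have : ∀ X : ListChain G, nrm X = nrm (nondeg X) := fun X => by
    induction X using induction with
    | zero => simp only [map_zero]
    | add X X' hX hY => simp only [map_add, ← hX, ← hY]
    | neg X hX => simp only [map_neg, ← hX]
    | of x =>
      by_cases hx : x.IsChain (· ≠ ·)
      · rw [nondeg_of, if_pos hx]
      · rw [nondeg_of_not hx, nrm_of_not hx, map_zero]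
  rw [this, h, map_zero]

/-- With the next lemmas, this shows that the operations descend to the normalized complex:
degenerate sequences may be discarded before an operation as well as after it. -/
theorem nrm_bd_nrm (X : ListChain G) : nrm (bd (nrm X)) = nrm (bd X) := by
  induction X using induction with
  | zero => simp only [map_zero]
  | add X X' hX hY => simp only [map_add, hX, hY]
  | neg X hX => simp only [map_neg, hX]
  | of x =>
    rcases nrm_of_cases x with ⟨rfl, h⟩ | ⟨hx, h⟩ | h
    · rw [h, bd_nil, map_zero]
    · rw [h, nrm_eq_zero (nondeg_bd_of hx), map_zero, map_zero]
    · rw [h]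

theorem nrm_map_nrm (f : G → H) (X : ListChain G) : nrm (map f (nrm X)) = nrm (map f X) := by
  induction X using induction with
  | zero => simp only [map_zero]
  | add X X' hX hY => simp only [map_add, hX, hY]
  | neg X hX => simp only [map_neg, hX]
  | of x =>
    rcases nrm_of_cases x with ⟨rfl, h⟩ | ⟨hx, h⟩ | h
    · rw [h, map_of, List.map_nil, nrm_nil, map_zero, map_zero]
    · rw [h, nrm_eq_zero (nondeg_map_of f hx), map_zero, map_zero]
    · rw [h]

theorem nrm_map_sh_nrm_left (f : G × H → K) (X : ListChain G) (Y : ListChain H) :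
    nrm (map f (sh (nrm X) Y)) = nrm (map f (sh X Y)) := by
  induction X using induction with
  | zero => simp only [map_zero]
  | add X X' hX hY => simp only [map_add, LinearMap.add_apply, hX, hY]
  | neg X hX => simp only [map_neg, LinearMap.neg_apply, hX]
  | of x =>
    induction Y using induction with
    | zero => simp only [map_zero]
    | add X X' hX hY => simp only [map_add, hX, hY]
    | neg X hX => simp only [map_neg, hX]
    | of y =>
      rcases nrm_of_cases x with ⟨rfl, h⟩ | ⟨hx, h⟩ | h
      · rw [h, sh_nil_left, map_zero, LinearMap.zero_apply]
      · rw [h, nrm_eq_zero (nondeg_map (nondeg_sh_of x y (Or.inl hx)))]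
        simp only [map_zero, LinearMap.zero_apply]
      · rw [h]

theorem nrm_map_sh_nrm_right (f : G × H → K) (X : ListChain G) (Y : ListChain H) :
    nrm (map f (sh X (nrm Y))) = nrm (map f (sh X Y)) := by
  induction X using induction with
  | zero => simp only [map_zero, LinearMap.zero_apply]
  | add X X' hX hY => simp only [map_add, LinearMap.add_apply, hX, hY]
  | neg X hX => simp only [map_neg, LinearMap.neg_apply, hX]
  | of x =>
    induction Y using induction with
    | zero => simp only [map_zero]
    | add X X' hX hY => simp only [map_add, hX, hY]
    | neg X hX => simp only [map_neg, hX]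
    | of y =>
      rcases nrm_of_cases y with ⟨rfl, h⟩ | ⟨hx, h⟩ | h
      · rw [h, sh_nil_right, map_zero]
      · rw [h, nrm_eq_zero (nondeg_map (nondeg_sh_of x y (Or.inr hx)))]
        simp only [map_zero]
      · rw [h]

theorem sh_singleton_left (a : G) {y : List H} (hy : y ≠ []) :
    sh (of [a]) (of y) = of (y.map fun b => (a, b)) := by
  rw [sh_of]
  induction y with
  | nil => exact absurd rfl hy
  | cons b y ih =>
    rw [shList_cons_cons, shList_nil_left, add_zero, List.length_nil, pow_zero, one_smul]
    rcases y with _ | ⟨c, y⟩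
    · rw [shList_nil_right, add_zero, nilCoeff_of_nil, cons_of]; rfl
    · rw [ih (by simp), ← cons_of c, nilCoeff_cons_right, zero_add, cons_of]; rfl

theorem sh_singleton_right {x : List G} (hx : x ≠ []) (b : H) :
    sh (of x) (of [b]) = of (x.map fun a => (a, b)) := by
  rw [sh_of]
  induction x with
  | nil => exact absurd rfl hx
  | cons a x ih =>
    rw [shList_cons_cons, shList_nil_right, smul_zero, add_zero]
    rcases x with _ | ⟨c, x⟩
    · rw [shList_nil_left, add_zero, nilCoeff_of_nil, cons_of]; rfl
    · rw [ih (by simp), ← cons_of c, nilCoeff_cons_left, zero_add, cons_of]; rfl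

end ListChain

/-! ### Variations of order along subsequences and shuffles. -/

section Variations

open Classical

/-- The number of changes of the truth value of `Q` along a sequence, with given initial value. -/
def changesFrom {G : Type} (Q : G → Prop) : Prop → List G → ℕ
  | _, [] => 0
  | q, a :: l => (if q ↔ Q a then 0 else 1) + changesFrom Q (Q a) l

theorem changesFrom_le_add {G : Type} (Q : G → Prop) (q q' : Prop) (l : List G) :
    changesFrom Q q l ≤ (if q ↔ q' then 0 else 1) + changesFrom Q q' l := by
  cases l with
  | nil => exact Nat.zero_le _
  | cons a l =>
    simp only [changesFrom]
    split_ifs <;> first | omega | (exfalso; tauto)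

theorem changesFrom_sublist {G : Type} (Q : G → Prop) {l l' : List G} (h : l'.Sublist l) (q : Prop) :
    changesFrom Q q l' ≤ changesFrom Q q l := by
  induction h generalizing q with
  | slnil => exact le_rfl
  | cons a h ih => exact (ih q).trans (changesFrom_le_add Q q (Q a) _)
  | cons_cons a h ih => exact Nat.add_le_add_left (ih _) _

/-- The number of changes of the truth value of `Q` along a sequence. -/
def changes {G : Type} (Q : G → Prop) : List G → ℕ
  | [] => 0
  | a :: l => changesFrom Q (Q a) l

theorem changes_le_changesFrom {G : Type} (Q : G → Prop) (q : Prop) (l : List G) :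
    changes Q l ≤ changesFrom Q q l := by
  cases l with
  | nil => exact le_rfl
  | cons a l => exact Nat.le_add_left _ _

/-- Omitting terms cannot create changes; this is the reason why `E_n` is stable under faces. -/
theorem changes_sublist {G : Type} (Q : G → Prop) {l l' : List G} (h : l'.Sublist l) :
    changes Q l' ≤ changes Q l := by
  induction h with
  | slnil => exact le_rfl
  | cons a h ih => exact ih.trans (changes_le_changesFrom Q (Q a) _)
  | cons_cons a h ih => exact changesFrom_sublist Q h _

theorem changesFrom_map {G H : Type} (Q : H → Prop) (f : G → H) (q : Prop) (l : List G) :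
    changesFrom Q q (l.map f) = changesFrom (fun a => Q (f a)) q l := by
  induction l generalizing q with
  | nil => rfl
  | cons a l ih => simp only [List.map_cons, changesFrom, ih]

theorem changes_map {G H : Type} (Q : H → Prop) (f : G → H) (l : List G) :
    changes Q (l.map f) = changes (fun a => Q (f a)) l := by
  cases l with
  | nil => rfl
  | cons a l => exact changesFrom_map Q f _ l

theorem variations_eq_changes {r : ℕ} (i j : Fin r) (l : List (Perm (Fin r))) :
    variations i j l = changes (fun w => w.symm i < w.symm j) l := by
  induction l with
  | nil => rfl
  | cons a l ih =>
    cases l with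
    | nil => rfl
    | cons b l =>
      rw [variations, ih]
      simp only [changes, changesFrom]
      congr!

theorem changes_cons_cons {G : Type} (Q : G → Prop) (a b : G) (l : List G) :
    changes Q (a :: b :: l) = (if Q a ↔ Q b then 0 else 1) + changes Q (b :: l) := rfl

/-- Each move of a path changes one coordinate only. Each coordinate thus runs through its own
sequence with repetitions, and repetitions create no change. -/
theorem shuffles_spec {G H : Type} (a : G) (x : List G) (b : H) (y : List H)
    {p : ℤ × List (G × H)} (hp : p ∈ shuffles (a :: x) (b :: y)) :
    p.2.length = x.length + y.length + 1 ∧ (∃ l, p.2 = (a, b) :: l) ∧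
      (∀ Q : G → Prop, changes (fun c => Q c.1) p.2 = changes Q (a :: x)) ∧
      ∀ Q : H → Prop, changes (fun c => Q c.2) p.2 = changes Q (b :: y) := by
  have stepL : ∀ {a a' : G} {x : List G} {b : H} {y : List H} {l : List (G × H)},
      (l.length = x.length + y.length + 1 ∧ (∃ l', l = (a', b) :: l') ∧
      (∀ Q : G → Prop, changes (fun c => Q c.1) l = changes Q (a' :: x)) ∧
      ∀ Q : H → Prop, changes (fun c => Q c.2) l = changes Q (b :: y)) →
      ((a, b) :: l).length = (a' :: x).length + y.length + 1 ∧ (∃ l', (a, b) :: l = (a, b) :: l') ∧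
      (∀ Q : G → Prop, changes (fun c => Q c.1) ((a, b) :: l) = changes Q (a :: a' :: x)) ∧
      ∀ Q : H → Prop, changes (fun c => Q c.2) ((a, b) :: l) = changes Q (b :: y) := by
    rintro a a' x b y l ⟨h1, ⟨l, rfl⟩, h3, h4⟩
    refine ⟨by simp only [List.length_cons] at h1 ⊢; omega, ⟨_, rfl⟩, fun Q => ?_, fun Q => ?_⟩
    · rw [changes_cons_cons, changes_cons_cons, h3]
    · rw [changes_cons_cons, h4, if_pos Iff.rfl, zero_add]
  have stepR : ∀ {a : G} {x : List G} {b b' : H} {y : List H} {l : List (G × H)},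
      (l.length = x.length + y.length + 1 ∧ (∃ l', l = (a, b') :: l') ∧
      (∀ Q : G → Prop, changes (fun c => Q c.1) l = changes Q (a :: x)) ∧
      ∀ Q : H → Prop, changes (fun c => Q c.2) l = changes Q (b' :: y)) →
      ((a, b) :: l).length = x.length + (b' :: y).length + 1 ∧ (∃ l', (a, b) :: l = (a, b) :: l') ∧
      (∀ Q : G → Prop, changes (fun c => Q c.1) ((a, b) :: l) = changes Q (a :: x)) ∧
      ∀ Q : H → Prop, changes (fun c => Q c.2) ((a, b) :: l) = changes Q (b :: b' :: y) := by
    rintro a x b b' y l ⟨h1, ⟨l, rfl⟩, h3, h4⟩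
    refine ⟨by simp only [List.length_cons] at h1 ⊢; omega, ⟨_, rfl⟩, fun Q => ?_, fun Q => ?_⟩
    · rw [changes_cons_cons, h3, if_pos Iff.rfl, zero_add]
    · rw [changes_cons_cons, changes_cons_cons, h4]
  induction x generalizing a b y p with
  | nil =>
    induction y generalizing a b p with
    | nil =>
      rw [shuffles] at hp
      obtain rfl := List.mem_singleton.1 hp
      exact ⟨rfl, ⟨_, rfl⟩, fun _ => rfl, fun _ => rfl⟩
    | cons b' y ihy =>
      rw [shuffles] at hp
      obtain ⟨p', hp', rfl⟩ := List.mem_map.1 hp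
      exact stepR (ihy _ _ hp')
  | cons a' x ihx =>
    induction y generalizing a b p with
    | nil =>
      rw [shuffles] at hp
      obtain ⟨p', hp', rfl⟩ := List.mem_map.1 hp
      exact stepL (ihx _ _ _ hp')
    | cons b' y ihy =>
      rw [shuffles] at hp
      rcases List.mem_append.1 hp with hp | hp
      · obtain ⟨p', hp', rfl⟩ := List.mem_map.1 hp
        exact stepL (ihx _ _ _ hp')
      · obtain ⟨p', hp', rfl⟩ := List.mem_map.1 hp
        exact stepR (ihy _ _ hp')

end Variations

/-! ### Associativity of the substitution of permutations -/

section Assoc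

variable {s t u a b r : ℕ}

theorem insFun_seq_inl (ha : a + 1 = s + t) (hra : r + 1 = a + u)
    (_hb : b + 1 = t + u) (hrb : r + 1 = s + b) {e : Fin s} {f : Fin t} {g : Fin a}
    (hg : (g : ℕ) = e + f) (i : Fin s) (hi : i ≠ e) (hi' : insFun ha e (Sum.inl ⟨i, hi⟩) ≠ g) :
    insFun hra g (Sum.inl ⟨insFun ha e (Sum.inl ⟨i, hi⟩), hi'⟩) = insFun hrb e (Sum.inl ⟨i, hi⟩) := by
  have := Fin.val_ne_iff.2 hi
  ext
  rw [insFun_inl_val, insFun_inl_val, insFun_inl_val]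
  split_ifs <;> omega

theorem insFun_seq_inr_inl (ha : a + 1 = s + t) (hra : r + 1 = a + u)
    (hb : b + 1 = t + u) (hrb : r + 1 = s + b) {e : Fin s} {f : Fin t} {g : Fin a}
    (hg : (g : ℕ) = e + f) (j : Fin t) (hj : j ≠ f) (hj' : insFun ha e (Sum.inr j) ≠ g) :
    insFun hra g (Sum.inl ⟨insFun ha e (Sum.inr j), hj'⟩) =
      insFun hrb e (Sum.inr (insFun hb f (Sum.inl ⟨j, hj⟩))) := by
  have := Fin.val_ne_iff.2 hj
  ext
  rw [insFun_inl_val, insFun_inr_val, insFun_inr_val, insFun_inl_val]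
  split_ifs <;> omega

theorem insFun_seq_inr_inr (_ha : a + 1 = s + t) (hra : r + 1 = a + u)
    (hb : b + 1 = t + u) (hrb : r + 1 = s + b) {e : Fin s} {f : Fin t} {g : Fin a}
    (hg : (g : ℕ) = e + f) (l : Fin u) :
    insFun hra g (Sum.inr l) = insFun hrb e (Sum.inr (insFun hb f (Sum.inr l))) := by
  ext
  rw [insFun_inr_val, insFun_inr_val, insFun_inr_val]
  omega

theorem blockPerm_assoc_seq (ha : a + 1 = s + t) (hra : r + 1 = a + u)
    (hb : b + 1 = t + u) (hrb : r + 1 = s + b) (e : Fin s) (f : Fin t) (g : Fin a)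
    (hg : (g : ℕ) = e + f) (σ : Perm (Fin s)) (τ : Perm (Fin t)) (υ : Perm (Fin u)) :
    blockPerm hra g (blockPerm ha e σ τ) υ = blockPerm hrb e σ (blockPerm hb f τ υ) := by
  have hg' : g = insFun ha e (Sum.inr f) := Fin.ext (by rw [insFun_inr_val, hg])
  have hg₂ : ((blockPerm ha e σ τ g : Fin a) : ℕ) = σ e + τ f := by
    rw [hg', blockPerm_inr, insFun_inr_val]
  refine blockPerm_ext hra g (fun x hx => ?_) fun l => ?_
  · rw [blockPerm_inl]
    rcases insFun_cases ha e x with ⟨i, hi, rfl⟩ | ⟨j, rfl⟩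
    · rw [insFun_seq_inl ha hra hb hrb hg]
      simp only [blockPerm_inl]
      exact insFun_seq_inl ha hra hb hrb hg₂ _ _ _
    · have hj : j ≠ f := fun h => hx (by rw [h, hg'])
      rw [insFun_seq_inr_inl ha hra hb hrb hg j hj]
      simp only [blockPerm_inr, blockPerm_inl]
      exact insFun_seq_inr_inl ha hra hb hrb hg₂ _ _ _
  · rw [blockPerm_inr, insFun_seq_inr_inr ha hra hb hrb hg, blockPerm_inr, blockPerm_inr]
    exact insFun_seq_inr_inr ha hra hb hrb hg₂ _

theorem insFun_par_inl (ha : a + 1 = s + t) (hra : r + 1 = a + u)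
    (hb : b + 1 = s + u) (hrb : r + 1 = b + t) {e f : Fin s} {g : Fin a} {h : Fin b} (hef : e ≠ f)
    (hg : g = insFun ha e (Sum.inl ⟨f, hef.symm⟩)) (hh : h = insFun hb f (Sum.inl ⟨e, hef⟩))
    (i : Fin s) (he : i ≠ e) (hf : i ≠ f) (hi : insFun ha e (Sum.inl ⟨i, he⟩) ≠ g)
    (hi' : insFun hb f (Sum.inl ⟨i, hf⟩) ≠ h) :
    insFun hra g (Sum.inl ⟨insFun ha e (Sum.inl ⟨i, he⟩), hi⟩) =
      insFun hrb h (Sum.inl ⟨insFun hb f (Sum.inl ⟨i, hf⟩), hi'⟩) := by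
  have h1 := Fin.val_ne_iff.2 he
  have h2 := Fin.val_ne_iff.2 hf
  have h3 := Fin.val_ne_iff.2 hef
  have hg' := congrArg Fin.val hg
  have hh' := congrArg Fin.val hh
  rw [insFun_inl_val] at hg' hh'
  ext
  rw [insFun_inl_val, insFun_inl_val, insFun_inl_val, insFun_inl_val]
  split_ifs at * <;> omega

theorem insFun_par_inr (ha : a + 1 = s + t) (hra : r + 1 = a + u)
    (hb : b + 1 = s + u) (hrb : r + 1 = b + t) {e f : Fin s} {g : Fin a} {h : Fin b} (hef : e ≠ f)
    (hg : g = insFun ha e (Sum.inl ⟨f, hef.symm⟩)) (hh : h = insFun hb f (Sum.inl ⟨e, hef⟩))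
    (j : Fin t) (hj : insFun ha e (Sum.inr j) ≠ g) :
    insFun hra g (Sum.inl ⟨insFun ha e (Sum.inr j), hj⟩) = insFun hrb h (Sum.inr j) := by
  have h3 := Fin.val_ne_iff.2 hef
  have hg' := congrArg Fin.val hg
  have hh' := congrArg Fin.val hh
  rw [insFun_inl_val] at hg' hh'
  ext
  rw [insFun_inl_val, insFun_inr_val, insFun_inr_val]
  split_ifs at * <;> omega

/-- The hypothesis is `e ≠ f` and not `e < f`, since `σ` may exchange the order of the two inputs.
For the same reason `g` and `h` are given as images under `insFun` rather than by their numerical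
values. -/
theorem blockPerm_assoc_par (ha : a + 1 = s + t) (hra : r + 1 = a + u)
    (hb : b + 1 = s + u) (hrb : r + 1 = b + t) (e f : Fin s) (g : Fin a) (h : Fin b) (hef : e ≠ f)
    (hg : g = insFun ha e (Sum.inl ⟨f, hef.symm⟩)) (hh : h = insFun hb f (Sum.inl ⟨e, hef⟩))
    (σ : Perm (Fin s)) (τ : Perm (Fin t)) (υ : Perm (Fin u)) :
    blockPerm hra g (blockPerm ha e σ τ) υ = blockPerm hrb h (blockPerm hb f σ υ) τ := by
  have hef' : σ e ≠ σ f := σ.injective.ne hef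
  have hg₂ : blockPerm ha e σ τ g = insFun ha (σ e) (Sum.inl ⟨σ f, hef'.symm⟩) := by
    rw [hg, blockPerm_inl]
  have hh₂ : blockPerm hb f σ υ h = insFun hb (σ f) (Sum.inl ⟨σ e, hef'⟩) := by
    rw [hh, blockPerm_inl]
  refine blockPerm_ext hra g (fun x hx => ?_) fun l => ?_
  · rw [blockPerm_inl]
    rcases insFun_cases ha e x with ⟨i, hi, rfl⟩ | ⟨j, rfl⟩
    · have hif : i ≠ f := fun h => hx (by subst h; exact hg.symm)
      have hih : insFun hb f (Sum.inl ⟨i, hif⟩) ≠ h := fun h' => hi (by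
        have := insFun_injective hb f (h'.trans hh)
        simpa using this)
      rw [insFun_par_inl ha hra hb hrb hef hg hh i hi hif hx hih]
      simp only [blockPerm_inl]
      exact insFun_par_inl ha hra hb hrb hef' hg₂ hh₂ _ _ _ _ _
    · rw [insFun_par_inr ha hra hb hrb hef hg hh j]
      simp only [blockPerm_inr]
      exact insFun_par_inr ha hra hb hrb hef' hg₂ hh₂ _ _
  · have hl : insFun hb f (Sum.inr l) ≠ h := fun h' => by
      have := insFun_injective hb f (h'.trans hh)
      simp at this
    rw [blockPerm_inr, ← insFun_par_inr hb hrb ha hra hef.symm hh hg l hl]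
    simp only [blockPerm_inr, blockPerm_inl]
    exact (insFun_par_inr hb hrb ha hra hef'.symm hh₂ hg₂ _ _).symm

theorem permComp_symm_inl {s t r : ℕ} (hr : r + 1 = s + t) (e : Fin s) (u : Perm (Fin s))
    (v : Perm (Fin t)) (i : Fin s) (hi : i ≠ e) :
    (permComp hr e u v).symm (insFun hr e (Sum.inl ⟨i, hi⟩)) =
      insFun hr (u.symm e) (Sum.inl ⟨u.symm i, u.symm.injective.ne hi⟩) := by
  rw [Equiv.symm_apply_eq, permComp, blockPerm_inl]
  simp only [Equiv.apply_symm_apply]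
  exact insFun_inl_congr hr (u.apply_symm_apply e).symm _ _ _

theorem permComp_symm_inr {s t r : ℕ} (hr : r + 1 = s + t) (e : Fin s) (u : Perm (Fin s))
    (v : Perm (Fin t)) (j : Fin t) :
    (permComp hr e u v).symm (insFun hr e (Sum.inr j)) =
      insFun hr (u.symm e) (Sum.inr (v.symm j)) := by
  rw [Equiv.symm_apply_eq, permComp, blockPerm_inr]
  simp only [Equiv.apply_symm_apply]
  exact insFun_inr_congr hr (u.apply_symm_apply e).symm _

theorem permComp_mul {s t r : ℕ} (hr : r + 1 = s + t) (e : Fin s) (σ u : Perm (Fin s))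
    (τ v : Perm (Fin t)) :
    permComp hr (σ e) (σ * u) (τ * v) = blockPerm hr e σ τ * permComp hr e u v := by
  have h : (σ * u).symm (σ e) = u.symm e := by
    rw [Equiv.symm_apply_eq, Equiv.Perm.mul_apply, Equiv.apply_symm_apply]
  rw [permComp, h, blockPerm_mul, Equiv.apply_symm_apply, permComp]

theorem permComp_assoc_seq (ha : a + 1 = s + t) (hra : r + 1 = a + u)
    (hb : b + 1 = t + u) (hrb : r + 1 = s + b) (e : Fin s) (f : Fin t) (g : Fin a)
    (hg : (g : ℕ) = e + f) (σ : Perm (Fin s)) (τ : Perm (Fin t)) (υ : Perm (Fin u)) :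
    permComp hra g (permComp ha e σ τ) υ = permComp hrb e σ (permComp hb f τ υ) := by
  have hg' : g = insFun ha e (Sum.inr f) := Fin.ext (by rw [insFun_inr_val, hg])
  refine blockPerm_assoc_seq ha hra hb hrb _ _ _ ?_ σ τ υ
  rw [hg', permComp_symm_inr, insFun_inr_val]

theorem permComp_assoc_par (ha : a + 1 = s + t) (hra : r + 1 = a + u)
    (hb : b + 1 = s + u) (hrb : r + 1 = b + t) (e f : Fin s) (g : Fin a) (h : Fin b) (hef : e ≠ f)
    (hg : g = insFun ha e (Sum.inl ⟨f, hef.symm⟩)) (hh : h = insFun hb f (Sum.inl ⟨e, hef⟩))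
    (σ : Perm (Fin s)) (τ : Perm (Fin t)) (υ : Perm (Fin u)) :
    permComp hra g (permComp ha e σ τ) υ = permComp hrb h (permComp hb f σ υ) τ := by
  refine blockPerm_assoc_par ha hra hb hrb _ _ _ _ (σ.symm.injective.ne hef) ?_ ?_ σ τ υ
  · rw [hg, permComp_symm_inl]
  · rw [hh, permComp_symm_inl]

theorem permComp_one_left {r : ℕ} (hr : r + 1 = 1 + r) (e : Fin 1) (v : Perm (Fin r)) :
    permComp hr e 1 v = v := by
  refine blockPerm_ext hr ((1 : Perm (Fin 1)).symm e)
    (fun i hi => absurd (Subsingleton.elim i _) hi) fun j => ?_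
  have h : ∀ e (j : Fin r), insFun hr e (Sum.inr j) = j := fun e j => by
    ext
    rw [insFun_inr_val]
    omega
  rw [permComp, blockPerm_inr, h, h]

theorem permComp_one_right {r : ℕ} (hr : r + 1 = r + 1) (e : Fin r) (u : Perm (Fin r)) :
    permComp hr e u 1 = u := by
  have h : ∀ (e i : Fin r) (hi : i ≠ e), insFun hr e (Sum.inl ⟨i, hi⟩) = i := fun e i hi => by
    have := Fin.val_ne_iff.2 hi
    ext
    rw [insFun_inl_val]
    split_ifs <;> omega
  have h' : ∀ (e : Fin r) (j : Fin 1), insFun hr e (Sum.inr j) = e := fun e i => by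
    ext
    rw [insFun_inr_val]
    omega
  refine blockPerm_ext hr (u.symm e) (fun i hi => ?_) fun j => ?_
  · rw [permComp, blockPerm_inl, h, h]
  · rw [permComp, blockPerm_inr, h', h']

theorem insFun_lt_iff_inl_inl {s t r : ℕ} (hr : r + 1 = s + t) (ht : 0 < t) (e i i' : Fin s)
    (hi : i ≠ e) (hi' : i' ≠ e) :
    insFun hr e (Sum.inl ⟨i, hi⟩) < insFun hr e (Sum.inl ⟨i', hi'⟩) ↔ i < i' := by
  have := Fin.val_ne_iff.2 hi
  have := Fin.val_ne_iff.2 hi'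
  rw [Fin.lt_def, Fin.lt_def, insFun_inl_val, insFun_inl_val]
  split_ifs <;> omega

theorem insFun_lt_iff_inl_inr {s t r : ℕ} (hr : r + 1 = s + t) (e i : Fin s) (j : Fin t)
    (hi : i ≠ e) :
    insFun hr e (Sum.inl ⟨i, hi⟩) < insFun hr e (Sum.inr j) ↔ i < e := by
  have := Fin.val_ne_iff.2 hi
  rw [Fin.lt_def, Fin.lt_def, insFun_inl_val, insFun_inr_val]
  split_ifs <;> omega

theorem insFun_lt_iff_inr_inl {s t r : ℕ} (hr : r + 1 = s + t) (e i : Fin s) (j : Fin t)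
    (hi : i ≠ e) :
    insFun hr e (Sum.inr j) < insFun hr e (Sum.inl ⟨i, hi⟩) ↔ e < i := by
  have := Fin.val_ne_iff.2 hi
  rw [Fin.lt_def, Fin.lt_def, insFun_inl_val, insFun_inr_val]
  split_ifs <;> omega

theorem insFun_lt_iff_inr_inr {s t r : ℕ} (hr : r + 1 = s + t) (e : Fin s) (j j' : Fin t) :
    insFun hr e (Sum.inr j) < insFun hr e (Sum.inr j') ↔ j < j' := by
  rw [Fin.lt_def, Fin.lt_def, insFun_inr_val, insFun_inr_val]
  omega

end Assoc

/-! ### The Barratt–Eccles operad -/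

section BarrattEccles

open ListChain

variable {n : ℕ}

/-- The conditions which define the simplices of `E_n`, possibly degenerate. -/
structure IsDegenSimplex (n r : ℕ) (d : ℤ) (w : List (Perm (Fin r))) : Prop where
  arity_pos : 0 < r
  length_eq : (w.length : ℤ) = d + 1
  variations_lt : ∀ i j : Fin r, i ≠ j → variations i j w < n

theorem IsSimplex.isDegenSimplex {r : ℕ} {d : ℤ} {w : List (Perm (Fin r))}
    (h : IsSimplex n r d w) : IsDegenSimplex n r d w :=
  ⟨h.arity_pos, h.length_eq, h.variations_lt⟩

/-- The sequence of permutations which underlies a simplex. -/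
def Simp.toList {r : ℕ} {d : ℤ} (w : Simp n r d) : List (Perm (Fin r)) := w.1

theorem Simp.isSimplex {r : ℕ} {d : ℤ} (w : Simp n r d) : IsSimplex n r d w.toList := w.2

theorem Simp.toList_injective {r : ℕ} {d : ℤ} :
    Function.Injective (Simp.toList : Simp n r d → List (Perm (Fin r))) :=
  Subtype.val_injective

/-- The basis element of `E_n(r)` given by a simplex. -/
def ofSimp {r : ℕ} {d : ℤ} (w : Simp n r d) : (barrattEccles n).X r d :=
  (Finsupp.single w 1 : Simp n r d →₀ ℤ)

variable (n) in
/-- The class of a sequence of permutations in `E_n(r)`. -/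
def ofSeq {r : ℕ} (d : ℤ) (w : List (Perm (Fin r))) : (barrattEccles n).X r d := simplex n d w

/-- The elements of `E_n(r)` as formal sums of sequences. -/
def toChain {r : ℕ} {d : ℤ} : (barrattEccles n).X r d →ₗ[ℤ] ListChain (Perm (Fin r)) :=
  Finsupp.lmapDomain ℤ ℤ (Simp.toList : Simp n r d → _)

theorem toChain_injective {r : ℕ} {d : ℤ} :
    Function.Injective (toChain : (barrattEccles n).X r d →ₗ[ℤ] _) :=
  Finsupp.mapDomain_injective Simp.toList_injective

theorem toChain_ofSimp {r : ℕ} {d : ℤ} (w : Simp n r d) : toChain (ofSimp w) = of w.toList :=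
  Finsupp.mapDomain_single

theorem barrattEccles_induction {r : ℕ} {d : ℤ} {p : (barrattEccles n).X r d → Prop}
    (x : (barrattEccles n).X r d) (zero : p 0) (add : ∀ x y, p x → p y → p (x + y))
    (neg : ∀ x, p x → p (-x)) (single : ∀ w : Simp n r d, p (ofSimp w)) : p x :=
  finsupp_int_induction x zero add neg single

theorem nrm_toChain {r : ℕ} {d : ℤ} (x : (barrattEccles n).X r d) :
    nrm (toChain x) = toChain x := by
  induction x using barrattEccles_induction with
  | zero => simp only [map_zero]
  | add x y hx hy => simp only [map_add, hx, hy]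
  | neg x hx => simp only [map_neg, hx]
  | single w => rw [toChain_ofSimp, nrm_of w.isSimplex.ne_nil w.isSimplex.nondegenerate]

theorem neg_one_pow_eq_negOnePow {m : ℕ} {d : ℤ} (h : (m : ℤ) = d) :
    (-1 : ℤ) ^ m = (d.negOnePow : ℤ) := by
  subst h
  rw [Int.negOnePow_def, zpow_natCast, Units.val_pow_eq_pow_val]; rfl

theorem alt_toChain {r : ℕ} {d : ℤ} (x : (barrattEccles n).X r d) :
    alt (toChain x) = -(d.negOnePow : ℤ) • toChain x := by
  induction x using barrattEccles_induction with
  | zero => simp only [map_zero, smul_zero]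
  | add x y hx hy => simp only [map_add, hx, hy, smul_add]
  | neg x hx => simp only [map_neg, hx, smul_neg]
  | single w =>
    rw [toChain_ofSimp, alt_of, neg_one_pow_eq_negOnePow w.isSimplex.length_eq, Int.negOnePow_succ]
    rfl

/-- Since `simplex` also returns zero on sequences with too many variations, the bound contained in
`IsDegenSimplex` is needed for its vanishing to mean degeneracy. -/
theorem toChain_ofSeq {r : ℕ} {d : ℤ} {w : List (Perm (Fin r))} (h : IsDegenSimplex n r d w) :
    toChain (ofSeq n d w) = nrm (of w) := by
  by_cases h' : IsSimplex n r d w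
  · have : ofSeq n d w = ofSimp ⟨w, h'⟩ := dif_pos h'
    rw [this, nrm_of h'.ne_nil h'.nondegenerate]
    exact toChain_ofSimp _
  · have : ofSeq n d w = 0 := dif_neg h'
    rw [this, map_zero]
    rcases nrm_of_cases w with ⟨-, hw⟩ | ⟨-, hw⟩ | hw
    · exact hw.symm
    · exact hw.symm
    · exfalso
      rcases eq_or_ne w [] with rfl | h0
      · rw [nrm_nil] at hw
        exact Finsupp.single_ne_zero.2 one_ne_zero hw.symm
      · refine h' ⟨h.arity_pos, h0, h.length_eq, ?_, h.variations_lt⟩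
        by_contra hc
        rw [nrm_of_not hc] at hw
        exact Finsupp.single_ne_zero.2 one_ne_zero hw.symm

theorem IsDegenSimplex.eraseIdx {r : ℕ} {i j : ℤ} (hij : j + 1 = i) {w : List (Perm (Fin r))}
    (h : IsDegenSimplex n r i w) {m : ℕ} (hm : m < w.length) :
    IsDegenSimplex n r j (w.eraseIdx m) where
  arity_pos := h.arity_pos
  length_eq := by
    have := h.length_eq
    rw [List.length_eraseIdx_of_lt hm]
    omega
  variations_lt a b hab := by
    refine lt_of_le_of_lt ?_ (h.variations_lt a b hab)
    rw [variations_eq_changes, variations_eq_changes]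
    exact changes_sublist _ (List.eraseIdx_sublist _ _)

theorem IsDegenSimplex.map {r : ℕ} {i : ℤ} {w : List (Perm (Fin r))}
    (h : IsDegenSimplex n r i w) (σ : Perm (Fin r)) :
    IsDegenSimplex n r i (w.map (σ * ·)) where
  arity_pos := h.arity_pos
  length_eq := by rw [List.length_map, h.length_eq]
  variations_lt a b hab := by
    have := h.variations_lt (σ.symm a) (σ.symm b) (σ.symm.injective.ne hab)
    rw [variations_eq_changes] at this ⊢
    rw [changes_map]
    exact this

/-- The relative order of two inputs of a composite is that of two inputs of a single factor,
possibly with `e` as one of them. By `shuffles_spec` its variations along a path are those of that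
factor, so the bound `n` is preserved. -/
theorem IsDegenSimplex.comp {s t r : ℕ} {i j k : ℤ} (hr : r + 1 = s + t) (hk : i + j = k)
    (e : Fin s) {u : List (Perm (Fin s))} {v : List (Perm (Fin t))} (hu : IsDegenSimplex n s i u)
    (hv : IsDegenSimplex n t j v) {p : ℤ × List (Perm (Fin s) × Perm (Fin t))}
    (hp : p ∈ shuffles u v) :
    IsDegenSimplex n r k (p.2.map fun ab => permComp hr e ab.1 ab.2) := by
  have h1 := hu.arity_pos
  have h2 := hv.arity_pos
  have h3 := hu.length_eq
  have h4 := hv.length_eq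
  rcases u with _ | ⟨u₀, u⟩
  · rw [shuffles] at hp; simp at hp
  rcases v with _ | ⟨v₀, v⟩
  · rw [shuffles] at hp; simp at hp
  obtain ⟨hl, -, hQ₁, hQ₂⟩ := shuffles_spec _ _ _ _ hp
  rw [List.length_cons] at h3 h4
  refine ⟨by omega, by rw [List.length_map, hl]; push_cast at *; omega, fun a b hab => ?_⟩
  rw [variations_eq_changes, changes_map]
  have hu' : ∀ a b : Fin s, a ≠ b → changes (fun c : Perm (Fin s) × Perm (Fin t) =>
      c.1.symm a < c.1.symm b) p.2 < n := fun a b hab => by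
    rw [hQ₁ fun c => c.symm a < c.symm b, ← variations_eq_changes]
    exact hu.variations_lt a b hab
  have hv' : ∀ a b : Fin t, a ≠ b → changes (fun c : Perm (Fin s) × Perm (Fin t) =>
      c.2.symm a < c.2.symm b) p.2 < n := fun a b hab => by
    rw [hQ₂ fun c => c.symm a < c.symm b, ← variations_eq_changes]
    exact hv.variations_lt a b hab
  rcases insFun_cases hr e a with ⟨a, ha, rfl⟩ | ⟨a, rfl⟩ <;>
    rcases insFun_cases hr e b with ⟨b, hb, rfl⟩ | ⟨b, rfl⟩ <;>
    simp only [permComp_symm_inl, permComp_symm_inr, insFun_lt_iff_inl_inl hr h2,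
      insFun_lt_iff_inl_inr, insFun_lt_iff_inr_inl, insFun_lt_iff_inr_inr]
  · exact hu' a b fun h => hab (by subst h; rfl)
  · exact hu' a e ha
  · exact hu' e b hb.symm
  · exact hv' a b fun h => hab (by rw [h])

theorem barrattEccles_d_ofSimp {r : ℕ} {i j : ℤ} (h : j + 1 = i) (w : Simp n r i) :
    (barrattEccles n).d h (ofSimp w) =
      ∑ m ∈ Finset.range w.toList.length, (-1 : ℤ) ^ m • ofSeq n j (w.toList.eraseIdx m) :=
  show (Finsupp.linearCombination ℤ (fun w : Simp n r i =>
      ∑ m ∈ Finset.range w.1.length, (-1 : ℤ) ^ m • simplex n j (w.1.eraseIdx m))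
      (Finsupp.single w 1) : Simp n r j →₀ ℤ) =
      ∑ m ∈ Finset.range w.1.length, (-1 : ℤ) ^ m • simplex n j (w.1.eraseIdx m) from
    (Finsupp.linearCombination_single ℤ _ _).trans (one_smul ℤ _)

theorem barrattEccles_act_ofSimp {r : ℕ} {i : ℤ} (σ : Perm (Fin r)) (w : Simp n r i) :
    (barrattEccles n).act σ (ofSimp w) = ofSeq n i (w.toList.map (σ * ·)) :=
  show (Finsupp.linearCombination ℤ (fun w : Simp n r i => simplex n i (w.1.map (σ * ·)))
      (Finsupp.single w 1) : Simp n r i →₀ ℤ) = simplex n i (w.1.map (σ * ·)) from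
    (Finsupp.linearCombination_single ℤ _ _).trans (one_smul ℤ _)

theorem barrattEccles_comp_ofSimp {s t r : ℕ} {i j k : ℤ} (hr : r + 1 = s + t) (hk : i + j = k)
    (e : Fin s) (u : Simp n s i) (v : Simp n t j) :
    (barrattEccles n).comp hr hk e (ofSimp u) (ofSimp v) =
      ((shuffles u.toList v.toList).map fun p =>
        p.1 • ofSeq n k (p.2.map fun ab => permComp hr e ab.1 ab.2)).sum :=
  show (Finsupp.linearCombination ℤ (fun u : Simp n s i =>
      Finsupp.linearCombination ℤ fun v : Simp n t j =>
        ((shuffles u.1 v.1).map fun p =>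
          p.1 • simplex n k (p.2.map fun ab => permComp hr e ab.1 ab.2)).sum)
      (Finsupp.single u 1) (Finsupp.single v 1) : Simp n r k →₀ ℤ) =
      ((shuffles u.1 v.1).map fun p =>
          p.1 • simplex n k (p.2.map fun ab => permComp hr e ab.1 ab.2)).sum from
    (LinearMap.congr_fun ((Finsupp.linearCombination_single ℤ _ _).trans (one_smul ℤ _)) _).trans
      ((Finsupp.linearCombination_single ℤ _ _).trans (one_smul ℤ _))

/-- Since `toChain` is injective, this formula and the two that follow it reduce the operad laws to
identities between formal sums, intermediate normalizations being removed by the lemmas on `nrm`. -/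
theorem toChain_d {r : ℕ} {i j : ℤ} (h : j + 1 = i) (x : (barrattEccles n).X r i) :
    toChain ((barrattEccles n).d h x) = nrm (bd (toChain x)) := by
  induction x using barrattEccles_induction with
  | zero => simp only [map_zero]
  | add x y hx hy => simp only [map_add, hx, hy]
  | neg x hx => simp only [map_neg, hx]
  | single w =>
    rw [barrattEccles_d_ofSimp, toChain_ofSimp, bd_of_eq_sum, map_sum, map_sum]
    refine Finset.sum_congr rfl fun m hm => ?_
    rw [map_smul, map_smul,
      toChain_ofSeq (w.isSimplex.isDegenSimplex.eraseIdx h (Finset.mem_range.1 hm))]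

theorem toChain_act {r : ℕ} {i : ℤ} (σ : Perm (Fin r)) (x : (barrattEccles n).X r i) :
    toChain ((barrattEccles n).act σ x) = nrm (map (σ * ·) (toChain x)) := by
  induction x using barrattEccles_induction with
  | zero => simp only [map_zero]
  | add x y hx hy => simp only [map_add, hx, hy]
  | neg x hx => simp only [map_neg, hx]
  | single w =>
    rw [barrattEccles_act_ofSimp, toChain_ofSimp, map_of,
      toChain_ofSeq (w.isSimplex.isDegenSimplex.map σ)]

theorem toChain_comp {s t r : ℕ} {i j k : ℤ} (hr : r + 1 = s + t) (hk : i + j = k)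
    (e : Fin s) (x : (barrattEccles n).X s i) (y : (barrattEccles n).X t j) :
    toChain ((barrattEccles n).comp hr hk e x y) =
      nrm (map (fun ab => permComp hr e ab.1 ab.2) (sh (toChain x) (toChain y))) := by
  induction x using barrattEccles_induction with
  | zero => simp only [map_zero, LinearMap.zero_apply]
  | add x y hx hy => simp only [map_add, LinearMap.add_apply, hx, hy]
  | neg x hx => simp only [map_neg, LinearMap.neg_apply, hx]
  | single u =>
    induction y using barrattEccles_induction with
    | zero => simp only [map_zero]
    | add x y hx hy => simp only [map_add, hx, hy]
    | neg x hx => simp only [map_neg, hx]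
    | single v =>
      rw [barrattEccles_comp_ofSimp, toChain_ofSimp, toChain_ofSimp, sh_of, shList,
        map_list_sum, map_list_sum, map_list_sum, List.map_map, List.map_map, List.map_map]
      congr 1
      refine List.map_congr_left fun p hp => ?_
      simp only [Function.comp_apply, map_smul, map_of]
      rw [toChain_ofSeq (u.isSimplex.isDegenSimplex.comp hr hk e v.isSimplex.isDegenSimplex hp)]

theorem sh_toChain_comm {s t : ℕ} {j k : ℤ} (x : (barrattEccles n).X s j)
    (y : (barrattEccles n).X t k) :
    sh (toChain y) (toChain x) =
      ((j * k).negOnePow : ℤ) • map Prod.swap (sh (toChain x) (toChain y)) := by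
  induction x using barrattEccles_induction with
  | zero => simp only [map_zero, LinearMap.zero_apply, smul_zero]
  | add x y hx hy => simp only [map_add, LinearMap.add_apply, hx, hy, smul_add]
  | neg x hx => simp only [map_neg, LinearMap.neg_apply, hx, smul_neg]
  | single u =>
    induction y using barrattEccles_induction with
    | zero => simp only [map_zero, LinearMap.zero_apply, smul_zero]
    | add x y hx hy => simp only [map_add, LinearMap.add_apply, hx, hy, smul_add]
    | neg x hx => simp only [map_neg, LinearMap.neg_apply, hx, smul_neg]
    | single v =>
      have hu := u.isSimplex.length_eq
      have hv := v.isSimplex.length_eq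
      rw [toChain_ofSimp, toChain_ofSimp, sh_comm, smul_smul,
        neg_one_pow_eq_negOnePow (d := (k + 2) * (j + 2)) (by push_cast; rw [hu, hv]; ring),
        negOnePow_mul_negOnePow, Int.negOnePow_even _ ⟨j * k + k + j + 2, by ring⟩, Units.val_one,
        one_smul]

/-- Associativity brings the last two factors together, where graded commutativity applies. -/
theorem sh_right_comm {s t u : ℕ} {j k : ℤ} (X : ListChain (Perm (Fin s)))
    (x : (barrattEccles n).X t j) (y : (barrattEccles n).X u k) :
    sh (sh X (toChain y)) (toChain x) = ((j * k).negOnePow : ℤ) •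
      map (fun c => ((c.1.1, c.2), c.1.2)) (sh (sh X (toChain x)) (toChain y)) := by
  have h : ∀ {A B C : Type} (X : ListChain A) (Y : ListChain B) (Z : ListChain C),
      sh (sh X Y) Z = map (Equiv.prodAssoc A B C).symm (sh X (sh Y Z)) := fun X Y Z => by
    rw [← sh_assoc, map_map, Equiv.symm_comp_self, map_id]
  rw [h, h, sh_toChain_comm, map_smul, map_smul, map_map]
  conv_lhs => rw [← map_id X, sh_map_map, map_map]
  rfl

theorem toChain_one {i : ℤ} (hi : i = 0) : toChain ((barrattEccles n).one hi) = of [1] := by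
  refine (toChain_ofSeq ⟨Nat.one_pos, by simp [hi], fun a b hab =>
    absurd (Subsingleton.elim a b) hab⟩).trans (nrm_of (by simp) (List.isChain_singleton _))

theorem isSigma_barrattEccles (n : ℕ) : IsSigma (barrattEccles n).toSigmaData where
  d_d hij hjk x := toChain_injective (by
    rw [toChain_d, toChain_d, nrm_bd_nrm, bd_bd, map_zero, map_zero])
  act_one x := toChain_injective (by
    rw [toChain_act]
    simp only [one_mul]
    exact (congrArg nrm (map_id _)).trans (nrm_toChain _))
  act_mul σ τ x := toChain_injective (by
    rw [toChain_act, toChain_act, toChain_act, nrm_map_nrm, map_map]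
    simp only [mul_assoc]; rfl)
  d_act h σ x := toChain_injective (by
    rw [toChain_act, toChain_d, toChain_act, toChain_d, nrm_map_nrm, nrm_bd_nrm, bd_map])

theorem Simp.not_arity_zero {i : ℤ} : IsEmpty (Simp n 0 i) := ⟨fun w => by
  have := w.isSimplex.arity_pos
  omega⟩

theorem Simp.eq_of_arity_one {i : ℤ} (w : Simp n 1 i) : i = 0 ∧ w.toList = [1] := by
  obtain ⟨w, hw⟩ := w
  have h1 := hw.length_eq
  rcases w with _ | ⟨a, _ | ⟨b, w⟩⟩
  · exact absurd rfl hw.ne_nil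
  · exact ⟨by simpa using h1.symm, congrArg (fun c => [c]) (Subsingleton.elim a 1)⟩
  · exact absurd (Subsingleton.elim a b) (List.isChain_cons_cons.1 hw.nondegenerate).1

theorem isOperad_barrattEccles (n : ℕ) : IsOperad (barrattEccles n) where
  isSigma := isSigma_barrattEccles n
  arity_zero i := by
    have := Simp.not_arity_zero (n := n) (i := i)
    exact inferInstanceAs (Subsingleton (Simp n 0 i →₀ ℤ))
  arity_one i hi := by
    have : IsEmpty (Simp n 1 i) := ⟨fun w => hi w.eq_of_arity_one.1⟩
    exact inferInstanceAs (Subsingleton (Simp n 1 i →₀ ℤ))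
  arity_one_zero := by
    constructor
    · intro a b hab
      have := congrArg toChain hab
      simp only [map_smul, toChain_one] at this
      have := DFunLike.congr_fun this [1]
      simpa using this
    · intro x
      induction x using barrattEccles_induction with
      | zero => exact ⟨0, zero_smul _ _⟩
      | add x y hx hy =>
        obtain ⟨a, rfl⟩ := hx
        obtain ⟨b, rfl⟩ := hy
        exact ⟨a + b, add_smul _ _ _⟩
      | neg x hx =>
        obtain ⟨a, rfl⟩ := hx
        exact ⟨-a, neg_smul _ _⟩
      | single w =>
        refine ⟨1, toChain_injective ?_⟩
        simp only [one_smul, toChain_one]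
        rw [toChain_ofSimp, w.eq_of_arity_one.2]
  one_comp {r k} hr hk e q := toChain_injective (by
    rw [toChain_comp, toChain_one]
    induction q using barrattEccles_induction with
    | zero => simp only [map_zero]
    | add x y hx hy => simp only [map_add, hx, hy]
    | neg x hx => simp only [map_neg, hx]
    | single w =>
      rw [toChain_ofSimp, sh_singleton_left _ w.isSimplex.ne_nil, map_of, List.map_map]
      have : (fun ab : Perm (Fin 1) × Perm (Fin r) => permComp hr e ab.1 ab.2) ∘
          (fun b => (1, b)) = id := funext fun b => permComp_one_left hr e b
      rw [this, List.map_id, nrm_of w.isSimplex.ne_nil w.isSimplex.nondegenerate])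
  comp_one {r k} hr hk e q := toChain_injective (by
    rw [toChain_comp, toChain_one]
    induction q using barrattEccles_induction with
    | zero => simp only [map_zero, LinearMap.zero_apply]
    | add x y hx hy => simp only [map_add, LinearMap.add_apply, hx, hy]
    | neg x hx => simp only [map_neg, LinearMap.neg_apply, hx]
    | single w =>
      rw [toChain_ofSimp, sh_singleton_right w.isSimplex.ne_nil, map_of, List.map_map]
      have : (fun ab : Perm (Fin r) × Perm (Fin 1) => permComp hr e ab.1 ab.2) ∘
          (fun a => (a, 1)) = id := funext fun b => permComp_one_right hr e b
      rw [this, List.map_id, nrm_of w.isSimplex.ne_nil w.isSimplex.nondegenerate])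
  assoc_seq {s t u a b r i j k l m n'} ha hra hb hrb hl hln hm hmn e f g hg p q x :=
    toChain_injective (by
      rw [toChain_comp, toChain_comp, toChain_comp, toChain_comp, nrm_map_sh_nrm_left,
        nrm_map_sh_nrm_right]
      -- Naturality of the shuffles pulls the inner substitution outside, leaving a substitution of
      -- triples applied to a triple shuffle.
      conv_lhs => rw [← map_id (toChain x), sh_map_map, map_map]
      conv_rhs => rw [← map_id (toChain p), sh_map_map, map_map, ← sh_assoc, map_map]
      congr 3
      exact funext fun c => permComp_assoc_seq ha hra hb hrb e f g hg _ _ _)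
  assoc_par {s t u a b r i j k l m n'} ha hra hb hrb hl hln hm hmn e f g h hef hg hh p q x :=
    toChain_injective (by
      have hef' : e ≠ f := hef.ne
      have hg' : g = insFun ha e (Sum.inl ⟨f, hef'.symm⟩) := Fin.ext (by
        rw [insFun_inl_val]
        split_ifs <;> omega)
      have hh' : h = insFun hb f (Sum.inl ⟨e, hef'⟩) := Fin.ext (by
        rw [insFun_inl_val]
        split_ifs <;> omega)
      rw [Units.smul_def, map_smul, toChain_comp, toChain_comp, toChain_comp, toChain_comp,
        nrm_map_sh_nrm_left, nrm_map_sh_nrm_left]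
      conv_lhs => rw [← map_id (toChain x), sh_map_map, map_map]
      conv_rhs => rw [← map_id (toChain q), sh_map_map, map_map, sh_right_comm, map_smul, map_smul,
        smul_smul, negOnePow_mul_negOnePow, Int.negOnePow_even _ ⟨_, rfl⟩, Units.val_one, one_smul,
        map_map]
      congr 3
      exact funext fun c => permComp_assoc_par ha hra hb hrb e f g h hef' hg' hh' _ _ _)
  equivariance {s t r i j k} hr hk e σ τ p q := toChain_injective (by
    rw [toChain_comp, toChain_act, toChain_act, toChain_act, toChain_comp, nrm_map_sh_nrm_left,
      nrm_map_sh_nrm_right, nrm_map_nrm, sh_map_map, map_map, map_map]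
    congr 3
    exact funext fun c => permComp_mul hr e σ _ τ _)
  leibniz {s t r i i' j j' k k'} hr hk hi hj hk' h₁ h₂ e p q := toChain_injective (by
    -- The augmentation term of `bd_sh` is a multiple of the empty sequence, which `nrm` kills.
    have h0 : ∀ (X : ListChain (Perm (Fin s))) (Y : ListChain (Perm (Fin t))),
        nrm (map (fun ab => permComp hr e ab.1 ab.2) (nilCoeff X Y)) = 0 := fun X Y => by
      rw [nilCoeff, map_smul, map_smul, map_of, List.map_nil, nrm_nil, smul_zero]
    rw [map_add, Units.smul_def, map_smul, toChain_d, toChain_comp, toChain_comp, toChain_comp,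
      toChain_d, toChain_d, nrm_map_sh_nrm_left, nrm_map_sh_nrm_right, nrm_bd_nrm, bd_map,
      bd_sh, map_add, map_sub, map_add, map_sub, h0, add_zero, alt_toChain]
    simp only [map_neg, map_smul, LinearMap.neg_apply, LinearMap.smul_apply, sub_neg_eq_add,
      neg_smul])

end BarrattEccles

/-! ### The signature of a sequence of values -/

section SgnList

open Classical

variable {r : ℕ}

/-- The signature of a sequence of `r` elements of `Fin r`, zero if it is not a permutation. -/
def sgnList (l : List (Fin r)) : ℤ :=
  if hl : l.length = r then
    if hf : Function.Bijective fun m : Fin r => l.get (m.cast hl.symm) then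
      (Perm.sign (Equiv.ofBijective _ hf) : ℤ)
    else 0
  else 0

theorem sgnList_ofFn (σ : Perm (Fin r)) : sgnList (List.ofFn σ) = Perm.sign σ := by
  have hl : (List.ofFn σ).length = r := List.length_ofFn
  have hf : (fun m : Fin r => (List.ofFn σ).get (m.cast hl.symm)) = σ := by
    ext m
    simp
  rw [sgnList, dif_pos hl, dif_pos (by rw [hf]; exact σ.bijective)]
  congr 2
  ext m
  simp

theorem exists_ofFn_of_nodup {l : List (Fin r)} (hl : l.length = r) (h : l.Nodup) :
    ∃ σ : Perm (Fin r), l = List.ofFn σ := by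
  have hinj : Function.Injective fun m : Fin r => l.get (m.cast hl.symm) :=
    (List.nodup_iff_injective_get.1 h).comp (Fin.cast_injective _)
  refine ⟨Equiv.ofBijective _ (Finite.injective_iff_bijective.1 hinj), ?_⟩
  refine List.ext_get (by simp [hl]) fun m h₁ h₂ => ?_
  simp

theorem sgnList_eq_zero_of_length {l : List (Fin r)} (h : l.length ≠ r) : sgnList l = 0 :=
  dif_neg h

theorem sgnList_eq_zero_of_not_nodup {l : List (Fin r)} (h : ¬ l.Nodup) : sgnList l = 0 := by
  by_cases hl : l.length = r
  · rw [sgnList, dif_pos hl, dif_neg]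
    refine fun hf => h (List.nodup_iff_injective_get.2 fun a b hab => ?_)
    have := hf.1 (a₁ := a.cast hl) (a₂ := b.cast hl) (by simpa using hab)
    simpa using this
  · exact sgnList_eq_zero_of_length hl

theorem sgnList_cases (l : List (Fin r)) :
    sgnList l = 0 ∨ ∃ σ : Perm (Fin r), l = List.ofFn σ := by
  by_cases hl : l.length = r
  · by_cases h : l.Nodup
    · exact Or.inr (exists_ofFn_of_nodup hl h)
    · exact Or.inl (sgnList_eq_zero_of_not_nodup h)
  · exact Or.inl (sgnList_eq_zero_of_length hl)

theorem sgnList_map (σ : Perm (Fin r)) (l : List (Fin r)) :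
    sgnList (l.map σ) = Perm.sign σ * sgnList l := by
  rcases sgnList_cases l with h | ⟨τ, rfl⟩
  · rcases sgnList_cases (l.map σ) with h' | ⟨τ, h'⟩
    · rw [h, h', mul_zero]
    · have : l = List.ofFn (σ⁻¹ * τ) := by
        rw [Equiv.Perm.coe_mul, ← List.map_ofFn, ← h', List.map_map]
        have : (σ⁻¹ : Perm (Fin r)) ∘ σ = id := by ext x; simp
        rw [this, List.map_id]
      rw [h', sgnList_ofFn]
      rw [this, sgnList_ofFn]
      simp [← mul_assoc]
  · rw [List.map_ofFn, ← Equiv.Perm.coe_mul, sgnList_ofFn, sgnList_ofFn, Equiv.Perm.sign_mul,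
      Units.val_mul]

theorem countP_of_sgnList_ne_zero (p : Fin r → Prop) {l : List (Fin r)} (h : sgnList l ≠ 0) :
    l.countP p = Fintype.card {x // p x} := by
  obtain ⟨σ, rfl⟩ := (sgnList_cases l).resolve_left h
  have : (List.ofFn σ).Perm (List.finRange r) := by
    rw [List.ofFn_eq_map]
    exact (List.perm_ext_iff_of_nodup ((List.nodup_finRange r).map σ.injective)
      (List.nodup_finRange r)).2 fun a => by simp [σ.surjective a]
  rw [this.countP_eq, Fintype.card_subtype, List.countP_eq_length_filter]
  rfl

/-- The determinant has the right value in all cases, as a repeated value gives two equal rows; it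
makes Laplace expansion available. -/
theorem sgnList_ofFn_eq_det (y : Fin r → Fin r) :
    sgnList (List.ofFn y) = Matrix.det (Matrix.of fun i j => if y i = j then (1 : ℤ) else 0) := by
  by_cases hy : Function.Injective y
  · obtain ⟨σ, rfl⟩ : ∃ σ : Perm (Fin r), y = σ :=
      ⟨Equiv.ofBijective y (Finite.injective_iff_bijective.1 hy), rfl⟩
    rw [sgnList_ofFn]
    have := Matrix.det_permutation (R := ℤ) σ
    rw [Int.cast_id] at this
    rw [← this]
    congr 1
    ext i j
    simp [Equiv.Perm.permMatrix, PEquiv.toMatrix_apply, eq_comm]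
  · rw [sgnList_eq_zero_of_not_nodup (fun h => hy (List.nodup_ofFn.1 h))]
    simp only [Function.Injective, not_forall] at hy
    obtain ⟨a, b, hab, hne⟩ := hy
    refine (Matrix.det_zero_of_row_eq hne ?_).symm
    ext j
    simp [hab]

/-- The cocycle property of `sgn`. The sum is the Laplace expansion along a first column of ones of
a matrix whose other columns are the indicators of the values. Every row contains exactly one
indicator equal to one, so the first column is the sum of the others and the determinant vanishes.
-/
theorem sum_sgnList_succAbove (x : Fin (r + 1) → Fin r) :
    ∑ m : Fin (r + 1), (-1 : ℤ) ^ (m : ℕ) * sgnList (List.ofFn fun i => x (m.succAbove i)) = 0 := by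
  let M : Matrix (Fin (r + 1)) (Fin (r + 1)) ℤ := Matrix.of fun i j =>
    Fin.cases 1 (fun j => if x i = j then (1 : ℤ) else 0) j
  have hM : M.det = 0 := by
    refine Matrix.exists_mulVec_eq_zero_iff.1 ⟨Fin.cons (-1) fun _ => 1, fun h => ?_, ?_⟩
    · have := congrFun h 0
      simp at this
    · ext i
      simp [M, Matrix.mulVec, dotProduct, Fin.sum_univ_succ]
  rw [Matrix.det_succ_column_zero] at hM
  rw [← hM]
  refine Finset.sum_congr rfl fun m _ => ?_
  rw [sgnList_ofFn_eq_det]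
  simp only [M, Matrix.of_apply, Fin.cases_zero, mul_one]
  congr 2

theorem sum_sgnList_eraseIdx {l : List (Fin r)} (hl : l.length = r + 1) :
    ∑ m ∈ Finset.range (r + 1), (-1 : ℤ) ^ m * sgnList (l.eraseIdx m) = 0 := by
  have := sum_sgnList_succAbove fun m : Fin (r + 1) => l.get (m.cast hl.symm)
  rw [← this, Finset.sum_range]
  refine Finset.sum_congr rfl fun m _ => ?_
  congr 2
  refine List.ext_get (by rw [List.length_eraseIdx_of_lt (by omega), List.length_ofFn]; omega)
    fun i h₁ h₂ => ?_
  simp only [List.get_eq_getElem, List.getElem_eraseIdx, List.getElem_ofFn, Fin.succAbove,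
    Fin.lt_def]
  simp
  split_ifs <;> simp

end SgnList


/-! ### The cap product -/

section Cap

open Classical ListChain

variable {G H : Type} {r : ℕ}

/-- The cap product of a sequence with the signature of the values of `F`, the first of which are
prescribed and the next `k` of which are taken on the sequence. -/
def capList (F : G → Fin r) : ℕ → List (Fin r) → List G → ListChain G
  | _, _, [] => 0
  | 0, _, _ :: _ => 0
  | 1, pre, a :: w => sgnList (pre ++ [F a]) • of (a :: w)
  | k + 2, pre, a :: w => capList F (k + 1) (pre ++ [F a]) w

/-- The linear extension of `capList`. -/
def cap (F : G → Fin r) (k : ℕ) (pre : List (Fin r)) : ListChain G →ₗ[ℤ] ListChain G :=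
  Finsupp.linearCombination ℤ (capList F k pre)

variable (F : G → Fin r)

theorem cap_of (k : ℕ) (pre : List (Fin r)) (w : List G) :
    cap F k pre (of w) = capList F k pre w := by
  rw [cap, Finsupp.linearCombination_single, one_smul]

theorem cap_nil (k : ℕ) (pre : List (Fin r)) : cap F k pre (of []) = 0 := by
  rw [cap_of, capList]

theorem cap_nilCoeff {K : Type} (F : G × K → Fin r) (k : ℕ) (pre : List (Fin r)) (X : ListChain G)
    (Y : ListChain K) : cap F k pre (nilCoeff X Y) = 0 := by
  rw [nilCoeff, map_smul, cap_nil, smul_zero]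

theorem cap_one_cons (pre : List (Fin r)) (a : G) (X : ListChain G) :
    cap F 1 pre (cons a X) = sgnList (pre ++ [F a]) • cons a X := by
  induction X using induction with
  | zero => simp only [map_zero, smul_zero]
  | add X Y hX hY => simp only [map_add, hX, hY, smul_add]
  | neg X hX => simp only [map_neg, hX, smul_neg]
  | of w => rw [cons_of, cap_of, capList]

theorem cap_succ_cons (k : ℕ) (pre : List (Fin r)) (a : G) (X : ListChain G) :
    cap F (k + 2) pre (cons a X) = cap F (k + 1) (pre ++ [F a]) X := by
  induction X using induction with
  | zero => simp only [map_zero]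
  | add X Y hX hY => simp only [map_add, hX, hY]
  | neg X hX => simp only [map_neg, hX]
  | of w => rw [cons_of, cap_of, cap_of, capList]

/-- If no completion of the prefix in a class closed under the addition of values has a non-zero
signature, the cap product vanishes. -/
theorem cap_eq_zero_of {p : List (Fin r) → Prop} (hp : ∀ l a, p l → p (l ++ [F a]))
    (hs : ∀ l, p l → sgnList l = 0) (k : ℕ) {pre : List (Fin r)} (h : p pre) (X : ListChain G) :
    cap F k pre X = 0 := by
  induction X using induction with
  | zero => simp only [map_zero]
  | add X Y hX hY => simp only [map_add, hX, hY, add_zero]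
  | neg X hX => simp only [map_neg, hX, neg_zero]
  | of w =>
    rw [cap_of]
    induction w generalizing k pre with
    | nil => rw [capList]
    | cons a w ih =>
      rcases k with _ | _ | k
      · rw [capList]
      · rw [capList, hs _ (hp _ a h), zero_smul]
      · rw [capList, ih _ (hp _ a h)]

theorem cap_eq_zero_of_not_nodup (k : ℕ) {pre : List (Fin r)} (h : ¬ pre.Nodup)
    (X : ListChain G) : cap F k pre X = 0 :=
  cap_eq_zero_of F (p := fun l => ¬ l.Nodup) (fun _ _ h h' => h (List.nodup_append.1 h').1)
    (fun _ h => sgnList_eq_zero_of_not_nodup h) k h X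

theorem cap_eq_zero_of_lt_countP (q : Fin r → Prop) (k : ℕ) {pre : List (Fin r)}
    (h : Fintype.card {x // q x} < pre.countP q) (X : ListChain G) : cap F k pre X = 0 :=
  cap_eq_zero_of F (p := fun l => Fintype.card {x // q x} < l.countP q)
    (fun l a h => lt_of_lt_of_le h (by rw [List.countP_append]; exact Nat.le_add_right _ _))
    (fun l h => by
      by_contra h'
      exact h.ne' (countP_of_sgnList_ne_zero q h')) k h X

theorem cap_map (f : G → H) (F : H → Fin r) (k : ℕ) (pre : List (Fin r)) (X : ListChain G) :
    cap F k pre (map f X) = map f (cap (fun a => F (f a)) k pre X) := by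
  induction X using induction with
  | zero => simp only [map_zero]
  | add X Y hX hY => simp only [map_add, hX, hY]
  | neg X hX => simp only [map_neg, hX]
  | of w =>
    rw [map_of, cap_of, cap_of]
    induction w generalizing k pre with
    | nil => rw [List.map_nil, capList, capList, map_zero]
    | cons a w ih =>
      rcases k with _ | _ | k
      · rw [List.map_cons, capList, capList, map_zero]
      · rw [List.map_cons, capList, capList, map_smul, map_of, List.map_cons]
      · rw [List.map_cons, capList, capList, ih]

theorem cap_perm (σ : Perm (Fin r)) (k : ℕ) (pre : List (Fin r)) (X : ListChain G) :
    cap (fun a => σ (F a)) k (pre.map σ) X = (Perm.sign σ : ℤ) • cap F k pre X := by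
  induction X using induction with
  | zero => simp only [map_zero, smul_zero]
  | add X Y hX hY => simp only [map_add, hX, hY, smul_add]
  | neg X hX => simp only [map_neg, hX, smul_neg]
  | of w =>
    rw [cap_of, cap_of]
    induction w generalizing k pre with
    | nil => rw [capList, capList, smul_zero]
    | cons a w ih =>
      have h : pre.map σ ++ [σ (F a)] = (pre ++ [F a]).map σ := by simp
      rcases k with _ | _ | k
      · rw [capList, capList, smul_zero]
      · rw [capList, capList, h, sgnList_map, mul_smul]
      · rw [capList, capList, h, ih]

theorem capList_eq (k : ℕ) (pre : List (Fin r)) (w : List G) (hk : k + 1 + pre.length = r) :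
    capList F (k + 1) pre w =
      sgnList (pre ++ (w.take (k + 1)).map F) • of (w.drop k) := by
  induction w generalizing k pre with
  | nil =>
    rw [capList, sgnList_eq_zero_of_length (by simp; omega), zero_smul]
  | cons a w ih =>
    rcases k with _ | k
    · rw [capList]
      simp
    · rw [capList, ih k _ (by simp; omega)]
      simp

/-- A repetition among the evaluated terms repeats a value and kills the signature; any other
repetition survives in the remaining sequence, which is then degenerate. -/
theorem nrm_cap_of_not (k : ℕ) (pre : List (Fin r)) {w : List G} (h : ¬ w.IsChain (· ≠ ·)) :
    nrm (cap F k pre (of w)) = 0 := by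
  induction w generalizing k pre with
  | nil => rw [cap_nil, map_zero]
  | cons a w ih =>
    rcases k with _ | _ | k
    · rw [cap_of, capList, map_zero]
    · rw [cap_of, capList, map_smul, nrm_of_not h, smul_zero]
    · rw [← cons_of, cap_succ_cons]
      rcases not_isChain_cons h with ⟨w, rfl⟩ | h
      · have hd : ¬ (pre ++ [F a] ++ [F a]).Nodup := fun h => by
          simp [List.nodup_append] at h
        rcases k with _ | k
        · rw [← cons_of, cap_one_cons, sgnList_eq_zero_of_not_nodup hd, zero_smul, map_zero]
        · rw [← cons_of, cap_succ_cons, cap_eq_zero_of_not_nodup F _ hd, map_zero]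
      · exact ih _ _ h

theorem nrm_cap_nrm (k : ℕ) (pre : List (Fin r)) (X : ListChain G) :
    nrm (cap F k pre (nrm X)) = nrm (cap F k pre X) := by
  induction X using induction with
  | zero => simp only [map_zero]
  | add X Y hX hY => simp only [map_add, hX, hY]
  | neg X hX => simp only [map_neg, hX]
  | of w =>
    rcases nrm_of_cases w with ⟨rfl, h⟩ | ⟨hw, h⟩ | h
    · rw [h, cap_nil, map_zero]
    · rw [h, nrm_cap_of_not F k pre hw, map_zero, map_zero]
    · rw [h]

/-- The prefix makes an induction on the sequence possible: the sum over `m` stands for the faces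
that omit a term already evaluated, one more term being evaluated instead. When one value remains to
be read, the identity is the cocycle property of the signature. -/
theorem nrm_cap_bd_of (k : ℕ) (pre : List (Fin r)) (hk : k + 1 + pre.length = r) (w : List G) :
    ∑ m ∈ Finset.range pre.length, (-1 : ℤ) ^ m • nrm (cap F (k + 2) (pre.eraseIdx m) (of w)) +
      (-1 : ℤ) ^ pre.length • nrm (cap F (k + 1) pre (bd (of w))) =
      (-1 : ℤ) ^ (pre.length + k) • nrm (bd (cap F (k + 1) pre (of w))) := by
  induction w generalizing k pre with
  | nil => simp only [cap_nil, bd_nil, map_zero, smul_zero, Finset.sum_const_zero, add_zero]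
  | cons a w ih =>
    have he : ∀ m ∈ Finset.range pre.length,
        (pre ++ [F a]).eraseIdx m = pre.eraseIdx m ++ [F a] := fun m hm =>
      List.eraseIdx_append_of_lt_length (Finset.mem_range.1 hm) _
    rcases k with _ | k
    · rcases w with _ | ⟨c, w⟩
      · have h1 : bd (of [a]) = of [] := by
          rw [bd_of, bdList, bdList, map_zero, sub_zero]
        simp only [h1, cap_nil, map_zero, smul_zero, add_zero]
        rw [← cons_of, cap_one_cons, cons_of, map_smul, h1, map_smul, nrm_nil, smul_zero, smul_zero]
        refine Finset.sum_eq_zero fun m _ => ?_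
        rw [← cons_of, zero_add, cap_succ_cons, cap_nil, map_zero, smul_zero]
      -- The cocycle identity for the prefix followed by `F a` and `F c`; its last two summands are
      -- the two faces at the cut.
      · have hs := sum_sgnList_eraseIdx (l := pre ++ [F a, F c]) (r := r) (by simp; omega)
        obtain ⟨q, rfl⟩ : ∃ q, r = q + 1 := ⟨pre.length, by omega⟩
        have hq : pre.length = q := by omega
        rw [Finset.sum_range_succ, Finset.sum_range_succ] at hs
        have h1 : (pre ++ [F a, F c]).eraseIdx q = pre ++ [F c] := by
          rw [List.eraseIdx_append_of_length_le (by omega), hq]; simp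
        have h2 : (pre ++ [F a, F c]).eraseIdx (q + 1) = pre ++ [F a] := by
          rw [List.eraseIdx_append_of_length_le (by omega), hq]; simp
        rw [h1, h2] at hs
        have h3 : ∀ m ∈ Finset.range pre.length,
            (-1 : ℤ) ^ m • nrm (cap F (0 + 2) (pre.eraseIdx m) (of (a :: c :: w))) =
              ((-1 : ℤ) ^ m * sgnList ((pre ++ [F a, F c]).eraseIdx m)) • nrm (of (c :: w)) := by
          intro m hm
          rw [← cons_of a, cap_succ_cons, ← cons_of c, zero_add, cap_one_cons, map_smul, smul_smul,
            List.append_assoc, List.eraseIdx_append_of_lt_length (Finset.mem_range.1 hm)]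
          rfl
        rw [Finset.sum_congr rfl h3, ← Finset.sum_smul, hq, ← cons_of a, bd_cons, map_sub,
          zero_add, cap_one_cons, cap_one_cons, map_smul bd, bd_cons, map_sub, map_smul, map_smul,
          map_sub, ← cons_of c, cap_one_cons, map_smul]
        rw [add_assoc, ← eq_neg_iff_add_eq_zero] at hs
        rw [hs, add_zero]
        module
    · have ih' := ih k (pre ++ [F a]) (by simp; omega)
      have h1 : (pre ++ [F a]).eraseIdx pre.length = pre := by
        rw [List.eraseIdx_append_of_length_le le_rfl]; simp
      have h3 : ∀ m ∈ Finset.range pre.length,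
          (-1 : ℤ) ^ m • nrm (cap F (k + 1 + 2) (pre.eraseIdx m) (of (a :: w))) =
            (-1 : ℤ) ^ m • nrm (cap F (k + 2) ((pre ++ [F a]).eraseIdx m) (of w)) := by
        intro m hm
        rw [← cons_of a, cap_succ_cons, he m hm]
      rw [List.length_append, List.length_singleton, Finset.sum_range_succ, h1] at ih'
      rw [Finset.sum_congr rfl h3, ← cons_of a, cap_succ_cons, bd_cons, map_sub, cap_succ_cons,
        map_sub, show pre.length + (k + 1) = pre.length + 1 + k by omega, ← ih', smul_sub, pow_succ]
      module

/-- The cap product is compatible with the boundaries. -/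
theorem nrm_cap_bd (k : ℕ) (hk : k + 1 = r) (X : ListChain G) :
    nrm (cap F r [] (bd X)) = (-1 : ℤ) ^ k • nrm (bd (cap F r [] X)) := by
  induction X using induction with
  | zero => simp only [map_zero, smul_zero]
  | add X Y hX hY => simp only [map_add, hX, hY, smul_add]
  | neg X hX => simp only [map_neg, hX, smul_neg]
  | of w =>
    subst hk
    have := nrm_cap_bd_of F k [] rfl w
    simpa using this

/-- The cap product along a sequence of pairs whose second term is constant. -/
theorem cap_sh_left (F : G × H → Fin r) (b : H) (y : List H) (k : ℕ) (pre : List (Fin r))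
    (h : ∀ a, (∀ b', F (a, b') = F (a, b)) ∨ F (a, b) ∈ pre) (x : List G) :
    cap F k pre (sh (of x) (of (b :: y))) =
      sh (cap (fun a => F (a, b)) k pre (of x)) (of (b :: y)) := by
  induction x generalizing k pre with
  | nil => rw [sh_nil_left, cap_nil, map_zero, map_zero, LinearMap.zero_apply]
  | cons a x ih =>
    rcases k with _ | _ | k
    · have h0 : ∀ {K : Type} (F : K → Fin r) X, cap F 0 pre X = 0 := fun F X => by
        induction X using induction with
        | zero => simp only [map_zero]
        | add X Y hX hY => simp only [map_add, hX, hY, add_zero]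
        | neg X hX => simp only [map_neg, hX, neg_zero]
        | of w => cases w <;> rw [cap_of, capList]
      rw [h0, h0, map_zero, LinearMap.zero_apply]
    · rw [← cons_of, ← cons_of, sh_cons_cons, zero_add, cap_one_cons, cap_one_cons, map_smul,
        LinearMap.smul_apply, ← sh_cons_cons]
    -- A move in the second direction contributes nothing: either the value at `a` does not depend
    -- on the second coordinate and is repeated, or it already occurs in the prefix.
    · have h1 : cap F (k + 1) (pre ++ [F (a, b)]) (sh (cons a (alt (of x))) (of y)) = 0 := by
        rcases h a with h | h
        · rw [alt_of, map_smul, cons_of, map_smul, LinearMap.smul_apply, map_smul]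
          rcases y with _ | ⟨b', y⟩
          · rw [sh_nil_right, map_zero, smul_zero]
          · have hd : ¬ (pre ++ [F (a, b)] ++ [F (a, b')]).Nodup := fun h' => by
              rw [h b'] at h'
              simp [List.nodup_append] at h'
            rw [← cons_of, ← cons_of, sh_cons_cons]
            rcases k with _ | k
            · rw [cap_one_cons, sgnList_eq_zero_of_not_nodup hd, zero_smul, smul_zero]
            · rw [cap_succ_cons, cap_eq_zero_of_not_nodup F _ hd, smul_zero]
        · refine cap_eq_zero_of_not_nodup F _ (fun h' => ?_) _
          simp only [List.nodup_append, List.mem_singleton, forall_eq] at h'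
          exact h'.2.2 _ h rfl
      rw [← cons_of a, cap_succ_cons, ← cons_of b, sh_cons_cons, cap_succ_cons, map_add, map_add,
        cap_nilCoeff, h1, zero_add, add_zero, cons_of b, ih]
      intro a'
      refine (h a').imp_right fun h => List.mem_append_left _ h

/-- No new value with the property `q` can appear, and those present are not the expected number, so
no completion is a permutation. -/
theorem cap_eq_zero_of_countP_ne (q : Fin r → Prop) (k : ℕ) {pre : List (Fin r)}
    (hF : ∀ a, ¬ q (F a) ∨ F a ∈ pre) (h : pre.countP q ≠ Fintype.card {x // q x})
    (X : ListChain G) : cap F k pre X = 0 := by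
  refine cap_eq_zero_of F (p := fun l => (∀ a, ¬ q (F a) ∨ F a ∈ l) ∧
    (¬ l.Nodup ∨ l.countP q ≠ Fintype.card {x // q x})) (fun l a hl => ⟨fun a' => ?_, ?_⟩)
    (fun l hl => ?_) k ⟨hF, Or.inr h⟩ X
  · exact (hl.1 a').imp_right fun h => List.mem_append_left _ h
  · rcases hl.2 with h | h
    · exact Or.inl fun h' => h (List.nodup_append.1 h').1
    · rcases hl.1 a with h' | h'
      · right
        rwa [List.countP_append, List.countP_singleton, if_neg (by simpa using h'), add_zero]
      · left
        intro h''
        simp only [List.nodup_append, List.mem_singleton, forall_eq] at h''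
        exact h''.2.2 _ h' rfl
  · rcases hl.2 with h | h
    · exact sgnList_eq_zero_of_not_nodup h
    · by_contra h'
      exact h (countP_of_sgnList_ne_zero q h')

theorem cap_cons_eq_zero (k : ℕ) {pre : List (Fin r)} {a : G} (h : sgnList (pre ++ [F a]) = 0)
    (h' : ∀ k X, cap F k (pre ++ [F a]) X = 0) (X : ListChain G) :
    cap F (k + 1) pre (cons a X) = 0 := by
  rcases k with _ | k
  · rw [cap_one_cons, h, zero_smul]
  · rw [cap_succ_cons, h']

theorem cap_cons_eq_zero_of_not_nodup (k : ℕ) {pre : List (Fin r)} {a : G}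
    (h : ¬ (pre ++ [F a]).Nodup) (X : ListChain G) : cap F (k + 1) pre (cons a X) = 0 :=
  cap_cons_eq_zero F k (sgnList_eq_zero_of_not_nodup h)
    (fun k X => cap_eq_zero_of_not_nodup F k h X) X

theorem cap_cons_eq_zero_of_lt_countP (q : Fin r → Prop) (k : ℕ) {pre : List (Fin r)} {a : G}
    (h : Fintype.card {x // q x} < (pre ++ [F a]).countP q) (X : ListChain G) :
    cap F (k + 1) pre (cons a X) = 0 :=
  cap_cons_eq_zero F k (by
    by_contra h'
    exact h.ne' (countP_of_sgnList_ne_zero q h'))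
    (fun k X => cap_eq_zero_of_lt_countP F q k h X) X

theorem cap_zero (pre : List (Fin r)) (X : ListChain G) : cap F 0 pre X = 0 := by
  induction X using induction with
  | zero => simp only [map_zero]
  | add X Y hX hY => simp only [map_add, hX, hY, add_zero]
  | neg X hX => simp only [map_neg, hX, neg_zero]
  | of w => cases w <;> rw [cap_of, capList]

end Cap

/-! ### The cap product of a composite -/

section CapComp

open Classical ListChain

variable {G H : Type} {s t r : ℕ} (hr : r + 1 = s + t) (e : Fin s)

/-- The first value of a composite. -/
def insVal (x : Fin s) (y : Fin t) : Fin r :=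
  if h : x = e then insFun hr e (Sum.inr y) else insFun hr e (Sum.inl ⟨x, h⟩)

theorem insVal_of_ne {x : Fin s} (h : x ≠ e) (y : Fin t) :
    insVal hr e x y = insFun hr e (Sum.inl ⟨x, h⟩) := dif_neg h

theorem insVal_self (y : Fin t) : insVal hr e e y = insFun hr e (Sum.inr y) := dif_pos rfl

theorem insVal_inj {x x' : Fin s} {y y' : Fin t} (h : insVal hr e x y = insVal hr e x' y') :
    x = x' ∧ (x = e → y = y') := by
  by_cases hx : x = e <;> by_cases hx' : x' = e
  · subst hx hx'
    rw [insVal_self, insVal_self] at h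
    exact ⟨rfl, fun _ => Sum.inr_injective (insFun_injective hr _ h)⟩
  · subst hx
    rw [insVal_self, insVal_of_ne hr _ hx'] at h
    exact absurd (insFun_injective hr _ h) (by simp)
  · subst hx'
    rw [insVal_self, insVal_of_ne hr _ hx] at h
    exact absurd (insFun_injective hr _ h) (by simp)
  · rw [insVal_of_ne hr _ hx, insVal_of_ne hr _ hx'] at h
    have := insFun_injective hr _ h
    simp only [Sum.inl.injEq, Subtype.mk.injEq] at this
    exact ⟨this, fun h => absurd h hx⟩

/-- The inputs of a composite which come from the second factor. -/
def IsInr (z : Fin r) : Prop := ∃ j, z = insFun hr e (Sum.inr j)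

theorem isInr_insVal (x : Fin s) (y : Fin t) : IsInr hr e (insVal hr e x y) ↔ x = e := by
  constructor
  · rintro ⟨j, hj⟩
    rw [← insVal_self] at hj
    exact (insVal_inj hr e hj).1
  · rintro rfl
    exact ⟨y, insVal_self hr x y⟩

theorem card_isInr : Fintype.card {z // IsInr hr e z} = t := by
  have : Function.Bijective (fun j : Fin t => (⟨insFun hr e (Sum.inr j), j, rfl⟩ :
      {z // IsInr hr e z})) := by
    refine ⟨fun a b hab => ?_, ?_⟩
    · exact Sum.inr_injective (insFun_injective hr e (Subtype.ext_iff.1 hab))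
    · rintro ⟨_, j, rfl⟩
      exact ⟨j, rfl⟩
  rw [← Fintype.card_of_bijective this, Fintype.card_fin]

theorem permComp_apply_zero (hs : 0 < s) (ht : 0 < t) (h0 : 0 < r) (u : Perm (Fin s))
    (v : Perm (Fin t)) :
    permComp hr e u v ⟨0, h0⟩ = insVal hr e (u ⟨0, hs⟩) (v ⟨0, ht⟩) := by
  rw [← Equiv.eq_symm_apply, insVal]
  split_ifs with h
  · rw [permComp_symm_inr]
    ext
    rw [insFun_inr_val, ← h]
    simp
  · rw [permComp_symm_inl]
    have h1 : u.symm e ≠ ⟨0, hs⟩ := fun h' => h (by rw [← h']; simp)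
    have h2 := Fin.val_ne_iff.2 h1
    ext
    rw [insFun_inl_val, if_pos] <;> simp only [Equiv.symm_apply_apply]
    exact Nat.pos_of_ne_zero h2

variable (f : G → Fin s) (g : H → Fin t)

/-- A path that leaves the column over `a`, where `f a = e`, before all the values of the second
factor are listed contributes nothing: any later move in the second direction repeats a value, so
the missing ones never appear. The first `l` moves are thus vertical, and each crosses the
`x.length` remaining horizontal moves. -/
theorem cap_sh_vertical (a : G) (ha : f a = e) (x : List G) (l k : ℕ) (pre : List (Fin r))
    (y : List H) (hc : pre.countP (IsInr hr e) + l + 1 = t) (hk : l + 1 ≤ k) :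
    cap (fun c : G × H => insVal hr e (f c.1) (g c.2)) k pre (sh (of (a :: x)) (of y)) =
      (-1 : ℤ) ^ (x.length * l) • cap (fun c : G × H => insVal hr e (f c.1) (g c.2)) (k - l)
        (pre ++ (y.take l).map fun b => insVal hr e e (g b)) (sh (of (a :: x)) (of (y.drop l))) := by
  induction l generalizing k pre y with
  | zero => simp
  | succ l ih =>
    rcases y with _ | ⟨b, y⟩
    · rw [List.drop_nil, sh_nil_right, map_zero, map_zero, smul_zero]
    obtain ⟨k, rfl⟩ : ∃ k', k = k' + 2 := ⟨k - 2, by omega⟩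
    have hcount : (pre ++ [insVal hr e (f a) (g b)]).countP (IsInr hr e) =
        pre.countP (IsInr hr e) + 1 := by
      rw [List.countP_append, List.countP_singleton, if_pos]
      exact decide_eq_true ((isInr_insVal hr e _ _).2 ha)
    have hmem : ∀ a', f a' = e →
        insVal hr e (f a') (g b) ∈ pre ++ [insVal hr e (f a) (g b)] := fun a' h => by
      rw [h, ha]; simp
    have h1 : cap (fun c : G × H => insVal hr e (f c.1) (g c.2)) (k + 1)
        (pre ++ [insVal hr e (f a) (g b)]) (sh (of x) (of (b :: y))) = 0 := by
      rw [cap_sh_left, cap_eq_zero_of_countP_ne _ (IsInr hr e), map_zero, LinearMap.zero_apply]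
      · intro a'
        by_cases h : f a' = e
        · exact Or.inr (hmem a' h)
        · exact Or.inl (mt (isInr_insVal hr e _ _).1 h)
      · rw [hcount, card_isInr]
        omega
      · intro a'
        by_cases h : f a' = e
        · exact Or.inr (hmem a' h)
        · exact Or.inl fun b' => by simp only [insVal_of_ne hr e h]
    rw [← cons_of, ← cons_of b, sh_cons_cons, cap_succ_cons, map_add, map_add, cap_nilCoeff,
      cons_of b, h1, zero_add, zero_add, alt_of, map_smul, cons_of, map_smul, LinearMap.smul_apply,
      map_smul, ih (k + 1) _ y (by rw [hcount]; omega) (by omega), smul_smul, ← pow_add]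
    rw [show k + 2 - (l + 1) = k + 1 - l by omega, List.take_succ_cons, List.drop_succ_cons,
      List.map_cons, List.append_assoc, List.singleton_append, ha, mul_add_one, add_comm]

/-- The only value of the second factor still missing is supplied by `b`. One more vertical move
over `a` would list too many of them, and vertical moves elsewhere repeat values, so the rest of the
evaluation is horizontal. -/
theorem cap_sh_last (a : G) (ha : f a = e) (x : List G) (k : ℕ) (pre : List (Fin r))
    (b : H) (y : List H) (hc : pre.countP (IsInr hr e) + 1 = t) :
    cap (fun c : G × H => insVal hr e (f c.1) (g c.2)) k pre (sh (of (a :: x)) (of (b :: y))) =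
      sh (cap (fun a : G => insVal hr e (f a) (g b)) k pre (of (a :: x))) (of (b :: y)) := by
  rcases k with _ | _ | k
  · rw [cap_zero, cap_zero, map_zero, LinearMap.zero_apply]
  · rw [← cons_of, ← cons_of, sh_cons_cons, zero_add, cap_one_cons, cap_one_cons, map_smul,
      LinearMap.smul_apply, ← sh_cons_cons]
  · have hcount : (pre ++ [insVal hr e (f a) (g b)]).countP (IsInr hr e) = t := by
      rw [List.countP_append, List.countP_singleton, if_pos, hc]
      exact decide_eq_true ((isInr_insVal hr e _ _).2 ha)
    have h1 : cap (fun c : G × H => insVal hr e (f c.1) (g c.2)) (k + 1)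
        (pre ++ [insVal hr e (f a) (g b)]) (sh (cons a (alt (of x))) (of y)) = 0 := by
      rcases y with _ | ⟨b', y⟩
      · rw [sh_nil_right, map_zero]
      · rw [← cons_of, sh_cons_cons]
        refine cap_cons_eq_zero_of_lt_countP _ (IsInr hr e) _ ?_ _
        rw [List.countP_append, hcount, card_isInr, List.countP_singleton, if_pos]
        · omega
        · exact decide_eq_true ((isInr_insVal hr e _ _).2 ha)
    rw [← cons_of a, ← cons_of b, sh_cons_cons, cap_succ_cons, cap_succ_cons, map_add, map_add,
      cap_nilCoeff, h1, zero_add, add_zero, cons_of b, cap_sh_left]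
    intro a'
    by_cases h : f a' = e
    · right
      rw [h, ha]
      simp
    · exact Or.inl fun b' => by simp only [insVal_of_ne hr e h]

end CapComp

/-! ### Signs, and multiplicativity of the cap product on shuffles. -/

section CapComp

open Classical ListChain

variable {G H : Type} {s t r : ℕ} (hr : r + 1 = s + t) (e : Fin s)

/-- Identifies the first values read along the surviving path: the values of the second factor form
a block, inserted where `e` occurs among the values of the first. -/
theorem append_eq_ofFn_blockPerm (σ : Perm (Fin s)) (τ : Perm (Fin t)) (L₁ L₂ : List (Fin s))
    (hσ : L₁ ++ e :: L₂ = List.ofFn σ) (y₀ : Fin t) (p : Fin s) (hp : (p : ℕ) = L₁.length) :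
    L₁.map (insVal hr e · y₀) ++ (List.ofFn τ).map (insVal hr e e) ++ L₂.map (insVal hr e · y₀) =
      List.ofFn (blockPerm hr p σ τ) := by
  have hlen : L₁.length + (L₂.length + 1) = s := by
    have := congrArg List.length hσ
    simpa using this
  have hget : ∀ (c : ℕ) (hc : c < s), σ ⟨c, hc⟩ = (L₁ ++ e :: L₂)[c]'(by simp; omega) := by
    intro c hc
    simp [hσ]
  have hpe : σ p = e := by
    have hp' : p = ⟨L₁.length, by omega⟩ := Fin.ext hp
    rw [hp', hget]
    simp
  refine List.ext_getElem (by simp; omega) fun i h₁ h₂ => ?_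
  have hi : i < r := by simpa using h₂
  rw [List.getElem_ofFn]
  obtain ⟨c, hc, h⟩ | ⟨j, h⟩ := insFun_cases hr p ⟨i, hi⟩
  · rw [h, blockPerm_inl]
    have hne : σ c ≠ e := fun h' => hc (σ.injective (h'.trans hpe.symm))
    have h3 := congrArg Fin.val h
    rw [insFun_inl_val] at h3
    have h4 := Fin.val_ne_iff.2 hc
    have h5 : insFun hr (σ p) (Sum.inl ⟨σ c, σ.injective.ne hc⟩) = insVal hr e (σ c) y₀ := by
      rw [insVal_of_ne hr e hne]
      exact insFun_inl_congr hr hpe _ _ _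
    rw [h5, hget c c.2]
    simp only [List.getElem_append, List.length_map, List.length_append, List.length_ofFn,
      List.getElem_map]
    simp only at h3
    split_ifs at h3 with h6
    · rw [dif_pos (by omega), dif_pos (by omega), dif_pos (by omega)]
      congr 2
    · rw [dif_neg (by omega), dif_neg (by omega)]
      congr 1
      obtain ⟨m, hm⟩ : ∃ m, (c : ℕ) - L₁.length = m + 1 := ⟨c - L₁.length - 1, by omega⟩
      simp only [hm, List.getElem_cons_succ]
      congr 1
      have := c.2
      omega
  · rw [h, blockPerm_inr]
    have h3 := congrArg Fin.val h
    rw [insFun_inr_val] at h3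
    simp only at h3
    have h5 : insFun hr (σ p) (Sum.inr (τ j)) = insVal hr e e (τ j) := by
      rw [insVal_self]
      exact insFun_inr_congr hr hpe _
    have := j.2
    rw [h5]
    simp only [List.getElem_append, List.length_map, List.length_append, List.length_ofFn,
      List.getElem_map, List.getElem_ofFn]
    rw [dif_pos (by omega), dif_neg (by omega)]
    congr 2
    ext
    simp only
    omega

/-- For permutations this is `sign_blockPerm`, the block going from place `L₁.length` to place `e`.
Otherwise a repetition in one of the two lists on the right produces one on the left; the assumption
`y₀ ∈ L` serves to detect another occurrence of `e` in `L₁` or `L₂`. -/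
theorem sgnList_append (T : ℕ) (hT : T + 1 = t) (L₁ L₂ : List (Fin s)) (L : List (Fin t))
    (hL : L.length = t) (y₀ : Fin t) (hy₀ : y₀ ∈ L) :
    sgnList (L₁.map (insVal hr e · y₀) ++ L.map (insVal hr e e) ++ L₂.map (insVal hr e · y₀)) =
      (-1) ^ (T * (L₁.length + e)) * (sgnList (L₁ ++ e :: L₂) * sgnList L) := by
  by_cases hlen : L₁.length + (L₂.length + 1) = s
  swap
  · rw [sgnList_eq_zero_of_length (by simp; omega),
      sgnList_eq_zero_of_length (l := L₁ ++ e :: L₂) (by simp; omega), zero_mul, mul_zero]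
  by_cases hnd : (L₁ ++ e :: L₂).Nodup ∧ L.Nodup
  · obtain ⟨σ, hσ⟩ := exists_ofFn_of_nodup (by simpa using hlen) hnd.1
    obtain ⟨τ, rfl⟩ := exists_ofFn_of_nodup hL hnd.2
    have hps : L₁.length < s := by omega
    have hpe : σ ⟨L₁.length, hps⟩ = e := by
      have : σ ⟨L₁.length, hps⟩ = (L₁ ++ e :: L₂)[L₁.length]'(by simp) := by simp [hσ]
      rw [this]; simp
    rw [append_eq_ofFn_blockPerm hr e σ τ L₁ L₂ hσ y₀ ⟨L₁.length, hps⟩ rfl, hσ, sgnList_ofFn,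
      sgnList_ofFn, sgnList_ofFn, sign_blockPerm, hpe, Units.val_mul, Units.val_mul, mul_comm,
      neg_one_pow_eq_negOnePow (d := ((t : ℤ) - 1) * (L₁.length + (e : ℕ)))]
    subst hT
    push_cast
    ring
  · have h1 : ¬ (L₁.map (insVal hr e · y₀) ++ L.map (insVal hr e e) ++
        L₂.map (insVal hr e · y₀)).Nodup := by
      intro h
      rw [List.nodup_append, List.nodup_append] at h
      obtain ⟨⟨h1, h2, h3⟩, h4, h5⟩ := h
      have hφ : Function.Injective (insVal hr e · y₀) := fun a b h => (insVal_inj hr e h).1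
      have hy : insVal hr e e y₀ ∈ L.map (insVal hr e e) := List.mem_map.2 ⟨_, hy₀, rfl⟩
      refine hnd ⟨?_, h2.of_map⟩
      rw [List.nodup_append, List.nodup_cons]
      refine ⟨h1.of_map, ⟨fun h => ?_, h4.of_map⟩, fun a ha b hb hab => ?_⟩
      · exact h5 _ (List.mem_append_right _ hy) _ (List.mem_map.2 ⟨e, h, rfl⟩) rfl
      · subst hab
        rcases List.mem_cons.1 hb with rfl | hb
        · exact h3 _ (List.mem_map.2 ⟨_, ha, rfl⟩) _ hy rfl
        · exact h5 _ (List.mem_append_left _ (List.mem_map.2 ⟨_, ha, rfl⟩)) _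
            (List.mem_map.2 ⟨_, hb, rfl⟩) rfl
    rw [sgnList_eq_zero_of_not_nodup h1]
    rcases not_and_or.1 hnd with h | h
    · rw [sgnList_eq_zero_of_not_nodup h, zero_mul, mul_zero]
    · rw [sgnList_eq_zero_of_not_nodup h, mul_zero, mul_zero]

variable (f : G → Fin s) (g : H → Fin t)

/-- The case where the first factor is about to take the value `e`. The first `T = t - 1` values of
the second factor are consumed vertically, the last one is read with the final vertical position,
and the remaining moves evaluate the first factor. The sign combines `x.length * T` from the
crossings with that of `sgnList_append`. -/
theorem cap_sh_block (T : ℕ) (hT : T + 1 = t) (a : G) (ha : f a = e) (x : List G) (m : ℕ)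
    (L : List (Fin s)) (hL : L.length + m + 1 = s) (heL : e ∉ L) (y₀ : Fin t) (y : List H) :
    cap (fun c : G × H => insVal hr e (f c.1) (g c.2)) (m + 1 + T) (L.map (insVal hr e · y₀))
      (sh (of (a :: x)) (of y)) =
      (-1 : ℤ) ^ (T * (L.length + x.length + e)) •
        sh (cap f (m + 1) L (of (a :: x))) (cap g t [] (of y)) := by
  have hc : (L.map (insVal hr e · y₀)).countP (IsInr hr e) = 0 := by
    rw [List.countP_eq_zero]
    intro z hz
    obtain ⟨x, hx, rfl⟩ := List.mem_map.1 hz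
    simp only [isInr_insVal, decide_eq_true_eq]
    rintro rfl
    exact heL hx
  rw [cap_sh_vertical hr e f g a ha x T _ _ y (by rw [hc]; omega) (by omega), Nat.add_sub_cancel]
  rcases hy : y.drop T with _ | ⟨b, y'⟩
  · have : y.length ≤ T := List.drop_eq_nil_iff.1 hy
    subst hT
    rw [cap_of g, capList_eq g T [] y (by simp), sgnList_eq_zero_of_length (by simp; omega), zero_smul, sh_nil_right,
      map_zero, map_zero, smul_zero, smul_zero]
  · have hyl : T < y.length := by
      by_contra h
      rw [List.drop_eq_nil_iff.2 (by omega)] at hy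
      simp at hy
    have hb : y[T] = b := by
      have := List.getElem_drop (xs := y) (i := T) (j := 0) (h := by rw [hy]; simp)
      simp only [hy, List.getElem_cons_zero, add_zero] at this
      exact this.symm
    have htake : y.take (T + 1) = y.take T ++ [b] := by rw [List.take_succ_eq_append_getElem hyl, hb]
    rw [cap_sh_last hr e f g a ha]
    swap
    · rw [List.countP_append, hc, zero_add, List.countP_eq_length.2, List.length_map,
        List.length_take]
      · omega
      · intro z hz
        obtain ⟨x, hx, rfl⟩ := List.mem_map.1 hz
        exact decide_eq_true ((isInr_insVal hr e _ _).2 rfl)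
    rw [cap_of, cap_of, cap_of, capList_eq _ _ _ _ (by simp; omega), capList_eq _ _ _ _ (by omega)]
    subst hT
    rw [capList_eq _ _ _ _ (by simp), hy, map_smul, map_smul, map_smul, LinearMap.smul_apply,
      LinearMap.smul_apply, smul_smul, smul_smul, smul_smul]
    congr 1
    have key := sgnList_append hr e T rfl L ((x.take m).map f) ((y.take (T + 1)).map g)
      (by simp; omega) (g b) (by rw [htake]; simp)
    rw [htake] at key
    simp only [List.map_append, List.map_cons, List.map_nil, List.map_map, Function.comp_def,
      List.append_assoc, List.singleton_append, List.nil_append, List.take_succ_cons, ha, htake]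
      at key ⊢
    have hL' : L.map (insVal hr e · y₀) = L.map (insVal hr e · (g b)) := by
      refine List.map_congr_left fun z hz => ?_
      have : z ≠ e := fun h => heL (h ▸ hz)
      rw [insVal_of_ne hr e this, insVal_of_ne hr e this]
    rw [hL', key, ← mul_assoc, ← mul_assoc, ← pow_add, mul_assoc, mul_assoc]
    rw [show x.length * T + T * (L.length + e) = T * (L.length + x.length + e) by ring]
    ring

/-- As long as the value `e` has not been reached, a vertical move repeats a value, so the path is
horizontal until `cap_sh_block` takes over. If `e` is never reached, both sides vanish. This is the
compatibility of `σ` with composites at the level of sequences. -/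
theorem cap_sh (T : ℕ) (hT : T + 1 = t) (y : List H) (x : List G) (m : ℕ)
    (L : List (Fin s)) (hL : L.length + m + 1 = s) (heL : e ∉ L) (y₀ : Fin t) :
    cap (fun c : G × H => insVal hr e (f c.1) (g c.2)) (m + 1 + T) (L.map (insVal hr e · y₀))
      (sh (of x) (of y)) =
      (-1 : ℤ) ^ (T * (L.length + x.length + 1 + e)) •
        sh (cap f (m + 1) L (of x)) (cap g t [] (of y)) := by
  induction x generalizing m L with
  | nil => rw [sh_nil_left, cap_nil, map_zero, map_zero, LinearMap.zero_apply, smul_zero]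
  | cons a x ih =>
    by_cases ha : f a = e
    · rw [cap_sh_block hr e f g T hT a ha x m L hL heL]
      congr 1
      refine neg_one_pow_congr ?_
      rw [List.length_cons]
      simp only [parity_simps]
      tauto
    rcases y with _ | ⟨b, y⟩
    · rw [sh_nil_right, cap_nil, map_zero, map_zero, smul_zero]
    have hF : insVal hr e (f a) (g b) = insVal hr e (f a) y₀ := by
      rw [insVal_of_ne hr e ha, insVal_of_ne hr e ha]
    have hF' : L.map (insVal hr e · y₀) ++ [insVal hr e (f a) (g b)] =
        (L ++ [f a]).map (insVal hr e · y₀) := by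
      rw [hF, List.map_append, List.map_singleton]
    have he' : e ∉ L ++ [f a] := by
      simpa [heL] using Ne.symm ha
    rcases m with _ | m
    -- A list of `s` distinct elements of `Fin s` would contain `e`.
    · have hnd : ¬ (L ++ [f a]).Nodup := fun h => by
        obtain ⟨σ, hσ⟩ := exists_ofFn_of_nodup (by simp; omega) h
        rw [hσ, List.mem_ofFn] at he'
        exact he' (σ.surjective e)
      rw [← cons_of a, ← cons_of b, sh_cons_cons, zero_add, add_comm 1 T,
        cap_cons_eq_zero_of_not_nodup, cap_one_cons, sgnList_eq_zero_of_not_nodup hnd, zero_smul,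
        map_zero, LinearMap.zero_apply, smul_zero]
      change ¬ (_ ++ [insVal hr e (f a) (g b)]).Nodup
      rw [hF']
      exact fun h => hnd h.of_map
    · have h1 : cap (fun c : G × H => insVal hr e (f c.1) (g c.2)) (m + T + 1)
          ((L ++ [f a]).map (insVal hr e · y₀)) (sh (cons a (alt (of x))) (of y)) = 0 := by
        rcases y with _ | ⟨b', y⟩
        · rw [sh_nil_right, map_zero]
        · rw [← cons_of, sh_cons_cons]
          refine cap_cons_eq_zero_of_not_nodup _ _ (fun h => ?_) _
          have hF₂ : insVal hr e (f a) (g b') = insVal hr e (f a) y₀ := by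
            rw [insVal_of_ne hr e ha, insVal_of_ne hr e ha]
          simp only [hF₂] at h
          simp [List.nodup_append] at h
      have ih' := ih m (L ++ [f a]) (by simp; omega) he'
      rw [show m + 1 + T = m + T + 1 by ring] at ih'
      rw [← cons_of a, ← cons_of b, sh_cons_cons, show m + 1 + 1 + T = m + T + 2 by ring,
        cap_succ_cons, cap_succ_cons]
      change cap _ _ (_ ++ [insVal hr e (f a) (g b)]) _ = _
      rw [hF', map_add, map_add, cap_nilCoeff, h1, zero_add, add_zero, cons_of b, ih']
      simp only [List.length_append, List.length_cons, List.length_nil]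
      rw [show L.length + (0 + 1) + x.length = L.length + (x.length + 1) by ring]

end CapComp

/-! ### The suspension morphism -/

section Suspension

open Classical ListChain

variable {n : ℕ}

theorem changes_append {G : Type} (Q : G → Prop) (l : List G) (a : G) (l' : List G) :
    changes Q (l ++ a :: l') = changes Q (l ++ [a]) + changes Q (a :: l') := by
  have h : ∀ (l : List G) (q : Prop), changesFrom Q q (l ++ a :: l') =
      changesFrom Q q (l ++ [a]) + changes Q (a :: l') := fun l => by
    induction l with
    | nil => exact fun q => congrArg (· + changesFrom Q (Q a) l') (add_zero _).symm
    | cons b l ih =>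
      intro q
      rw [List.cons_append, List.cons_append, changesFrom, changesFrom, ih, add_assoc]
  cases l with
  | nil => exact (zero_add _).symm
  | cons b l => exact h l (Q b)

theorem changes_pos {G : Type} (Q : G → Prop) {l : List G} {a b : G} (ha : a ∈ l) (hb : b ∈ l)
    (hQa : Q a) (hQb : ¬ Q b) : 0 < changes Q l := by
  have h1 : ∀ (l : List G) q, changesFrom Q q l = 0 → ∀ c ∈ l, (Q c ↔ q) := fun l => by
    induction l with
    | nil => simp
    | cons a l ih =>
      intro q h c hc
      rw [changesFrom, Nat.add_eq_zero_iff] at h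
      have h2 : q ↔ Q a := by
        by_contra h2
        simp [h2] at h
      rcases List.mem_cons.1 hc with rfl | hc
      · exact h2.symm
      · exact (ih _ h.2 c hc).trans h2.symm
  rw [Nat.pos_iff_ne_zero]
  intro h
  cases l with
  | nil => simp at ha
  | cons c l =>
    have h2 : ∀ x ∈ c :: l, (Q x ↔ Q c) := fun x hx => by
      rcases List.mem_cons.1 hx with rfl | hx
      · exact Iff.rfl
      · exact h1 l _ h x hx
    exact hQb ((h2 b hb).2 ((h2 a ha).1 hQa))

/-- If the signature is non-zero, every input is the first value of one of the first `r`
permutations. Two distinct inputs therefore exchange their order at least once among these, which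
leaves fewer than `n` variations for the rest. -/
theorem IsDegenSimplex.drop {r : ℕ} {i : ℤ} {w : List (Perm (Fin r))} (hr : 0 < r)
    (h : IsDegenSimplex (n + 1) r (i + (r - 1)) w)
    (hs : sgnList ((w.take r).map (· ⟨0, hr⟩)) ≠ 0) :
    IsDegenSimplex n r i (w.drop (r - 1)) := by
  obtain ⟨σ, hσ⟩ := (sgnList_cases _).resolve_left hs
  have hlen : r ≤ w.length := by
    have := congrArg List.length hσ
    simp only [List.length_map, List.length_take, List.length_ofFn] at this
    omega
  have hmem : ∀ a : Fin r, ∃ v ∈ w.take r, v ⟨0, hr⟩ = a := fun a => by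
    have : a ∈ (w.take r).map (· ⟨0, hr⟩) := by
      rw [hσ, List.mem_ofFn]
      exact σ.surjective a
    exact List.mem_map.1 this
  have hl := h.length_eq
  refine ⟨hr, by rw [List.length_drop]; omega, fun a b hab => ?_⟩
  have hlt := h.variations_lt a b hab
  rw [variations_eq_changes] at hlt ⊢
  -- The permutation of index `r - 1` belongs to both pieces, so that no variation is lost at the
  -- cut.
  have hw : w = w.take (r - 1) ++ w[r - 1] :: w.drop r := by
    have := List.drop_eq_getElem_cons (l := w) (i := r - 1) (by omega)
    rw [show r - 1 + 1 = r by omega] at this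
    rw [← this, List.take_append_drop]
  have hd : w.drop (r - 1) = w[r - 1] :: w.drop r := by
    have := List.drop_eq_getElem_cons (l := w) (i := r - 1) (by omega)
    rwa [show r - 1 + 1 = r by omega] at this
  have ht : w.take r = w.take (r - 1) ++ [w[r - 1]] := by
    have := List.take_succ_eq_append_getElem (l := w) (i := r - 1) (by omega)
    rwa [show r - 1 + 1 = r by omega] at this
  rw [hw, changes_append, ← ht, ← hd] at hlt
  obtain ⟨v, hv, hva⟩ := hmem a
  obtain ⟨v', hv', hvb⟩ := hmem b
  have key : ∀ {v : Perm (Fin r)} {a b : Fin r}, a ≠ b → v ⟨0, hr⟩ = a → v.symm a < v.symm b := by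
    intro v a b hab h
    have h1 : v.symm a = ⟨0, hr⟩ := by rw [← h, Equiv.symm_apply_apply]
    have h2 : v.symm b ≠ ⟨0, hr⟩ := fun h2 => hab (v.symm.injective (h1.trans h2.symm))
    rw [h1]
    exact Nat.pos_of_ne_zero (Fin.val_ne_iff.2 h2)
  have := changes_pos (fun v : Perm (Fin r) => v.symm a < v.symm b) hv hv' (key hab hva)
    (not_lt_of_gt (key hab.symm hvb))
  omega

theorem sgnCochain_eq {r : ℕ} (hr : 0 < r) (w : List (Perm (Fin r))) :
    sgnCochain hr w = sgnList (w.map (· ⟨0, hr⟩)) := by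
  by_cases hw : w.length = r
  · have hw' : (w.map (· ⟨0, hr⟩)).length = r := by rwa [List.length_map]
    rw [sgnCochain, dif_pos hw, sgnList, dif_pos hw']
    have : (fun m : Fin r => (w.map (· ⟨0, hr⟩)).get (m.cast hw'.symm)) =
        fun m : Fin r => w.get (m.cast hw.symm) ⟨0, hr⟩ := by
      ext m
      simp
    simp only [this]
  · rw [sgnCochain, dif_neg hw, sgnList_eq_zero_of_length (by rwa [List.length_map])]

theorem suspension_ofSimp {r : ℕ} {i : ℤ} (w : Simp (n + 1) r (i + (r - 1))) :
    suspension n r i (ofSimp w) =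
      sgnCochain w.isSimplex.arity_pos (w.toList.take r) • ofSeq n i (w.toList.drop (r - 1)) :=
  show (Finsupp.linearCombination ℤ (fun w : Simp (n + 1) r (i + (r - 1)) =>
      sgnCochain w.2.arity_pos (w.1.take r) • simplex n i (w.1.drop (r - 1)))
      (Finsupp.single w 1) : Simp n r i →₀ ℤ) =
      sgnCochain w.2.arity_pos (w.1.take r) • simplex n i (w.1.drop (r - 1)) from
    (Finsupp.linearCombination_single ℤ _ _).trans (one_smul ℤ _)

theorem toChain_suspension {r : ℕ} {i : ℤ} (hr : 0 < r)
    (x : (barrattEccles (n + 1)).X r (i + (r - 1))) :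
    toChain (suspension n r i x) =
      nrm (cap (fun w : Perm (Fin r) => w ⟨0, hr⟩) r [] (toChain x)) := by
  have hadd : ∀ x y : (barrattEccles (n + 1)).X r (i + (r - 1)),
      suspension n r i (x + y) = suspension n r i x + suspension n r i y :=
    (suspension n r i).map_add
  have hneg : ∀ x : (barrattEccles (n + 1)).X r (i + (r - 1)),
      suspension n r i (-x) = -suspension n r i x := (suspension n r i).map_neg
  have hzero : suspension n r i (0 : (barrattEccles (n + 1)).X r (i + (r - 1))) = 0 :=
    (suspension n r i).map_zero
  induction x using barrattEccles_induction with
  | zero => simp only [hzero, map_zero]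
  | add x y hx hy => simp only [hadd, map_add, hx, hy]
  | neg x hx => simp only [hneg, map_neg, hx]
  | single w =>
    have hc := capList_eq (fun w : Perm (Fin r) => w ⟨0, hr⟩) (r - 1) [] w.toList (by simp; omega)
    rw [show r - 1 + 1 = r by omega, List.nil_append] at hc
    rw [suspension_ofSimp, toChain_ofSimp, cap_of, hc, map_smul, map_smul, sgnCochain_eq]
    by_cases h : sgnList ((w.toList.take r).map (· ⟨0, hr⟩)) = 0
    · rw [h, zero_smul, zero_smul]
    · rw [toChain_ofSeq (w.isSimplex.isDegenSimplex.drop hr h)]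

/-- Compatibility with differentials is the cocycle property, equivariance the behaviour of the
signature under left translation, and compatibility with composites is `cap_sh`, whose sign is
exactly cancelled by that of the composites of `Λ`. -/
theorem isOperadHom_suspension (n : ℕ) : IsOperadHom (suspension n) where
  isSigmaHom :=
    { map_d := fun {r i j} h x => toChain_injective (by
        change (barrattEccles (n + 1)).X r (i + (r - 1)) at x
        rcases Nat.eq_zero_or_pos r with rfl | hr
        · have := (isOperad_barrattEccles n).arity_zero j
          rw [Subsingleton.elim (suspension n 0 j _) ((barrattEccles n).d h (suspension n 0 i x))]
        rw [toChain_d, toChain_suspension hr x, nrm_bd_nrm]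
        refine (congrArg (fun y => toChain (suspension n r j y)) (lam_d_apply _ h x)).trans ?_
        refine (toChain_suspension hr _).trans ?_
        rw [map_smul, map_smul, map_smul, toChain_d, nrm_cap_nrm, nrm_cap_bd _ (r - 1) (by omega),
          smul_smul, neg_one_pow_eq_negOnePow (d := (r : ℤ) - 1) (by omega),
          negOnePow_mul_negOnePow, Int.negOnePow_even _ ⟨_, rfl⟩, Units.val_one, one_smul])
      map_act := fun {r i} σ x => toChain_injective (by
        change (barrattEccles (n + 1)).X r (i + (r - 1)) at x
        rcases Nat.eq_zero_or_pos r with rfl | hr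
        · have := (isOperad_barrattEccles n).arity_zero i
          rw [Subsingleton.elim (suspension n 0 i _) ((barrattEccles n).act σ (suspension n 0 i x))]
        rw [toChain_act, toChain_suspension hr x, nrm_map_nrm]
        refine (congrArg (fun y => toChain (suspension n r i y)) (lam_act_apply _ σ x)).trans ?_
        refine (toChain_suspension hr _).trans ?_
        have := cap_perm (fun w : Perm (Fin r) => w ⟨0, hr⟩) σ r [] (toChain x)
        rw [map_smul, map_smul, map_smul, toChain_act, nrm_cap_nrm, cap_map]
        simp only [Equiv.Perm.mul_apply]
        rw [List.map_nil] at this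
        rw [this, map_smul, map_smul, smul_smul]
        simp) }
  map_one := toChain_injective (by
    refine (toChain_suspension Nat.one_pos _).trans ?_
    refine (congrArg (fun y => nrm (cap _ 1 [] y)) (toChain_one (n := n + 1)
      (show (0 : ℤ) + ((1 : ℕ) - 1) = 0 by simp))).trans ?_
    rw [toChain_one, ← cons_of, cap_one_cons, cons_of]
    have : ([] ++ [(1 : Perm (Fin 1)) ⟨0, Nat.one_pos⟩]) = List.ofFn (1 : Perm (Fin 1)) := by simp
    rw [this, sgnList_ofFn, map_one, Units.val_one, one_smul,
      nrm_of (by simp) (List.isChain_singleton _)])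
  map_comp {s t r i j k} hr hk e p q := toChain_injective (by
    change (barrattEccles (n + 1)).X s (i + (s - 1)) at p
    change (barrattEccles (n + 1)).X t (j + (t - 1)) at q
    have hs : 0 < s := by have := e.2; omega
    rcases Nat.eq_zero_or_pos t with rfl | ht
    · have h1 := (isOperad_barrattEccles (n + 1)).arity_zero (j + ((0 : ℕ) - 1))
      have h2 := (isOperad_barrattEccles n).arity_zero j
      have h3 : q = 0 := Subsingleton.elim _ _
      rw [Subsingleton.elim (suspension n 0 j q) 0, map_zero, h3]
      refine (congrArg (fun y => toChain (suspension n r k y))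
        (((lam (barrattEccles (n + 1))).comp hr hk e p).map_zero)).trans ?_
      exact (congrArg toChain (suspension n r k).map_zero).trans rfl
    have hr0 : 0 < r := by omega
    rw [toChain_comp, toChain_suspension hs p, toChain_suspension ht q]
    refine (congrArg (fun y => toChain (suspension n r k y)) (lam_comp_apply _ hr hk e p q)).trans ?_
    refine (toChain_suspension hr0 _).trans ?_
    rw [map_smul, map_smul, map_smul, toChain_comp, nrm_cap_nrm, cap_map, nrm_map_sh_nrm_left,
      nrm_map_sh_nrm_right]
    simp only [permComp_apply_zero hr e hs ht hr0]
    obtain ⟨T, rfl⟩ : ∃ T, t = T + 1 := ⟨t - 1, by omega⟩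
    have key : cap (fun c : Perm (Fin s) × Perm (Fin (T + 1)) =>
        insVal hr e (c.1 ⟨0, hs⟩) (c.2 ⟨0, ht⟩)) r [] (sh (toChain p) (toChain q)) =
        ((T * (i + (s - 1) + e)).negOnePow : ℤ) •
          sh (cap (fun w : Perm (Fin s) => w ⟨0, hs⟩) s [] (toChain p))
            (cap (fun w : Perm (Fin (T + 1)) => w ⟨0, ht⟩) (T + 1) [] (toChain q)) := by
      induction p using barrattEccles_induction with
      | zero => simp only [map_zero, LinearMap.zero_apply, smul_zero]
      | add x y hx hy => simp only [map_add, LinearMap.add_apply, smul_add, hx, hy]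
      | neg x hx => simp only [map_neg, LinearMap.neg_apply, smul_neg, hx]
      | single u =>
        induction q using barrattEccles_induction with
        | zero => simp only [map_zero, smul_zero]
        | add x y hx hy => simp only [map_add, smul_add, hx, hy]
        | neg x hx => simp only [map_neg, smul_neg, hx]
        | single v =>
          have := cap_sh hr e (fun w : Perm (Fin s) => w ⟨0, hs⟩)
            (fun w : Perm (Fin (T + 1)) => w ⟨0, ht⟩) T rfl v.toList u.toList (s - 1) []
            (by simp; omega) (by simp) ⟨0, ht⟩
          rw [show s - 1 + 1 + T = r by omega, show s - 1 + 1 = s by omega, List.map_nil] at this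
          have hu := u.isSimplex.length_eq
          -- A simplex has one more term than its degree and `cap_sh` adds one again; the resulting
          -- `2` does not affect the sign.
          rw [toChain_ofSimp, toChain_ofSimp, this,
            neg_one_pow_eq_negOnePow (d := T * (i + (s - 1) + 2 + e)) (by
              push_cast; rw [hu, List.length_nil]; push_cast; ring)]
          congr 1
          refine negOnePow_congr ⟨T, by ring⟩
    rw [key, map_smul, map_smul, smul_smul, negOnePow_mul_negOnePow]
    push_cast
    rw [Int.negOnePow_even _ ⟨T * (i + (s - 1) + e), by ring⟩, Units.val_one, one_smul])

end Suspension

/-! ### The cooperads `D_n` -/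

theorem bounded_lamPow (n : ℕ) {P : OperadData}
    (hb : ∀ r, ∃ N, ∀ i < N, Subsingleton (P.X r i)) (r : ℕ) :
    ∃ N, ∀ i < N, Subsingleton ((lam^[n] P).X r i) := by
  induction n generalizing P with
  | zero => exact hb r
  | succ n ih =>
    refine ih (P := lam P) fun r => ?_
    obtain ⟨N, hN⟩ := hb r
    exact ⟨N - (r - 1), fun i hi => hN (i + (r - 1)) (show i + (r - 1) < N by linarith)⟩

theorem bounded_above_lamPow (n : ℕ) {P : OperadData}
    (hb : ∀ r, ∃ N, ∀ i > N, Subsingleton (P.X r i)) (r : ℕ) :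
    ∃ N, ∀ i > N, Subsingleton ((lam^[n] P).X r i) := by
  induction n generalizing P with
  | zero => exact hb r
  | succ n ih =>
    refine ih (P := lam P) fun r => ?_
    obtain ⟨N, hN⟩ := hb r
    exact ⟨N - (r - 1), fun i hi => hN (i + (r - 1)) (show i + (r - 1) > N by linarith)⟩

theorem bounded_barrattEccles (n r : ℕ) :
    ∃ N, ∀ i < N, Subsingleton ((barrattEccles n).X r i) := by
  refine ⟨0, fun i hi => ?_⟩
  have : IsEmpty (Simp n r i) := ⟨fun w => by
    have := w.2.length_eq
    have := List.length_pos_of_ne_nil w.2.ne_nil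
    omega⟩
  exact inferInstanceAs (Subsingleton (Simp n r i →₀ ℤ))

theorem isCooperad_dualCooperad (n : ℕ) : IsCooperad (dualCooperad n) :=
  IsOperad.dual _ (IsOperad.lamPow (isOperad_barrattEccles n) n)
    (bounded_lamPow n (bounded_barrattEccles n))

theorem isCooperadHom_suspensionStar (n : ℕ) : IsCooperadHom (suspensionStar n) :=
  IsOperadHom.dualMap (P := lam^[n + 1] (barrattEccles (n + 1))) (Q := lam^[n] (barrattEccles n))
    (IsOperadHom.lamPowMap n (isOperadHom_suspension n))

/-- If `a` and `b` ordered all pairs alike, `b⁻¹ a` would be an increasing bijection of `Fin r`,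
hence the identity. -/
theorem exists_order_ne {r : ℕ} {a b : Perm (Fin r)} (h : a ≠ b) :
    ∃ i j, ¬ (a.symm i < a.symm j ↔ b.symm i < b.symm j) := by
  by_contra! hc
  apply h
  let f : Fin r ≃o Fin r := StrictMono.orderIsoOfSurjective (fun x => b.symm (a x))
    (fun x y hxy => (hc _ _).1 (by simpa using hxy)) (b.symm.surjective.comp a.surjective)
  have : f = OrderIso.refl _ := Subsingleton.elim _ _
  ext1 x
  have hx : b.symm (a x) = x := congrArg (fun g : Fin r ≃o Fin r => g x) this
  rw [← b.apply_symm_apply (a x), hx]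

theorem length_le_sum_variations {r : ℕ} (w : List (Perm (Fin r))) (h : w.IsChain (· ≠ ·)) :
    w.length ≤ (∑ i, ∑ j, variations i j w) + 1 := by
  induction w with
  | nil => simp
  | cons a l ih =>
    cases l with
    | nil => simp
    | cons b l =>
      rw [List.isChain_cons_cons] at h
      obtain ⟨i, j, hij⟩ := exists_order_ne h.1
      have h1 := ih h.2
      have h2 : (∑ i, ∑ j, variations i j (a :: b :: l)) =
          (∑ i, ∑ j, if (a.symm i < a.symm j ↔ b.symm i < b.symm j) then 0 else 1) +
            ∑ i, ∑ j, variations i j (b :: l) := by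
        simp only [variations, Finset.sum_add_distrib]
      have h3 : 1 ≤ ∑ i, ∑ j, if (a.symm i < a.symm j ↔ b.symm i < b.symm j) then 0 else 1 := by
        refine le_trans ?_ (Finset.single_le_sum (fun _ _ => Nat.zero_le _) (Finset.mem_univ i))
        refine le_trans ?_ (Finset.single_le_sum (fun _ _ => Nat.zero_le _) (Finset.mem_univ j))
        rw [if_neg hij]
      rw [h2, List.length_cons]
      omega

/-- Here the finiteness of `n` is essential: each pair varies fewer than `n` times and each
non-degenerate step makes some pair vary, so the length of simplices is bounded. After duality this
becomes the lower bound from which liftings are built degree by degree. -/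
theorem bounded_above_barrattEccles (n r : ℕ) :
    ∃ N, ∀ i > N, Subsingleton ((barrattEccles n).X r i) := by
  refine ⟨(∑ _i : Fin r, ∑ _j : Fin r, n : ℕ), fun i hi => ?_⟩
  have : IsEmpty (Simp n r i) := ⟨fun w => by
    have h1 := w.2.length_eq
    have h2 := length_le_sum_variations w.1 w.2.nondegenerate
    have h3 : (∑ i, ∑ j, variations i j w.1) ≤ ∑ _i : Fin r, ∑ _j : Fin r, n := by
      refine Finset.sum_le_sum fun i _ => Finset.sum_le_sum fun j _ => ?_
      -- The bound in `IsSimplex` says nothing of diagonal pairs; these never vary.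
      rcases eq_or_ne i j with rfl | hij
      · rw [variations_eq_changes]
        simp only [lt_irrefl]
        have : changes (fun _ : Perm (Fin r) => False) w.1 = 0 := by
          generalize w.1 = l
          induction l with
          | nil => rfl
          | cons a l ih =>
            cases l with
            | nil => rfl
            | cons b l => rw [changes_cons_cons, ih, if_pos Iff.rfl]
        omega
      · exact (w.2.variations_lt i j hij).le
    omega⟩
  exact inferInstanceAs (Subsingleton (Simp n r i →₀ ℤ))

theorem bounded_dualCooperad (n r : ℕ) :
    ∃ N, ∀ i < N, Subsingleton ((dualCooperad n).X r i) := by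
  obtain ⟨N, hN⟩ := bounded_above_lamPow n (bounded_above_barrattEccles n) r
  refine ⟨-N, fun i hi => ?_⟩
  have := hN (-i) (by omega)
  exact inferInstanceAs (Subsingleton (Module.Dual ℤ ((lam^[n] (barrattEccles n)).X r (-i))))

/-! ### Endomorphisms of norm one -/

/-- Every `A(r)_i` has an endomorphism of norm one. -/
def HasNormOne (A : SigmaData) : Prop :=
  ∀ r i, ∃ π : A.X r i →ₗ[ℤ] A.X r i, ∀ y, ∑ τ, A.act τ (π (A.act τ⁻¹ y)) = y

/-- The same `π` works: the signatures contributed by `τ` and `τ⁻¹` cancel. -/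
theorem HasNormOne.lam {P : OperadData} (h : HasNormOne P.toSigmaData) :
    HasNormOne (lam P).toSigmaData := fun r i => by
  obtain ⟨π, hπ⟩ := h r (i + (r - 1))
  refine ⟨π, fun y => Eq.trans (Finset.sum_congr rfl fun τ _ => ?_) (hπ y)⟩
  refine (lam_act_apply P τ _).trans ?_
  refine (congrArg (fun z => (Perm.sign τ : ℤ) • P.act τ (π z)) (lam_act_apply P τ⁻¹ y)).trans ?_
  rw [map_smul, map_smul, smul_smul, Perm.sign_inv, Int.units_coe_mul_self, one_smul]

theorem HasNormOne.lamPow (n : ℕ) {P : OperadData} (h : HasNormOne P.toSigmaData) :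
    HasNormOne (EnKoszul.lam^[n] P).toSigmaData := by
  induction n generalizing P with
  | zero => exact h
  | succ n ih => exact ih h.lam

/-- The transpose of `τ π τ⁻¹` is the conjugate by `τ` of the transpose of `π` for the dual action,
so the norm is still one. -/
theorem HasNormOne.dual {P : OperadData} [FiniteFree P.toSigmaData]
    (h : HasNormOne P.toSigmaData) : HasNormOne (dual P).toSigmaData := fun r i => by
  obtain ⟨π, hπ⟩ := h r (-i)
  refine ⟨show Module.Dual ℤ (P.X r (-i)) →ₗ[ℤ] Module.Dual ℤ (P.X r (-i)) from π.dualMap,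
    fun y => ?_⟩
  change Module.Dual ℤ (P.X r (-i)) at y
  change (∑ τ : Perm (Fin r), ((P.act τ⁻¹).dualMap (π.dualMap ((P.act τ⁻¹⁻¹).dualMap y)) :
    Module.Dual ℤ (P.X r (-i)))) = y
  refine LinearMap.ext fun x => ?_
  rw [LinearMap.sum_apply]
  conv_rhs => rw [← hπ x, map_sum]
  refine Finset.sum_congr rfl fun τ _ => ?_
  simp only [LinearMap.dualMap_apply, inv_inv]

theorem IsSimplex.map {n r : ℕ} {i : ℤ} {w : List (Perm (Fin r))} (h : IsSimplex n r i w)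
    (σ : Perm (Fin r)) : IsSimplex n r i (w.map (σ * ·)) :=
  { h.isDegenSimplex.map σ with
    ne_nil := by simpa using h.ne_nil
    nondegenerate := by
      rw [List.isChain_map]
      exact h.nondegenerate.imp fun _ _ h h' => h (mul_left_cancel h') }

theorem ofSeq_toList {n r : ℕ} {d : ℤ} (w : Simp n r d) : ofSeq n d w.toList = ofSimp w :=
  dif_pos w.isSimplex

/-- Left translation is free on simplices, and every orbit contains exactly one simplex that begins
with the identity. If `π` projects onto these, then `τ π τ⁻¹` projects onto the simplices that begin
with `τ`. -/
theorem hasNormOne_barrattEccles (n : ℕ) : HasNormOne (barrattEccles n).toSigmaData :=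
  fun r i => by
  classical
  let π : (barrattEccles n).X r i →ₗ[ℤ] (barrattEccles n).X r i :=
    Finsupp.linearCombination ℤ fun w : Simp n r i =>
      if w.toList.head? = some 1 then ofSimp w else 0
  have hπ : ∀ w : Simp n r i, π (ofSimp w) = if w.toList.head? = some 1 then ofSimp w else 0 :=
    fun w => (Finsupp.linearCombination_single ℤ _ _).trans (one_smul ℤ _)
  refine ⟨π, fun y => ?_⟩
  induction y using barrattEccles_induction with
  | zero => simp only [map_zero, Finset.sum_const_zero]
  | add x y hx hy => simp only [map_add, Finset.sum_add_distrib, hx, hy]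
  | neg x hx => simp only [map_neg, Finset.sum_neg_distrib, hx]
  | single w =>
    have hS := (isSigma_barrattEccles n)
    obtain ⟨a, l, hw⟩ := List.exists_cons_of_ne_nil w.isSimplex.ne_nil
    have key : ∀ τ : Perm (Fin r), (barrattEccles n).act τ (π ((barrattEccles n).act τ⁻¹ (ofSimp w)))
        = if τ = a then ofSimp w else 0 := fun τ => by
      obtain ⟨w', hw'⟩ : ∃ w' : Simp n r i, w'.toList = w.toList.map (τ⁻¹ * ·) := 
        ⟨⟨_, w.isSimplex.map τ⁻¹⟩, rfl⟩
      have h1 : (barrattEccles n).act τ⁻¹ (ofSimp w) = ofSimp w' := by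
        rw [barrattEccles_act_ofSimp, ← hw']
        exact ofSeq_toList w'
      have h2 : w'.toList.head? = some 1 ↔ τ = a := by
        rw [hw', hw, List.map_cons, List.head?_cons, Option.some_inj, inv_mul_eq_one]
      rw [h1, hπ]
      simp only [h2]
      split_ifs
      · rw [← h1, ← hS.act_mul, mul_inv_cancel, hS.act_one]
      · exact map_zero _
    simp only [key, Finset.sum_ite_eq', Finset.mem_univ, if_true]

/-! ### The equivariant sections of the suspension morphisms -/

/-- `f` has an equivariant section in every arity and degree. -/
def HasSection {A B : SigmaData} (f : GradedMap A B) : Prop :=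
  ∀ r i, ∃ s : B.X r i →ₗ[ℤ] A.X r i, (∀ y, f r i (s y) = y) ∧
    ∀ σ y, s (B.act σ y) = A.act σ (s y)

theorem HasSection.lamMap {P Q : OperadData} {f : GradedMap P.toSigmaData Q.toSigmaData}
    (h : HasSection f) : HasSection (lamMap f) := fun r i => by
  obtain ⟨s, hs, hs'⟩ := h r (i + (r - 1))
  refine ⟨s, hs, fun σ y => ?_⟩
  change Q.X r (i + (r - 1)) at y
  refine (congrArg s (lam_act_apply Q σ y)).trans ?_
  rw [map_smul, hs']
  exact (lam_act_apply P σ (s y)).symm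

theorem HasSection.lamPowMap (n : ℕ) {P Q : OperadData}
    {f : GradedMap P.toSigmaData Q.toSigmaData} (h : HasSection f) :
    HasSection (lamPowMap n f) := by
  induction n generalizing P Q with
  | zero => exact h
  | succ n ih => exact ih h.lamMap

/-- The involution which reverses the order of the first `m + 1` positions. -/
def reversal {r : ℕ} (m : ℕ) (hm : m < r) : Perm (Fin r) where
  toFun p := if (p : ℕ) ≤ m then ⟨m - p, by omega⟩ else p
  invFun p := if (p : ℕ) ≤ m then ⟨m - p, by omega⟩ else p
  left_inv p := by
    ext
    by_cases h : (p : ℕ) ≤ m <;> simp [h]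
    omega
  right_inv p := by
    ext
    by_cases h : (p : ℕ) ≤ m <;> simp [h]
    omega

/-- The pair is inverted exactly when both positions are among the first `m + 1`, that is, when `j ≤
m`. -/
theorem reversal_symm_lt_iff {r m : ℕ} (hm : m < r) {i j : Fin r} (hij : i < j) :
    (reversal m hm).symm i < (reversal m hm).symm j ↔ m < j := by
  have hij' : (i : ℕ) < j := hij
  simp only [reversal, Equiv.coe_fn_symm_mk, Fin.lt_def]
  split_ifs <;> simp <;> omega

/-- The sequence of the reversals of the first `m + 1, m, …, 2` positions. -/
def reversals {r : ℕ} : ∀ m : ℕ, m < r → List (Perm (Fin r))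
  | 0, _ => []
  | m + 1, hm => reversal (m + 1) hm :: reversals m (by omega)

theorem length_reversals {r : ℕ} (m : ℕ) (hm : m < r) : (reversals m hm).length = m := by
  induction m with
  | zero => rfl
  | succ m ih => rw [reversals, List.length_cons, ih]

theorem reversal_zero {r : ℕ} (hr : 0 < r) : reversal 0 hr = 1 := by
  ext p
  by_cases h : (p : ℕ) = 0 <;> simp [reversal, h]

theorem reversals_append {r : ℕ} (m : ℕ) (hm : m < r) :
    ∃ l, reversals m hm ++ [1] = reversal m hm :: l := by
  cases m with
  | zero => exact ⟨[], by rw [reversal_zero]; rfl⟩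
  | succ m => exact ⟨_, rfl⟩

/-- As the reversed segment shrinks, the pair stays inverted until its larger position leaves the
segment and is in order from then on: it changes at most once. -/
theorem changes_reversals_le {r : ℕ} {i j : Fin r} (hij : i < j) (m : ℕ) (hm : m < r) :
    changes (fun v : Perm (Fin r) => v.symm i < v.symm j) (reversals m hm ++ [1]) ≤ if m < j then 0 else 1 := by
  induction m with
  | zero => simp [reversals, changes, changesFrom]
  | succ m ih =>
    have h1 := ih (by omega)
    obtain ⟨l, hl⟩ := reversals_append m (by omega : m < r)
    rw [reversals, List.cons_append, hl, changes_cons_cons, ← hl, reversal_symm_lt_iff _ hij,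
      reversal_symm_lt_iff _ hij]
    split_ifs at h1 ⊢ <;> omega

theorem reversals_isChain {r : ℕ} (m : ℕ) (hm : m < r) :
    (reversals m hm ++ [1]).IsChain (· ≠ ·) := by
  induction m with
  | zero => simp [reversals]
  | succ m ih =>
    have h1 := ih (by omega)
    obtain ⟨l, hl⟩ := reversals_append m (by omega : m < r)
    rw [reversals, List.cons_append, hl, List.isChain_cons_cons, ← hl]
    refine ⟨fun h => ?_, h1⟩
    have := congrArg (fun v : Perm (Fin r) => (v ⟨0, by omega⟩ : ℕ)) h
    simp [reversal] at this

/-- Reversing `k + 1` positions brings `k` to the front. For `m = r - 1` the first values thus run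
through all inputs in decreasing order, and their signature is non-zero. -/
theorem map_zero_reversals {r : ℕ} (m : ℕ) (hm : m < r) :
    (reversals m hm ++ [1]).map (fun v : Perm (Fin r) => v ⟨0, by omega⟩) =
      List.ofFn fun k : Fin (m + 1) => (⟨m - k, by omega⟩ : Fin r) := by
  induction m with
  | zero => simp [reversals]
  | succ m ih =>
    rw [reversals, List.cons_append, List.map_cons, ih (by omega), List.ofFn_succ]
    ext
    simp [reversal]

theorem changes_not {G : Type} (Q : G → Prop) (l : List G) :
    changes (fun a => ¬ Q a) l = changes Q l := by
  induction l with
  | nil => rfl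
  | cons a l ih =>
    cases l with
    | nil => rfl
    | cons b l =>
      rw [changes_cons_cons, changes_cons_cons, ih]
      congr 1
      split_ifs <;> tauto

theorem changes_reversals_le_one {r : ℕ} {i j : Fin r} (hij : i ≠ j) (m : ℕ) (hm : m < r) :
    changes (fun v : Perm (Fin r) => v.symm i < v.symm j) (reversals m hm ++ [1]) ≤ 1 := by
  rcases lt_or_gt_of_ne hij with h | h
  · refine (changes_reversals_le h m hm).trans ?_
    split_ifs <;> omega
  · have h1 : (fun v : Perm (Fin r) => v.symm i < v.symm j) = fun v => ¬ (v.symm j < v.symm i) := by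
      ext v
      rw [not_lt]
      exact (v.symm.injective.ne hij).le_iff_lt.symm
    rw [h1, changes_not]
    refine (changes_reversals_le h m hm).trans ?_
    split_ifs <;> omega

/-- A simplex that begins with `a` is preceded by the translates by `a` of the reversals. At most
one variation is added to each pair, so the result lies in `E_{n+1}`; its first values form a
permutation, whose signature `c a` is used as a coefficient, and the cap product gives back the
original simplex because `c a * c a = 1`. The rule `c (τ * a) = sign τ * c a` is the twist of the
action in `Λ`. Compatibility with the differentials is neither claimed nor needed. -/
theorem hasSection_suspension (n : ℕ) :
    HasSection (A := (lam (barrattEccles (n + 1))).toSigmaData) (suspension n) := fun r i => by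
  rcases r with _ | m
  · have h1 := (isOperad_barrattEccles n).arity_zero i
    have h2 := (isOperad_barrattEccles n).lam
    refine ⟨0, fun _ => Subsingleton.elim _ _, fun σ y => (map_zero _).symm⟩
  let c : Perm (Fin (m + 1)) → ℤ := fun a =>
    sgnList ((reversals m m.lt_succ_self ++ [1]).map fun v : Perm (Fin (m + 1)) =>
      a (v ⟨0, by omega⟩))
  have hc : ∀ τ a, c (τ * a) = Perm.sign τ * c a := fun τ a => by
    rw [← sgnList_map, List.map_map]
    rfl
  have hc2 : ∀ a, c a * c a = 1 := fun a => by
    have : c a = Perm.sign (a * Fin.revPerm) := by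
      have h1 := sgnList_ofFn (a * Fin.revPerm : Perm (Fin (m + 1)))
      rw [← h1]
      change sgnList (List.map (a ∘ _) _) = _
      rw [← List.map_map, map_zero_reversals, List.map_ofFn]
      congr 2
      ext k
      simp only [Function.comp_apply, Perm.mul_apply, Fin.revPerm_apply]
      congr 2
      ext
      simp
    rw [this, Int.units_coe_mul_self]
  let E (w : List (Perm (Fin (m + 1)))) : List (Perm (Fin (m + 1))) :=
    (reversals m m.lt_succ_self).map (w.headI * ·) ++ w
  have hE : ∀ a l, E (a :: l) = (reversals m m.lt_succ_self).map (a * ·) ++ a :: l :=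
    fun a l => rfl
  have hE' : ∀ a : Perm (Fin (m + 1)), (reversals m m.lt_succ_self).map (a * ·) ++ [a] =
      (reversals m m.lt_succ_self ++ [1]).map (a * ·) := fun a => by simp
  have hEs : ∀ w : Simp n (m + 1) i,
      IsSimplex (n + 1) (m + 1) (i + ((m + 1 : ℕ) - 1)) (E w.toList) := fun w => by
    have hw := w.isSimplex
    obtain ⟨a, l, hal⟩ := List.exists_cons_of_ne_nil hw.ne_nil
    rw [hal] at hw ⊢
    rw [hE]
    refine ⟨m.succ_pos, by simp, ?_, ?_, fun x y hxy => ?_⟩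
    · have := hw.length_eq
      rw [List.length_append, List.length_map, length_reversals]
      push_cast
      linarith
    · rw [List.isChain_split, hE', List.isChain_map]
      exact ⟨(reversals_isChain m _).imp fun _ _ h h' => h (mul_left_cancel h'), hw.nondegenerate⟩
    · have h1 := hw.variations_lt x y hxy
      rw [variations_eq_changes] at h1 ⊢
      rw [changes_append, hE', changes_map]
      have h2 := changes_reversals_le_one (a.symm.injective.ne hxy) m m.lt_succ_self
      exact Nat.lt_of_le_of_lt (Nat.add_le_add_right h2 _) (by omega)
  let s : (barrattEccles n).X (m + 1) i →ₗ[ℤ]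
      (barrattEccles (n + 1)).X (m + 1) (i + ((m + 1 : ℕ) - 1)) :=
    Finsupp.linearCombination ℤ fun w : Simp n (m + 1) i =>
      c w.toList.headI • ofSeq (n + 1) (i + ((m + 1 : ℕ) - 1)) (E w.toList)
  have hs : ∀ w : Simp n (m + 1) i, s (ofSimp w) =
      c w.toList.headI • ofSeq (n + 1) (i + ((m + 1 : ℕ) - 1)) (E w.toList) :=
    fun w => (Finsupp.linearCombination_single ℤ _ _).trans (one_smul ℤ _)
  let S : (barrattEccles (n + 1)).X (m + 1) (i + ((m + 1 : ℕ) - 1)) →ₗ[ℤ]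
      (barrattEccles n).X (m + 1) i := suspension n (m + 1) i
  have hS : ∀ w, S (ofSimp w) = sgnList ((w.toList.take (m + 1)).map (· ⟨0, m.succ_pos⟩)) •
      ofSeq n i (w.toList.drop m) := fun w => by
    rw [← sgnCochain_eq m.succ_pos]
    exact suspension_ofSimp w
  have h₁ : ∀ y, S (s y) = y := fun y => by
    induction y using barrattEccles_induction with
    | zero => simp only [map_zero]
    | add x y hx hy => simp only [map_add, hx, hy]
    | neg x hx => simp only [map_neg, hx]
    | single w =>
      obtain ⟨a, l, hal⟩ := List.exists_cons_of_ne_nil w.isSimplex.ne_nil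
      obtain ⟨w', hw'⟩ : ∃ w' : Simp (n + 1) (m + 1) (i + ((m + 1 : ℕ) - 1)),
        w'.toList = E w.toList := ⟨⟨_, hEs w⟩, rfl⟩
      have h1 : (E w.toList).take (m + 1) = (reversals m m.lt_succ_self ++ [1]).map (a * ·) := by
        rw [hal, hE, List.take_append, List.take_of_length_le (by simp [length_reversals]), ← hE']
        simp [length_reversals]
      have h2 : (E w.toList).drop m = w.toList := by
        rw [hal, hE, List.drop_left' (by simp [length_reversals])]
      rw [hs, map_smul, ← hw', ofSeq_toList, hS, hw', h1, h2, ofSeq_toList, smul_smul, List.map_map, hal]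
      exact (congrArg (· • ofSimp w) (hc2 a)).trans (one_smul ℤ _)
  have h₂ : ∀ σ y, s ((barrattEccles n).act σ y) =
      (Perm.sign σ : ℤ) • (barrattEccles (n + 1)).act σ (s y) := fun σ y => by
    induction y using barrattEccles_induction with
    | zero => simp only [map_zero, smul_zero]
    | add x y hx hy => simp only [map_add, smul_add, hx, hy]
    | neg x hx => simp only [map_neg, smul_neg, hx]
    | single w =>
      obtain ⟨a, l, hal⟩ := List.exists_cons_of_ne_nil w.isSimplex.ne_nil
      obtain ⟨w', hw'⟩ : ∃ w' : Simp n (m + 1) i, w'.toList = w.toList.map (σ * ·) :=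
        ⟨⟨_, w.isSimplex.map σ⟩, rfl⟩
      obtain ⟨w'', hw''⟩ : ∃ w' : Simp (n + 1) (m + 1) (i + ((m + 1 : ℕ) - 1)),
        w'.toList = E w.toList := ⟨⟨_, hEs w⟩, rfl⟩
      have h1 : E (w.toList.map (σ * ·)) = (E w.toList).map (σ * ·) := by
        rw [hal, List.map_cons, hE, hE]
        simp [mul_assoc]
      rw [barrattEccles_act_ofSimp, ← hw', ofSeq_toList, hs, hs, ← hw'', ofSeq_toList, map_smul,
        barrattEccles_act_ofSimp, hw'', hw', h1, smul_smul, hal]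
      exact congrArg (· • _) (hc σ a)
  exact ⟨s, h₁, fun σ y => (h₂ σ y).trans (lam_act_apply (barrattEccles (n + 1)) σ (s y)).symm⟩

theorem free_dualCooperad (n r : ℕ) (i : ℤ) : Module.Free ℤ ((dualCooperad n).X r i) := by
  have h1 := (lamPow_finiteFree n (barrattEccles n)).free r (-i)
  have h2 := (lamPow_finiteFree n (barrattEccles n)).finite r (-i)
  exact inferInstanceAs (Module.Free ℤ (Module.Dual ℤ ((lam^[n] (barrattEccles n)).X r (-i))))

theorem hasNormOne_dualCooperad (n : ℕ) : HasNormOne (dualCooperad n).toSigmaData :=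
  ((hasNormOne_barrattEccles n).lamPow n).dual

/-- Transposition turns the equivariant section of `Λⁿσ` into an equivariant retraction of `σ^*`,
and upper bounds on degrees into lower bounds. -/
theorem isProjectiveExtension_suspensionStar (n r : ℕ) :
    IsProjectiveExtension r (suspensionStar n) where
  isSigmaHom := (isCooperadHom_suspensionStar n).isSigmaHom
  free := free_dualCooperad (n + 1) r
  retraction i := by
    obtain ⟨s, hs, hs'⟩ := (hasSection_suspension n).lamPowMap n r (-i)
    refine ⟨show Module.Dual ℤ ((lam^[n + 1] (barrattEccles (n + 1))).X r (-i)) →ₗ[ℤ]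
      Module.Dual ℤ ((lam^[n] (barrattEccles n)).X r (-i)) from s.dualMap, fun x => ?_,
      fun σ y => ?_⟩
    · change Module.Dual ℤ ((lam^[n] (barrattEccles n)).X r (-i)) at x
      exact LinearMap.ext fun z => congrArg x (hs z)
    · change Module.Dual ℤ ((lam^[n + 1] (barrattEccles (n + 1))).X r (-i)) at y
      exact LinearMap.ext fun z => congrArg y (hs' σ⁻¹ z).symm
  norm_one := hasNormOne_dualCooperad (n + 1) r
  bounded := bounded_dualCooperad (n + 1) r

theorem isProjectiveExtension_zero (n r : ℕ) : IsProjectiveExtension r (X := zeroSigma)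
    (Y := (dualCooperad n).toSigmaData) fun _ _ => 0 where
  isSigmaHom := ⟨fun _ _ => (map_zero _).symm, fun _ _ => (map_zero _).symm⟩
  free := free_dualCooperad n r
  retraction _ := ⟨0, fun _ => rfl, fun _ _ => rfl⟩
  norm_one := hasNormOne_dualCooperad n r
  bounded := bounded_dualCooperad n r

theorem IsSeqColimit.isProjectiveFiltration {L : CooperadData}
    {ι : ∀ n : ℕ, GradedMap (dualCooperad (n + 1)).toSigmaData L.toSigmaData}
    (h : IsSeqColimit (fun n => dualCooperad (n + 1)) (fun n => suspensionStar (n + 1)) L ι)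
    (r : ℕ) :
    IsProjectiveFiltration r (fun n => (dualCooperad (n + 1)).toSigmaData)
      (fun n => suspensionStar (n + 1)) L.toSigmaData ι where
  isSigma n := (isCooperad_dualCooperad (n + 1)).isSigma
  zero := isProjectiveExtension_zero 1 r
  succ n := isProjectiveExtension_suspensionStar (n + 1) r
  isSigmaHom n := (h.isHom n).isSigmaHom
  comm n := h.comm n r
  injective n _ := h.injective (fun n => isCooperad_dualCooperad (n + 1))
    (fun n => isCooperadHom_suspensionStar (n + 1)) (fun m => by
      obtain ⟨ρ, hρ, -⟩ := (isProjectiveExtension_suspensionStar (m + 1) r).retraction _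
      exact Function.LeftInverse.injective hρ) n
  exhaustive _ x := h.exhaustive (fun n => isCooperad_dualCooperad (n + 1))
    (fun n => isCooperadHom_suspensionStar (n + 1)) x

/-- The untwisted case `θ = 0`, solved independently in each arity. -/
theorem isCofibrantSigma_of_filtration {L : SigmaData} (hL : IsSigma L) {D : ℕ → ℕ → SigmaData}
    {φ : ∀ r n, GradedMap (D r n) (D r (n + 1))} {ι : ∀ r n, GradedMap (D r n) L}
    (h : ∀ r, IsProjectiveFiltration r (D r) (φ r) L (ι r)) : IsCofibrantSigma L := by
  refine ⟨hL, fun A B hA hB p hp hf hw f hfh => ?_⟩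
  have key := fun r => (h r).exists_lift hA hp hf hw (f := f r) (θ := fun _ => 0)
    { f_act := fun σ y => hfh.map_act σ y
      θ_act := fun h σ y => (map_zero _).symm
      f_d := fun h y => by simp [hfh.map_d]
      θ_d := fun _ _ y => by simp }
  choose g hg using key
  exact ⟨g, ⟨fun h x => by simpa using ((hg _).map_d h x).symm, fun σ x => (hg _).map_act σ x⟩,
    fun r i x => (hg r).proj x⟩

/-! ### Twisting elements -/

/-- The laws of a pseudo-operad: those of an operad, except the ones which concern the unit, the
components of arity `0` and `1`, and the square of the differential. -/
structure IsPseudoOperad (C : OperadData) : Prop where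
  act_one : ∀ {r : ℕ} {i : ℤ} (x : C.X r i), C.act 1 x = x
  act_mul : ∀ {r : ℕ} {i : ℤ} (σ τ : Perm (Fin r)) (x : C.X r i),
    C.act (σ * τ) x = C.act σ (C.act τ x)
  d_act : ∀ {r : ℕ} {i j : ℤ} (h : j + 1 = i) (σ : Perm (Fin r)) (x : C.X r i),
    C.d h (C.act σ x) = C.act σ (C.d h x)
  assoc_seq : ∀ {s t u a b r : ℕ} {i j k l m n : ℤ} (ha : a + 1 = s + t) (hra : r + 1 = a + u)
    (hb : b + 1 = t + u) (hrb : r + 1 = s + b) (hl : i + j = l) (hln : l + k = n)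
    (hm : j + k = m) (hmn : i + m = n) (e : Fin s) (f : Fin t) (g : Fin a), (g : ℕ) = e + f →
    ∀ (p : C.X s i) (q : C.X t j) (x : C.X u k),
    C.comp hra hln g (C.comp ha hl e p q) x = C.comp hrb hmn e p (C.comp hb hm f q x)
  assoc_par : ∀ {s t u a b r : ℕ} {i j k l m n : ℤ} (ha : a + 1 = s + t) (hra : r + 1 = a + u)
    (hb : b + 1 = s + u) (hrb : r + 1 = b + t) (hl : i + j = l) (hln : l + k = n)
    (hm : i + k = m) (hmn : m + j = n) (e f : Fin s) (g : Fin a) (h : Fin b), e < f →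
    (g : ℕ) + 1 = f + t → (h : ℕ) = e →
    ∀ (p : C.X s i) (q : C.X t j) (x : C.X u k),
    C.comp hra hln g (C.comp ha hl e p q) x =
      (j * k).negOnePow • C.comp hrb hmn h (C.comp hb hm f p x) q
  equivariance : ∀ {s t r : ℕ} {i j k : ℤ} (hr : r + 1 = s + t) (hk : i + j = k) (e : Fin s)
    (σ : Perm (Fin s)) (τ : Perm (Fin t)) (p : C.X s i) (q : C.X t j),
    C.comp hr hk (σ e) (C.act σ p) (C.act τ q) = C.act (blockPerm hr e σ τ) (C.comp hr hk e p q)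
  leibniz : ∀ {s t r : ℕ} {i i' j j' k k' : ℤ} (hr : r + 1 = s + t) (hk : i + j = k)
    (hi : i' + 1 = i) (hj : j' + 1 = j) (hk' : k' + 1 = k) (h₁ : i' + j = k') (h₂ : i + j' = k')
    (e : Fin s) (p : C.X s i) (q : C.X t j),
    C.d hk' (C.comp hr hk e p q) =
      C.comp hr h₁ e (C.d hi p) q + i.negOnePow • C.comp hr h₂ e p (C.d hj q)

theorem IsOperad.isPseudoOperad {P : OperadData} (h : IsOperad P) : IsPseudoOperad P where
  act_one := h.isSigma.act_one
  act_mul := h.isSigma.act_mul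
  d_act := h.isSigma.d_act
  assoc_seq := h.assoc_seq
  assoc_par := h.assoc_par
  equivariance := h.equivariance
  leibniz := h.leibniz

/-- Composing with the block permutation that exchanges `0` and `e` reduces to a block placed at
`0`. -/
theorem exists_blockPerm_of_mapsTo {s t r : ℕ} (hr : r + 1 = s + t) (hs : 0 < s) (e : Fin s)
    (g : Perm (Fin r)) (hg : ∀ m : Fin r, (e : ℕ) ≤ m → (m : ℕ) < e + t → ((g m : Fin r) : ℕ) < t) :
    ∃ (σ : Perm (Fin s)) (τ : Perm (Fin t)), σ e = ⟨0, hs⟩ ∧ g = blockPerm hr e σ τ := by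
  obtain ⟨σ, τ, hσ, h⟩ := exists_blockPerm hr hs
    (g * blockPerm hr ⟨0, hs⟩ (Equiv.swap ⟨0, hs⟩ e) 1) (fun m hm => by
      obtain ⟨j, rfl⟩ : ∃ j, m = insFun hr ⟨0, hs⟩ (Sum.inr j) :=
        ⟨⟨m, hm⟩, Fin.ext (Nat.zero_add _).symm⟩
      rw [Perm.mul_apply, blockPerm_inr]
      refine hg _ ?_ ?_ <;> rw [insFun_inr_val, Equiv.swap_apply_left]
      · exact Nat.le_add_right _ _
      · simp)
  refine ⟨σ * Equiv.swap ⟨0, hs⟩ e, τ, by simpa using hσ, ?_⟩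
  have h1 := blockPerm_mul hr e σ (Equiv.swap ⟨0, hs⟩ e) τ 1
  have h2 := blockPerm_mul hr e (Equiv.swap ⟨0, hs⟩ e) (Equiv.swap ⟨0, hs⟩ e) (1 : Perm (Fin t)) 1
  rw [Equiv.swap_apply_right, mul_one] at h1
  rw [Equiv.swap_apply_right, Equiv.swap_mul_self, mul_one, blockPerm_one] at h2
  rw [h1, ← h, mul_assoc, ← h2, mul_one]

theorem card_eq_of_forall_mem_iff {r e t : ℕ} (het : e + t ≤ r) {J : Finset (Fin r)}
    {w : Perm (Fin r)} (hw : ∀ m : Fin r, w m ∈ J ↔ e ≤ (m : ℕ) ∧ (m : ℕ) < e + t) :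
    J.card = t := by
  have : J = (Finset.univ : Finset (Fin t)).map
      ⟨fun j : Fin t => w ⟨e + j, by omega⟩, fun j j' h => by
        have := Fin.val_eq_of_eq (w.injective h)
        exact Fin.ext (by simpa using this)⟩ := by
    ext y
    obtain ⟨m, rfl⟩ := w.surjective y
    rw [hw, Finset.mem_map]
    constructor
    · rintro ⟨h1, h2⟩
      exact ⟨⟨m - e, by omega⟩, Finset.mem_univ _, congrArg w (Fin.ext (by simp; omega))⟩
    · rintro ⟨j, -, h⟩
      rw [← w.injective h]
      simp
  rw [this, Finset.card_map, Finset.card_univ, Fintype.card_fin]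

section Twisting

variable {C : OperadData} {k l : ℤ}

theorem card_add_one {r : ℕ} (J : Finset (Fin r)) : r + 1 = (r + 1 - J.card) + J.card := by
  have := J.card_le_univ
  rw [Fintype.card_fin] at this
  omega

theorem zero_lt_sub_card {r : ℕ} (J : Finset (Fin r)) : 0 < r + 1 - J.card := by
  have := J.card_le_univ
  rw [Fintype.card_fin] at this
  omega

/-- The composite of the elements `x` along the tree with two vertices where the inputs of the
upper vertex are the elements of `J`. -/
def treeTerm (x : ∀ r, C.X r (-1)) (hk : -1 + -1 = k) {r : ℕ} (J : Finset (Fin r)) : C.X r k :=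
  C.act (subsetPerm J)
    (C.comp (card_add_one J) hk ⟨0, zero_lt_sub_card J⟩ (x (r + 1 - J.card)) (x J.card))

/-- The sum of the composites of the elements `x` along the trees with two vertices. -/
def treeSum (x : ∀ r, C.X r (-1)) (hk : -1 + -1 = k) (r : ℕ) : C.X r k :=
  ∑ J : Finset (Fin r), treeTerm x hk J

variable {x : ∀ r, C.X r (-1)}

theorem act_mul_blockPerm_comp (hC : IsPseudoOperad C) {s t r : ℕ} {i j : ℤ} (hr : r + 1 = s + t)
    (hk : i + j = k) (w : Perm (Fin r)) (e e' : Fin s) (σ : Perm (Fin s)) (τ : Perm (Fin t))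
    (he : σ e = e') (p : C.X s i) (q : C.X t j) :
    C.act (w * blockPerm hr e σ τ) (C.comp hr hk e p q) =
      C.act w (C.comp hr hk e' (C.act σ p) (C.act τ q)) := by
  rw [hC.act_mul, ← hC.equivariance, he]

theorem exists_eq_subsetPerm_mul {s t r : ℕ} (hr : r + 1 = s + t) (hs : 0 < s) (e : Fin s)
    {J : Finset (Fin r)} {w : Perm (Fin r)} (hJ : J.card = t)
    (hw : ∀ m : Fin r, w m ∈ J ↔ (e : ℕ) ≤ m ∧ (m : ℕ) < e + t) :
    ∃ (σ : Perm (Fin s)) (τ : Perm (Fin t)), σ e = ⟨0, hs⟩ ∧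
      w = subsetPerm J * blockPerm hr e σ τ := by
  obtain ⟨σ, τ, hσ, h⟩ := exists_blockPerm_of_mapsTo hr hs e ((subsetPerm J)⁻¹ * w)
    (fun m h1 h2 => by
      rw [← hJ, ← mem_subsetPerm, Perm.mul_apply]
      rw [show subsetPerm J ((subsetPerm J)⁻¹ (w m)) = w m from Equiv.apply_symm_apply _ _, hw]
      exact ⟨h1, h2⟩)
  exact ⟨σ, τ, hσ, by rw [← h, mul_inv_cancel_left]⟩

/-- Two ways of sorting the inputs differ by a block permutation, which by equivariance acts through
the two factors, and these are invariant. The term therefore depends on `J` alone, and the block may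
be grafted at any input `e`. -/
theorem treeTerm_eq (hC : IsPseudoOperad C) (hx : ∀ r (σ : Perm (Fin r)), C.act σ (x r) = x r)
    (hk : -1 + -1 = k) {s t r : ℕ} (hr : r + 1 = s + t) (e : Fin s) (J : Finset (Fin r))
    (w : Perm (Fin r)) (hw : ∀ m : Fin r, w m ∈ J ↔ (e : ℕ) ≤ m ∧ (m : ℕ) < e + t) :
    treeTerm x hk J = C.act w (C.comp hr hk e (x s) (x t)) := by
  have he := e.2
  have ht := card_eq_of_forall_mem_iff (by omega) hw
  subst ht
  obtain rfl : s = r + 1 - J.card := by omega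
  obtain ⟨σ, τ, hσ, rfl⟩ := exists_eq_subsetPerm_mul hr (by omega) e rfl hw
  rw [act_mul_blockPerm_comp hC hr hk _ _ _ _ _ hσ, hx, hx]
  rfl

theorem act_treeSum (hC : IsPseudoOperad C) (hx : ∀ r (σ : Perm (Fin r)), C.act σ (x r) = x r)
    (hk : -1 + -1 = k) {r : ℕ} (σ : Perm (Fin r)) :
    C.act σ (treeSum x hk r) = treeSum x hk r := by
  rw [treeSum, map_sum]
  refine Fintype.sum_equiv (Equiv.finsetCongr σ) _ _ fun J => ?_
  rw [treeTerm_eq hC hx hk (card_add_one J) ⟨0, zero_lt_sub_card J⟩ (Equiv.finsetCongr σ J)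
    (σ * subsetPerm J) (fun m => by
      have h := mem_subsetPerm J m
      simp only [Equiv.finsetCongr_apply, Finset.mem_map_equiv, Perm.mul_apply,
        Equiv.symm_apply_apply, h, Nat.zero_le, true_and, Nat.zero_add]), hC.act_mul]
  rfl

/-- The image of the subset `J'` under the contraction of `J` to the input `0`. -/
def pushSubset {r : ℕ} (J J' : Finset (Fin r)) : Finset (Fin (r + 1 - J.card)) :=
  open Classical in
  Finset.univ.filter fun m => if h : m = ⟨0, zero_lt_sub_card J⟩ then J ⊆ J' else
    subsetPerm J (insFun (card_add_one J) ⟨0, zero_lt_sub_card J⟩ (Sum.inl ⟨m, h⟩)) ∈ J'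

theorem zero_mem_pushSubset {r : ℕ} (J J' : Finset (Fin r)) :
    ⟨0, zero_lt_sub_card J⟩ ∈ pushSubset J J' ↔ J ⊆ J' := by
  simp [pushSubset]

theorem mem_pushSubset {r : ℕ} (J J' : Finset (Fin r)) (m : Fin (r + 1 - J.card))
    (h : m ≠ ⟨0, zero_lt_sub_card J⟩) :
    m ∈ pushSubset J J' ↔
      subsetPerm J (insFun (card_add_one J) ⟨0, zero_lt_sub_card J⟩ (Sum.inl ⟨m, h⟩)) ∈ J' := by
  simp [pushSubset, h]

/-- The composite along the tree with three vertices given by `J` and the contraction of `J'`. -/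
def leftTerm (x : ∀ r, C.X r (-1)) (hk : -1 + -1 = k) (hl : k + -1 = l) {r : ℕ} (J : Finset (Fin r))
    (K : Finset (Fin (r + 1 - J.card))) : C.X r l :=
  C.act (subsetPerm J)
    (C.comp (card_add_one J) hl ⟨0, zero_lt_sub_card J⟩ (treeTerm x hk K) (x J.card))

/-- The composite along the tree with three vertices given by `J` and a subset of `J`. -/
def rightTerm (x : ∀ r, C.X r (-1)) (hk : -1 + -1 = k) (hl : -1 + k = l) {r : ℕ} (J : Finset (Fin r))
    (K : Finset (Fin J.card)) : C.X r l :=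
  C.act (subsetPerm J)
    (C.comp (card_add_one J) hl ⟨0, zero_lt_sub_card J⟩ (x (r + 1 - J.card)) (treeTerm x hk K))

/-- A normal form: any `W` that places `J` and `J'` in the prescribed intervals can be used, so two
different terms can be compared with the same `W`. -/
theorem leftTerm_eq (hC : IsPseudoOperad C) (hx : ∀ r (σ : Perm (Fin r)), C.act σ (x r) = x r)
    (hk : -1 + -1 = k) (hl : k + -1 = l) {s t u a r : ℕ} (ha : a + 1 = s + t) (hra : r + 1 = a + u)
    (f : Fin s) (g : Fin a) (J J' : Finset (Fin r)) (W : Perm (Fin r))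
    (hW : ∀ m : Fin r, W m ∈ J ↔ (g : ℕ) ≤ m ∧ (m : ℕ) < g + u)
    (hg : J ⊆ J' ↔ (f : ℕ) ≤ g ∧ (g : ℕ) < f + t)
    (hm : ∀ (m : Fin a) (h : m ≠ g), W (insFun hra g (Sum.inl ⟨m, h⟩)) ∈ J' ↔
      (f : ℕ) ≤ m ∧ (m : ℕ) < f + t) :
    leftTerm x hk hl J (pushSubset J J') =
      C.act W (C.comp hra hl g (C.comp ha hk f (x s) (x t)) (x u)) := by
  have he := g.2
  have ht := card_eq_of_forall_mem_iff (by omega) hW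
  subst ht
  obtain rfl : a = r + 1 - J.card := by omega
  obtain ⟨σ, τ, hσ, rfl⟩ := exists_eq_subsetPerm_mul hra (by omega) g rfl hW
  rw [act_mul_blockPerm_comp hC hra hl _ _ _ _ _ hσ, hx,
    ← treeTerm_eq hC hx hk ha f (pushSubset J J') σ fun m => ?_]
  · rfl
  · rcases eq_or_ne m g with rfl | h
    · rw [hσ, zero_mem_pushSubset, hg]
    · have h' : σ m ≠ ⟨0, zero_lt_sub_card J⟩ := fun h' => h (σ.injective (h'.trans hσ.symm))
      rw [mem_pushSubset J J' (σ m) h', ← hm m h, Perm.mul_apply, blockPerm_inl,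
        insFun_inl_congr _ hσ]

theorem rightTerm_eq (hC : IsPseudoOperad C) (hx : ∀ r (σ : Perm (Fin r)), C.act σ (x r) = x r)
    (hk : -1 + -1 = k) (hl : -1 + k = l) {s t u b r : ℕ} (hb : b + 1 = t + u) (hrb : r + 1 = s + b)
    (e : Fin s) (f : Fin t) (J : Finset (Fin r)) (K : Finset (Fin J.card)) (W : Perm (Fin r))
    (hW : ∀ m : Fin r, W m ∈ J ↔ (e : ℕ) ≤ m ∧ (m : ℕ) < e + b)
    (hm : ∀ (m : Fin b) (m' : Fin J.card), W (insFun hrb e (Sum.inr m)) =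
      subsetPerm J (insFun (card_add_one J) ⟨0, zero_lt_sub_card J⟩ (Sum.inr m')) →
      (m' ∈ K ↔ (f : ℕ) ≤ m ∧ (m : ℕ) < f + u)) :
    rightTerm x hk hl J K =
      C.act W (C.comp hrb hl e (x s) (C.comp hb hk f (x t) (x u))) := by
  have he := e.2
  have ht := card_eq_of_forall_mem_iff (by omega) hW
  subst ht
  obtain rfl : s = r + 1 - J.card := by omega
  obtain ⟨σ, τ, hσ, rfl⟩ := exists_eq_subsetPerm_mul hrb (by omega) e rfl hW
  rw [act_mul_blockPerm_comp hC hrb hl _ _ _ _ _ hσ, hx,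
    ← treeTerm_eq hC hx hk hb f K τ fun m => ?_]
  · rfl
  · refine hm m (τ m) ?_
    rw [Perm.mul_apply, blockPerm_inr, insFun_inr_congr _ hσ]

/-- A permutation which sorts the values of a function. -/
theorem exists_perm_lt_iff {r : ℕ} (key : Fin r → ℕ) :
    ∃ W : Perm (Fin r), ∀ c (m : Fin r),
      key (W m) < c ↔ (m : ℕ) < (Finset.univ.filter fun y => key y < c).card := by
  refine ⟨Tuple.sort key, fun c => ?_⟩
  have hmono := Tuple.monotone_sort key
  set W := Tuple.sort key
  have hcard : (Finset.univ.filter fun y => key y < c).card =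
      (Finset.univ.filter fun m => key (W m) < c).card := by
    refine Eq.trans ?_ (Finset.card_map W.toEmbedding)
    congr 1
    ext y
    obtain ⟨m, rfl⟩ := W.surjective y
    simp
  intro m
  rw [hcard]
  constructor
  · intro h
    have : Finset.Iic m ⊆ Finset.univ.filter fun m => key (W m) < c := fun m' hm' => by
      simp only [Finset.mem_filter, Finset.mem_univ, true_and]
      exact lt_of_le_of_lt (hmono (Finset.mem_Iic.1 hm')) h
    have := Finset.card_le_card this
    rw [Fin.card_Iic] at this
    omega
  · intro h
    by_contra hc
    have : (Finset.univ.filter fun m => key (W m) < c) ⊆ Finset.Iio m := fun m' hm' => by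
      simp only [Finset.mem_filter, Finset.mem_univ, true_and] at hm'
      rw [Finset.mem_Iio]
      by_contra hle
      exact hc (lt_of_le_of_lt (hmono (not_lt.1 hle)) hm')
    have := Finset.card_le_card this
    rw [Fin.card_Iio] at this
    omega

/-- The preimage of a subset `K` under the contraction of `J` to the input `0`. -/
def pullSubset {r : ℕ} (J : Finset (Fin r)) (K : Finset (Fin (r + 1 - J.card))) :
    Finset (Fin r) :=
  Finset.univ.filter fun y => Sum.elim (fun m => m.1) (fun _ => ⟨0, zero_lt_sub_card J⟩)
    ((insEquiv (card_add_one J) ⟨0, zero_lt_sub_card J⟩).symm ((subsetPerm J).symm y)) ∈ K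

theorem inl_mem_pullSubset {r : ℕ} (J : Finset (Fin r)) (K : Finset (Fin (r + 1 - J.card)))
    (m : Fin (r + 1 - J.card)) (h : m ≠ ⟨0, zero_lt_sub_card J⟩) :
    subsetPerm J (insFun (card_add_one J) ⟨0, zero_lt_sub_card J⟩ (Sum.inl ⟨m, h⟩)) ∈
      pullSubset J K ↔ m ∈ K := by
  have := (insEquiv (card_add_one J) ⟨0, zero_lt_sub_card J⟩).symm_apply_apply (Sum.inl ⟨m, h⟩)
  rw [pullSubset, Finset.mem_filter, Equiv.symm_apply_apply]
  erw [this]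
  simp

theorem inr_mem_pullSubset {r : ℕ} (J : Finset (Fin r)) (K : Finset (Fin (r + 1 - J.card)))
    (m : Fin J.card) :
    subsetPerm J (insFun (card_add_one J) ⟨0, zero_lt_sub_card J⟩ (Sum.inr m)) ∈
      pullSubset J K ↔ ⟨0, zero_lt_sub_card J⟩ ∈ K := by
  have := (insEquiv (card_add_one J) ⟨0, zero_lt_sub_card J⟩).symm_apply_apply (Sum.inr m)
  rw [pullSubset, Finset.mem_filter, Equiv.symm_apply_apply]
  erw [this]
  simp

theorem inr_mem {r : ℕ} (J : Finset (Fin r)) (m : Fin J.card) :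
    subsetPerm J (insFun (card_add_one J) ⟨0, zero_lt_sub_card J⟩ (Sum.inr m)) ∈ J := by
  rw [mem_subsetPerm, insFun_inr_val]
  simp

theorem inl_notMem {r : ℕ} (J : Finset (Fin r)) (m : Fin (r + 1 - J.card))
    (h : m ≠ ⟨0, zero_lt_sub_card J⟩) :
    subsetPerm J (insFun (card_add_one J) ⟨0, zero_lt_sub_card J⟩ (Sum.inl ⟨m, h⟩)) ∉ J := by
  rw [mem_subsetPerm, insFun_inl_val]
  have : (m : ℕ) ≠ 0 := fun h' => h (Fin.ext h')
  simp only [Nat.not_lt_zero, if_false]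
  omega

theorem subsetPerm_cases {r : ℕ} (J : Finset (Fin r)) (y : Fin r) :
    (∃ m h, y = subsetPerm J
      (insFun (card_add_one J) ⟨0, zero_lt_sub_card J⟩ (Sum.inl ⟨m, h⟩))) ∨
    ∃ m, y = subsetPerm J (insFun (card_add_one J) ⟨0, zero_lt_sub_card J⟩ (Sum.inr m)) := by
  obtain ⟨z, rfl⟩ := (subsetPerm J).surjective y
  rcases insFun_cases (card_add_one J) ⟨0, zero_lt_sub_card J⟩ z with ⟨i, hi, rfl⟩ | ⟨j, rfl⟩
  exacts [Or.inl ⟨i, hi, rfl⟩, Or.inr ⟨j, rfl⟩]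

/-- A set of inputs of the contracted tree contains the contracted input or not, and its preimage
accordingly contains `J` or is disjoint from it. For empty `J` the preimage would forget the
contracted input. -/
theorem sum_pushSubset {T : Type} [AddCommMonoid T] {r : ℕ} (J : Finset (Fin r)) (hJ : J.Nonempty)
    (F : Finset (Fin (r + 1 - J.card)) → T) :
    ∑ K, F K = ∑ J' with J ⊆ J' ∨ Disjoint J J', F (pushSubset J J') := by
  have hJ' : 0 < J.card := hJ.card_pos
  have hinv : ∀ K, pushSubset J (pullSubset J K) = K := fun K => by
    ext m
    rcases eq_or_ne m ⟨0, zero_lt_sub_card J⟩ with rfl | h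
    · rw [zero_mem_pushSubset]
      constructor
      · exact fun h => (inr_mem_pullSubset J K ⟨0, hJ'⟩).1 (h (inr_mem J _))
      · intro h y hy
        rcases subsetPerm_cases J y with ⟨m, hm, rfl⟩ | ⟨m, rfl⟩
        · exact absurd hy (inl_notMem J m hm)
        · exact (inr_mem_pullSubset J K m).2 h
    · rw [mem_pushSubset J _ m h, inl_mem_pullSubset]
  refine Finset.sum_nbij' (pullSubset J) (pushSubset J) (fun K _ => ?_) (fun _ _ => Finset.mem_univ _)
    (fun K _ => hinv K) (fun J' h => ?_) (fun K _ => by rw [hinv])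
  · rw [Finset.mem_filter]
    refine ⟨Finset.mem_univ _, ?_⟩
    by_cases h : ⟨0, zero_lt_sub_card J⟩ ∈ K
    · left
      rwa [← zero_mem_pushSubset, hinv]
    · right
      rw [Finset.disjoint_left]
      intro y hy
      rcases subsetPerm_cases J y with ⟨m, hm, rfl⟩ | ⟨m, rfl⟩
      · exact absurd hy (inl_notMem J m hm)
      · rwa [inr_mem_pullSubset]
  · have h := (Finset.mem_filter.1 h).2
    ext y
    rcases subsetPerm_cases J y with ⟨m, hm, rfl⟩ | ⟨m, rfl⟩
    · rw [inl_mem_pullSubset, mem_pushSubset]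
    · rw [inr_mem_pullSubset, zero_mem_pushSubset]
      rcases h with h | h
      · exact ⟨fun _ => h (inr_mem J m), fun _ => h⟩
      · have h1 := Finset.disjoint_left.1 h (inr_mem J m)
        exact ⟨fun h' => h' (inr_mem J m), fun h' => absurd h' h1⟩

/-- The subset `J'` of `J`, in the numbering of the elements of `J`. -/
def innerSubset {r : ℕ} (J J' : Finset (Fin r)) : Finset (Fin J.card) :=
  Finset.univ.filter fun m =>
    subsetPerm J (insFun (card_add_one J) ⟨0, zero_lt_sub_card J⟩ (Sum.inr m)) ∈ J'

theorem sum_innerSubset {T : Type} [AddCommMonoid T] {r : ℕ} (J : Finset (Fin r))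
    (F : Finset (Fin J.card) → T) :
    ∑ K, F K = ∑ J' with J' ⊆ J, F (innerSubset J J') := by
  let φ : Fin J.card → Fin r := fun m =>
    subsetPerm J (insFun (card_add_one J) ⟨0, zero_lt_sub_card J⟩ (Sum.inr m))
  have hφ : Function.Injective φ := fun m m' h =>
    Sum.inr_injective (insFun_injective _ _ ((subsetPerm J).injective h))
  have hinv : ∀ K : Finset (Fin J.card), innerSubset J (K.image φ) = K := fun K => by
    ext m
    change m ∈ Finset.univ.filter (fun m => φ m ∈ K.image φ) ↔ _
    simp only [Finset.mem_filter, Finset.mem_univ, true_and, Finset.mem_image]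
    exact ⟨fun ⟨m', hm', h⟩ => hφ h ▸ hm', fun h => ⟨m, h, rfl⟩⟩
  refine Finset.sum_nbij' (fun K => K.image φ) (innerSubset J) (fun K _ => ?_)
    (fun _ _ => Finset.mem_univ _) (fun K _ => hinv K) (fun J' h => ?_) (fun K _ => by rw [hinv])
  · rw [Finset.mem_filter]
    refine ⟨Finset.mem_univ _, fun y hy => ?_⟩
    obtain ⟨m, -, rfl⟩ := Finset.mem_image.1 hy
    exact inr_mem J m
  · have h := (Finset.mem_filter.1 h).2
    ext y
    rw [Finset.mem_image]
    constructor
    · rintro ⟨m, hm, rfl⟩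
      exact (Finset.mem_filter.1 hm).2
    · intro hy
      rcases subsetPerm_cases J y with ⟨m, hm, rfl⟩ | ⟨m, rfl⟩
      · exact absurd (h hy) (inl_notMem J m hm)
      · exact ⟨m, Finset.mem_filter.2 ⟨Finset.mem_univ _, hy⟩, rfl⟩

/-- Sorting the inputs with `J` first, then the rest of `J'`, then the others, makes both sides the
same sequential triple composite, bracketed in two ways. -/
theorem leftTerm_eq_rightTerm (hC : IsPseudoOperad C)
    (hx : ∀ r (σ : Perm (Fin r)), C.act σ (x r) = x r) (hk : -1 + -1 = k) (hl : k + -1 = l)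
    (hl' : -1 + k = l) {r : ℕ} (J J' : Finset (Fin r)) (hJ : J.Nonempty) (hJJ' : J ⊆ J') :
    leftTerm x hk hl J (pushSubset J J') = rightTerm x hk hl' J' (innerSubset J' J) := by
  classical
  obtain ⟨W, hW⟩ := exists_perm_lt_iff fun y => if y ∈ J then 0 else if y ∈ J' then 1 else 2
  have h1 : ∀ m, W m ∈ J ↔ (m : ℕ) < J.card := fun m => by
    have h := hW 1 m
    have e1 : ∀ y : Fin r, (if y ∈ J then 0 else if y ∈ J' then 1 else 2) < 1 ↔ y ∈ J :=
      fun y => by split_ifs <;> simp_all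
    simpa only [e1, Finset.filter_mem_eq_inter, Finset.univ_inter] using h
  have h2 : ∀ m, W m ∈ J' ↔ (m : ℕ) < J'.card := fun m => by
    have h := hW 2 m
    have e1 : ∀ y : Fin r, (if y ∈ J then 0 else if y ∈ J' then 1 else 2) < 2 ↔ y ∈ J' :=
      fun y => by
        have := @hJJ' y
        split_ifs <;> simp_all
    simpa only [e1, Finset.filter_mem_eq_inter, Finset.univ_inter] using h
  have hu := hJ.card_pos
  have hub := Finset.card_le_card hJJ'
  have hb := card_add_one J'
  have hs := zero_lt_sub_card J'
  have ha := card_add_one J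
  rw [leftTerm_eq hC hx hk hl (s := r + 1 - J'.card) (t := J'.card + 1 - J.card)
      (a := r + 1 - J.card) (by omega) ha ⟨0, hs⟩ ⟨0, zero_lt_sub_card J⟩ J J' W
      (fun m => by rw [h1]; simp) (by simp [hJJ']; omega) (fun m hm => by
        have : (m : ℕ) ≠ 0 := fun h => hm (Fin.ext h)
        rw [h2, insFun_inl_val]
        simp only [Nat.not_lt_zero, if_false]
        omega),
    rightTerm_eq hC hx hk hl' (s := r + 1 - J'.card) (t := J'.card + 1 - J.card)
      (u := J.card) (b := J'.card) (by omega) hb ⟨0, hs⟩ ⟨0, by omega⟩ J' (innerSubset J' J) W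
      (fun m => by rw [h2]; simp) (fun m m' h => by
        rw [innerSubset, Finset.mem_filter, ← h, h1, insFun_inr_val]
        simp)]
  exact congrArg _ (hC.assoc_seq _ _ _ _ _ _ _ _ _ _ _ rfl _ _ _)

/-- Grafting at two different inputs in either order gives the same parallel composite up to
`(-1)^{jk}`, which is `-1` because both grafted elements have degree `-1`. -/
theorem leftTerm_add_leftTerm (hC : IsPseudoOperad C)
    (hx : ∀ r (σ : Perm (Fin r)), C.act σ (x r) = x r) (hk : -1 + -1 = k) (hl : k + -1 = l)
    {r : ℕ} (J J' : Finset (Fin r)) (hJ : J.Nonempty) (hJ' : J'.Nonempty) (hJJ' : Disjoint J J') :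
    leftTerm x hk hl J (pushSubset J J') + leftTerm x hk hl J' (pushSubset J' J) = 0 := by
  classical
  obtain ⟨W, hW⟩ := exists_perm_lt_iff fun y => if y ∈ J then 0 else if y ∈ J' then 1 else 2
  have h1 : ∀ m, W m ∈ J ↔ (m : ℕ) < J.card := fun m => by
    have h := hW 1 m
    have e1 : ∀ y : Fin r, (if y ∈ J then 0 else if y ∈ J' then 1 else 2) < 1 ↔ y ∈ J :=
      fun y => by split_ifs <;> simp_all
    simpa only [e1, Finset.filter_mem_eq_inter, Finset.univ_inter] using h
  have h2 : ∀ m, W m ∈ J' ↔ J.card ≤ (m : ℕ) ∧ (m : ℕ) < J.card + J'.card := fun m => by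
    have h := hW 2 m
    have e1 : ∀ y : Fin r, (if y ∈ J then 0 else if y ∈ J' then 1 else 2) < 2 ↔ y ∈ J ∪ J' :=
      fun y => by
        rw [Finset.mem_union]
        split_ifs <;> simp_all
    simp only [e1, Finset.filter_mem_eq_inter, Finset.univ_inter] at h
    rw [Finset.card_union_of_disjoint hJJ', Finset.mem_union] at h
    have h3 := h1 m
    have h4 : W m ∈ J → W m ∉ J' := fun h => Finset.disjoint_left.1 hJJ' h
    constructor
    · intro h5
      have h6 : ¬ (m : ℕ) < J.card := fun h6 => h4 (h3.2 h6) h5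
      exact ⟨not_lt.1 h6, h.1 (Or.inr h5)⟩
    · rintro ⟨h5, h6⟩
      exact (h.2 h6).resolve_left fun h7 => by have := h3.1 h7; omega
  have hu := hJ.card_pos
  have ht := hJ'.card_pos
  have hle : J.card + J'.card ≤ r := by
    rw [← Finset.card_union_of_disjoint hJJ']
    simpa using (J ∪ J').card_le_univ
  have ha := card_add_one J
  have ha' := card_add_one J'
  have hsub : ¬ J ⊆ J' := fun h => by
    obtain ⟨y, hy⟩ := hJ
    exact Finset.disjoint_left.1 hJJ' hy (h hy)
  have hsub' : ¬ J' ⊆ J := fun h => by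
    obtain ⟨y, hy⟩ := hJ'
    exact Finset.disjoint_left.1 hJJ' (h hy) hy
  rw [leftTerm_eq hC hx hk hl (s := r + 2 - J.card - J'.card) (t := J'.card)
      (a := r + 1 - J.card) (by omega) ha ⟨1, by omega⟩ ⟨0, zero_lt_sub_card J⟩ J J' W
      (fun m => by rw [h1]; simp) (by simp [hsub]) (fun m hm => by
        have : (m : ℕ) ≠ 0 := fun h => hm (Fin.ext h)
        rw [h2, insFun_inl_val]
        simp only [Nat.not_lt_zero, if_false]
        omega),
    leftTerm_eq hC hx hk hl (s := r + 2 - J.card - J'.card) (t := J.card)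
      (a := r + 1 - J'.card) (by omega) ha' ⟨0, by omega⟩ ⟨J.card, by omega⟩ J' J W
      (fun m => by rw [h2]) (by simp [hsub']) (fun m hm => by
        have : (m : ℕ) ≠ J.card := fun h => hm (Fin.ext h)
        rw [h1, insFun_inl_val]
        simp only
        split_ifs <;> omega)]
  refine (congrArg (_ + ·) (congrArg (C.act W) (hC.assoc_par
    (s := r + 2 - J.card - J'.card) _ _ (by omega) ha hk hl hk hl _
    ⟨1, by omega⟩ _ ⟨0, zero_lt_sub_card J⟩ (Nat.zero_lt_one) ?_ rfl _ _ _))).trans ?_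
  · simp; omega
  · simp

/-- Let `x` be a family of invariant elements of degree `-1`, which vanishes in arity `0` and `1`.
If the equation of twisting elements holds in arity less than `r`, then the sum over the trees with
two vertices is a cycle in arity `r`. -/
theorem d_treeSum (hC : IsPseudoOperad C) (hx : ∀ r (σ : Perm (Fin r)), C.act σ (x r) = x r)
    (hx0 : x 0 = 0) (hx1 : x 1 = 0) (hk : -1 + -1 = k) (hk' : k + 1 = -1) (hl : l + 1 = k) {r : ℕ}
    (h : ∀ s < r, C.d hk' (x s) = treeSum x hk s) : C.d hl (treeSum x hk r) = 0 := by
  classical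
  have hl₁ : k + -1 = l := by omega
  have hl₂ : -1 + k = l := by omega
  -- The Leibniz rule, with the sign of a first factor of degree `-1`. The equation in smaller
  -- arities replaces differentials by sums over trees; where the arity is too large for it, the
  -- other factor vanishes.
  have hJ : ∀ J : Finset (Fin r), C.d hl (treeTerm x hk J) =
      ∑ K, leftTerm x hk hl₁ J K - ∑ K, rightTerm x hk hl₂ J K := fun J => by
    have hle := J.card_le_univ
    rw [Fintype.card_fin] at hle
    have e1 : C.comp (card_add_one J) hl₁ ⟨0, zero_lt_sub_card J⟩ (C.d hk' (x (r + 1 - J.card)))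
        (x J.card) = C.comp (card_add_one J) hl₁ ⟨0, zero_lt_sub_card J⟩
          (treeSum x hk (r + 1 - J.card)) (x J.card) := by
      rcases Nat.lt_or_ge 1 J.card with h1 | h1
      · rw [h _ (by omega)]
      · have : x J.card = 0 := by
          generalize J.card = n at h1
          interval_cases n <;> assumption
        rw [this, map_zero, map_zero]
    have e2 : C.comp (card_add_one J) hl₂ ⟨0, zero_lt_sub_card J⟩ (x (r + 1 - J.card))
        (C.d hk' (x J.card)) = C.comp (card_add_one J) hl₂ ⟨0, zero_lt_sub_card J⟩
          (x (r + 1 - J.card)) (treeSum x hk J.card) := by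
      rcases Nat.lt_or_ge J.card r with h1 | h1
      · rw [h _ h1]
      · have : x (r + 1 - J.card) = 0 := by
          generalize hn : r + 1 - J.card = n
          obtain rfl : n = 1 := by omega
          exact hx1
        rw [this, map_zero, LinearMap.zero_apply, LinearMap.zero_apply]
    rw [treeTerm, hC.d_act, hC.leibniz _ hk hk' hk' hl hl₁ hl₂, e1, e2, treeSum, treeSum, map_add,
      map_sum, LinearMap.sum_apply, map_sum, map_units_smul, map_sum, map_sum, Int.negOnePow_neg,
      Int.negOnePow_one, Units.neg_smul, one_smul, ← sub_eq_add_neg]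
    rfl
  have hL0 : ∀ K, leftTerm x hk hl₁ (∅ : Finset (Fin r)) K = 0 := fun K => by
    have : x (∅ : Finset (Fin r)).card = 0 := hx0
    rw [leftTerm, this, map_zero, map_zero]
  have hT0 : ∀ {s : ℕ}, treeTerm x hk (∅ : Finset (Fin s)) = 0 := fun {s} => by
    have : x (∅ : Finset (Fin s)).card = 0 := hx0
    rw [treeTerm, this, map_zero, map_zero]
  rw [treeSum, map_sum, Finset.sum_congr rfl fun J _ => hJ J, Finset.sum_sub_distrib, sub_eq_zero]
  have hR : ∑ J : Finset (Fin r), ∑ K, rightTerm x hk hl₂ J K =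
      ∑ J' : Finset (Fin r), ∑ J : Finset (Fin r),
        if J'.Nonempty ∧ J' ⊆ J then rightTerm x hk hl₂ J (innerSubset J J') else 0 := by
    rw [Finset.sum_comm]
    refine Finset.sum_congr rfl fun J _ => ?_
    rw [sum_innerSubset, Finset.sum_filter]
    refine Finset.sum_congr rfl fun J' _ => ?_
    by_cases hJ' : J'.Nonempty
    · simp [hJ']
    · rw [Finset.not_nonempty_iff_eq_empty] at hJ'
      subst hJ'
      have : innerSubset J ∅ = ∅ := by simp [innerSubset]
      simp [this, rightTerm, hT0]
  -- Exchanging `J` and `J'` is an involution without fixed points on pairs of disjoint non-empty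
  -- subsets, and it changes the sign of the terms.
  have hLd : ∑ J : Finset (Fin r), ∑ J' : Finset (Fin r),
      (if J.Nonempty ∧ J'.Nonempty ∧ Disjoint J J' then leftTerm x hk hl₁ J (pushSubset J J')
        else 0) = 0 := by
    rw [← Finset.sum_product', ← Finset.sum_filter]
    refine Finset.sum_involution (fun p _ => p.swap) ?_ ?_ ?_ ?_
    · rintro ⟨J, J'⟩ hp
      obtain ⟨-, h1, h2, h3⟩ := Finset.mem_filter.1 hp
      exact leftTerm_add_leftTerm hC hx hk hl₁ J J' h1 h2 h3
    · rintro ⟨J, J'⟩ hp - heq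
      obtain ⟨-, h1, h2, h3⟩ := Finset.mem_filter.1 hp
      obtain rfl : J' = J := congrArg Prod.fst heq
      exact h1.ne_empty (disjoint_self.1 h3)
    · rintro ⟨J, J'⟩ hp
      obtain ⟨-, h1, h2, h3⟩ := Finset.mem_filter.1 hp
      exact Finset.mem_filter.2 ⟨Finset.mem_univ _, h2, h1, h3.symm⟩
    · rintro ⟨J, J'⟩ hp
      rfl
  rw [hR]
  -- Adding this vanishing sum to the right-hand side makes the two sides agree term by term.
  refine Eq.trans ?_ ((congrArg (_ + ·) hLd).trans (add_zero _))
  rw [← Finset.sum_add_distrib]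
  refine Finset.sum_congr rfl fun J _ => ?_
  rcases J.eq_empty_or_nonempty with rfl | hJ
  · rw [Finset.sum_congr rfl fun K _ => hL0 K]
    simp
  · rw [sum_pushSubset J hJ, Finset.sum_filter, ← Finset.sum_add_distrib]
    refine Finset.sum_congr rfl fun J' _ => ?_
    by_cases h1 : J ⊆ J'
    · have h2 : ¬ Disjoint J J' := fun h2 =>
        hJ.ne_empty (disjoint_self.1 (h2.mono_right h1))
      simp [h1, h2, hJ, leftTerm_eq_rightTerm hC hx hk hl₁ hl₂ J J' hJ h1]
    · by_cases h2 : Disjoint J J'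
      · rcases J'.eq_empty_or_nonempty with rfl | hJ'
        · have : pushSubset J ∅ = ∅ := by
            ext m
            rcases eq_or_ne m ⟨0, zero_lt_sub_card J⟩ with rfl | h
            · rw [zero_mem_pushSubset]
              simpa using h1
            · rw [mem_pushSubset J _ m h]
              simp
          simp [h1, this, leftTerm, hT0]
        · simp [h1, h2, hJ, hJ']
      · simp [h1, h2]

end Twisting

/-! ### The convolution pseudo-operad -/

/-! ### Locally finite sums of maps on tensor products. -/

section FinsumTensor

open TensorProduct

variable {M N T N' R : Type} [AddCommGroup M] [AddCommGroup N] [AddCommGroup T] [AddCommGroup N']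
  [AddCommGroup R] {Q : ℤ → Type} [∀ x, AddCommGroup (Q x)] [∀ x, Module ℤ (Q x)]

theorem rTensor_finite (Δ : ∀ x, M →ₗ[ℤ] Q x)
    (hΔ : ∀ m, {x | Δ x m ≠ 0}.Finite) (z : M ⊗[ℤ] N) :
    {x | (Δ x).rTensor N z ≠ 0}.Finite := by
  induction z with
  | zero => simp
  | tmul m n =>
    refine (hΔ m).subset fun x hx h => hx ?_
    simp only [LinearMap.rTensor_tmul, h, zero_tmul]
  | add y z hy hz =>
    refine (hy.union hz).subset fun x hx => ?_
    by_contra h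
    simp only [Set.mem_union, Set.mem_ofPred_eq, not_or, not_not] at h
    exact hx (by simp only [map_add, h.1, h.2, add_zero])

theorem lTensor_finite (Δ : ∀ x, N →ₗ[ℤ] Q x)
    (hΔ : ∀ m, {x | Δ x m ≠ 0}.Finite) (z : M ⊗[ℤ] N) :
    {x | (Δ x).lTensor M z ≠ 0}.Finite := by
  induction z with
  | zero => simp
  | tmul m n =>
    refine (hΔ n).subset fun x hx h => hx ?_
    simp only [LinearMap.lTensor_tmul, h, tmul_zero]
  | add y z hy hz =>
    refine (hy.union hz).subset fun x hx => ?_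
    by_contra h
    simp only [Set.mem_union, Set.mem_ofPred_eq, not_or, not_not] at h
    exact hx (by simp only [map_add, h.1, h.2, add_zero])

theorem finite_support_of_vanish {ι B : Type} {A : ι → Type} [∀ x, Zero (A x)] [Zero B]
    {f : ∀ x, A x} {g : ι → B} (hf : {x | f x ≠ 0}.Finite) (h : ∀ x, f x = 0 → g x = 0) :
    (Function.support g).Finite :=
  hf.subset fun x hx h' => hx (h x h')

/-- A convolution product is a sum over all splittings of the degree, of which finitely many matter
for a given element. This moves such a sum out of a further product. -/
theorem lift_finsum_left (φ : T →ₗ[ℤ] N' →ₗ[ℤ] R) (G : M →ₗ[ℤ] T) (X : N →ₗ[ℤ] N')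
    (Δ : ∀ x, M →ₗ[ℤ] Q x) (f : ∀ x, Q x →ₗ[ℤ] T) (u : ℤ → ℤ)
    (hΔ : ∀ m, {x | Δ x m ≠ 0}.Finite)
    (hG : ∀ m, G m = ∑ᶠ x, u x • f x (Δ x m)) (z : M ⊗[ℤ] N) :
    lift (φ.compl₁₂ G X) z = ∑ᶠ x, u x • lift (φ.compl₁₂ (f x) X) ((Δ x).rTensor N z) := by
  induction z with
  | zero => simp only [map_zero, smul_zero, finsum_zero]
  | tmul m n =>
    rw [lift.tmul, LinearMap.compl₁₂_apply, hG]
    refine ((φ.flip (X n)).toAddMonoidHom.map_finsum (finite_support_of_vanish (hΔ m)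
      (fun x h => by rw [h, map_zero, smul_zero]))).trans (finsum_congr fun x => ?_)
    rw [LinearMap.rTensor_tmul, lift.tmul, LinearMap.compl₁₂_apply]
    exact map_smul (φ.flip (X n)) _ _
  | add y z hy hz =>
    simp only [map_add, smul_add, hy, hz]
    refine (finsum_add_distrib ?_ ?_).symm
    · exact finite_support_of_vanish (rTensor_finite Δ hΔ y)
        (fun x h => by rw [h, map_zero, smul_zero])
    · exact finite_support_of_vanish (rTensor_finite Δ hΔ z)
        (fun x h => by rw [h, map_zero, smul_zero])

theorem lift_finsum_right (φ : N' →ₗ[ℤ] T →ₗ[ℤ] R) (G : N →ₗ[ℤ] T) (X : M →ₗ[ℤ] N')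
    (Δ : ∀ x, N →ₗ[ℤ] Q x) (f : ∀ x, Q x →ₗ[ℤ] T) (u : ℤ → ℤ)
    (hΔ : ∀ m, {x | Δ x m ≠ 0}.Finite)
    (hG : ∀ m, G m = ∑ᶠ x, u x • f x (Δ x m)) (z : M ⊗[ℤ] N) :
    lift (φ.compl₁₂ X G) z = ∑ᶠ x, u x • lift (φ.compl₁₂ X (f x)) ((Δ x).lTensor M z) := by
  induction z with
  | zero => simp only [map_zero, smul_zero, finsum_zero]
  | tmul m n =>
    rw [lift.tmul, LinearMap.compl₁₂_apply, hG]
    refine ((φ (X m)).toAddMonoidHom.map_finsum (finite_support_of_vanish (hΔ n)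
      (fun x h => by rw [h, map_zero, smul_zero]))).trans (finsum_congr fun x => ?_)
    rw [LinearMap.lTensor_tmul, lift.tmul, LinearMap.compl₁₂_apply]
    exact map_smul (φ (X m)) _ _
  | add y z hy hz =>
    simp only [map_add, smul_add, hy, hz]
    refine (finsum_add_distrib ?_ ?_).symm
    · exact finite_support_of_vanish (lTensor_finite Δ hΔ y)
        (fun x h => by rw [h, map_zero, smul_zero])
    · exact finite_support_of_vanish (lTensor_finite Δ hΔ z)
        (fun x h => by rw [h, map_zero, smul_zero])

/-- A single sum over `ℤ × ℤ` with finite support allows both indices to be changed at once. -/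
theorem finsum_finsum_reindex (E : ℤ × ℤ ≃ ℤ × ℤ) (F F' : ℤ → ℤ → R)
    (hF : (Function.support fun p : ℤ × ℤ => F p.1 p.2).Finite)
    (h : ∀ p : ℤ × ℤ, F p.1 p.2 = F' (E p).1 (E p).2) :
    ∑ᶠ y, ∑ᶠ x, F y x = ∑ᶠ y, ∑ᶠ x, F' y x := by
  have hF' : (Function.support fun p : ℤ × ℤ => F' p.1 p.2).Finite := by
    refine (hF.image E).subset fun p hp => ⟨E.symm p, ?_, E.apply_symm_apply p⟩
    rw [Function.mem_support, h, E.apply_symm_apply]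
    exact hp
  rw [← finsum_curry _ hF, ← finsum_curry _ hF', finsum_congr h]
  exact finsum_comp_equiv E (f := fun p : ℤ × ℤ => F' p.1 p.2)

theorem finite_support_prod {A : ℤ → Type} [∀ y, Zero (A y)] {f : ∀ y, A y}
    (hf : {y | f y ≠ 0}.Finite)
    (F : ℤ → ℤ → R) (h0 : ∀ y, f y = 0 → ∀ x, F y x = 0)
    (hF : ∀ y, (Function.support (F y)).Finite) :
    (Function.support fun p : ℤ × ℤ => F p.1 p.2).Finite := by
  refine (hf.biUnion fun y _ => (hF y).image (Prod.mk y)).subset fun p hp => ?_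
  simp only [Set.mem_iUnion]
  exact ⟨p.1, fun h => hp (h0 _ h _), p.2, hp, rfl⟩

end FinsumTensor

/-! ### Composites, differential and laws of the convolution. -/

section Convolution

open TensorProduct

/-- The families of homomorphisms `D(r)_a → P(r)_{a + i}`. -/
abbrev ConvHom (D : CooperadData) (P : OperadData) (r : ℕ) (i : ℤ) : Type :=
  ∀ p : {p : ℤ × ℤ // p.1 + i = p.2}, D.X r p.1.1 →ₗ[ℤ] P.X r p.1.2

variable {D : CooperadData} {P : OperadData}

theorem convHom_ext {r : ℕ} {i : ℤ} {A B : ConvHom D P r i}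
    (h : ∀ n m (hn : n + i = m) c, A ⟨(n, m), hn⟩ c = B ⟨(n, m), hn⟩ c) : A = B :=
  funext fun ⟨(n, m), hn⟩ => LinearMap.ext fun c => h n m hn c

/-- The component of degree `(a, b)` of the convolution product `A ∘_e B`. -/
def convTerm {s t r : ℕ} {i j k n m : ℤ} (hr : r + 1 = s + t) (hk : i + j = k) (e : Fin s)
    (h : n + k = m) (A : ConvHom D P s i) (B : ConvHom D P t j) {a b : ℤ} (hab : a + b = n) :
    D.X r n →ₗ[ℤ] P.X r m :=
  ((j * a).negOnePow : ℤ) •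
    (lift ((P.comp hr (show a + i + (b + j) = m by omega) e).compl₁₂ (A ⟨(a, a + i), rfl⟩)
      (B ⟨(b, b + j), rfl⟩)) ∘ₗ D.decomp hr hab e)

theorem convTerm_apply {s t r : ℕ} {i j k n m : ℤ} (hr : r + 1 = s + t) (hk : i + j = k) (e : Fin s)
    (h : n + k = m) (A : ConvHom D P s i) (B : ConvHom D P t j) {a b : ℤ} (hab : a + b = n)
    (c : D.X r n) : convTerm hr hk e h A B hab c = ((j * a).negOnePow : ℤ) •
      lift ((P.comp hr (show a + i + (b + j) = m by omega) e).compl₁₂ (A ⟨(a, a + i), rfl⟩)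
        (B ⟨(b, b + j), rfl⟩)) (D.decomp hr hab e c) := rfl

theorem decomp_finite (hD : IsCooperad D) {s t r : ℕ} {n : ℤ} (hr : r + 1 = s + t) (e : Fin s)
    (c : D.X r n) :
    {a | D.decomp hr (show a + (n - a) = n by omega) e c ≠ 0}.Finite := by
  refine ((hD.finite hr e c).preimage (f := fun a : ℤ => (a, n - a)) ?_).subset ?_
  · intro a _ b _ hab
    exact congrArg Prod.fst hab
  · intro a ha
    exact ⟨show a + (n - a) = n by omega, ha⟩

theorem convTerm_finite (hD : IsCooperad D) {s t r : ℕ} {i j k n m : ℤ} (hr : r + 1 = s + t)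
    (hk : i + j = k) (e : Fin s) (h : n + k = m) (A : ConvHom D P s i) (B : ConvHom D P t j)
    (c : D.X r n) : (Function.support fun a =>
      convTerm hr hk e h A B (show a + (n - a) = n by omega) c).Finite :=
  finite_support_of_vanish (decomp_finite hD hr e c) fun a ha => by
    rw [convTerm_apply, ha, map_zero, smul_zero]

/-- The partial composites of the convolution pseudo-operad. -/
def convComp (hD : IsCooperad D) {s t r : ℕ} {i j k : ℤ} (hr : r + 1 = s + t) (hk : i + j = k)
    (e : Fin s) (A : ConvHom D P s i) (B : ConvHom D P t j) : ConvHom D P r k := fun p =>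
  AddMonoidHom.toIntLinearMap (AddMonoidHom.mk'
    (fun c => ∑ᶠ a, convTerm hr hk e p.2 A B (show a + (p.1.1 - a) = p.1.1 by omega) c)
    fun c c' => by
      simp only [map_add]
      exact finsum_add_distrib (convTerm_finite hD hr hk e p.2 A B c)
        (convTerm_finite hD hr hk e p.2 A B c'))

theorem convComp_apply (hD : IsCooperad D) {s t r : ℕ} {i j k n m : ℤ} (hr : r + 1 = s + t)
    (hk : i + j = k) (e : Fin s) (A : ConvHom D P s i) (B : ConvHom D P t j) (h : n + k = m)
    (c : D.X r n) : convComp hD hr hk e A B ⟨(n, m), h⟩ c =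
      ∑ᶠ a, convTerm hr hk e h A B (show a + (n - a) = n by omega) c := rfl

/-- The differential of homomorphisms. -/
def convDiff (D : CooperadData) (P : OperadData) {r : ℕ} {i j : ℤ} (h : j + 1 = i) :
    ConvHom D P r i →ₗ[ℤ] ConvHom D P r j :=
  AddMonoidHom.toIntLinearMap (AddMonoidHom.mk'
    (fun A p => P.d rfl ∘ₗ A ⟨(p.1.1, p.1.2 + 1), by have := p.2; omega⟩ - (i.negOnePow : ℤ) •
      (A ⟨(p.1.1 - 1, p.1.2), by have := p.2; omega⟩ ∘ₗ D.d (sub_add_cancel p.1.1 1)))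
    fun A B => convHom_ext fun n m hn c => by
      simp only [Pi.add_apply, LinearMap.sub_apply, LinearMap.comp_apply, LinearMap.add_apply,
        LinearMap.smul_apply, map_add, smul_add]
      abel)

/-- The action of permutations on homomorphisms by conjugation. -/
def convAct (D : CooperadData) (P : OperadData) {r : ℕ} {i : ℤ} (σ : Perm (Fin r)) :
    ConvHom D P r i →ₗ[ℤ] ConvHom D P r i :=
  AddMonoidHom.toIntLinearMap (AddMonoidHom.mk'
    (fun A p => P.act σ ∘ₗ A p ∘ₗ D.act σ⁻¹) fun A B => convHom_ext fun n m hn c => by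
      simp only [Pi.add_apply, LinearMap.comp_apply, LinearMap.add_apply, map_add])

/-- The convolution pseudo-operad `Hom(D, P)` (its operadic unit is not specified). -/
def conv (hD : IsCooperad D) (P : OperadData) : OperadData where
  X r i := ConvHom D P r i
  d h := convDiff D P h
  act σ := convAct D P σ
  one _ := 0
  comp {s t r i j k} hr hk e := AddMonoidHom.toIntLinearMap (AddMonoidHom.mk'
    (fun A => AddMonoidHom.toIntLinearMap (AddMonoidHom.mk' (fun B => convComp hD hr hk e A B)
      fun B B' => convHom_ext fun n m hn c => by
        rw [Pi.add_apply, LinearMap.add_apply, convComp_apply, convComp_apply, convComp_apply,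
          ← finsum_add_distrib (convTerm_finite hD hr hk e hn A B c)
            (convTerm_finite hD hr hk e hn A B' c)]
        refine finsum_congr fun a => ?_
        rw [convTerm_apply, convTerm_apply, convTerm_apply, ← smul_add]
        congr 1
        generalize D.decomp hr _ e c = z
        induction z with
        | zero => simp only [map_zero, add_zero]
        | add y z hy hz => simp only [map_add, hy, hz]; abel
        | tmul y z => simp only [lift.tmul, LinearMap.compl₁₂_apply, Pi.add_apply,
            LinearMap.add_apply, map_add]))
    fun A A' => LinearMap.ext fun B => convHom_ext fun n m hn c => by
      change convComp hD hr hk e (A + A') B ⟨(n, m), hn⟩ c =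
        convComp hD hr hk e A B ⟨(n, m), hn⟩ c + convComp hD hr hk e A' B ⟨(n, m), hn⟩ c
      rw [convComp_apply, convComp_apply, convComp_apply,
          ← finsum_add_distrib (convTerm_finite hD hr hk e hn A B c)
            (convTerm_finite hD hr hk e hn A' B c)]
      refine finsum_congr fun a => ?_
      rw [convTerm_apply, convTerm_apply, convTerm_apply, ← smul_add]
      congr 1
      generalize D.decomp hr _ e c = z
      induction z with
      | zero => simp only [map_zero, add_zero]
      | add y z hy hz => simp only [map_add, hy, hz]; abel
      | tmul y z => simp only [lift.tmul, LinearMap.compl₁₂_apply, Pi.add_apply,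
          LinearMap.add_apply, map_add])

theorem convAct_apply {r : ℕ} {i n m : ℤ} (σ : Perm (Fin r))
    (A : ConvHom D P r i) (hn : n + i = m) (c : D.X r n) :
    convAct D P σ A ⟨(n, m), hn⟩ c = P.act σ (A ⟨(n, m), hn⟩ (D.act σ⁻¹ c)) := rfl


theorem convDiff_apply {r : ℕ} {i j n n' m m' : ℤ} (h : j + 1 = i)
    (A : ConvHom D P r i) (hn : n + j = m) (hm : m + 1 = m') (hn' : n' + 1 = n) (h₁ : n + i = m')
    (h₂ : n' + i = m) (c : D.X r n) :
    convDiff D P h A ⟨(n, m), hn⟩ c =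
      P.d hm (A ⟨(n, m'), h₁⟩ c) - (i.negOnePow : ℤ) • A ⟨(n', m), h₂⟩ (D.d hn' c) := by
  subst hm
  obtain rfl : n' = n - 1 := by omega
  rfl

theorem convComp_equivariance (hD : IsCooperad D) (hP : IsPseudoOperad P) {s t r : ℕ} {i j k : ℤ}
    (hr : r + 1 = s + t) (hk : i + j = k) (e : Fin s) (σ : Perm (Fin s)) (τ : Perm (Fin t))
    (A : ConvHom D P s i) (B : ConvHom D P t j) :
    convComp hD hr hk (σ e) (convAct D P σ A) (convAct D P τ B) =
      convAct D P (blockPerm hr e σ τ) (convComp hD hr hk e A B) := by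
  refine convHom_ext fun n m hn c => ?_
  rw [convAct_apply]
  refine Eq.trans ?_ ((P.act (blockPerm hr e σ τ)).toAddMonoidHom.map_finsum
    (convTerm_finite hD hr hk e hn A B _)).symm
  refine finsum_congr fun a => ?_
  have h1 := hD.equivariance hr (show a + (n - a) = n by omega) e σ τ
    (D.act (blockPerm hr e σ τ)⁻¹ c)
  rw [← hD.isSigma.act_mul, mul_inv_cancel, hD.isSigma.act_one] at h1
  change _ = P.act _ (convTerm hr hk e hn A B _ _)
  rw [convTerm_apply, convTerm_apply, h1, map_smul]
  congr 1
  generalize D.decomp hr _ e _ = z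
  induction z with
  | zero => simp only [map_zero]
  | add y z hy hz => simp only [map_add, hy, hz]
  | tmul y z =>
    rw [map_tmul, lift.tmul, lift.tmul, LinearMap.compl₁₂_apply, LinearMap.compl₁₂_apply,
      convAct_apply, convAct_apply, ← hD.isSigma.act_mul, ← hD.isSigma.act_mul, inv_mul_cancel,
      inv_mul_cancel, hD.isSigma.act_one, hD.isSigma.act_one, hP.equivariance]

theorem lift_rTensor_eq {M M' N T N' R : Type} [AddCommGroup M] [AddCommGroup M'] [AddCommGroup N]
    [AddCommGroup T] [AddCommGroup N'] [AddCommGroup R] (φ : T →ₗ[ℤ] N' →ₗ[ℤ] R) (f : M' →ₗ[ℤ] T)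
    (g : N →ₗ[ℤ] N') (h : M →ₗ[ℤ] M') (z : M ⊗[ℤ] N) :
    lift (φ.compl₁₂ f g) (h.rTensor N z) = lift (φ.compl₁₂ (f ∘ₗ h) g) z := by
  induction z with
  | zero => simp only [map_zero]
  | add y z hy hz => simp only [map_add, hy, hz]
  | tmul y z => rfl

theorem lift_lTensor_eq {M N N₁ T N' R : Type} [AddCommGroup M] [AddCommGroup N] [AddCommGroup N₁]
    [AddCommGroup T] [AddCommGroup N'] [AddCommGroup R] (φ : T →ₗ[ℤ] N' →ₗ[ℤ] R) (f : M →ₗ[ℤ] T)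
    (g : N₁ →ₗ[ℤ] N') (h : N →ₗ[ℤ] N₁) (z : M ⊗[ℤ] N) :
    lift (φ.compl₁₂ f g) (h.lTensor M z) = lift (φ.compl₁₂ f (g ∘ₗ h)) z := by
  induction z with
  | zero => simp only [map_zero]
  | add y z hy hz => simp only [map_add, hy, hz]
  | tmul y z => rfl

theorem lift_units_smul {M N R : Type} [AddCommGroup M] [Module ℤ M] [AddCommGroup N]
    [Module ℤ N] [AddCommGroup R] (F : M →ₗ[ℤ] N →ₗ[ℤ] R) (u : ℤˣ) (z : M ⊗[ℤ] N) : lift F (u • z) = (u : ℤ) • lift F z := by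
  rcases Int.units_eq_one_or u with rfl | rfl <;> simp

theorem smul_lift_eq_of_tmul {M N R : Type} [AddCommGroup M] [AddCommGroup N] [AddCommGroup R]
    {F G H : M →ₗ[ℤ] N →ₗ[ℤ] R} {u : ℤ} (h : ∀ y z, F y z = G y z + u • H y z) (z : M ⊗[ℤ] N) :
    lift F z = lift G z + u • lift H z := by
  induction z with
  | zero => simp only [map_zero, smul_zero, add_zero]
  | add y z hy hz => simp only [map_add, smul_add, hy, hz]; abel
  | tmul y z => exact h y z

/-- Terms with the differential of `P` match by its Leibniz rule. Those with the differential of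
`D`, named `U` and `V`, come from the coderivation property on one side and from the differentials
of `A` and `B` on the other. In `U` the degree of the first tensor factor drops by one, whence the
shift of the summation index. -/
theorem convComp_leibniz (hD : IsCooperad D) (hP : IsPseudoOperad P) {s t r : ℕ}
    {i i' j j' k k' : ℤ} (hr : r + 1 = s + t) (hk : i + j = k)
    (hi : i' + 1 = i) (hj : j' + 1 = j) (hk' : k' + 1 = k) (h₁ : i' + j = k') (h₂ : i + j' = k')
    (e : Fin s) (A : ConvHom D P s i) (B : ConvHom D P t j) :
    convDiff D P hk' (convComp hD hr hk e A B) =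
      convComp hD hr h₁ e (convDiff D P hi A) B +
        (i.negOnePow : ℤ) • convComp hD hr h₂ e A (convDiff D P hj B) := by
  refine convHom_ext fun n m hn c => ?_
  change _ = convComp hD hr h₁ e (convDiff D P hi A) B ⟨(n, m), hn⟩ c +
    (i.negOnePow : ℤ) • convComp hD hr h₂ e A (convDiff D P hj B) ⟨(n, m), hn⟩ c
  rw [convDiff_apply hk' _ hn rfl (sub_add_cancel n 1) (by omega) (by omega), convComp_apply,
    convComp_apply, convComp_apply, convComp_apply]
  have hfin : {a | D.decomp hr (show a + (n - a) = n by omega) e c ≠ 0}.Finite :=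
    decomp_finite hD hr e c
  let G : ∀ a a' b x : ℤ, a' + 1 = a → a + b = n → a' + i = x → P.X r m :=
    fun a a' b x h hab hx => lift ((P.comp hr (show x + (b + j) = m by omega) e).compl₁₂
      (A ⟨(a', x), hx⟩ ∘ₗ D.d h) (B ⟨(b, b + j), rfl⟩)) (D.decomp hr hab e c)
  -- The degrees in `G` are variables linked by equations, so that `a + 1 - 1` and `a` can be
  -- identified without transport.
  have hG : ∀ {a a₁ a₂ b₁ b₂ x₁ x₂ : ℤ} (h₁ : a₁ + 1 = a) (h₂ : a₂ + 1 = a) (hab₁ : a + b₁ = n)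
      (hab₂ : a + b₂ = n) (hx₁ : a₁ + i = x₁) (hx₂ : a₂ + i = x₂),
      G a a₁ b₁ x₁ h₁ hab₁ hx₁ = G a a₂ b₂ x₂ h₂ hab₂ hx₂ := by
    intro a a₁ a₂ b₁ b₂ x₁ x₂ h₁ h₂ hab₁ hab₂ hx₁ hx₂
    obtain rfl : a₁ = a₂ := by omega
    obtain rfl : b₁ = b₂ := by omega
    obtain rfl : x₁ = x₂ := by omega
    rfl
  let U : ℤ → P.X r m := fun a => ((j * (a - 1)).negOnePow : ℤ) •
    G a (a - 1) (n - a) (a + i') (by omega) (by omega) (by omega)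
  let V : ℤ → P.X r m := fun a => ((j * a + a).negOnePow : ℤ) •
    lift ((P.comp hr (show a + i + (n - a + j') = m by omega) e).compl₁₂
      (A ⟨(a, a + i), rfl⟩) (B ⟨(n - a - 1, n - a + j'), by omega⟩ ∘ₗ D.d (sub_add_cancel _ 1)))
      (D.decomp hr (show a + (n - a) = n by omega) e c)
  let T : ℤ → P.X r m := fun a => P.d rfl
    (convTerm hr hk e (show n + k = m + 1 by omega) A B (show a + (n - a) = n by omega) c)
  have hUfin : (Function.support U).Finite := finite_support_of_vanish hfin fun a ha => by
    simp only [U, G, ha, map_zero, smul_zero]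
  have hVfin : (Function.support V).Finite := finite_support_of_vanish hfin fun a ha => by
    simp only [V, ha, map_zero, smul_zero]
  have hTfin : (Function.support T).Finite := finite_support_of_vanish hfin fun a ha => by
    simp only [T, convTerm_apply, ha, map_zero, smul_zero]
  have hUVfin : (Function.support fun a => U a + V a).Finite :=
    (hUfin.union hVfin).subset (Function.support_add _ _)
  have e1 : P.d rfl (∑ᶠ a, convTerm hr hk e (show n + k = m + 1 by omega) A B
      (show a + (n - a) = n by omega) c) = ∑ᶠ a, T a :=
    (P.d rfl).toAddMonoidHom.map_finsum (convTerm_finite hD hr hk e _ A B c)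
  have e2 : ∑ᶠ a, convTerm hr hk e (show n - 1 + k = m by omega) A B
      (show a + (n - 1 - a) = n - 1 by omega) (D.d (sub_add_cancel n 1) c) =
      ∑ᶠ a, (U a + V a) := by
    rw [finsum_add_distrib hUfin hVfin, ← finsum_comp_equiv (Equiv.addRight (1 : ℤ)) (f := U),
      ← finsum_add_distrib (hUfin.preimage (Equiv.addRight (1 : ℤ)).injective.injOn) hVfin]
    refine finsum_congr fun a => ?_
    rw [convTerm_apply, hD.leibniz hr rfl (show n - 1 - a + 1 = n - a by omega)
      (sub_add_cancel n 1) _ (show a + 1 + (n - 1 - a) = n by omega)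
      (show a + (n - a) = n by omega), map_add, smul_add, lift_units_smul,
      lift_rTensor_eq, lift_lTensor_eq, smul_smul, negOnePow_mul_negOnePow]
    congr 1
    · have : a + 1 - 1 = a := by omega
      simp only [U, Equiv.coe_addRight, this]
      congr 1
      exact hG _ _ _ _ _ _
    · simp only [V]
      congr 1
      have : ∀ {b b' x x' : ℤ} (h : b + 1 = n - a) (h' : b' + 1 = n - a) (hx : b + j = x)
        (hx' : b' + j = x') (y : D.X s a ⊗[ℤ] D.X t (n - a)),
        lift ((P.comp hr (show a + i + x = m by omega) e).compl₁₂ (A ⟨(a, a + i), rfl⟩)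
          (B ⟨(b, x), hx⟩ ∘ₗ D.d h)) y =
        lift ((P.comp hr (show a + i + x' = m by omega) e).compl₁₂ (A ⟨(a, a + i), rfl⟩)
          (B ⟨(b', x'), hx'⟩ ∘ₗ D.d h')) y := by
        intro b b' x x' h h' hx hx' y
        obtain rfl : b = b' := by omega
        obtain rfl : x = x' := by omega
        rfl
      exact this _ _ _ _ _
  have f3 := convTerm_finite hD hr h₁ e hn (convDiff D P hi A) B c
  have f4 := convTerm_finite hD hr h₂ e hn A (convDiff D P hj B) c
  rw [e1, e2, smul_finsum' _ hUVfin, smul_finsum' _ f4, ← finsum_sub_distrib hTfin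
    (finite_support_of_vanish hUVfin fun a ha => by rw [ha, smul_zero]),
    ← finsum_add_distrib f3 (finite_support_of_vanish f4 fun a ha => by rw [ha, smul_zero])]
  refine finsum_congr fun a => ?_
  have eT : T a = ((j * a).negOnePow : ℤ) •
      (lift ((P.comp hr (show a + i' + (n - a + j) = m by omega) e).compl₁₂
        (P.d (show a + i' + 1 = a + i by omega) ∘ₗ A ⟨(a, a + i), rfl⟩) (B ⟨(n - a, n - a + j), rfl⟩))
        (D.decomp hr (show a + (n - a) = n by omega) e c) + ((a + i).negOnePow : ℤ) •
      lift ((P.comp hr (show a + i + (n - a + j') = m by omega) e).compl₁₂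
        (A ⟨(a, a + i), rfl⟩) (P.d (show n - a + j' + 1 = n - a + j by omega) ∘ₗ B ⟨(n - a, n - a + j), rfl⟩))
        (D.decomp hr (show a + (n - a) = n by omega) e c)) := by
    simp only [T]
    rw [convTerm_apply, map_smul]
    congr 1
    rw [← LinearMap.comp_apply, ← lift_compr₂]
    refine smul_lift_eq_of_tmul (fun y z => ?_) _
    exact (hP.leibniz hr _ (show a + i' + 1 = a + i by omega)
      (show n - a + j' + 1 = n - a + j by omega) rfl (show a + i' + (n - a + j) = m by omega)
      (show a + i + (n - a + j') = m by omega) e _ _).trans (by rw [Units.smul_def]; rfl)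
  have e3 : convTerm hr h₁ e hn (convDiff D P hi A) B
      (show a + (n - a) = n by omega) c = ((j * a).negOnePow : ℤ) •
      (lift ((P.comp hr (show a + i' + (n - a + j) = m by omega) e).compl₁₂
        (P.d (show a + i' + 1 = a + i by omega) ∘ₗ A ⟨(a, a + i), rfl⟩) (B ⟨(n - a, n - a + j), rfl⟩))
        (D.decomp hr (show a + (n - a) = n by omega) e c) + (-(i.negOnePow : ℤ)) •
      G a (a - 1) (n - a) (a + i') (by omega) (by omega) (by omega)) := by
    rw [convTerm_apply]
    congr 1
    refine smul_lift_eq_of_tmul (fun y z => ?_) _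
    rw [LinearMap.compl₁₂_apply, convDiff_apply hi A rfl (show a + i' + 1 = a + i by omega)
      (sub_add_cancel a 1) rfl (show a - 1 + i = a + i' by omega), map_sub, LinearMap.sub_apply,
      map_smul, LinearMap.smul_apply, sub_eq_add_neg, ← neg_smul]
    rfl
  have e4 : convTerm hr h₂ e hn A (convDiff D P hj B)
      (show a + (n - a) = n by omega) c = ((j' * a).negOnePow : ℤ) •
      (lift ((P.comp hr (show a + i + (n - a + j') = m by omega) e).compl₁₂
        (A ⟨(a, a + i), rfl⟩) (P.d (show n - a + j' + 1 = n - a + j by omega) ∘ₗ B ⟨(n - a, n - a + j), rfl⟩))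
        (D.decomp hr (show a + (n - a) = n by omega) e c) + (-(j.negOnePow : ℤ)) •
      lift ((P.comp hr (show a + i + (n - a + j') = m by omega) e).compl₁₂
      (A ⟨(a, a + i), rfl⟩) (B ⟨(n - a - 1, n - a + j'), by omega⟩ ∘ₗ D.d (sub_add_cancel _ 1)))
      (D.decomp hr (show a + (n - a) = n by omega) e c)) := by
    rw [convTerm_apply]
    congr 1
    refine smul_lift_eq_of_tmul (fun y z => ?_) _
    rw [LinearMap.compl₁₂_apply, convDiff_apply hj B rfl
      (show n - a + j' + 1 = n - a + j by omega)
      (sub_add_cancel (n - a) 1) rfl (show n - a - 1 + j = n - a + j' by omega), map_sub,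
      map_smul, sub_eq_add_neg, ← neg_smul]
    rfl
  rw [eT, e3, e4]
  simp only [U, V, smul_add, smul_smul, negOnePow_mul_negOnePow, neg_smul, smul_neg]
  have c1 : ((j * a + (a + i)).negOnePow : ℤ) = ((i + j' * a).negOnePow : ℤ) :=
    negOnePow_congr ⟨a, by rw [← hj]; ring⟩
  have c2 : ((k + j * (a - 1)).negOnePow : ℤ) = ((j * a + i).negOnePow : ℤ) :=
    negOnePow_congr ⟨0, by rw [← hk]; ring⟩
  have c3 : ((k + (j * a + a)).negOnePow : ℤ) = ((i + (j' * a + j)).negOnePow : ℤ) :=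
    negOnePow_congr ⟨a, by rw [← hk, ← hj]; ring⟩
  rw [c1, c2, c3]
  abel

theorem lift_lift_assoc {M₁ M₂ M₃ N₁ N₂ N₃ S T R : Type} [AddCommGroup M₁] [AddCommGroup M₂]
    [AddCommGroup M₃] [AddCommGroup N₁] [AddCommGroup N₂] [AddCommGroup N₃] [AddCommGroup S]
    [AddCommGroup T] [AddCommGroup R] {φ : S →ₗ[ℤ] N₃ →ₗ[ℤ] R} {ψ : N₁ →ₗ[ℤ] N₂ →ₗ[ℤ] S}
    {φ' : N₁ →ₗ[ℤ] T →ₗ[ℤ] R} {ψ' : N₂ →ₗ[ℤ] N₃ →ₗ[ℤ] T}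
    (h : ∀ p q x, φ (ψ p q) x = φ' p (ψ' q x)) (A : M₁ →ₗ[ℤ] N₁) (B : M₂ →ₗ[ℤ] N₂)
    (X : M₃ →ₗ[ℤ] N₃) (z : (M₁ ⊗[ℤ] M₂) ⊗[ℤ] M₃) :
    lift (φ.compl₁₂ (lift (ψ.compl₁₂ A B)) X) z =
      lift (φ'.compl₁₂ A (lift (ψ'.compl₁₂ B X))) (TensorProduct.assoc ℤ M₁ M₂ M₃ z) := by
  induction z with
  | zero => simp only [map_zero]
  | add y z hy hz => simp only [map_add, hy, hz]
  | tmul y z =>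
    induction y with
    | zero => simp only [zero_tmul, map_zero]
    | add y y' hy hz => simp only [add_tmul, map_add, hy, hz]
    | tmul y y' => exact h _ _ _

theorem lift_lift_rightComm {M₁ M₂ M₃ N₁ N₂ N₃ S T R : Type} [AddCommGroup M₁] [AddCommGroup M₂]
    [AddCommGroup M₃] [AddCommGroup N₁] [AddCommGroup N₂] [AddCommGroup N₃] [AddCommGroup S]
    [AddCommGroup T] [AddCommGroup R] {φ : S →ₗ[ℤ] N₃ →ₗ[ℤ] R} {ψ : N₁ →ₗ[ℤ] N₂ →ₗ[ℤ] S}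
    {φ' : T →ₗ[ℤ] N₂ →ₗ[ℤ] R} {ψ' : N₁ →ₗ[ℤ] N₃ →ₗ[ℤ] T} {u : ℤ}
    (h : ∀ p q x, φ (ψ p q) x = u • φ' (ψ' p x) q) (A : M₁ →ₗ[ℤ] N₁) (B : M₂ →ₗ[ℤ] N₂)
    (X : M₃ →ₗ[ℤ] N₃) (z : (M₁ ⊗[ℤ] M₂) ⊗[ℤ] M₃) :
    lift (φ.compl₁₂ (lift (ψ.compl₁₂ A B)) X) z =
      u • lift (φ'.compl₁₂ (lift (ψ'.compl₁₂ A X)) B) (TensorProduct.rightComm ℤ M₁ M₂ M₃ z) := by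
  induction z with
  | zero => simp only [map_zero, smul_zero]
  | add y z hy hz => simp only [map_add, smul_add, hy, hz]
  | tmul y z =>
    induction y with
    | zero => simp only [zero_tmul, map_zero, smul_zero]
    | add y y' hy hz => simp only [add_tmul, map_add, smul_add, hy, hz]
    | tmul y y' => exact h _ _ _

/-- The component of degree `(x, w, v)` of an iterated convolution product
`(A ∘_e B) ∘_g X`. -/
def convTermLeft {s t u a r : ℕ} {i j k l n N M : ℤ} (ha : a + 1 = s + t) (hra : r + 1 = a + u)
    (hl : i + j = l) (hln : l + k = n) (e : Fin s) (g : Fin a) (h : N + n = M)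
    (A : ConvHom D P s i) (B : ConvHom D P t j) (X : ConvHom D P u k) {x w v y : ℤ}
    (hy : x + w = y) (hN : y + v = N) (c : D.X r N) : P.X r M :=
  lift ((P.comp hra (show y + l + (v + k) = M by omega) g).compl₁₂
    (lift ((P.comp ha (show x + i + (w + j) = y + l by omega) e).compl₁₂ (A ⟨(x, x + i), rfl⟩)
      (B ⟨(w, w + j), rfl⟩))) (X ⟨(v, v + k), rfl⟩))
    ((D.decomp ha hy e).rTensor (D.X u v) (D.decomp hra hN g c))

/-- The component of degree `(x, w, v)` of an iterated convolution product
`A ∘_e (B ∘_f X)`. -/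
def convTermRight {s t u b r : ℕ} {i j k m n N M : ℤ} (hb : b + 1 = t + u) (hrb : r + 1 = s + b)
    (hm : j + k = m) (hmn : i + m = n) (e : Fin s) (f : Fin t) (h : N + n = M)
    (A : ConvHom D P s i) (B : ConvHom D P t j) (X : ConvHom D P u k) {x w v z : ℤ}
    (hz : w + v = z) (hN : x + z = N) (c : D.X r N) : P.X r M :=
  lift ((P.comp hrb (show x + i + (z + m) = M by omega) e).compl₁₂ (A ⟨(x, x + i), rfl⟩)
    (lift ((P.comp hb (show w + j + (v + k) = z + m by omega) f).compl₁₂ (B ⟨(w, w + j), rfl⟩)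
      (X ⟨(v, v + k), rfl⟩))))
    ((D.decomp hb hz f).lTensor (D.X s x) (D.decomp hrb hN e c))

theorem convComp_convComp_left (hD : IsCooperad D) {s t u a r : ℕ} {i j k l n N M : ℤ}
    (ha : a + 1 = s + t) (hra : r + 1 = a + u) (hl : i + j = l) (hln : l + k = n) (e : Fin s)
    (g : Fin a) (h : N + n = M) (A : ConvHom D P s i) (B : ConvHom D P t j) (X : ConvHom D P u k)
    (c : D.X r N) :
    convComp hD hra hln g (convComp hD ha hl e A B) X ⟨(N, M), h⟩ c =
      ∑ᶠ y, ∑ᶠ x, ((k * y + j * x).negOnePow : ℤ) • convTermLeft ha hra hl hln e g h A B X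
        (show x + (y - x) = y by omega) (show y + (N - y) = N by omega) c := by
  rw [convComp_apply]
  refine finsum_congr fun y => ?_
  rw [convTerm_apply, lift_finsum_left _ _ _
    (fun x => D.decomp ha (show x + (y - x) = y by omega) e)
    (fun x => lift ((P.comp ha (show x + i + (y - x + j) = y + l by omega) e).compl₁₂
      (A ⟨(x, x + i), rfl⟩) (B ⟨(y - x, y - x + j), rfl⟩)))
    (fun x => ((j * x).negOnePow : ℤ)) (decomp_finite hD ha e) (fun _ => rfl),
    smul_finsum' _ (finite_support_of_vanish (rTensor_finite _ (decomp_finite hD ha e) _)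
      fun x hx => by rw [hx, map_zero, smul_zero])]
  refine finsum_congr fun x => ?_
  rw [smul_smul, negOnePow_mul_negOnePow]
  rfl

theorem convTermLeft_finite (hD : IsCooperad D) {s t u a r : ℕ} {i j k l n N M : ℤ}
    (ha : a + 1 = s + t) (hra : r + 1 = a + u) (hl : i + j = l) (hln : l + k = n) (e : Fin s)
    (g : Fin a) (h : N + n = M) (A : ConvHom D P s i) (B : ConvHom D P t j) (X : ConvHom D P u k)
    (c : D.X r N) : (Function.support fun p : ℤ × ℤ => ((k * p.1 + j * p.2).negOnePow : ℤ) •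
      convTermLeft ha hra hl hln e g h A B X (show p.2 + (p.1 - p.2) = p.1 by omega)
        (show p.1 + (N - p.1) = N by omega) c).Finite := by
  refine finite_support_prod (decomp_finite hD hra g c) (fun y x =>
    ((k * y + j * x).negOnePow : ℤ) • convTermLeft ha hra hl hln e g h A B X
      (show x + (y - x) = y by omega) (show y + (N - y) = N by omega) c) ?_ ?_
  · intro y hy x
    simp only [convTermLeft, hy, map_zero, smul_zero]
  · intro y
    refine finite_support_of_vanish (rTensor_finite
      (fun x => D.decomp ha (show x + (y - x) = y by omega) e) (decomp_finite hD ha e)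
      (D.decomp hra (show y + (N - y) = N by omega) g c)) fun x hx => ?_
    simp only [convTermLeft, hx, map_zero, smul_zero]

theorem convComp_convComp_right (hD : IsCooperad D) {s t u b r : ℕ} {i j k m n N M : ℤ}
    (hb : b + 1 = t + u) (hrb : r + 1 = s + b) (hm : j + k = m) (hmn : i + m = n) (e : Fin s)
    (f : Fin t) (h : N + n = M) (A : ConvHom D P s i) (B : ConvHom D P t j) (X : ConvHom D P u k)
    (c : D.X r N) :
    convComp hD hrb hmn e A (convComp hD hb hm f B X) ⟨(N, M), h⟩ c =
      ∑ᶠ x, ∑ᶠ w, ((m * x + k * w).negOnePow : ℤ) • convTermRight hb hrb hm hmn e f h A B X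
        (show w + (N - x - w) = N - x by omega) (show x + (N - x) = N by omega) c := by
  rw [convComp_apply]
  refine finsum_congr fun x => ?_
  rw [convTerm_apply, lift_finsum_right _ _ _
    (fun w => D.decomp hb (show w + (N - x - w) = N - x by omega) f)
    (fun w => lift ((P.comp hb (show w + j + (N - x - w + k) = N - x + m by omega) f).compl₁₂
      (B ⟨(w, w + j), rfl⟩) (X ⟨(N - x - w, N - x - w + k), rfl⟩)))
    (fun w => ((k * w).negOnePow : ℤ)) (decomp_finite hD hb f) (fun _ => rfl),
    smul_finsum' _ (finite_support_of_vanish (lTensor_finite _ (decomp_finite hD hb f) _)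
      fun x hx => by rw [hx, map_zero, smul_zero])]
  refine finsum_congr fun x => ?_
  rw [smul_smul, negOnePow_mul_negOnePow]
  rfl

theorem convTermRight_congr {s t u b r : ℕ} {i j k m n N M : ℤ} (hb : b + 1 = t + u)
    (hrb : r + 1 = s + b) (hm : j + k = m) (hmn : i + m = n) (e : Fin s) (f : Fin t)
    (h : N + n = M) (A : ConvHom D P s i) (B : ConvHom D P t j) (X : ConvHom D P u k)
    {x w v z w' v' z' : ℤ} (hz : w + v = z) (hN : x + z = N) (hz' : w' + v' = z')
    (hN' : x + z' = N) (c : D.X r N) (hw : w = w') :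
    convTermRight hb hrb hm hmn e f h A B X hz hN c =
      convTermRight hb hrb hm hmn e f h A B X hz' hN' c := by
  subst hw
  obtain rfl : z = z' := by omega
  obtain rfl : v = v' := by omega
  rfl

theorem convTermLeft_congr {s t u a r : ℕ} {i j k l n N M : ℤ} (ha : a + 1 = s + t)
    (hra : r + 1 = a + u) (hl : i + j = l) (hln : l + k = n) (e : Fin s) (g : Fin a)
    (h : N + n = M) (A : ConvHom D P s i) (B : ConvHom D P t j) (X : ConvHom D P u k)
    {x w v y w' v' y' : ℤ} (hy : x + w = y) (hN : y + v = N) (hy' : x + w' = y')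
    (hN' : y' + v' = N) (c : D.X r N) (hw : w = w') :
    convTermLeft ha hra hl hln e g h A B X hy hN c =
      convTermLeft ha hra hl hln e g h A B X hy' hN' c := by
  subst hw
  obtain rfl : y = y' := by omega
  obtain rfl : v = v' := by omega
  rfl

/-- Both sides are sums over the degrees `(x, w, v)` of the three tensor factors, indexed by `(x +
w, x)` on the left and by `(x, w)` on the right. Corresponding terms agree by coassociativity in `D`
and associativity in `P`. -/
theorem convComp_assoc_seq (hD : IsCooperad D) (hP : IsPseudoOperad P) {s t u a b r : ℕ}
    {i j k l m n : ℤ} (ha : a + 1 = s + t) (hra : r + 1 = a + u)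
    (hb : b + 1 = t + u) (hrb : r + 1 = s + b) (hl : i + j = l) (hln : l + k = n)
    (hm : j + k = m) (hmn : i + m = n) (e : Fin s) (f : Fin t) (g : Fin a)
    (hg : (g : ℕ) = e + f) (A : ConvHom D P s i) (B : ConvHom D P t j) (X : ConvHom D P u k) :
    convComp hD hra hln g (convComp hD ha hl e A B) X =
      convComp hD hrb hmn e A (convComp hD hb hm f B X) := by
  refine convHom_ext fun N M h c => ?_
  rw [convComp_convComp_left, convComp_convComp_right]
  let E : ℤ × ℤ ≃ ℤ × ℤ :=
    { toFun := fun p => (p.2, p.1 - p.2)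
      invFun := fun p => (p.1 + p.2, p.1)
      left_inv := fun p => Prod.ext (add_sub_cancel p.2 p.1) rfl
      right_inv := fun p => Prod.ext rfl (add_sub_cancel_left p.1 p.2) }
  refine finsum_finsum_reindex E _ _ (convTermLeft_finite hD ha hra hl hln e g h A B X c) ?_
  rintro ⟨y, x⟩
  change _ = ((m * x + k * (y - x)).negOnePow : ℤ) • _
  have hs : ((k * y + j * x).negOnePow : ℤ) = ((m * x + k * (y - x)).negOnePow : ℤ) :=
    negOnePow_congr ⟨0, by rw [← hm]; ring⟩
  rw [hs]
  congr 1
  refine Eq.trans ?_ (convTermRight_congr hb hrb hm hmn e f h A B X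
    (show y - x + (N - y) = N - x by omega) (show x + (N - x) = N by omega) _ _ c rfl)
  rw [convTermLeft, convTermRight, lift_lift_assoc (fun p q z => hP.assoc_seq ha hra hb hrb _ _
      (show y - x + j + (N - y + k) = N - x + m by omega)
      (show x + i + (N - x + m) = M by omega) e f g hg p q z),
    hD.coassoc_seq ha hra hb hrb _ _ (show y - x + (N - y) = N - x by omega)
      (show x + (N - x) = N by omega) e f g hg]

theorem convComp_assoc_par (hD : IsCooperad D) (hP : IsPseudoOperad P) {s t u a b r : ℕ}
    {i j k l m n : ℤ} (ha : a + 1 = s + t) (hra : r + 1 = a + u)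
    (hb : b + 1 = s + u) (hrb : r + 1 = b + t) (hl : i + j = l) (hln : l + k = n)
    (hm : i + k = m) (hmn : m + j = n) (e f : Fin s) (g : Fin a) (h : Fin b) (hef : e < f)
    (hg : (g : ℕ) + 1 = f + t) (hh : (h : ℕ) = e) (A : ConvHom D P s i) (B : ConvHom D P t j)
    (X : ConvHom D P u k) :
    convComp hD hra hln g (convComp hD ha hl e A B) X =
      ((j * k).negOnePow : ℤ) • convComp hD hrb hmn h (convComp hD hb hm f A X) B := by
  refine convHom_ext fun N M hN c => ?_
  change _ = ((j * k).negOnePow : ℤ) • convComp hD hrb hmn h (convComp hD hb hm f A X) B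
    ⟨(N, M), hN⟩ c
  rw [convComp_convComp_left, convComp_convComp_left]
  have hfin := convTermLeft_finite hD hb hrb hm hmn f h hN A X B c
  -- The index `y` is the sum of the degrees of the first two factors; exchanging the second factor
  -- with the third replaces it by `N - y + x`.
  let E : ℤ × ℤ ≃ ℤ × ℤ :=
    { toFun := fun p => (N - p.1 + p.2, p.2)
      invFun := fun p => (N - p.1 + p.2, p.2)
      left_inv := fun p => Prod.ext (by change N - (N - p.1 + p.2) + p.2 = p.1; omega) rfl
      right_inv := fun p => Prod.ext (by change N - (N - p.1 + p.2) + p.2 = p.1; omega) rfl }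
  have hout : ((j * k).negOnePow : ℤ) • (∑ᶠ y, ∑ᶠ x, ((j * y + k * x).negOnePow : ℤ) •
      convTermLeft hb hrb hm hmn f h hN A X B (show x + (y - x) = y by omega)
        (show y + (N - y) = N by omega) c) = ∑ᶠ y, ∑ᶠ x, ((j * k).negOnePow : ℤ) •
      (((j * y + k * x).negOnePow : ℤ) •
      convTermLeft hb hrb hm hmn f h hN A X B (show x + (y - x) = y by omega)
        (show y + (N - y) = N by omega) c) := by
    rw [← finsum_curry (fun p : ℤ × ℤ => ((j * p.1 + k * p.2).negOnePow : ℤ) •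
      convTermLeft hb hrb hm hmn f h hN A X B (show p.2 + (p.1 - p.2) = p.1 by omega)
        (show p.1 + (N - p.1) = N by omega) c) hfin, smul_finsum' _ hfin]
    exact finsum_curry _ (hfin.subset fun p hp h0 => hp (by simp only [h0, smul_zero]))
  rw [hout]
  refine finsum_finsum_reindex E _ _ (convTermLeft_finite hD ha hra hl hln e g hN A B X c) ?_
  rintro ⟨y, x⟩
  change _ = ((j * k).negOnePow : ℤ) • (((j * (N - y + x) + k * x).negOnePow : ℤ) • _)
  rw [smul_smul, negOnePow_mul_negOnePow]
  refine Eq.trans ?_ (congrArg _ (convTermLeft_congr hb hrb hm hmn f h hN A X B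
    (show x + (N - y) = N - y + x by omega) (show N - y + x + (y - x) = N by omega) _ _ c
    (by change N - y = N - y + x - x; omega)))
  rw [convTermLeft, convTermLeft, lift_lift_rightComm (u := ((y - x + j) * (N - y + k)).negOnePow)
      (fun p q z => (hP.assoc_par ha hra hb hrb _ _
      (show x + i + (N - y + k) = N - y + x + m by omega)
      (show N - y + x + m + (y - x + j) = M by omega) e f g h hef hg hh p q z).trans
        (Units.smul_def _ _)),
    hD.coassoc_par ha hra hb hrb _ _ (show x + (N - y) = N - y + x by omega)
      (show N - y + x + (y - x) = N by omega) e f g h hef hg hh, lift_units_smul, smul_smul,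
    smul_smul, negOnePow_mul_negOnePow, negOnePow_mul_negOnePow]
  congr 1
  refine negOnePow_congr ⟨(y - x) * k + (y - x) * (N - y), ?_⟩
  ring

theorem isPseudoOperad_conv (hD : IsCooperad D) (hP : IsPseudoOperad P) :
    IsPseudoOperad (conv hD P) where
  act_one {r i} A := convHom_ext fun n m hn c => by
    change P.act 1 ((A : ConvHom D P r i) ⟨(n, m), hn⟩ (D.act 1⁻¹ c)) = _
    rw [inv_one, hD.isSigma.act_one, hP.act_one]
  act_mul {r i} σ τ A := convHom_ext fun n m hn c => by
    change P.act (σ * τ) ((A : ConvHom D P r i) ⟨(n, m), hn⟩ (D.act (σ * τ)⁻¹ c)) =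
      P.act σ (P.act τ ((A : ConvHom D P r i) ⟨(n, m), hn⟩ (D.act τ⁻¹ (D.act σ⁻¹ c))))
    rw [mul_inv_rev, hD.isSigma.act_mul, hP.act_mul]
  d_act {r i j} h σ A := convHom_ext fun n m hn c => by
    change P.d rfl (P.act σ ((A : ConvHom D P r i) ⟨(n, m + 1), _⟩ (D.act σ⁻¹ c))) -
      (i.negOnePow : ℤ) • P.act σ ((A : ConvHom D P r i) ⟨(n - 1, m), _⟩
        (D.act σ⁻¹ (D.d (sub_add_cancel n 1) c))) =
      P.act σ (P.d rfl ((A : ConvHom D P r i) ⟨(n, m + 1), _⟩ (D.act σ⁻¹ c)) -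
      (i.negOnePow : ℤ) • (A : ConvHom D P r i) ⟨(n - 1, m), _⟩
        (D.d (sub_add_cancel n 1) (D.act σ⁻¹ c)))
    rw [map_sub, map_smul, hP.d_act, hD.isSigma.d_act]
  assoc_seq := convComp_assoc_seq hD hP
  assoc_par ha hra hb hrb hl hln hm hmn e f g h hef hg hh A B X :=
    (convComp_assoc_par hD hP ha hra hb hrb hl hln hm hmn e f g h hef hg hh A B X).trans
      (Units.smul_def _ _).symm
  equivariance := convComp_equivariance hD hP
  leibniz hr hk hi hj hk' h₁ h₂ e A B :=
    (convComp_leibniz hD hP hr hk hi hj hk' h₁ h₂ e A B).trans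
      (congrArg _ (Units.smul_def _ _).symm)

end Convolution

/-! ### Free and quasi-free operads -/

section QuasiFree

variable {M : SigmaData}

theorem FreeOp.mk_neg {r : ℕ} {i : ℤ} (p : FreeTerm M r i) :
    (FreeOp.mk (.neg p) : FreeOp M r i) = -FreeOp.mk p := rfl

theorem FreeOp.exists_mk {r : ℕ} {i : ℤ} (p : FreeOp M r i) : ∃ q, FreeOp.mk q = p :=
  Quot.exists_rep p

theorem FreeOp.deriv_mk (θ : GenDerivation M) {r : ℕ} {i j : ℤ} (h : j + 1 = i)
    (p : FreeTerm M r i) : FreeOp.deriv θ h (FreeOp.mk p) = derivTerm θ p j h := rfl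

theorem FreeOp.deriv_comp (θ : GenDerivation M) {s t r : ℕ} {i i' j j' k k' : ℤ}
    (hr : r + 1 = s + t) (hk : i + j = k) (hi : i' + 1 = i) (hj : j' + 1 = j) (hk' : k' + 1 = k)
    (h₁ : i' + j = k') (h₂ : i + j' = k') (e : Fin s) (p : FreeOp M s i) (q : FreeOp M t j) :
    FreeOp.deriv θ hk' (FreeOp.comp hr hk e p q) =
      FreeOp.comp hr h₁ e (FreeOp.deriv θ hi p) q +
        i.negOnePow • FreeOp.comp hr h₂ e p (FreeOp.deriv θ hj q) := by
  obtain ⟨p, rfl⟩ := FreeOp.exists_mk p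
  obtain ⟨q, rfl⟩ := FreeOp.exists_mk q
  obtain rfl := eq_sub_of_add_eq hi
  obtain rfl := eq_sub_of_add_eq hj
  rfl

theorem FreeOp.deriv_act (θ : GenDerivation M) {r : ℕ} {i j : ℤ} (h : j + 1 = i)
    (σ : Perm (Fin r)) (p : FreeOp M r i) :
    FreeOp.deriv θ h (FreeOp.act σ p) = FreeOp.act σ (FreeOp.deriv θ h p) := by
  obtain ⟨p, rfl⟩ := FreeOp.exists_mk p
  rfl

theorem isPseudoOperad_quasiFree (θ : GenDerivation M) : IsPseudoOperad (quasiFree M θ) where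
  act_one := FreeOp.act_one
  act_mul := FreeOp.act_mul
  d_act := FreeOp.deriv_act θ
  assoc_seq := FreeOp.assoc_seq
  assoc_par := FreeOp.assoc_par
  equivariance := FreeOp.equivariance
  leibniz := FreeOp.deriv_comp θ

/-- In the square of an odd derivation applied to a composite, the two mixed terms have opposite
signs; the square is thus a derivation and vanishes if it does on generators. -/
theorem FreeOp.deriv_deriv (θ : GenDerivation M)
    (hθ : ∀ {r : ℕ} {i j k : ℤ} (hr : 2 ≤ r) (h : j + 1 = i) (h' : k + 1 = j) (x : M.X r i),
      FreeOp.deriv θ h' (θ.toFun hr h x) = 0) {r : ℕ} {i j k : ℤ} (h : j + 1 = i) (h' : k + 1 = j)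
    (p : FreeOp M r i) : FreeOp.deriv θ h' (FreeOp.deriv θ h p) = 0 := by
  obtain ⟨p, rfl⟩ := FreeOp.exists_mk p
  rw [FreeOp.deriv_mk]
  induction p generalizing j k with
  | gen hr x => exact hθ hr h h' x
  | one hi => exact map_zero _
  | zero => exact map_zero _
  | add p q hp hq => rw [derivTerm, map_add, hp, hq, add_zero]
  | neg p hp => rw [derivTerm, map_neg, hp, neg_zero]
  | act σ p hp => rw [derivTerm, FreeOp.deriv_act, hp, map_zero]
  | @comp s t r a b c hr hk e p q hp hq =>
    rw [derivTerm, map_add, map_units_smul,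
      FreeOp.deriv_comp θ hr _ (sub_add_cancel (a - 1) 1) (sub_add_cancel b 1) h'
        (show a - 1 - 1 + b = k by omega) (show a - 1 + (b - 1) = k by omega),
      FreeOp.deriv_comp θ hr _ (sub_add_cancel a 1) (sub_add_cancel (b - 1) 1) h'
        (show a - 1 + (b - 1) = k by omega) (show a + (b - 1 - 1) = k by omega), hp, hq,
      FreeOp.deriv_mk, FreeOp.deriv_mk, map_zero, map_zero, LinearMap.zero_apply, smul_zero,
      zero_add, add_zero, Int.negOnePow_sub, Int.negOnePow_one, mul_neg, mul_one, Units.neg_smul,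
      neg_add_cancel]

/-- The unit in arity one and degree zero, and zero in all other arities and degrees. -/
def FreeOp.unitElt : ∀ (r : ℕ) (i : ℤ), FreeOp M r i
  | 1, 0 => FreeOp.one rfl
  | _, _ => 0

theorem FreeOp.unitElt_one (i : ℤ) (hi : i ≠ 0) : FreeOp.unitElt (M := M) 1 i = 0 := by
  rw [FreeOp.unitElt]
  exact fun _ => hi

theorem FreeOp.comp_unitElt {r : ℕ} {i j k : ℤ} (hr : r + 1 = 1 + 1) (hk : i + j = k) (e : Fin 1) :
    FreeOp.comp hr hk e (FreeOp.unitElt (M := M) 1 i) (FreeOp.unitElt 1 j) =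
      if i = 0 then FreeOp.unitElt r k else 0 := by
  obtain rfl : r = 1 := by omega
  by_cases hi : i = 0
  · subst hi
    obtain rfl : j = k := by omega
    rw [if_pos rfl]
    exact FreeOp.one_comp _ _ _ _
  · rw [if_neg hi, FreeOp.unitElt_one i hi, map_zero, LinearMap.zero_apply]

/-- The generators have arity at least two. A composite of arity at most one has either a second
factor of arity zero, which vanishes, or two factors of arity one. -/
theorem FreeOp.exists_eq_zsmul_unitElt {r : ℕ} {i : ℤ} (p : FreeOp M r i) (hr : r ≤ 1) :
    ∃ n : ℤ, p = n • FreeOp.unitElt r i := by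
  obtain ⟨p, rfl⟩ := FreeOp.exists_mk p
  induction p with
  | gen hr' x => omega
  | one hi => subst hi; exact ⟨1, (one_smul _ _).symm⟩
  | zero => exact ⟨0, (zero_smul _ _).symm⟩
  | add p q hp hq =>
    obtain ⟨n, hn⟩ := hp hr
    obtain ⟨m, hm⟩ := hq hr
    exact ⟨n + m, by rw [FreeOp.mk_add, hn, hm, add_smul]⟩
  | neg p hp =>
    obtain ⟨n, hn⟩ := hp hr
    exact ⟨-n, by rw [FreeOp.mk_neg, hn, neg_smul]⟩
  | @act r i σ p hp =>
    obtain ⟨n, hn⟩ := hp hr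
    have : Subsingleton (Fin r) := Fin.subsingleton_iff_le_one.2 hr
    exact ⟨n, by rw [FreeOp.mk_act, Subsingleton.elim σ 1, FreeOp.act_one, hn]⟩
  | @comp s t r i j k hr' hk e p q hp hq =>
    have := e.2
    obtain ⟨m, hm⟩ := hq (by omega)
    rcases Nat.eq_zero_or_pos t with rfl | ht
    · have h0 : FreeOp.unitElt (M := M) 0 j = 0 := rfl
      exact ⟨0, by rw [FreeOp.mk_comp, hm, h0, smul_zero, map_zero, zero_smul]⟩
    · obtain rfl : s = 1 := by omega
      obtain rfl : t = 1 := by omega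
      obtain ⟨n, hn⟩ := hp (by omega)
      refine ⟨if i = 0 then n * m else 0, ?_⟩
      rw [FreeOp.mk_comp, hn, hm, map_smul, map_smul, LinearMap.smul_apply, FreeOp.comp_unitElt]
      split_ifs
      · rw [smul_smul, mul_comm]
      · rw [smul_zero, smul_zero, zero_smul]

/-- The augmentation of formal expressions, which vanishes on the generators. -/
def augTerm : ∀ {r : ℕ} {i : ℤ}, FreeTerm M r i → ℤ
  | _, _, .gen _ _ => 0
  | _, _, .one _ => 1
  | _, _, .zero => 0
  | _, _, .add p q => augTerm p + augTerm q
  | _, _, .neg p => -augTerm p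
  | _, _, .act _ p => augTerm p
  | _, _, .comp _ _ _ p q => augTerm p * augTerm q

theorem augTerm_eq_zero {r : ℕ} {i : ℤ} (p : FreeTerm M r i) (hr : r ≠ 1) : augTerm p = 0 := by
  induction p with
  | gen hr' x => rfl
  | one hi => exact absurd rfl hr
  | zero => rfl
  | add p q hp hq => rw [augTerm, hp hr, hq hr, add_zero]
  | neg p hp => rw [augTerm, hp hr, neg_zero]
  | act σ p hp => rw [augTerm, hp hr]
  | @comp s t r i j k hr' hk e p q hp hq =>
    rw [augTerm]
    by_cases hs : s = 1
    · rw [hq (by omega), mul_zero]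
    · rw [hp hs, zero_mul]

/-- The only relation whose sign could cause trouble is the odd parallel one. There `p` has two
distinct inputs, hence arity different from one, and both sides have augmentation zero. -/
theorem augTerm_rel {r : ℕ} {i : ℤ} {p q : FreeTerm M r i} (h : FreeRel M p q) :
    augTerm p = augTerm q := by
  induction h with
  | add_left q _ ih => simp only [augTerm, ih]
  | add_right p _ ih => simp only [augTerm, ih]
  | neg_congr _ ih => simp only [augTerm, ih]
  | act_congr σ _ ih => simp only [augTerm, ih]
  | comp_left hr hk e q _ ih => simp only [augTerm, ih]
  | comp_right hr hk e p _ ih => simp only [augTerm, ih]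
  | assoc_par_odd ha hra hb hrb hl hln hm hmn e f g h' hef hg hh hjk p q x =>
    have := e.2
    have := f.2
    rw [Fin.lt_def] at hef
    simp only [augTerm]
    rw [augTerm_eq_zero p (by omega)]
    simp
  | _ => simp only [augTerm] <;> ring

/-- The augmentation of the free operad in arity one and degree zero. -/
def FreeOp.aug : FreeOp M 1 0 →+ ℤ :=
  AddMonoidHom.mk' (Quot.lift augTerm fun _ _ h => augTerm_rel h) (by rintro ⟨p⟩ ⟨q⟩; rfl)

theorem isOperad_quasiFree (θ : GenDerivation M)
    (hθ : ∀ {r : ℕ} {i j k : ℤ} (hr : 2 ≤ r) (h : j + 1 = i) (h' : k + 1 = j) (x : M.X r i),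
      FreeOp.deriv θ h' (θ.toFun hr h x) = 0) : IsOperad (quasiFree M θ) where
  isSigma :=
    { d_d := FreeOp.deriv_deriv θ hθ
      act_one := FreeOp.act_one
      act_mul := FreeOp.act_mul
      d_act := FreeOp.deriv_act θ }
  arity_zero i := subsingleton_of_forall_eq (0 : FreeOp M 0 i) fun p => by
    obtain ⟨n, rfl⟩ := FreeOp.exists_eq_zsmul_unitElt p zero_le_one
    exact smul_zero n
  arity_one i hi := subsingleton_of_forall_eq (0 : FreeOp M 1 i) fun p => by
    obtain ⟨n, rfl⟩ := FreeOp.exists_eq_zsmul_unitElt p le_rfl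
    rw [FreeOp.unitElt_one i hi, smul_zero]
  arity_one_zero := by
    refine ⟨fun n m h => ?_, fun p => ?_⟩
    · have h' := congrArg (FreeOp.aug (M := M)) h
      have h1 : FreeOp.aug (M := M) (FreeOp.one rfl) = 1 := rfl
      have h2 : ∀ n : ℤ, FreeOp.aug (M := M) (n • FreeOp.one rfl) = n := fun n => by
        rw [map_zsmul, h1, smul_eq_mul, mul_one]
      exact (h2 n).symm.trans (h'.trans (h2 m))
    · obtain ⟨n, hn⟩ := FreeOp.exists_eq_zsmul_unitElt (M := M) p le_rfl
      exact ⟨n, hn.symm⟩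
  one_comp := FreeOp.one_comp
  comp_one := FreeOp.comp_one
  assoc_seq := FreeOp.assoc_seq
  assoc_par := FreeOp.assoc_par
  equivariance := FreeOp.equivariance
  leibniz := FreeOp.deriv_comp θ

/-! ### Universal property of the free operad. -/

section Eval

variable {P : OperadData}

/-- The value in `P` of a formal expression, the generators being sent to `P` by `φ`. -/
def valueIn (P : OperadData) (φ : GradedMap M P.toSigmaData) :
    ∀ {r : ℕ} {i : ℤ}, FreeTerm M r i → P.X r i
  | r, i, .gen _ x => φ r i x
  | _, _, .one hi => P.one hi
  | _, _, .zero => 0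
  | _, _, .add p q => valueIn P φ p + valueIn P φ q
  | _, _, .neg p => -valueIn P φ p
  | _, _, .act σ p => P.act σ (valueIn P φ p)
  | _, _, .comp hr hk e p q => P.comp hr hk e (valueIn P φ p) (valueIn P φ q)

theorem valueIn_rel (hP : IsOperad P) {φ : GradedMap M P.toSigmaData}
    (hφ : ∀ {r : ℕ} {i : ℤ}, 2 ≤ r → ∀ (σ : Perm (Fin r)) (x : M.X r i),
      φ r i (M.act σ x) = P.act σ (φ r i x)) {r : ℕ} {i : ℤ} {p q : FreeTerm M r i}
    (h : FreeRel M p q) : valueIn P φ p = valueIn P φ q := by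
  induction h with
  | add_left q _ ih => simp only [valueIn, ih]
  | add_right p _ ih => simp only [valueIn, ih]
  | neg_congr _ ih => simp only [valueIn, ih]
  | act_congr σ _ ih => simp only [valueIn, ih]
  | comp_left hr hk e q _ ih => simp only [valueIn, ih]
  | comp_right hr hk e p _ ih => simp only [valueIn, ih]
  | add_assoc p q x => simp only [valueIn, _root_.add_assoc]
  | add_comm p q => simp only [valueIn]; exact _root_.add_comm _ _
  | zero_add p => simp only [valueIn, _root_.zero_add]
  | neg_add p => simp only [valueIn, neg_add_cancel]
  | gen_add hr x y => simp only [valueIn, map_add]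
  | gen_act hr σ x => exact hφ hr σ x
  | act_add σ p q => simp only [valueIn, map_add]
  | act_one p => simp only [valueIn, hP.isSigma.act_one]
  | act_mul σ τ p => simp only [valueIn, hP.isSigma.act_mul]
  | comp_add_left hr hk e p p' q => simp only [valueIn, map_add, LinearMap.add_apply]
  | comp_add_right hr hk e p q q' => simp only [valueIn, map_add]
  | one_comp hr hk e q => simp only [valueIn, hP.one_comp]
  | comp_one hr hk e p => simp only [valueIn, hP.comp_one]
  | assoc_seq ha hra hb hrb hl hln hm hmn e f g hg p q x =>
    exact hP.assoc_seq ha hra hb hrb hl hln hm hmn e f g hg _ _ _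
  | assoc_par_even ha hra hb hrb hl hln hm hmn e f g h' hef hg hh hjk p q x =>
    simp only [valueIn]
    rw [hP.assoc_par ha hra hb hrb hl hln hm hmn e f g h' hef hg hh, Int.negOnePow_even _ hjk,
      one_smul]
  | assoc_par_odd ha hra hb hrb hl hln hm hmn e f g h' hef hg hh hjk p q x =>
    simp only [valueIn]
    rw [hP.assoc_par ha hra hb hrb hl hln hm hmn e f g h' hef hg hh, Int.negOnePow_odd _ hjk,
      Units.neg_smul, one_smul]
  | equivariance hr hk e σ τ p q => exact hP.equivariance hr hk e σ τ _ _

/-- The extension of `φ` to the free operad. -/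
def FreeOp.eval (hP : IsOperad P) (φ : GradedMap M P.toSigmaData)
    (hφ : ∀ {r : ℕ} {i : ℤ}, 2 ≤ r → ∀ (σ : Perm (Fin r)) (x : M.X r i),
      φ r i (M.act σ x) = P.act σ (φ r i x)) (r : ℕ) (i : ℤ) : FreeOp M r i →ₗ[ℤ] P.X r i :=
  AddMonoidHom.toIntLinearMap (AddMonoidHom.mk'
    (Quot.lift (valueIn P φ) fun _ _ h => valueIn_rel hP hφ h) (by rintro ⟨p⟩ ⟨q⟩; rfl))

theorem FreeOp.eval_act (hP : IsOperad P) {φ : GradedMap M P.toSigmaData}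
    (hφ : ∀ {r : ℕ} {i : ℤ}, 2 ≤ r → ∀ (σ : Perm (Fin r)) (x : M.X r i),
      φ r i (M.act σ x) = P.act σ (φ r i x)) {r : ℕ} {i : ℤ} (σ : Perm (Fin r))
    (p : FreeOp M r i) :
    FreeOp.eval hP φ hφ r i (FreeOp.act σ p) = P.act σ (FreeOp.eval hP φ hφ r i p) := by
  obtain ⟨p, rfl⟩ := FreeOp.exists_mk p
  rfl

theorem FreeOp.eval_comp (hP : IsOperad P) {φ : GradedMap M P.toSigmaData}
    (hφ : ∀ {r : ℕ} {i : ℤ}, 2 ≤ r → ∀ (σ : Perm (Fin r)) (x : M.X r i),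
      φ r i (M.act σ x) = P.act σ (φ r i x)) {s t r : ℕ} {i j k : ℤ} (hr : r + 1 = s + t)
    (hk : i + j = k) (e : Fin s) (p : FreeOp M s i) (q : FreeOp M t j) :
    FreeOp.eval hP φ hφ r k (FreeOp.comp hr hk e p q) =
      P.comp hr hk e (FreeOp.eval hP φ hφ s i p) (FreeOp.eval hP φ hφ t j q) := by
  obtain ⟨p, rfl⟩ := FreeOp.exists_mk p
  obtain ⟨q, rfl⟩ := FreeOp.exists_mk q
  rfl

/-- Both differentials are derivations for the composites, so the commutation with `eval` need only
be known on generators. -/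
theorem isOperadHom_eval (hP : IsOperad P) (θ : GenDerivation M) (φ : GradedMap M P.toSigmaData)
    (hφ : ∀ {r : ℕ} {i : ℤ}, 2 ≤ r → ∀ (σ : Perm (Fin r)) (x : M.X r i),
      φ r i (M.act σ x) = P.act σ (φ r i x))
    (hφd : ∀ {r : ℕ} {i j : ℤ} (hr : 2 ≤ r) (h : j + 1 = i) (x : M.X r i),
      FreeOp.eval hP φ hφ r j (θ.toFun hr h x) = P.d h (φ r i x)) :
    IsOperadHom (P := quasiFree M θ) (Q := P) (FreeOp.eval hP φ hφ) where
  isSigmaHom :=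
    { map_d := fun {r i j} h p => by
        obtain ⟨p, rfl⟩ := FreeOp.exists_mk p
        change FreeOp.eval hP φ hφ r j (derivTerm θ p j h) = P.d h (valueIn P φ p)
        induction p generalizing j with
        | gen hr x => exact hφd hr h x
        | one hi =>
          have := hP.arity_one j (by omega)
          exact Subsingleton.elim _ _
        | zero => exact (map_zero _).trans (map_zero _).symm
        | add p q hp hq => rw [derivTerm, valueIn, map_add, map_add, hp, hq]
        | neg p hp => rw [derivTerm, valueIn, map_neg, map_neg, hp]
        | @act r i σ p hp =>
          rw [valueIn, hP.isSigma.d_act, ← hp]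
          exact FreeOp.eval_act hP hφ σ _
        | @comp s t r a b c hr hk e p q hp hq =>
          rw [valueIn, hP.leibniz hr hk (sub_add_cancel a 1) (sub_add_cancel b 1) h
            (show a - 1 + b = j by omega) (show a + (b - 1) = j by omega), ← hp, ← hq, derivTerm,
            map_add, map_units_smul, FreeOp.eval_comp, FreeOp.eval_comp]
          rfl
      map_act := FreeOp.eval_act hP hφ }
  map_one := rfl
  map_comp := FreeOp.eval_comp hP hφ

theorem IsOperadHom.comp {P Q R : OperadData} {f : GradedMap P.toSigmaData Q.toSigmaData}
    {g : GradedMap Q.toSigmaData R.toSigmaData} (hf : IsOperadHom f) (hg : IsOperadHom g) :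
    IsOperadHom (P := P) (Q := R) fun r i => g r i ∘ₗ f r i where
  isSigmaHom :=
    { map_d := fun h x => by
        rw [LinearMap.comp_apply, LinearMap.comp_apply, hf.isSigmaHom.map_d, hg.isSigmaHom.map_d]
      map_act := fun σ x => by
        rw [LinearMap.comp_apply, LinearMap.comp_apply, hf.isSigmaHom.map_act,
          hg.isSigmaHom.map_act] }
  map_one := by rw [LinearMap.comp_apply, hf.map_one, hg.map_one]
  map_comp hr hk e p q := by
    rw [LinearMap.comp_apply, LinearMap.comp_apply, LinearMap.comp_apply, hf.map_comp, hg.map_comp]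

theorem IsOperadHom.ext_of_gen {θ : GenDerivation M}
    {f g : GradedMap (quasiFree M θ).toSigmaData P.toSigmaData} (hf : IsOperadHom f)
    (hg : IsOperadHom g)
    (h : ∀ {r : ℕ} {i : ℤ} (hr : 2 ≤ r) (x : M.X r i),
      f r i (FreeOp.gen hr x) = g r i (FreeOp.gen hr x)) (r : ℕ) (i : ℤ)
    (p : (quasiFree M θ).X r i) : f r i p = g r i p := by
  obtain ⟨p, rfl⟩ := FreeOp.exists_mk p
  induction p with
  | gen hr x => exact h hr x
  | one hi => subst hi; exact hf.map_one.trans hg.map_one.symm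
  | zero => exact (map_zero (f _ _)).trans (map_zero (g _ _)).symm
  | add p q hp hq =>
    exact (map_add (f _ _) _ _).trans ((congrArg₂ _ hp hq).trans (map_add (g _ _) _ _).symm)
  | neg p hp => exact (map_neg (f _ _) _).trans ((congrArg _ hp).trans (map_neg (g _ _) _).symm)
  | act σ p hp =>
    exact (hf.isSigmaHom.map_act σ _).trans
      ((congrArg _ hp).trans (hg.isSigmaHom.map_act σ _).symm)
  | comp hr hk e p q hp hq =>
    exact (hf.map_comp hr hk e (FreeOp.mk p) (FreeOp.mk q)).trans ((congrArg₂ (fun x y =>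
      P.comp hr hk e x y) hp hq).trans (hg.map_comp hr hk e (FreeOp.mk p) (FreeOp.mk q)).symm)

end Eval

end QuasiFree

/-! ### The cobar construction of a connected cooperad -/

theorem treeTerm_eq_zero {C : OperadData} {x : ∀ r, C.X r (-1)} (h0 : ∀ s < 2, x s = 0) {k : ℤ}
    (hk : -1 + -1 = k) {r : ℕ} {J : Finset (Fin r)} (hJ : ¬(2 ≤ J.card ∧ J.card < r)) :
    treeTerm x hk J = 0 := by
  by_cases h : J.card < 2
  · rw [treeTerm, h0 _ h, map_zero, map_zero]
  · rw [treeTerm, h0 (r + 1 - J.card) (by omega), map_zero, LinearMap.zero_apply, map_zero]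

/-- Vertices of arity less than two contribute nothing, so both vertices of a tree that counts have
arity less than `r`. This triangularity is what permits induction on the arity. -/
theorem treeSum_congr {C : OperadData} {x x' : ∀ r, C.X r (-1)} (h0 : ∀ s < 2, x s = 0)
    (h0' : ∀ s < 2, x' s = 0) {k : ℤ} (hk : -1 + -1 = k) {r : ℕ} (h : ∀ s < r, x s = x' s) :
    treeSum x hk r = treeSum x' hk r := by
  refine Finset.sum_congr rfl fun J _ => ?_
  by_cases hJ : 2 ≤ J.card ∧ J.card < r
  · rw [treeTerm, treeTerm, h _ hJ.2, h _ (by omega)]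
  · rw [treeTerm_eq_zero h0 hk hJ, treeTerm_eq_zero h0' hk hJ]

/-! ### Twisting maps and their quadratic term. -/

section Twisting

open TensorProduct

variable {D : CooperadData} {P Q : OperadData}

/-- Families of linear maps `Σ⁻¹D → P` of degree zero. -/
abbrev DesuspMap (D : CooperadData) (P : OperadData) : Type :=
  ∀ (r : ℕ) (i : ℤ), D.X r (i + 1) →ₗ[ℤ] P.X r i

/-- Equivariance of a family `Σ⁻¹D → P` in arity at least two. -/
def IsEquivariant (φ : DesuspMap D P) : Prop :=
  ∀ {r : ℕ} {i : ℤ}, 2 ≤ r → ∀ (σ : Perm (Fin r)) (x : D.X r (i + 1)),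
    φ r i (D.act σ x) = P.act σ (φ r i x)

/-- The homomorphism of degree `-1` from `D̄` to `P` given by a family of maps on `Σ⁻¹D̄`. -/
def convDesusp (φ : DesuspMap D P) (r : ℕ) :
    ConvHom D P r (-1) :=
  if 2 ≤ r then fun ⟨(a, b), h⟩ => by
    obtain rfl : a = b + 1 := by omega
    exact φ r b
  else 0

theorem convDesusp_apply (φ : DesuspMap D P) {r : ℕ} {b : ℤ}
    (hr : 2 ≤ r) (h : b + 1 + -1 = b) (c : D.X r (b + 1)) :
    convDesusp φ r ⟨(b + 1, b), h⟩ c = φ r b c := by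
  rw [convDesusp, if_pos hr]

theorem convDesusp_eq_zero (φ : DesuspMap D P) {r : ℕ}
    (hr : r < 2) : convDesusp φ r = 0 :=
  if_neg (by omega)

theorem convDesusp_ext {φ : DesuspMap D P} {r : ℕ}
    {A : ConvHom D P r (-1)} (h0 : r < 2 → A = 0)
    (h : 2 ≤ r → ∀ (b : ℤ) (h : b + 1 + -1 = b) (c : D.X r (b + 1)), A ⟨(b + 1, b), h⟩ c = φ r b c) :
    A = convDesusp φ r := by
  by_cases hr : 2 ≤ r
  · refine convHom_ext fun n m hn c => ?_
    obtain rfl : n = m + 1 := by omega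
    rw [convDesusp_apply φ hr, h hr]
  · rw [convDesusp_eq_zero φ (by omega), h0 (by omega)]

/-- The quadratic map on `Σ⁻¹D̄` associated with `φ`. -/
def treeVal (hD : IsCooperad D) (φ : DesuspMap D P) {r : ℕ}
    {i j : ℤ} (h : j + 1 = i) : D.X r (i + 1) →ₗ[ℤ] P.X r j :=
  (treeSum (C := conv hD P) (k := -2) (convDesusp φ) (by norm_num) r : ConvHom D P r (-2))
    ⟨(i + 1, j), by omega⟩

theorem treeVal_congr (hD : IsCooperad D) {φ φ' : DesuspMap D P}
    {r : ℕ} {i j : ℤ} (h : j + 1 = i) (hφ : ∀ s < r, 2 ≤ s → φ s = φ' s) :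
    treeVal hD φ (r := r) h = treeVal hD φ' h := by
  have := treeSum_congr (C := conv hD P) (k := -2) (x := convDesusp φ) (x' := convDesusp φ')
    (r := r) (fun s hs => convDesusp_eq_zero φ hs) (fun s hs => convDesusp_eq_zero φ' hs)
    (by norm_num) (fun s hs => convDesusp_ext (fun h => convDesusp_eq_zero φ h) fun h2 b hb c => by
      rw [convDesusp_apply φ h2, hφ s hs h2])
  exact congrFun this _

theorem convAct_convDesusp (hD : IsCooperad D)
    {φ : DesuspMap D P}
    (hφ : IsEquivariant φ) (r : ℕ) (σ : Perm (Fin r)) :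
    convAct D P σ (convDesusp φ r) = convDesusp φ r := by
  refine convDesusp_ext (fun h => by rw [convDesusp_eq_zero φ h, map_zero]) fun hr b hb c => ?_
  rw [convAct_apply, convDesusp_apply φ hr, ← hφ hr]
  congr 1
  change D.act σ (D.act σ⁻¹ c) = c
  rw [← hD.isSigma.act_mul, mul_inv_cancel, hD.isSigma.act_one]

theorem treeVal_act (hD : IsCooperad D) (hP : IsPseudoOperad P)
    {φ : DesuspMap D P}
    (hφ : IsEquivariant φ) {r : ℕ} {i j : ℤ}
    (h : j + 1 = i) (σ : Perm (Fin r)) (y : D.X r (i + 1)) :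
    treeVal hD φ h (D.act σ y) = P.act σ (treeVal hD φ h y) := by
  have h1 := act_treeSum (isPseudoOperad_conv hD hP) (k := -2) (x := convDesusp φ)
    (convAct_convDesusp hD hφ) (by norm_num) σ
  have h2 := LinearMap.congr_fun (congrFun h1 ⟨(i + 1, j), by omega⟩) (D.act σ y)
  refine h2.symm.trans ?_
  change P.act σ (treeVal hD φ h (D.act σ⁻¹ (D.act σ y))) = _
  rw [← hD.isSigma.act_mul, inv_mul_cancel, hD.isSigma.act_one]

/-- The twisting equation for `φ` in arity `r`. -/
def IsTwisting (hD : IsCooperad D) (φ : DesuspMap D P)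
    (r : ℕ) : Prop :=
  ∀ {i j : ℤ} (h : j + 1 = i) (y : D.X r (i + 1)),
    P.d h (φ r i y) = φ r j (-D.d (by omega) y) + treeVal hD φ h y

/-- Translates the twisting equation, written with desuspensions, into the equation of `d_treeSum`
in the convolution pseudo-operad. In arity less than two, both sides vanish. -/
theorem IsTwisting.convDiff_convDesusp {hD : IsCooperad D}
    {φ : DesuspMap D P} {r : ℕ} (hφ : 2 ≤ r → IsTwisting hD φ r)
    (hk : (-2 : ℤ) + 1 = -1) : convDiff D P hk (convDesusp φ r) =
      treeSum (C := conv hD P) (convDesusp φ) (by norm_num) r := by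
  by_cases hr : 2 ≤ r
  · refine convHom_ext fun n m hn c => ?_
    obtain rfl : n = m + 1 + 1 := by omega
    rw [convDiff_apply hk _ hn rfl rfl (by omega) (by omega), convDesusp_apply φ hr,
      convDesusp_apply φ hr, hφ hr rfl c]
    refine Eq.trans ?_ (show treeVal hD φ rfl c = _ from rfl)
    rw [map_neg, Int.negOnePow_neg, Int.negOnePow_one, Units.val_neg, Units.val_one, neg_smul,
      one_smul, sub_neg_eq_add]
    exact neg_add_cancel_comm _ _
  · rw [convDesusp_eq_zero φ (by omega), map_zero]
    exact (Finset.sum_eq_zero fun J _ => treeTerm_eq_zero (C := conv hD P)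
      (fun s hs => convDesusp_eq_zero φ hs) _ (by omega)).symm

/-- This is `d_treeSum` in the convolution pseudo-operad, evaluated on an element. It yields both
`∂² = 0` in the cobar construction and the consistency of the lifting problem in arity `r`. -/
theorem d_treeVal_add (hD : IsCooperad D) (hP : IsPseudoOperad P)
    {φ : DesuspMap D P}
    (hφ : IsEquivariant φ) {r : ℕ}
    (hφr : ∀ s < r, 2 ≤ s → IsTwisting hD φ s) {i j k : ℤ} (hij : j + 1 = i) (hjk : k + 1 = j)
    (y : D.X r (i + 1)) :
    P.d hjk (treeVal hD φ hij y) + treeVal hD φ hjk (-D.d (show j + 1 + 1 = i + 1 by omega) y) = 0 := by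
  have h1 := d_treeSum (isPseudoOperad_conv hD hP) (x := convDesusp φ) (r := r)
    (convAct_convDesusp hD hφ) (convDesusp_eq_zero φ two_pos) (convDesusp_eq_zero φ one_lt_two)
    (show -1 + -1 = (-2 : ℤ) by norm_num) (show (-2 : ℤ) + 1 = -1 by norm_num)
    (show (-3 : ℤ) + 1 = -2 by norm_num)
    (fun s hs => IsTwisting.convDiff_convDesusp (hφr s hs) (by norm_num))
  have h2 := LinearMap.congr_fun (congrFun h1 ⟨(i + 1, k), by omega⟩) y
  subst hij
  refine Eq.trans ?_ h2
  refine Eq.trans ?_ (convDiff_apply (D := D) (P := P) (show (-3 : ℤ) + 1 = -2 by norm_num)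
    (treeSum (C := conv hD P) (convDesusp φ) (by norm_num) r) _ hjk rfl (by omega) (by omega) y).symm
  rw [sub_eq_add_neg, Int.negOnePow_even (-2) ⟨-1, by norm_num⟩, Units.val_one, one_smul]
  congr 1
  exact map_neg _ _

theorem map_convTerm {f : GradedMap P.toSigmaData Q.toSigmaData}
    (hf : ∀ {s t r : ℕ} {i j k : ℤ} (hr : r + 1 = s + t) (hk : i + j = k) (e : Fin s)
      (p : P.X s i) (q : P.X t j), f r k (P.comp hr hk e p q) = Q.comp hr hk e (f s i p) (f t j q))
    {s t r : ℕ} {i j k n m : ℤ} (hr : r + 1 = s + t) (hk : i + j = k) (e : Fin s)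
    (h : n + k = m) (A : ConvHom D P s i) (B : ConvHom D P t j) {a b : ℤ} (hab : a + b = n)
    (c : D.X r n) : f r m (convTerm hr hk e h A B hab c) =
      convTerm hr hk e h (fun p => f s p.1.2 ∘ₗ A p) (fun p => f t p.1.2 ∘ₗ B p) hab c := by
  rw [convTerm_apply, convTerm_apply, map_smul]
  congr 1
  generalize D.decomp hr _ e c = z
  induction z with
  | zero => simp only [map_zero]
  | add y z hy hz => simp only [map_add, hy, hz]
  | tmul y z => exact hf _ _ _ _ _

/-- The composite of `φ` with itself along the tree with two vertices given by `J`. -/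
def convTree (hD : IsCooperad D) (φ : DesuspMap D P) {r : ℕ} (J : Finset (Fin r)) :
    ConvHom D P r (-2) :=
  treeTerm (C := conv hD P) (k := -2) (convDesusp φ) (by norm_num) J

theorem convTree_eq_zero (hD : IsCooperad D) (φ : DesuspMap D P) {r : ℕ} {J : Finset (Fin r)}
    (hJ : ¬(2 ≤ J.card ∧ J.card < r)) : convTree hD φ J = 0 :=
  treeTerm_eq_zero (C := conv hD P) (fun _ hs => convDesusp_eq_zero φ hs) _ hJ

theorem treeVal_apply (hD : IsCooperad D) (φ : DesuspMap D P)
    {r : ℕ} {i j : ℤ} (h : j + 1 = i) (y : D.X r (i + 1)) :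
    treeVal hD φ h y = ∑ J : Finset (Fin r),
      convTree hD φ J
        ⟨(i + 1, j), by omega⟩ y := by
  have h1 : (treeSum (C := conv hD P) (k := -2) (convDesusp φ) (by norm_num) r :
      ConvHom D P r (-2)) ⟨(i + 1, j), by omega⟩ = ∑ J : Finset (Fin r),
      convTree hD φ J
        ⟨(i + 1, j), by omega⟩ := Finset.sum_apply _ _ _
  exact (LinearMap.congr_fun h1 y).trans (LinearMap.sum_apply _ _ _)

theorem convTree_apply (hD : IsCooperad D)
    (φ : DesuspMap D P) {r : ℕ} {n m : ℤ}
    (h : n + -2 = m) (J : Finset (Fin r)) (c : D.X r n) :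
    convTree hD φ J
        ⟨(n, m), h⟩ c = P.act (subsetPerm J) (∑ᶠ a, convTerm (card_add_one J)
          (show -1 + -1 = (-2 : ℤ) by norm_num) ⟨0, zero_lt_sub_card J⟩ h
          (convDesusp φ (r + 1 - J.card)) (convDesusp φ J.card) (show a + (n - a) = n by omega)
          (D.act (subsetPerm J)⁻¹ c)) := rfl

/-- The quadratic term is built from composites and permutations, so only these need be respected by
`f`. As it involves smaller arities only, `hψ` is not required in arity `r`, which is the arity
where a lifting is still to be found. -/
theorem map_treeVal (hD : IsCooperad D) {φ : DesuspMap D P}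
    {ψ : DesuspMap D Q}
    {f : GradedMap P.toSigmaData Q.toSigmaData}
    (hf : ∀ {s t r : ℕ} {i j k : ℤ} (hr : r + 1 = s + t) (hk : i + j = k) (e : Fin s)
      (p : P.X s i) (q : P.X t j), f r k (P.comp hr hk e p q) = Q.comp hr hk e (f s i p) (f t j q))
    (hfa : ∀ {r : ℕ} {i : ℤ} (σ : Perm (Fin r)) (p : P.X r i),
      f r i (P.act σ p) = Q.act σ (f r i p)) {r : ℕ}
    (hψ : ∀ s < r, 2 ≤ s → ∀ i x, f s i (φ s i x) = ψ s i x) {i j : ℤ} (h : j + 1 = i)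
    (y : D.X r (i + 1)) :
    f r j (treeVal hD φ h y) = treeVal hD ψ h y := by
  rw [treeVal_apply, treeVal_apply, map_sum]
  refine Finset.sum_congr rfl fun J _ => ?_
  have hx : ∀ s < r, (fun p => f s p.1.2 ∘ₗ convDesusp φ s p : ConvHom D Q s (-1)) =
      convDesusp ψ s := fun s hs => by
    refine convDesusp_ext (fun h => ?_) fun hs2 b hb c => ?_
    · rw [convDesusp_eq_zero φ h]
      exact convHom_ext fun n m hn c => map_zero (f s m)
    · rw [← hψ s hs hs2, ← convDesusp_apply φ hs2 hb]
      rfl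
  by_cases hJ : 2 ≤ J.card ∧ J.card < r
  · rw [convTree_apply, convTree_apply, hfa]
    congr 1
    refine ((f r j).toAddMonoidHom.map_finsum (convTerm_finite hD _ _ _ _ _ _ _)).trans
      (finsum_congr fun a => (map_convTerm hf _ _ _ _ _ _ _ _).trans ?_)
    rw [hx _ hJ.2, hx _ (by omega)]
  · rw [convTree_eq_zero hD φ hJ, convTree_eq_zero hD ψ hJ]
    exact map_zero _

end Twisting

/-! ### Differential and cofibrancy of the cobar construction. -/

section CobarOperad

open TensorProduct

variable {D : CooperadData} {P : OperadData}

theorem convTerm_apply_of_eq {s t r : ℕ} {i j k n m : ℤ} (hr : r + 1 = s + t) (hk : i + j = k)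
    (e : Fin s) (h : n + k = m) (A : ConvHom D P s i) (B : ConvHom D P t j) {a b b' x y : ℤ}
    (hab : a + b = n) (hx : a + i = x) (hy : b' + j = y) (hab' : a + b' = n) (hxy : x + y = m)
    (c : D.X r n) :
    convTerm hr hk e h A B hab c = ((j * a).negOnePow : ℤ) •
      lift ((P.comp hr hxy e).compl₁₂ (A ⟨(a, x), hx⟩) (B ⟨(b', y), hy⟩))
        (D.decomp hr hab' e c) := by
  obtain rfl : b = b' := by omega
  subst hx hy
  rfl

/-- The inclusion of the generators in the cobar construction, extended by zero in arity less than
two. -/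
def cobarIncl (hD : IsCooperad D) : DesuspMap D (cobar D hD) := fun r i =>
  if h : 2 ≤ r then show D.X r (i + 1) →ₗ[ℤ] (cobar D hD).X r i from genDesusp h else 0

theorem cobarIncl_apply (hD : IsCooperad D) {r : ℕ} {i : ℤ} (h : 2 ≤ r) (c : D.X r (i + 1)) :
    cobarIncl hD r i c = (genDesusp h c : FreeOp (desusp D.toSigmaData) r i) :=
  LinearMap.congr_fun (dif_pos h) c

theorem isEquivariant_cobarIncl (hD : IsCooperad D) : IsEquivariant (cobarIncl hD) := by
  intro r i hr σ x
  rw [cobarIncl_apply hD hr, cobarIncl_apply hD hr]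
  exact genDesusp_act hr σ x

/-- The two sums differ by a shift: the index is the degree of `Σ⁻¹c'` on one side and that of `c'`
on the other. The sign `(-1)^{|c'|}` is the Koszul sign of the second factor, a map of degree `-1`,
passing `c'`. -/
theorem treeComp_eq_convTree (hD : IsCooperad D) {r : ℕ} {i j : ℤ} (h : j + 1 = i)
    (J : Finset (Fin r)) (hr : r + 1 = (r + 1 - J.card) + J.card) (hs : 2 ≤ r + 1 - J.card)
    (ht : 2 ≤ J.card) (c : D.X r (i + 1)) :
    treeComp hD hr hs ht h (subsetPerm J) c =
      convTree hD (cobarIncl hD) J ⟨(i + 1, j), by omega⟩ c := by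
  rw [convTree_apply]
  refine congrArg (FreeOp.act (M := desusp D.toSigmaData) (subsetPerm J)) ?_
  change (∑ᶠ a : ℤ, rootCompAux hr hs ht (show a + (j - a) = j by omega) h
    (D.act (subsetPerm J)⁻¹ c)) = _
  refine Eq.trans (finsum_congr fun a => ?_) (finsum_comp_equiv (Equiv.addRight (1 : ℤ)))
  rw [Equiv.coe_addRight]
  refine Eq.trans ?_ (convTerm_apply_of_eq (D := D) (P := cobar D hD) (a := a + 1) (b := i + 1 - (a + 1)) (b' := j - a + 1) (x := a)
    (y := j - a) (card_add_one J) (show -1 + -1 = (-2 : ℤ) by norm_num) ⟨0, zero_lt_sub_card J⟩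
    (show i + 1 + -2 = j by omega) (convDesusp (cobarIncl hD) (r + 1 - J.card))
    (convDesusp (cobarIncl hD) J.card) (by omega) (by omega) (by omega) (by omega) (by omega) _).symm
  have hsgn : ((-1 * (a + 1)).negOnePow : ℤ) = ((a + 1).negOnePow : ℤ) :=
    negOnePow_congr ⟨-(a + 1), by ring⟩
  rw [hsgn]
  refine congrArg (fun z : FreeOp (desusp D.toSigmaData) r j => ((a + 1).negOnePow : ℤ) • z) ?_
  have e : ∀ {t : ℕ} (ht : 2 ≤ t) (b : ℤ) (hb : b + 1 + -1 = b),
      convDesusp (cobarIncl hD) t ⟨(b + 1, b), hb⟩ =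
        show D.X t (b + 1) →ₗ[ℤ] (cobar D hD).X t b from genDesusp ht := fun ht b hb =>
    LinearMap.ext fun y => (convDesusp_apply _ ht hb y).trans (cobarIncl_apply hD ht y)
  rw [e hs, e ht]
  rfl

theorem quadraticDiff_eq_treeVal (hD : IsCooperad D) {r : ℕ} {i j : ℤ} (h : j + 1 = i)
    (c : D.X r (i + 1)) : quadraticDiff hD h c = treeVal hD (cobarIncl hD) h c := by
  rw [treeVal_apply, quadraticDiff, LinearMap.sum_apply]
  refine Finset.sum_congr rfl fun J _ => ?_
  by_cases hJ : 2 ≤ J.card ∧ J.card < r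
  · rw [dif_pos hJ]
    exact treeComp_eq_convTree hD h J _ _ _ c
  · rw [dif_neg hJ, convTree_eq_zero hD _ hJ]
    rfl

theorem cobarGen_apply (hD : IsCooperad D) {r : ℕ} {i j : ℤ} (hr : 2 ≤ r) (h : j + 1 = i)
    (c : D.X r (i + 1)) : ((cobarGen hD).toFun hr h c : (cobar D hD).X r j) =
      cobarIncl hD r j (-D.d (by omega) c) + treeVal hD (cobarIncl hD) h c := by
  rw [← quadraticDiff_eq_treeVal, cobarIncl_apply hD hr]
  rfl

theorem isTwisting_cobarIncl (hD : IsCooperad D) {r : ℕ} (hr : 2 ≤ r) :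
    IsTwisting hD (cobarIncl hD) r := by
  intro i j h y
  rw [cobarIncl_apply hD hr]
  exact cobarGen_apply hD hr h y

/-- By the definition of the differential, the inclusion of the generators satisfies the twisting
equation, and `d_treeVal_add` then says that `∂²` vanishes on generators. There is no circularity,
as a pseudo-operad is not required to satisfy `d² = 0`. -/
theorem isOperad_cobar (hD : IsCooperad D) : IsOperad (cobar D hD) := by
  refine isOperad_quasiFree _ fun {r i j k} hr h h' x => ?_
  change D.X r (i + 1) at x
  have h1 := d_treeVal_add hD (isPseudoOperad_quasiFree (cobarGen hD))
    (isEquivariant_cobarIncl hD) (r := r) (fun s _ hs => isTwisting_cobarIncl hD hs) h h' x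
  have h2 := isTwisting_cobarIncl hD hr h' (-D.d (show j + 1 + 1 = i + 1 by omega) x)
  refine (congrArg ((cobar D hD).d h') (cobarGen_apply hD hr h x)).trans ?_
  rw [map_add, h2, map_neg (D.d _), hD.isSigma.d_d, neg_zero, neg_zero, map_zero, zero_add,
    add_comm]
  exact h1

/-- Morphisms out of the cobar construction are twisting maps, and the lifting is found by induction
on the arity. In arity `k` the quadratic term is known from smaller arities, so what remains is a
twisted lifting problem for `Σ⁻¹D(k)`, which the hypothesis `lift` solves. -/
theorem isCofibrantOperad_cobar (hD : IsCooperad D)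
    (lift : ∀ (r : ℕ) {A B : SigmaData}, IsSigma A → ∀ {p : GradedMap A B}, IsSigmaHom p →
      IsFibration p → IsWeakEquivalence p → ∀ {f : ∀ i, D.X r (i + 1) →ₗ[ℤ] B.X r i}
      {θ : ∀ {i j : ℤ}, j + 1 = i → D.X r (i + 1) →ₗ[ℤ] A.X r j},
      IsTwistedDatum r (Y := desusp D.toSigmaData) p f θ →
      ∃ g : ∀ i, D.X r (i + 1) →ₗ[ℤ] A.X r i,
        IsTwistedLift r (Y := desusp D.toSigmaData) p f θ g) :
    IsCofibrantOperad (cobar D hD) := by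
  refine ⟨isOperad_cobar hD, fun A B hA hB p hp hf hw f hfB => ?_⟩
  let ψ : DesuspMap D B := fun r i => f r i ∘ₗ cobarIncl hD r i
  have hψ : IsEquivariant ψ := fun {r i} hr σ x =>
    (congrArg (f r i) (isEquivariant_cobarIncl hD hr σ x)).trans (hfB.isSigmaHom.map_act σ _)
  have hψt : ∀ r, 2 ≤ r → IsTwisting hD ψ r := fun r hr i j h y => by
    refine (hfB.isSigmaHom.map_d h _).symm.trans ?_
    rw [isTwisting_cobarIncl hD hr h y, map_add,
      map_treeVal hD (ψ := ψ) hfB.map_comp hfB.isSigmaHom.map_act (fun _ _ _ _ _ => rfl)]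
    rfl
  let S : ℕ → DesuspMap D A → Prop := fun k φ => ∀ r < k, 2 ≤ r →
    IsTwistedLift r (Y := desusp D.toSigmaData) p (ψ r) (fun h => treeVal hD φ h) (φ r)
  have loc : ∀ k φ φ', (∀ r < k, φ r = φ' r) → S k φ → S k φ' := by
    intro k φ φ' hφφ' hφ r hr h2
    have h1 := hφ r hr h2
    have h3 : ∀ {i j : ℤ} (h : j + 1 = i), treeVal hD φ' (r := r) h = treeVal hD φ h :=
      fun h => treeVal_congr hD h fun s hs _ => (hφφ' s (hs.trans hr)).symm
    rw [← hφφ' r hr]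
    exact ⟨h1.map_act, h1.proj, fun h y => (h1.map_d h y).trans (by rw [h3])⟩
  have step : ∀ k φ, S k φ → ∃ φ', S (k + 1) φ' ∧ ∀ r < k, φ' r = φ r := by
    intro k φ₀ hφ₀
    -- Truncation makes the partial lifting equivariant in all arities, as the lemmas on the
    -- quadratic term require, and does not change that term in arities up to `k`.
    let φ : DesuspMap D A := fun r => if 2 ≤ r ∧ r < k then φ₀ r else 0
    have hφ : ∀ r < k, 2 ≤ r → IsTwistedLift r (Y := desusp D.toSigmaData) p (ψ r)
        (fun h => treeVal hD φ h) (φ r) := fun r hr h2 => by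
      have h1 := hφ₀ r hr h2
      have h3 : ∀ {i j : ℤ} (h : j + 1 = i), treeVal hD φ (r := r) h = treeVal hD φ₀ h :=
        fun h => treeVal_congr hD h fun s hs hs2 => if_pos ⟨hs2, hs.trans hr⟩
      rw [show φ r = φ₀ r from if_pos ⟨h2, hr⟩]
      exact ⟨h1.map_act, h1.proj, fun h y => (h1.map_d h y).trans (by rw [h3])⟩
    have heq : IsEquivariant φ := fun {r i} hr σ x => by
      by_cases h : r < k
      · exact (hφ r h hr).map_act σ x
      · rw [show φ r = 0 from if_neg fun h' => h h'.2]
        exact (map_zero (A.act σ)).symm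
    have hp1 : ∀ s < k, 2 ≤ s → ∀ i x, p s i (φ s i x) = ψ s i x :=
      fun s hs h2 i x => (hφ s hs h2).proj x
    by_cases hk : 2 ≤ k
    -- The field `f_d` holds because `ψ` is twisting and `p` carries the quadratic term of `φ` to
    -- that of `ψ`; `θ_d` is `d_treeVal_add`, which uses the twisting equation in the arities
    -- already treated.
    · have datum : IsTwistedDatum k (Y := desusp D.toSigmaData) p (ψ k)
          (fun h => treeVal hD φ h) :=
        { f_act := fun σ y => hψ hk σ y
          θ_act := fun h σ y => treeVal_act hD hA.isPseudoOperad heq h σ y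
          f_d := fun h y => (hψt k hk h y).trans (congrArg _
            (map_treeVal hD hp.map_comp hp.isSigmaHom.map_act hp1 h y).symm)
          θ_d := fun hij hjk y => d_treeVal_add hD hA.isPseudoOperad heq
            (fun s hs h2 {_ _} h y => (hφ s hs h2).map_d h y) hij hjk y }
      obtain ⟨g, hg⟩ := lift k hA.isSigma hp.isSigmaHom hf hw datum
      let φ₁ : DesuspMap D A := fun r => if h : r = k then h ▸ g else φ₀ r
      have hφ₁k : φ₁ k = g := dif_pos rfl
      have hφ₁ : ∀ r < k, φ₁ r = φ₀ r := fun r hr => dif_neg hr.ne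
      refine ⟨φ₁, fun r hr h2 => ?_, hφ₁⟩
      rcases Nat.lt_succ_iff_lt_or_eq.1 hr with hr | rfl
      · exact loc k φ₀ φ₁ (fun r hr => (hφ₁ r hr).symm) hφ₀ r hr h2
      · have h3 : ∀ {i j : ℤ} (h : j + 1 = i), treeVal hD φ₁ (r := r) h = treeVal hD φ h :=
          fun h => treeVal_congr hD h fun s hs hs2 =>
            (hφ₁ s hs).trans (show φ s = φ₀ s from if_pos ⟨hs2, hs⟩).symm
        rw [hφ₁k]
        exact ⟨hg.map_act, hg.proj, fun h y => (hg.map_d h y).trans (by rw [h3])⟩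
    · exact ⟨φ₀, fun r hr h2 => absurd h2 (by omega), fun _ _ => rfl⟩
  obtain ⟨φ, hφ⟩ := exists_stable id S ⟨fun _ _ => 0, fun r hr => absurd hr (Nat.not_lt_zero r)⟩
    step loc
  let φ' : DesuspMap D A := fun r => if 2 ≤ r then φ r else 0
  have hφ' : ∀ r, 2 ≤ r → φ' r = φ r := fun r hr => if_pos hr
  have hlift : ∀ r, 2 ≤ r → IsTwistedLift r (Y := desusp D.toSigmaData) p (ψ r)
      (fun h => treeVal hD φ' h) (φ' r) := fun r hr => by
    have h1 := hφ (r + 1) r (Nat.lt_succ_self r) hr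
    have h2 : ∀ {i j : ℤ} (h : j + 1 = i), treeVal hD φ' (r := r) h = treeVal hD φ h :=
      fun h => treeVal_congr hD h fun s _ hs => hφ' s hs
    rw [hφ' r hr]
    exact ⟨h1.map_act, h1.proj, fun h y => (h1.map_d h y).trans (by rw [h2])⟩
  have heq : IsEquivariant φ' := fun {r i} hr σ x => (hlift r hr).map_act σ x
  have heval : ∀ {r : ℕ} {i : ℤ} (_ : 2 ≤ r) (x : D.X r (i + 1)),
      FreeOp.eval hA (M := desusp D.toSigmaData) φ' heq r i (cobarIncl hD r i x) = φ' r i x :=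
    fun {r i} hr x => by rw [cobarIncl_apply hD hr]; rfl
  -- On generators, compatibility with the differentials is the twisting equation of `φ'`.
  have hg : IsOperadHom (P := cobar D hD) (FreeOp.eval hA (M := desusp D.toSigmaData) φ' heq) := by
    refine isOperadHom_eval hA _ _ _ fun {r i j} hr h x => ?_
    change D.X r (i + 1) at x
    refine (congrArg (FreeOp.eval hA (M := desusp D.toSigmaData) φ' heq r j)
      (cobarGen_apply hD hr h x)).trans ?_
    refine (map_add (FreeOp.eval hA (M := desusp D.toSigmaData) φ' heq r j) _ _).trans ?_
    rw [(hlift r hr).map_d h x]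
    refine congrArg₂ _ (heval hr _) ?_
    exact map_treeVal (P := cobar D hD) hD (FreeOp.eval_comp hA heq) (FreeOp.eval_act hA heq)
      (fun s _ hs _ x => heval hs x) h x
  refine ⟨_, hg, IsOperadHom.ext_of_gen (hg.comp hp) hfB fun {r i} hr x => ?_⟩
  refine ((hlift r hr).proj x).trans ?_
  exact congrArg (f r i) (cobarIncl_apply hD hr x)

end CobarOperad

end EnKoszul

end

/-! ### The theorem. -/

theorem mainTheorem11 :
    (∀ n : ℕ, 1 ≤ n → EnKoszul.IsCooperad (EnKoszul.dualCooperad n)) ∧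
    (∀ n : ℕ, 1 ≤ n → EnKoszul.IsCooperadHom (EnKoszul.suspensionStar n)) ∧
    (∃ (L : EnKoszul.CooperadData)
      (ι : ∀ n : ℕ, EnKoszul.GradedMap (EnKoszul.dualCooperad (n + 1)).toSigmaData L.toSigmaData),
      EnKoszul.IsSeqColimit (fun n => EnKoszul.dualCooperad (n + 1))
        (fun n => EnKoszul.suspensionStar (n + 1)) L ι) ∧
    ∀ (L : EnKoszul.CooperadData)
      (ι : ∀ n : ℕ, EnKoszul.GradedMap (EnKoszul.dualCooperad (n + 1)).toSigmaData L.toSigmaData)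
      (h : EnKoszul.IsSeqColimit (fun n => EnKoszul.dualCooperad (n + 1))
        (fun n => EnKoszul.suspensionStar (n + 1)) L ι),
      EnKoszul.IsCofibrantSigma L.toSigmaData ∧
      EnKoszul.IsCofibrantOperad (EnKoszul.cobar L h.isCooperad) := by
  refine ⟨fun n _ => EnKoszul.isCooperad_dualCooperad n,
    fun n _ => EnKoszul.isCooperadHom_suspensionStar n, ?_, fun L ι h => ?_⟩
  · exact ⟨_, _, EnKoszul.isSeqColimit_seqColimit
      (fun n => EnKoszul.isCooperadHom_suspensionStar (n + 1))
      (fun n => EnKoszul.isCooperad_dualCooperad (n + 1))⟩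
  · exact ⟨EnKoszul.isCofibrantSigma_of_filtration h.isCooperad.isSigma
        fun r => h.isProjectiveFiltration r,
      -- The generators are `Σ⁻¹D_∞`, so the filtration of `D_∞` is used after desuspension.
      EnKoszul.isCofibrantOperad_cobar h.isCooperad
        fun r _ _ hA _ hp hf hw _ _ hfθ =>
          (h.isProjectiveFiltration r).desusp.exists_lift hA hp hf hw hfθ⟩
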